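/- Let $E/F$ be a ramified quadratic extension of $p$-adic fields with $p$ odd, with Galois involution $\mathtt c$, and let $u$ be a uniformizer of $E$ with $u^{\mathtt c}=-u$. Let $q$ be the cardinality of the residue field of $F$. For an $O_E$-lattice $L$ in a nondegenerate hermitian space $(V,(\,,)_V)$ over $E$ put $L^\vee=\{x\in V : \mathrm{Tr}_{E/F}(x,y)_V\in O_F\ \forall y\in L\}$; call $L$ integral if $L\subseteq L^\vee$, and in that case let $t(L)$ be its type, i.e. the number of nonzero $a_i$ in $L^\vee/L\simeq\bigoplus_{i=1}^{\dim V}O_E/(u^{a_i})$. For hermitian $O_E$-modules $L,M$ let $\mathrm{Herm}_{L,M}$ be the $O_F$-scheme of hermitian $O_E$-module homomorphisms from $L$ to $M$ (where the pairings take values in the $O_E$-submodule of $E$ generated by the values of the pairings of $L$ and $M$), let $d_{L,M}=\dim(\mathrm{Herm}_{L,M}\otimes_{O_F}F)$, and $$\mathrm{Den}(M,L)=\lim_{N\to\infty}\frac{|\mathrm{Herm}_{L,M}(O_F/(u^{2N}))|}{q^{N d_{L,M}}}.$$ Let $H$ be the hermitian $O_E$-module of rank $2$ with moment matrix $\begin{pmatrix}0&u^{-1}\\-u^{-1}&0\end{pmatrix}$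 and $H_s=H^{\oplus s}$. Let $\boldsymbol V$ be a nonsplit nondegenerate hermitian space over $E$ of even dimension $n=2r$ (nonsplit: there is no totally isotropic subspace of dimension $r$), and let $\boldsymbol L$ be an $O_E$-lattice of $\boldsymbol V$. Then there is a unique polynomial $\mathrm{Den}(X,\boldsymbol L)\in\mathbb Z[X]$, the normalized local Siegel series, such that for every integer $s\ge 0$ the limit $\mathrm{Den}(H_{r+s},\boldsymbol L)$ exists and $$\mathrm{Den}(q^{-s},\boldsymbol L)=\frac{\mathrm{Den}(H_{r+s},\boldsymbol L)}{\prod_{i=s+1}^{r+s}(1-q^{-2i})}.$$ There are only finitely many integral $O_E$-lattices $L$ of $\boldsymbol V$ containing $\boldsymbol L$; each of them has $\mathrm{length}_{O_E}(L/\boldsymbol L)<\infty$ and $t(L)$ even and at least $2$; and $$\mathrm{Den}(X,\boldsymbol L)=\sum_{\boldsymbol L\subseteq L\subseteq L^\vee}X^{2\,\mathrm{length}_{O_E}(L/\boldsymbol L)}\prod_{i=0}^{\frac{t(L)}2-1}(1-q^{2i}X^2).$$ Moreover, with $\partial\mathrm{Den}(\boldsymbol L):=-\frac{\mathrm d}{\mathrm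 dX}\Big|_{X=1}\mathrm{Den}(X,\boldsymbol L)$, $$\partial\mathrm{Den}(\boldsymbol L)=2\sum_{\boldsymbol L\subseteq L\subseteq L^\vee}\ \prod_{i=1}^{\frac{t(L)}2-1}(1-q^{2i}),$$ where both sums run over the integral $O_E$-lattices $L$ of $\boldsymbol V$ containing $\boldsymbol L$, and the last product is $1$ when $t(L)=2$. -/

import Mathlib

open Polynomial TensorProduct

noncomputable section

namespace RamifiedSiegel

/-! Throughout, `OF` is the ring of integers of a `p`-adic field `F`, `E / F` is a quadratic
extension with involution `c`, and the ring of integers of `E` is `integralClosure OF E`. -/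

section Hom

variable (OF : Type*) [CommRing OF] {E : Type*} [Field E] [Algebra OF E]
variable {L M : Type*}

/-- The (fractional ideal of) values of two pairings `hL`, `hM` on `O_E`-modules `L`, `M`. -/
def valueModule (hL : L → L → E) (hM : M → M → E) : Submodule (integralClosure OF E) E :=
  Submodule.span _ {a | (∃ x y, a = hL x y) ∨ ∃ x y, a = hM x y}

theorem left_mem (hL : L → L → E) (hM : M → M → E) (x y : L) :
    hL x y ∈ valueModule OF hL hM :=
  Submodule.subset_span (Or.inl ⟨x, y, rfl⟩)

theorem right_mem (hL : L → L → E) (hM : M → M → E) (x y : M) :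
    hM x y ∈ valueModule OF hL hM :=
  Submodule.subset_span (Or.inr ⟨x, y, rfl⟩)

variable [AddCommGroup L] [Module (integralClosure OF E) L]
  [AddCommGroup M] [Module (integralClosure OF E) M]

/-- `β` is an `O_F`-basis of the module of `O_E`-linear maps `L → M`. -/
def IsHomBasis {d : ℕ} (β : Fin d → (L →ₗ[integralClosure OF E] M)) : Prop :=
  ∀ f : L →ₗ[integralClosure OF E] M,
    ∃! x : Fin d → OF, f = ∑ i, algebraMap OF (integralClosure OF E) (x i) • β i

/-- Let `I` be the module of values of `hL` and `hM`. For the homomorphism `f = ∑ Xᵢ βᵢ` with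
indeterminate coordinates `Xᵢ` (on which the involution of `E / F` acts trivially), this is the
image of `hM (f v) (f w) - hL v w ∈ O_F[X] ⊗ I` under an `O_F`-linear functional `ev : I → O_F`. -/
def hermRelation (hL : L → L → E) (hM : M → M → E) {d : ℕ}
    (β : Fin d → (L →ₗ[integralClosure OF E] M)) (v w : L)
    (ev : valueModule OF hL hM →ₗ[OF] OF) : MvPolynomial (Fin d) OF :=
  ∑ i, ∑ j, MvPolynomial.C (ev ⟨hM (β i v) (β j w), right_mem OF hL hM _ _⟩) *
      (MvPolynomial.X i * MvPolynomial.X j) -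
    MvPolynomial.C (ev ⟨hL v w, left_mem OF hL hM _ _⟩)

/-- The ideal of equations of the scheme `Herm_{L,M}` inside the affine space over `O_F` underlying
the free `O_F`-module `Hom_{O_E}(L, M)`. -/
def hermIdeal (hL : L → L → E) (hM : M → M → E) {d : ℕ}
    (β : Fin d → (L →ₗ[integralClosure OF E] M)) : Ideal (MvPolynomial (Fin d) OF) :=
  Ideal.span {P | ∃ v w ev, P = hermRelation OF hL hM β v w ev}

/-- The coordinate ring of the affine `O_F`-scheme `Herm_{L,M}` of homomorphisms of hermitian
`O_E`-modules from `L` to `M`: for an `O_F`-algebra `R`, its `R`-points are the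
`O_E ⊗ R`-linear maps `L ⊗ R → M ⊗ R` which respect the pairings with values in `I ⊗ R`. -/
abbrev HermRing (hL : L → L → E) (hM : M → M → E) {d : ℕ}
    (β : Fin d → (L →ₗ[integralClosure OF E] M)) : Type _ :=
  MvPolynomial (Fin d) OF ⧸ hermIdeal OF hL hM β

/-- The number of points of `Herm_{L,M}` over `O_F / 𝔪 ^ N`
(here `𝔪 ^ N` is `u ^ (2 * N) O_F` in the ramified situation). -/
def hermCount [IsLocalRing OF] (hL : L → L → E) (hM : M → M → E) {d : ℕ}
    (β : Fin d → (L →ₗ[integralClosure OF E] M)) (N : ℕ) : ℕ :=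
  Nat.card (HermRing OF hL hM β →ₐ[OF] (OF ⧸ IsLocalRing.maximalIdeal OF ^ N))

/-- The dimension of the generic fibre `Herm_{L,M} ⊗ F` (with value `0` when it is empty). -/
def hermDim (F : Type*) [Field F] [Algebra OF F] (hL : L → L → E) (hM : M → M → E) {d : ℕ}
    (β : Fin d → (L →ₗ[integralClosure OF E] M)) : ℕ :=
  ((ringKrullDim (F ⊗[OF] HermRing OF hL hM β)).unbotD 0).toNat

/-- The limit defining the local density `Den(M, L)` exists and is equal to `δ`. -/
def IsLocalDensity [IsLocalRing OF] (F : Type*) [Field F] [Algebra OF F]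
    (hM : M → M → E) (hL : L → L → E) (δ : ℝ) : Prop :=
  ∃ (d : ℕ) (β : Fin d → (L →ₗ[integralClosure OF E] M)), IsHomBasis OF β ∧
    Filter.Tendsto (fun N : ℕ =>
        (hermCount OF hL hM β N : ℝ) /
          (Nat.card (IsLocalRing.ResidueField OF) : ℝ) ^ (N * hermDim OF F hL hM β))
      Filter.atTop (nhds δ)

end Hom

section Hyperbolic

variable {OF E F : Type*} [CommRing OF] [Field F] [Field E] [Algebra OF E] [Algebra F E]

/-- The pairing of the hermitian `O_E`-module `H_s = H^{⊕ s}`, where `H = O_E ⊕ O_E` has moment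
matrix `(0, u⁻¹; -u⁻¹, 0)`. -/
def hypPairing (c : E ≃ₐ[F] E) (u : integralClosure OF E) (s : ℕ)
    (x y : Fin s → integralClosure OF E × integralClosure OF E) : E :=
  ∑ i, ((u : E)⁻¹ * ((x i).1 * c (y i).2) - (u : E)⁻¹ * ((x i).2 * c (y i).1))

end Hyperbolic

section Lattice

variable (OF : Type*) [CommRing OF] {F E : Type*} [Field F] [Field E]
  [Algebra OF F] [Algebra OF E] [Algebra F E] [IsScalarTower OF F E]
  {c : E ≃ₐ[F] E} {V : Type*} [AddCommGroup V] [Module E V]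

/-- The sesquilinear form `h` (linear in the first variable, `c`-linear in the second) is a
nondegenerate hermitian form. -/
structure IsHermitianForm (h : V →ₗ[E] V →ₛₗ[(c : E →+* E)] E) : Prop where
  conj_symm : ∀ x y, h y x = c (h x y)
  nondegenerate : ∀ x, (∀ y, h x y = 0) → x = 0

/-- An even dimensional hermitian space is split if it has a totally isotropic subspace of half the
dimension. -/
def IsSplit (h : V →ₗ[E] V →ₛₗ[(c : E →+* E)] E) : Prop :=
  ∃ W : Submodule E V, Module.finrank E V = 2 * Module.finrank E W ∧
    ∀ x ∈ W, ∀ y ∈ W, h x y = 0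

/-- The dual `L^∨ = {x | Tr_{E/F} (x, y) ∈ O_F for all y ∈ L}`. -/
def dual (h : V →ₗ[E] V →ₛₗ[(c : E →+* E)] E) (L : Submodule (integralClosure OF E) V) :
    Submodule (integralClosure OF E) V where
  carrier := {x | ∀ y ∈ L, Algebra.trace F E (h x y) ∈ (algebraMap OF F).range}
  zero_mem' := fun y _ => by simp
  add_mem' := fun {a b} ha hb y hy => by
    simpa using add_mem (ha y hy) (hb y hy)
  smul_mem' := fun a x hx y hy => by
    have hi : c.symm (a : E) ∈ integralClosure OF E :=
      IsIntegral.map (c.symm.toAlgHom.restrictScalars OF) a.2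
    have key : h (a • x) y = h x ((⟨c.symm (a : E), hi⟩ : integralClosure OF E) • y) := by
      change h ((a : E) • x) y = h x (c.symm (a : E) • y)
      simp
    rw [key]
    exact hx _ (L.smul_mem _ hy)

/-- `a_1 ≤ ⋯ ≤ a_m` are the fundamental invariants of the integral lattice `L`, i.e.
`L^∨ / L ≃ ⨁ O_E / (u ^ a_i)`. -/
def IsFundamentalInvariants (u : integralClosure OF E) (h : V →ₗ[E] V →ₛₗ[(c : E →+* E)] E)
    (L : Submodule (integralClosure OF E) V) (a : Fin (Module.finrank E V) → ℕ) : Prop :=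
  Monotone a ∧
    Nonempty ((dual OF h L ⧸ L.submoduleOf (dual OF h L)) ≃ₗ[integralClosure OF E]
      (∀ i, integralClosure OF E ⧸ Ideal.span {u ^ a i}))

/-- The type `t(L)`: the number of nonzero fundamental invariants of `L`. -/
def latticeType (u : integralClosure OF E) (h : V →ₗ[E] V →ₛₗ[(c : E →+* E)] E)
    (L : Submodule (integralClosure OF E) V) : ℕ :=
  Nat.card {i // Classical.epsilon (IsFundamentalInvariants OF u h L) i ≠ 0}

/-- The set of integral `O_E`-lattices of `V` which contain `L`. -/
def integralOverlattices (h : V →ₗ[E] V →ₛₗ[(c : E →+* E)] E)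
    (L : Submodule (integralClosure OF E) V) : Set (Submodule (integralClosure OF E) V) :=
  {L' | L'.IsLattice E ∧ L ≤ L' ∧ L' ≤ dual OF h L'}

/-- `P` is the normalized local Siegel series of the lattice `L` in a space of dimension `2 * r`:
for every `s ≥ 0`, the limit `Den(H_{r+s}, L)` exists and
`P (q ^ (-s)) = Den(H_{r+s}, L) / ∏_{i=s+1}^{r+s} (1 - q ^ (-2i))`. -/
def IsSiegelSeries [IsLocalRing OF] (u : integralClosure OF E)
    (h : V →ₗ[E] V →ₛₗ[(c : E →+* E)] E) (r : ℕ)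
    (L : Submodule (integralClosure OF E) V) (P : ℤ[X]) : Prop :=
  ∀ s : ℕ, ∃ δ : ℝ,
    IsLocalDensity OF F (hypPairing (OF := OF) c u (r + s)) (fun x y : L => h x y) δ ∧
    aeval (((Nat.card (IsLocalRing.ResidueField OF) : ℝ) ^ s)⁻¹) P =
      δ / ∏ i ∈ Finset.Icc (s + 1) (r + s),
        (1 - ((Nat.card (IsLocalRing.ResidueField OF) : ℝ) ^ (2 * i))⁻¹)

/-- The normalized local Siegel series `Den(X, L)`. -/
def siegelSeries [IsLocalRing OF] (u : integralClosure OF E)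
    (h : V →ₗ[E] V →ₛₗ[(c : E →+* E)] E) (r : ℕ)
    (L : Submodule (integralClosure OF E) V) : ℤ[X] :=
  Classical.epsilon (IsSiegelSeries OF u h r L)

/-- `∂Den(L) = - d/dX Den(X, L)` at `X = 1`. -/
def derivDen [IsLocalRing OF] (u : integralClosure OF E)
    (h : V →ₗ[E] V →ₛₗ[(c : E →+* E)] E) (r : ℕ)
    (L : Submodule (integralClosure OF E) V) : ℤ :=
  -(derivative (siegelSeries OF u h r L)).eval 1

end Lattice

end RamifiedSiegel

end

/-! Write R = O_E, n = 2r and m = 2(r+s). The inverse different of E/F is u⁻¹R, so trace duality is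
duality for pairings with values in u⁻¹R, and the lattice M = H_{r+s} is self-dual. Points of
Herm_{L,M} over O_F/𝔪^N are classes modulo u^{2N} of R-linear maps f : L → M which, for integral L,
are isometric modulo u^{2N-1}. For large N the preimage of M under the E-linear extension of f is an
integral lattice L' ⊇ L that depends only on the class of f (`comap_mem_overModules`,
`comap_le_comap`), so the count is a sum over these L'.

For fixed L' take a basis e_i of L' such that the u^{a_i} e_i form a basis of L. The maps with
preimage L' correspond to families f(e_i) in M that are independent modulo u and whose Gram matrix
agrees with that of L' modulo u^{2N-1-a_i-a_j} (`approx_iff_gramSet`). Because M is self-dual and 2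
is invertible, a Newton step lifts all solutions uniformly (`cosetCount_gramSet_le`). Only the count
modulo u matters, up to explicit powers of q; those that depend on L' combine to q^{(n-m)
length(L'/L)}.

Modulo u the involution is trivial on residues and changes the sign of u, so u·h becomes an
alternating form, nondegenerate on M/uM. What remains is the number of independent n-tuples with a
prescribed alternating Gram matrix in a symplectic space of dimension m over the residue field
(`card_gramTuples`). It is a power of q times ∏_{j < (n+t)/2} (1 - q^{2j-m}), where the corank t of
the Gram matrix is t(L') (`card_leftKer_eq`). The first r factors are the normalizing product; the
others are 1 - q^{2i}X² at X = q^{-s}, and q^{(n-m) length(L'/L)} is X^{2 length(L'/L)}. Infinitely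
many values determine the polynomial.

The power of q in the definition of the density involves the dimension of the generic fibre. After
base change to E a homomorphism and its conjugate become independent matrices X and Z, subject to X
Zᵀ = T with T invertible, a scheme of dimension 2nm - n² (`ringKrullDim_of_universal_hermPoint`).
With this exponent the sequence of quotients is eventually constant.

Finally t(L') is even since alternating matrices have even rank, and it is not 0: otherwise L' would
be self-dual, and Hensel's lemma would produce a totally isotropic subspace of half the dimension
(`exists_isotropic`). Hence every term contains the factor 1 - X², which gives the derivative at 1.
-/

set_option linter.unusedSectionVars false

noncomputable section

namespace RamifiedSiegel

/-! ### Counting the cosets of a subgroup met by a set. -/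

section Cosets

variable {A : Type*} [AddCommGroup A]

/-- The number of cosets of `B` which meet `S`. -/
def cosetCount (B : AddSubgroup A) (S : Set A) : ℕ :=
  ((QuotientAddGroup.mk : A → A ⧸ B) '' S).ncard

/-- `S` is a union of cosets of `B`. -/
def IsCosetUnion (B : AddSubgroup A) (S : Set A) : Prop :=
  ∀ x ∈ S, ∀ b ∈ B, x + b ∈ S

/-- `S` meets only finitely many cosets of `B`. -/
def FiniteMod (B : AddSubgroup A) (S : Set A) : Prop :=
  ((QuotientAddGroup.mk : A → A ⧸ B) '' S).Finite

theorem FiniteMod.mono {B : AddSubgroup A} {S S' : Set A} (h : FiniteMod B S) (hS : S' ⊆ S) :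
    FiniteMod B S' :=
  Set.Finite.subset h (Set.image_mono hS)

theorem mk_eq_iff {B : AddSubgroup A} {x y : A} :
    (QuotientAddGroup.mk x : A ⧸ B) = QuotientAddGroup.mk y ↔ y - x ∈ B := by
  rw [QuotientAddGroup.eq, neg_add_eq_sub]

theorem finiteMod_of_relIndex {B H : AddSubgroup A} (h : B.relIndex H ≠ 0) {S : Set A}
    (hS : S ⊆ H) : FiniteMod B S := by
  have : Finite (H ⧸ B.addSubgroupOf H) := by
    refine Nat.finite_of_card_ne_zero ?_
    exact h
  refine Set.Finite.subset (Set.finite_range fun z : H ⧸ B.addSubgroupOf H =>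
    (QuotientAddGroup.map (B.addSubgroupOf H) B H.subtype (fun _ hx => hx) z : A ⧸ B)) ?_
  rintro _ ⟨x, hx, rfl⟩
  exact ⟨QuotientAddGroup.mk ⟨x, hS hx⟩, rfl⟩

/-- A map which respects the congruence modulo `B` in both directions does not decrease the number
of cosets. -/
theorem cosetCount_le {A' : Type*} [AddCommGroup A'] {B : AddSubgroup A} {B' : AddSubgroup A'}
    {S : Set A} {S' : Set A'} (hf : FiniteMod B' S') (φ : A → A') (hφ : ∀ x ∈ S, φ x ∈ S')
    (hinj : ∀ x ∈ S, ∀ y ∈ S, φ y - φ x ∈ B' → y - x ∈ B) :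
    cosetCount B S ≤ cosetCount B' S' := by
  have key : ∀ z ∈ (QuotientAddGroup.mk : A → A ⧸ B) '' S, ∃ x ∈ S, QuotientAddGroup.mk x = z :=
    fun z hz => hz
  choose! g hg hg' using key
  refine Set.ncard_le_ncard_of_injOn (fun z => (QuotientAddGroup.mk (φ (g z)) : A' ⧸ B'))
    (fun z hz => ⟨_, hφ _ (hg z hz), rfl⟩) ?_ hf
  intro z hz w hw hzw
  rw [← hg' z hz, ← hg' w hw]
  exact mk_eq_iff.2 (hinj _ (hg z hz) _ (hg w hw) (mk_eq_iff.1 hzw))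

theorem cosetCount_image {A' : Type*} [AddCommGroup A'] (B : AddSubgroup A) (B' : AddSubgroup A')
    (S : Set A) (e : A →+ A') (hB : ∀ x, e x ∈ B' ↔ x ∈ B) :
    cosetCount B' (e '' S) = cosetCount B S := by
  unfold cosetCount
  have hinj : Function.Injective (QuotientAddGroup.map B B' e
      (show B ≤ B'.comap e from fun x hx => (hB x).2 hx)) := by
    rw [injective_iff_map_eq_zero]
    intro z
    induction z using QuotientAddGroup.induction_on with
    | H x =>
      intro hx
      rw [QuotientAddGroup.map_mk, QuotientAddGroup.eq_zero_iff, hB] at hx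
      exact (QuotientAddGroup.eq_zero_iff x).2 hx
  rw [← Set.ncard_image_of_injective _ hinj, Set.image_image, Set.image_image]
  rfl

theorem cosetCount_eq_sum {X : Type*} {B : AddSubgroup A} {S : Set A} (hS : FiniteMod B S)
    (ψ : A → X) (hψ : ∀ x ∈ S, ∀ y ∈ S, y - x ∈ B → ψ x = ψ y) (Y : Finset X)
    (hY : ∀ x ∈ S, ψ x ∈ Y) :
    cosetCount B S = ∑ y ∈ Y, cosetCount B {x ∈ S | ψ x = y} := by
  classical
  have hfin : ∀ y, ((QuotientAddGroup.mk : A → A ⧸ B) '' {x ∈ S | ψ x = y}).Finite := fun y =>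
    hS.mono fun x hx => hx.1
  have hU : (QuotientAddGroup.mk : A → A ⧸ B) '' S =
      ((Y.biUnion fun y => (hfin y).toFinset : Finset (A ⧸ B)) : Set (A ⧸ B)) := by
    ext z
    simp only [Finset.coe_biUnion, Set.mem_iUnion, Finset.mem_coe, Set.Finite.mem_toFinset,
      Set.mem_image]
    constructor
    · rintro ⟨x, hx, rfl⟩
      exact ⟨ψ x, hY x hx, x, ⟨hx, rfl⟩, rfl⟩
    · rintro ⟨y, _, x, hx, rfl⟩
      exact ⟨x, hx.1, rfl⟩
  rw [cosetCount, hU, Set.ncard_coe_finset, Finset.card_biUnion]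
  · refine Finset.sum_congr rfl fun y _ => ?_
    rw [cosetCount, ← Set.ncard_coe_finset, Set.Finite.coe_toFinset]
  · intro y _ y' _ hyy'
    refine Finset.disjoint_left.2 fun z hz hz' => hyy' ?_
    rw [Set.Finite.mem_toFinset] at hz hz'
    obtain ⟨x, hx, rfl⟩ := hz
    obtain ⟨x', hx', hxx'⟩ := hz'
    rw [← hx.2, ← hx'.2]
    exact (hψ _ hx'.1 _ hx.1 (mk_eq_iff.1 hxx')).symm

/-- Congruent points have congruent images under `ψ`, so the cosets met by `S` are sorted by the
class of `ψ` in `H / H'`. Surjectivity of `ψ` is not assumed: `hC` asks for the same number `C` of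
cosets over every class, attained or not. -/
theorem cosetCount_eq_mul_of_fibres {G : Type*} [AddCommGroup G] {B : AddSubgroup A}
    {H H' : AddSubgroup G} (hfin : H'.relIndex H ≠ 0) {S : Set A}
    (hS : FiniteMod B S) (ψ : A → G) (hψH : ∀ x ∈ S, ψ x ∈ H)
    (hψ : ∀ x ∈ S, ∀ y ∈ S, y - x ∈ B → ψ y - ψ x ∈ H') (C : ℕ)
    (hC : ∀ g ∈ H, cosetCount B {x ∈ S | ψ x - g ∈ H'} = C) :
    cosetCount B S = H'.relIndex H * C := by
  classical
  have hfq : ((QuotientAddGroup.mk : G → G ⧸ H') '' H).Finite :=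
    finiteMod_of_relIndex hfin subset_rfl
  rw [cosetCount_eq_sum hS (fun x => (QuotientAddGroup.mk (ψ x) : G ⧸ H'))
    (fun x hx y hy hxy => mk_eq_iff.2 (hψ x hx y hy hxy)) hfq.toFinset
    (fun x hx => by simpa using ⟨ψ x, hψH x hx, rfl⟩),
    Finset.sum_congr rfl (g := fun _ => C), Finset.sum_const, smul_eq_mul]
  · congr 1
    rw [← Set.ncard_coe_finset, Set.Finite.coe_toFinset, AddSubgroup.relIndex, AddSubgroup.index,
      ← Nat.card_coe_set_eq]
    refine (Nat.card_congr (Equiv.ofBijective (fun z : H ⧸ H'.addSubgroupOf H =>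
      (⟨QuotientAddGroup.map (H'.addSubgroupOf H) H' H.subtype (fun _ hx => hx) z, ?_⟩ :
        ((QuotientAddGroup.mk : G → G ⧸ H') '' H))) ⟨?_, ?_⟩)).symm
    · induction z using QuotientAddGroup.induction_on with
      | H x => exact ⟨x, x.2, rfl⟩
    · intro z w
      induction z using QuotientAddGroup.induction_on with
      | H x =>
      induction w using QuotientAddGroup.induction_on with
      | H y =>
      intro hxy
      rw [Subtype.mk.injEq] at hxy
      have hxy' : (QuotientAddGroup.mk (x : G) : G ⧸ H') = QuotientAddGroup.mk (y : G) := hxy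
      have h0 : ((y - x : H) : G) ∈ H' := mk_eq_iff.1 hxy'
      exact mk_eq_iff.2 h0
    · rintro ⟨_, x, hx, rfl⟩
      exact ⟨QuotientAddGroup.mk ⟨x, hx⟩, rfl⟩
  · intro z hz
    rw [Set.Finite.mem_toFinset] at hz
    obtain ⟨g, hg, rfl⟩ := hz
    rw [← hC g hg]
    congr 1
    ext x
    refine and_congr_right fun _ => ?_
    rw [mk_eq_iff, ← neg_mem_iff, neg_sub]

/-- Every coset of `B` inside `S` breaks into `[B : B']` cosets of `B'`. This serves to change the
modulus of a congruence. -/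
theorem cosetCount_relIndex {B B' : AddSubgroup A} (hB : B' ≤ B) (hfin : B'.relIndex B ≠ 0)
    {S : Set A} (hS : FiniteMod B' S) (hst : IsCosetUnion B S) :
    cosetCount B' S = B'.relIndex B * cosetCount B S := by
  classical
  have hS' : ((QuotientAddGroup.mk : A → A ⧸ B) '' S).Finite := by
    refine (Set.Finite.image (QuotientAddGroup.map B' B (AddMonoidHom.id A) hB) hS).subset ?_
    rintro _ ⟨x, hx, rfl⟩
    exact ⟨_, ⟨x, hx, rfl⟩, rfl⟩
  rw [cosetCount_eq_sum hS (fun x => (QuotientAddGroup.mk x : A ⧸ B))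
    (fun x hx y hy hxy => mk_eq_iff.2 (hB hxy)) (Set.Finite.toFinset hS')
    (fun x hx => by simpa using ⟨x, hx, rfl⟩),
    Finset.sum_congr rfl (g := fun _ => B'.relIndex B), Finset.sum_const, smul_eq_mul, mul_comm]
  · congr 1
    rw [← Set.ncard_coe_finset, Set.Finite.coe_toFinset, cosetCount]
  · intro z hz
    rw [Set.Finite.mem_toFinset] at hz
    obtain ⟨g, hg, rfl⟩ := hz
    have h1 : {x ∈ S | (QuotientAddGroup.mk x : A ⧸ B) = QuotientAddGroup.mk g} =
        (fun b => g + b) '' (B : Set A) := by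
      ext x
      simp only [Set.mem_ofPred_eq, mk_eq_iff, Set.mem_image, SetLike.mem_coe]
      constructor
      · rintro ⟨_, hx⟩
        exact ⟨x - g, by rw [← neg_mem_iff, neg_sub]; exact hx, by abel⟩
      · rintro ⟨b, hb, rfl⟩
        exact ⟨hst g hg b hb, by simpa using hb⟩
    have hfB : FiniteMod B' (B : Set A) := finiteMod_of_relIndex hfin subset_rfl
    -- `B` is fibred over `B / B'` by the identity, and every fibre is a translate of `B'`.
    have h2 : cosetCount B' (B : Set A) = B'.relIndex B * cosetCount B' (B' : Set A) := by
      refine cosetCount_eq_mul_of_fibres hfin hfB id (fun x hx => hx)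
        (fun x hx y hy hxy => hxy) _ fun g hg => ?_
      refine le_antisymm (cosetCount_le (hfB.mono hB) (fun x => x - g) (fun x hx => hx.2)
        (fun x _ y _ hxy => by simpa using hxy))
        (cosetCount_le (hfB.mono fun x hx => hx.1) (fun x => x + g)
          (fun x hx => ⟨add_mem (hB hx) hg, by simpa using hx⟩)
          (fun x _ y _ hxy => by simpa using hxy))
    have h3 : cosetCount B' (B' : Set A) = 1 := by
      rw [cosetCount, Set.ncard_eq_one]
      refine ⟨0, ?_⟩
      ext z
      constructor
      · rintro ⟨x, hx, rfl⟩
        exact (QuotientAddGroup.eq_zero_iff x).2 hx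
      · rintro rfl
        exact ⟨0, zero_mem _, rfl⟩
    rw [h1, ← mul_one (B'.relIndex B), ← h3, ← h2]
    refine le_antisymm (cosetCount_le hfB (fun x => x - g) ?_
      (fun x _ y _ hxy => by simpa using hxy)) (cosetCount_le ?_ (fun x => g + x)
          (fun x hx => ⟨x, hx, rfl⟩) (fun x _ y _ hxy => by simpa using hxy))
    · rintro _ ⟨b, hb, rfl⟩
      simpa using hb
    · rw [← h1]
      exact hS.mono fun x hx => hx.1

/-- The relative index, computed by a homomorphism to a product. -/
theorem relIndex_eq_prod {ι : Type*} [Fintype ι] {Q : ι → Type*} [∀ i, AddCommGroup (Q i)]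
    (H H' : AddSubgroup A) (C C' : ∀ i, AddSubgroup (Q i)) (φ : A →+ ∀ i, Q i)
    (hH : ∀ x ∈ H, ∀ i, φ x i ∈ C i) (hH' : ∀ x ∈ H, x ∈ H' ↔ ∀ i, φ x i ∈ C' i)
    (hsurj : ∀ y : ∀ i, Q i, (∀ i, y i ∈ C i) → ∃ x ∈ H, φ x = y) :
    H'.relIndex H = ∏ i, (C' i).relIndex (C i) := by
  let ψ : H →+ ∀ i, C i ⧸ (C' i).addSubgroupOf (C i) :=
    { toFun := fun x i => QuotientAddGroup.mk ⟨φ x i, hH x x.2 i⟩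
      map_zero' := by
        ext i
        refine (QuotientAddGroup.eq_zero_iff _).2 ?_
        simp [AddSubgroup.mem_addSubgroupOf]
      map_add' := fun x y => by
        ext i
        rw [Pi.add_apply, ← QuotientAddGroup.mk_add]
        congr 1
        ext
        simp }
  have hker : ψ.ker = H'.addSubgroupOf H := by
    ext x
    rw [AddMonoidHom.mem_ker, AddSubgroup.mem_addSubgroupOf, hH' x x.2, funext_iff]
    refine forall_congr' fun i => ?_
    exact QuotientAddGroup.eq_zero_iff _
  have hψ : Function.Surjective ψ := by
    intro z
    have : ∀ i, ∃ y : C i, QuotientAddGroup.mk y = z i := fun i =>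
      QuotientAddGroup.mk_surjective (z i)
    choose y hy using this
    obtain ⟨x, hx, hxy⟩ := hsurj (fun i => y i) fun i => (y i).2
    refine ⟨⟨x, hx⟩, ?_⟩
    ext i
    rw [← hy i]
    change QuotientAddGroup.mk _ = _
    congr 1
    ext
    exact congrFun hxy i
  rw [AddSubgroup.relIndex, ← hker, AddSubgroup.index_ker, AddMonoidHom.range_eq_top.2 hψ,
    AddSubgroup.card_top, Nat.card_pi]
  rfl

end Cosets

/-! ### Powers of the uniformizer and ramified involutions. -/

section Powers

variable {R : Type*} (E : Type*) [CommRing R] [Field E] [Algebra R E]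

/-- The fractional ideal `u ^ k R` of `E`. -/
def pw (u : R) (k : ℤ) : Submodule R E where
  carrier := {x | ∃ a : R, x = algebraMap R E u ^ k * algebraMap R E a}
  zero_mem' := ⟨0, by simp⟩
  add_mem' := by
    rintro _ _ ⟨a, rfl⟩ ⟨b, rfl⟩
    exact ⟨a + b, by rw [map_add, mul_add]⟩
  smul_mem' := by
    rintro r _ ⟨a, rfl⟩
    exact ⟨r * a, by rw [map_mul, Algebra.smul_def]; ring⟩

/-- `c` is an involution of `E` which preserves the discrete valuation ring `R`, acts trivially on
its residue field and changes the sign of the uniformizer `u`; moreover, `2` is a unit. -/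
structure IsRamifiedInvolution {E : Type*} [Field E] [Algebra R E] (c : E →+* E) (u : R) :
    Prop where
  irreducible : Irreducible u
  involutive : ∀ x, c (c x) = x
  map_uniformizer : c (algebraMap R E u) = -algebraMap R E u
  residue : ∀ a : R, ∃ b : R, c (algebraMap R E a) = algebraMap R E (a + u * b)
  two : IsUnit (2 : R)

end Powers

/-! ### Fractional ideals, their fixed elements, and indices of groups of hermitian matrices. -/

section DVR

variable {R E : Type*} [CommRing R] [IsDomain R] [IsDiscreteValuationRing R] [Field E]
  [Algebra R E] [IsFractionRing R E] {c : E →+* E} {u : R}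

theorem mem_pw_zero {x : E} : x ∈ pw E u 0 ↔ ∃ a : R, algebraMap R E a = x := by
  constructor
  · rintro ⟨a, rfl⟩
    exact ⟨a, by simp⟩
  · rintro ⟨a, rfl⟩
    exact ⟨a, by simp⟩

namespace IsRamifiedInvolution

theorem ne_zero (hc : IsRamifiedInvolution c u) : algebraMap R E u ≠ 0 := by
  rw [Ne, FaithfulSMul.algebraMap_eq_zero_iff]
  exact hc.irreducible.ne_zero

theorem two_ne_zero (hc : IsRamifiedInvolution c u) : (2 : E) ≠ 0 := by
  have := hc.two.map (algebraMap R E)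
  rw [map_ofNat] at this
  exact this.ne_zero

theorem zpow_mul_mem (hc : IsRamifiedInvolution c u) (l k : ℤ) {x : E} :
    algebraMap R E u ^ l * x ∈ pw E u (l + k) ↔ x ∈ pw E u k := by
  have h0 := hc.ne_zero
  constructor
  · rintro ⟨a, ha⟩
    refine ⟨a, mul_left_cancel₀ (zpow_ne_zero l h0) ?_⟩
    rw [ha, zpow_add₀ h0, mul_assoc]
  · rintro ⟨a, rfl⟩
    exact ⟨a, by rw [zpow_add₀ h0, mul_assoc]⟩

theorem zpow_mul_mem' (hc : IsRamifiedInvolution c u) {l k : ℤ} {x : E} (j : ℤ)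
    (hx : x ∈ pw E u k) (hj : l + k = j := by ring) : algebraMap R E u ^ l * x ∈ pw E u j := by
  rw [← hj]
  exact (hc.zpow_mul_mem l k).2 hx

theorem mul_mem (hc : IsRamifiedInvolution c u) {k l : ℤ} {x y : E} (hx : x ∈ pw E u k)
    (hy : y ∈ pw E u l) : x * y ∈ pw E u (k + l) := by
  obtain ⟨a, rfl⟩ := hx
  rw [mul_assoc, hc.zpow_mul_mem]
  exact Algebra.smul_def a y ▸ (pw E u l).smul_mem a hy

theorem anti (hc : IsRamifiedInvolution c u) {k l : ℤ} (hkl : k ≤ l) : pw E u l ≤ pw E u k := by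
  rintro _ ⟨a, rfl⟩
  obtain ⟨i, rfl⟩ := Int.le.dest hkl
  exact ⟨u ^ i * a, by rw [zpow_add₀ hc.ne_zero, map_mul, map_pow, zpow_natCast, mul_assoc]⟩

theorem c_mem (hc : IsRamifiedInvolution c u) {k : ℤ} {x : E} (hx : x ∈ pw E u k) :
    c x ∈ pw E u k := by
  obtain ⟨a, rfl⟩ := hx
  obtain ⟨b, hb⟩ := hc.residue a
  rw [map_mul, hb, map_zpow₀, hc.map_uniformizer, neg_eq_neg_one_mul, mul_zpow]
  have : ∃ e : R, algebraMap R E e = (-1) ^ k := by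
    rcases Int.even_or_odd k with h | h
    · exact ⟨1, by rw [h.neg_one_zpow, map_one]⟩
    · exact ⟨-1, by rw [h.neg_one_zpow, map_neg, map_one]⟩
  obtain ⟨e, he⟩ := this
  exact ⟨e * (a + u * b), by rw [map_mul, he]; ring⟩

theorem c_mem_iff (hc : IsRamifiedInvolution c u) {k : ℤ} {x : E} :
    c x ∈ pw E u k ↔ x ∈ pw E u k :=
  ⟨fun h => hc.involutive x ▸ hc.c_mem h, hc.c_mem⟩

/-- Being trivial on the residue field and sending `u` to `-u`, the involution acts on `u ^ k R / u
^ (k + 1) R` by the sign `(-1) ^ k`; `c_add_mem` is the odd case. -/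
theorem c_sub_mem (hc : IsRamifiedInvolution c u) {k : ℤ} (hk : Even k) {x : E}
    (hx : x ∈ pw E u k) : c x - x ∈ pw E u (k + 1) := by
  obtain ⟨a, rfl⟩ := hx
  obtain ⟨b, hb⟩ := hc.residue a
  rw [map_mul, hb, map_zpow₀, hc.map_uniformizer, hk.neg_zpow, ← mul_sub, hc.zpow_mul_mem]
  exact ⟨b, by rw [map_add, map_mul]; simp⟩

theorem c_add_mem (hc : IsRamifiedInvolution c u) {k : ℤ} (hk : Odd k) {x : E}
    (hx : x ∈ pw E u k) : c x + x ∈ pw E u (k + 1) := by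
  obtain ⟨a, rfl⟩ := hx
  obtain ⟨b, hb⟩ := hc.residue a
  rw [map_mul, hb, map_zpow₀, hc.map_uniformizer, hk.neg_zpow, neg_mul, neg_add_eq_sub, ← mul_sub,
    hc.zpow_mul_mem]
  exact ⟨-b, by rw [map_add, map_mul, map_neg]; simp⟩

theorem half_mem (hc : IsRamifiedInvolution c u) {k : ℤ} {x : E} (hx : x ∈ pw E u k) :
    x / 2 ∈ pw E u k := by
  obtain ⟨b, hb⟩ := hc.two.exists_right_inv
  have h2 : (2 : E) * algebraMap R E b = 1 := by
    rw [← map_ofNat (algebraMap R E), ← map_mul, hb, map_one]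
  have : x / 2 = b • x := by
    rw [div_eq_iff hc.two_ne_zero, Algebra.smul_def]
    linear_combination -x * h2
  rw [this]
  exact Submodule.smul_mem _ _ hx

theorem exists_mem (hc : IsRamifiedInvolution c u) (x : E) : ∃ d : ℕ, x ∈ pw E u (-d : ℤ) := by
  obtain ⟨a, b, hb, rfl⟩ := IsFractionRing.div_surjective (A := R) x
  have hb0 : b ≠ 0 := nonZeroDivisors.ne_zero hb
  obtain ⟨d, v, rfl⟩ := IsDiscreteValuationRing.eq_unit_mul_pow_irreducible hb0 hc.irreducible
  refine ⟨d, a * (v⁻¹ : Rˣ), ?_⟩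
  have hv : algebraMap R E v * algebraMap R E (v⁻¹ : Rˣ) = 1 := by
    rw [← map_mul, Units.mul_inv, map_one]
  have hv0 := left_ne_zero_of_mul_eq_one hv
  have h0 := hc.ne_zero
  rw [zpow_neg, zpow_natCast, map_mul, map_mul, map_pow]
  field_simp
  linear_combination (-algebraMap R E a) * hv

theorem maximalIdeal_eq (hc : IsRamifiedInvolution c u) :
    IsLocalRing.maximalIdeal R = Ideal.span {u} :=
  (IsDiscreteValuationRing.irreducible_iff_uniformizer u).1 hc.irreducible

theorem relIndex_pw_succ (hc : IsRamifiedInvolution c u) (k : ℤ) :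
    (pw E u (k + 1)).toAddSubgroup.relIndex (pw E u k).toAddSubgroup =
      Nat.card (IsLocalRing.ResidueField R) := by
  let f : R →+ E := (AddMonoidHom.mulLeft (algebraMap R E u ^ k)).comp
    (algebraMap R E : R →+* E).toAddMonoidHom
  have hf : Function.Injective f := by
    intro a b hab
    exact FaithfulSMul.algebraMap_injective R E (mul_left_cancel₀ (zpow_ne_zero k hc.ne_zero) hab)
  have h1 : (pw E u k).toAddSubgroup = (⊤ : AddSubgroup R).map f := by
    ext x
    constructor
    · rintro ⟨a, rfl⟩
      exact ⟨a, trivial, rfl⟩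
    · rintro ⟨a, _, rfl⟩
      exact ⟨a, rfl⟩
  have h2 : (pw E u (k + 1)).toAddSubgroup =
      ((IsLocalRing.maximalIdeal R).toAddSubgroup).map f := by
    ext x
    rw [hc.maximalIdeal_eq]
    constructor
    · rintro ⟨a, rfl⟩
      refine ⟨u * a, Ideal.mem_span_singleton.2 ⟨a, rfl⟩, ?_⟩
      change _ * algebraMap R E (u * a) = _
      rw [zpow_add_one₀ hc.ne_zero, map_mul, mul_assoc]
    · rintro ⟨b, hb, rfl⟩
      obtain ⟨a, rfl⟩ := Ideal.mem_span_singleton.1 hb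
      refine ⟨a, ?_⟩
      change _ * algebraMap R E (u * a) = _
      rw [zpow_add_one₀ hc.ne_zero, map_mul, mul_assoc]
  rw [h1, h2, AddSubgroup.relIndex_map_map_of_injective _ _ hf, AddSubgroup.relIndex_top_right]
  rfl

theorem relIndex_pw (hc : IsRamifiedInvolution c u) {k l : ℤ} (i : ℕ) (hi : l = k + i) :
    (pw E u l).toAddSubgroup.relIndex (pw E u k).toAddSubgroup =
      Nat.card (IsLocalRing.ResidueField R) ^ i := by
  subst hi
  induction i with
  | zero => simp
  | succ i ih =>
    rw [← AddSubgroup.relIndex_mul_relIndex (pw E u (k + (i + 1 : ℕ))).toAddSubgroup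
      (pw E u (k + i)).toAddSubgroup (pw E u k).toAddSubgroup (hc.anti (by push_cast; linarith))
      (hc.anti (by linarith)), ih, pow_succ']
    congr 1
    rw [← hc.relIndex_pw_succ (k + i), Nat.cast_succ, add_assoc]

end IsRamifiedInvolution

/-- The elements of `u ^ k R` fixed by `c`. -/
def fixedPw (c : E →+* E) (u : R) (k : ℤ) : AddSubgroup E :=
  (pw E u k).toAddSubgroup ⊓ (c.toAddMonoidHom - AddMonoidHom.id E).ker

theorem mem_fixedPw {k : ℤ} {x : E} : x ∈ fixedPw c u k ↔ x ∈ pw E u k ∧ c x = x := by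
  rw [fixedPw, AddSubgroup.mem_inf, AddMonoidHom.mem_ker, AddMonoidHom.sub_apply, sub_eq_zero]
  rfl

namespace IsRamifiedInvolution

/-- On an odd graded piece `c` acts by `-1`, so `2 x = c x + x` gains a power of `u`. This is what
makes the reduced hermitian form alternating, and it lets fixed elements jump two powers at a time.
-/
theorem fixedPw_odd (hc : IsRamifiedInvolution c u) {k : ℤ} (hk : Odd k) :
    fixedPw c u k = fixedPw c u (k + 1) := by
  ext x
  rw [mem_fixedPw, mem_fixedPw]
  refine ⟨fun ⟨h, hx⟩ => ⟨?_, hx⟩, fun ⟨h, hx⟩ => ⟨hc.anti (by linarith) h, hx⟩⟩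
  have := hc.half_mem (hc.c_add_mem hk h)
  have h2 := hc.two_ne_zero
  rwa [hx, ← two_mul, mul_div_cancel_left₀ _ h2] at this

/-- For even `k` the average of `x` and `c x` differs from `x` only modulo `u ^ (k + 1)`, so fixed
elements represent all classes. -/
theorem relIndex_fixedPw_succ (hc : IsRamifiedInvolution c u) {k : ℤ} (hk : Even k) :
    (fixedPw c u (k + 1)).relIndex (fixedPw c u k) = Nat.card (IsLocalRing.ResidueField R) := by
  have h1 : fixedPw c u (k + 1) = (pw E u (k + 1)).toAddSubgroup ⊓ fixedPw c u k := by
    ext x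
    rw [AddSubgroup.mem_inf, mem_fixedPw, mem_fixedPw]
    exact ⟨fun h => ⟨h.1, hc.anti (by linarith) h.1, h.2⟩, fun h => ⟨h.1, h.2.2⟩⟩
  have h2 : fixedPw c u k ⊔ (pw E u (k + 1)).toAddSubgroup = (pw E u k).toAddSubgroup := by
    refine le_antisymm (sup_le (fun x hx => (mem_fixedPw.1 hx).1) (hc.anti (by linarith))) ?_
    intro x hx
    have hx' : x = (x + c x) / 2 + -((c x - x) / 2) := by
      have := hc.two_ne_zero
      field_simp
      ring
    rw [hx']
    refine AddSubgroup.add_mem_sup (mem_fixedPw.2 ⟨?_, ?_⟩) ?_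
    · exact hc.half_mem (add_mem hx (hc.c_mem hx))
    · rw [map_div₀, map_add, hc.involutive, map_ofNat, add_comm]
    · exact neg_mem (hc.half_mem (hc.c_sub_mem hk hx))
  rw [h1, AddSubgroup.inf_relIndex_right, ← AddSubgroup.relIndex_sup_right, h2, hc.relIndex_pw_succ]

theorem relIndex_fixedPw_even (hc : IsRamifiedInvolution c u) {k l : ℤ} (hk : Even k) (i : ℕ)
    (hi : l = k + 2 * i) :
    (fixedPw c u l).relIndex (fixedPw c u k) = Nat.card (IsLocalRing.ResidueField R) ^ i := by
  subst hi
  induction i with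
  | zero => simp
  | succ i ih =>
    have hki : Even (k + 2 * i : ℤ) := hk.add (even_two_mul _)
    have hle : ∀ {a b : ℤ}, a ≤ b → fixedPw c u b ≤ fixedPw c u a := fun hab x hx =>
      mem_fixedPw.2 ⟨hc.anti hab (mem_fixedPw.1 hx).1, (mem_fixedPw.1 hx).2⟩
    rw [← AddSubgroup.relIndex_mul_relIndex (fixedPw c u (k + 2 * (i + 1 : ℕ)))
      (fixedPw c u (k + 2 * i)) (fixedPw c u k) (hle (by push_cast; linarith))
      (hle (by linarith)), ih, pow_succ', ← hc.relIndex_fixedPw_succ hki,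
      hc.fixedPw_odd hki.add_one]
    congr 3
    push_cast
    ring

theorem relIndex_fixedPw_odd (hc : IsRamifiedInvolution c u) {k l : ℤ} (hk : Odd k) (i : ℕ)
    (hi : l = k + 2 * i) :
    (fixedPw c u l).relIndex (fixedPw c u k) = Nat.card (IsLocalRing.ResidueField R) ^ i := by
  subst hi
  rw [hc.fixedPw_odd hk, hc.fixedPw_odd (hk.add_even (even_two_mul _)),
    hc.relIndex_fixedPw_even hk.add_one i (by ring)]

end IsRamifiedInvolution

/-- Hermitian matrices whose `(i, j)` entry lies in `u ^ (p i j) R`. -/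
def hermMatrices (c : E →+* E) (u : R) {n : ℕ} (p : Fin n → Fin n → ℤ) :
    AddSubgroup (Fin n → Fin n → E) where
  carrier := {S | ∀ i j, S j i = c (S i j) ∧ S i j ∈ pw E u (p i j)}
  zero_mem' := fun i j => by simp
  add_mem' := fun ha hb i j => ⟨by simp [(ha i j).1, (hb i j).1], add_mem (ha i j).2 (hb i j).2⟩
  neg_mem' := fun ha i j => ⟨by simp [(ha i j).1], neg_mem (ha i j).2⟩

namespace IsRamifiedInvolution

/-- A hermitian matrix is a free choice of strictly upper triangular entries and of `c`-fixed
diagonal entries, so the index is a product over these positions. -/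
theorem relIndex_hermMatrices (hc : IsRamifiedInvolution c u) {n : ℕ} (p p' : Fin n → Fin n → ℤ)
    (hp : ∀ i j, p i j = p j i) (hp' : ∀ i j, p' i j = p' j i)
    (δ : Fin n → Fin n → ℕ) (ε : Fin n → ℕ) (hδ : ∀ i j, i < j → p' i j = p i j + δ i j)
    (hε : ∀ i, (fixedPw c u (p' i i)).relIndex (fixedPw c u (p i i)) =
      Nat.card (IsLocalRing.ResidueField R) ^ ε i) :
    (hermMatrices c u p').relIndex (hermMatrices c u p) =
      Nat.card (IsLocalRing.ResidueField R) ^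
        (∑ i, ∑ j, if i < j then δ i j else if i = j then ε i else 0) := by
  -- Positions below the diagonal carry the zero group and contribute the factor 1.
  let C : (Fin n → Fin n → ℤ) → ∀ _ : Fin n × Fin n, AddSubgroup E := fun p s =>
    if s.1 < s.2 then (pw E u (p s.1 s.2)).toAddSubgroup
    else if s.1 = s.2 then fixedPw c u (p s.1 s.1) else ⊥
  let φ : (Fin n → Fin n → E) →+ (Fin n × Fin n → E) :=
    { toFun := fun S s => if s.1 ≤ s.2 then S s.1 s.2 else 0
      map_zero' := by ext; simp
      map_add' := fun S S' => by
        ext s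
        simp only [Pi.add_apply]
        split_ifs <;> simp }
  have hφ : ∀ S s, φ S s = if s.1 ≤ s.2 then S s.1 s.2 else 0 := fun _ _ => rfl
  have hmem : ∀ p : Fin n → Fin n → ℤ, (∀ i j, p i j = p j i) → ∀ S, (∀ i j, S j i = c (S i j)) →
      (S ∈ hermMatrices c u p ↔ ∀ s, φ S s ∈ C p s) := by
    intro p hp S hS
    constructor
    · rintro h ⟨i, j⟩
      simp only [hφ, C]
      rcases lt_trichotomy i j with hij | rfl | hij
      · rw [if_pos hij.le, if_pos hij]
        exact (h i j).2
      · rw [if_pos le_rfl, if_neg (lt_irrefl _), if_pos rfl]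
        exact mem_fixedPw.2 ⟨(h i i).2, (h i i).1.symm⟩
      · rw [if_neg hij.not_ge, if_neg hij.not_gt, if_neg hij.ne']
        exact zero_mem _
    · intro h i j
      refine ⟨hS i j, ?_⟩
      rcases lt_trichotomy i j with hij | rfl | hij
      · have := h (i, j)
        simp only [hφ, C] at this
        rwa [if_pos hij.le, if_pos hij] at this
      · have := h (i, i)
        simp only [hφ, C, le_refl, lt_irrefl, if_true, if_false] at this
        exact (mem_fixedPw.1 this).1
      · have := h (j, i)
        simp only [hφ, C] at this
        rw [if_pos hij.le, if_pos hij] at this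
        rw [hS j i, hp]
        exact hc.c_mem this
  rw [relIndex_eq_prod (hermMatrices c u p) (hermMatrices c u p') (C p) (C p') φ
    (fun S hS => (hmem p hp S fun i j => (hS i j).1).1 hS)
    (fun S hS => hmem p' hp' S fun i j => (hS i j).1), Fintype.prod_prod_type,
    ← Finset.prod_pow_eq_pow_sum]
  · refine Finset.prod_congr rfl fun i _ => ?_
    rw [← Finset.prod_pow_eq_pow_sum]
    refine Finset.prod_congr rfl fun j _ => ?_
    simp only [C]
    split_ifs with h1 h2
    · exact hc.relIndex_pw _ (hδ i j h1)
    · exact hε i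
    · simp
  · intro y hy
    have hy0 : ∀ i, c (y (i, i)) = y (i, i) := by
      intro i
      have := hy (i, i)
      simp only [C, lt_irrefl, if_true, if_false] at this
      exact (mem_fixedPw.1 this).2
    have hS : ∀ i j, (fun i j => if i ≤ j then y (i, j) else c (y (j, i))) j i =
        c ((fun i j => if i ≤ j then y (i, j) else c (y (j, i))) i j) := by
      intro i j
      rcases lt_trichotomy i j with hij | rfl | hij
      · simp [hij.le, hij.not_ge]
      · simp [hy0]
      · simp [hij.le, hij.not_ge, hc.involutive]
    have hφy : φ (fun i j => if i ≤ j then y (i, j) else c (y (j, i))) = y := by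
      ext ⟨i, j⟩
      rw [hφ]
      dsimp only
      split_ifs with h
      · rfl
      · have := hy (i, j)
        simp only [C] at this
        rw [if_neg (fun h' => h h'.le), if_neg (fun h' => h h'.le)] at this
        exact this.symm
    exact ⟨_, (hmem p hp _ hS).2 (by rw [hφy]; exact hy), hφy⟩

end IsRamifiedInvolution

/-- Each `a i` occurs once for each of the `n - 1` pairs containing `i` and once on the diagonal. -/
theorem sum_pairs_add {n : ℕ} (a : Fin n → ℕ) :
    (∑ i, ∑ j, if i < j then a i + a j else if i = j then a i else 0) = n * ∑ i, a i := by
  have h1 : ∀ i j : Fin n, (if i < j then a i + a j else if i = j then a i else 0) =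
      (if i ≤ j then a i else 0) + if i < j then a j else 0 := by
    intro i j
    rcases lt_trichotomy i j with h | rfl | h
    · simp [h, h.le]
    · simp
    · simp [h.not_gt, h.not_ge, h.ne']
  simp only [h1, Finset.sum_add_distrib]
  rw [Finset.sum_comm (f := fun i j => if i < j then a j else 0), ← Finset.sum_add_distrib,
    Finset.mul_sum]
  refine Finset.sum_congr rfl fun i _ => ?_
  rw [← Finset.sum_add_distrib, Finset.sum_congr rfl (g := fun _ => a i)]
  · simp
  · intro j _
    rcases lt_or_ge j i with h | h
    · simp [h, h.not_ge]
    · simp [h, h.not_gt]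

theorem sum_pairs_const (n b e : ℕ) :
    (∑ i : Fin n, ∑ j, if i < j then b else if i = j then e else 0) = n * (n - 1) / 2 * b + n * e := by
  have h1 := sum_pairs_add (n := n) fun _ => 1
  have h2 : ∀ b e, (∑ i : Fin n, ∑ j, if i < j then b else if i = j then e else 0) =
      (∑ i : Fin n, ∑ j : Fin n, if i < j then 1 else 0) * b + n * e := by
    intro b e
    have : ∀ i j : Fin n, (if i < j then b else if i = j then e else 0) =
      (if i < j then 1 else 0) * b + if i = j then e else 0 := by
      intro i j
      rcases lt_trichotomy i j with h | rfl | h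
      · simp [h, h.ne]
      · simp
      · simp [h.not_gt, h.ne']
    simp only [this, Finset.sum_add_distrib, Finset.sum_mul]
    simp
  rw [h2] at h1 ⊢
  simp only [Finset.sum_const, Finset.card_univ, Fintype.card_fin, smul_eq_mul, mul_one] at h1
  congr 2
  rw [Nat.mul_sub_one]
  omega

end DVR

/-! ### Fibres of additive homomorphisms. -/

section Fibres

variable {A B : Type*} [AddCommGroup A] [AddCommGroup B] (f : A →+ B)

theorem card_fibre_eq_card_ker (a₀ : A) : Nat.card {a // f a = f a₀} = Nat.card f.ker :=
  Nat.card_congr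
    { toFun := fun a => ⟨a - a₀, by rw [AddMonoidHom.mem_ker, map_sub, a.2, sub_self]⟩
      invFun := fun a => ⟨a + a₀, by rw [map_add, a.2, zero_add]⟩
      left_inv := fun a => by simp
      right_inv := fun a => by simp }

theorem card_ker_mul_card (hf : Function.Surjective f) :
    Nat.card f.ker * Nat.card B = Nat.card A := by
  rw [← AddSubgroup.card_mul_index f.ker, AddSubgroup.index_ker, AddMonoidHom.range_eq_top.2 hf,
    AddSubgroup.card_top]

end Fibres

/-! ### Tuples with prescribed Gram matrix in a symplectic space over a finite field. -/

section Symplectic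

variable {k W : Type*} [Field k] [AddCommGroup W] [Module k W]

/-- Linearly independent families with prescribed Gram matrix `T`. -/
def gramTuples (B : W →ₗ[k] W →ₗ[k] k) {n : ℕ} (T : Fin n → Fin n → k) : Set (Fin n → W) :=
  {x | LinearIndependent k x ∧ ∀ i j, B (x i) (x j) = T i j}

/-- The left kernel of the square matrix `T`. -/
def leftKer {n : ℕ} (T : Fin n → Fin n → k) : Submodule k (Fin n → k) where
  carrier := {a | ∀ j, ∑ i, a i * T i j = 0}
  zero_mem' := fun j => by simp
  add_mem' := fun ha hb j => by simp [add_mul, Finset.sum_add_distrib, ha j, hb j]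
  smul_mem' := fun r a ha j => by simp [mul_assoc, ← Finset.mul_sum, ha j]

/-- A vector outside the column space is detected by a functional that vanishes on the column space;
the coordinates of the functional form a vector of the left kernel. -/
theorem exists_mem_leftKer_of_notMem_range {n : ℕ} {T : Fin n → Fin n → k} {v : Fin n → k}
    (hv : ¬∃ a : Fin n → k, ∀ i, ∑ j, T i j * a j = v i) :
    ∃ z ∈ leftKer T, ∑ i, z i * v i ≠ 0 := by
  have hv' : v ∉ LinearMap.range (Matrix.mulVecLin (Matrix.of T)) := by
    rintro ⟨a, ha⟩
    exact hv ⟨a, fun i => congrFun ha i⟩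
  obtain ⟨f, hf, hf'⟩ := Submodule.exists_dual_map_eq_bot_of_notMem hv' inferInstance
  have hrep : ∀ w : Fin n → k, f w = ∑ i, f (Pi.single i 1) * w i := by
    intro w
    conv_lhs => rw [pi_eq_sum_univ' w]
    simp [mul_comm, Pi.single]
  refine ⟨fun i => f (Pi.single i 1), fun j => ?_, ?_⟩
  · have : Matrix.mulVecLin (Matrix.of T) (Pi.single j 1) ∈
        LinearMap.range (Matrix.mulVecLin (Matrix.of T)) := ⟨_, rfl⟩
    have h0 := Submodule.mem_map_of_mem (f := f) this
    rw [hf', Submodule.mem_bot, hrep] at h0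
    simpa using h0
  · rw [← hrep]
    exact hf

variable [Finite k]

/-- If the new column is `T' a₀`, a simultaneous row and column operation turns the bordered matrix
into `T' ⊕ 0`, because `a₀ᵀ T' a₀ = 0` for alternating `T'`. The corank rises by one. -/
theorem card_leftKer_snoc_of_mem_range {n : ℕ} {T : Fin (n + 1) → Fin (n + 1) → k}
    (hT : ∀ i, T i i = 0) (hT' : ∀ i j, T j i = -T i j) (a₀ : Fin n → k)
    (ha₀ : ∀ i : Fin n, ∑ j : Fin n, T i.castSucc j.castSucc * a₀ j = T i.castSucc (Fin.last n)) :
    Nat.card (leftKer T) = Nat.card (leftKer fun i j : Fin n => T i.castSucc j.castSucc) *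
      Nat.card k := by
  have key : ∀ a : Fin (n + 1) → k, a ∈ leftKer T ↔
      (fun i : Fin n => a i.castSucc + a (Fin.last n) * a₀ i) ∈
        leftKer fun i j : Fin n => T i.castSucc j.castSucc := by
    intro a
    have h1 : ∀ j : Fin n, ∑ i, a i * T i j.castSucc =
        ∑ i : Fin n, (a i.castSucc + a (Fin.last n) * a₀ i) * T i.castSucc j.castSucc := by
      intro j
      rw [Fin.sum_univ_castSucc, hT' j.castSucc, ← ha₀]
      simp only [add_mul, Finset.sum_add_distrib, mul_neg, Finset.mul_sum, ← Finset.sum_neg_distrib]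
      congr 1
      refine Finset.sum_congr rfl fun i _ => ?_
      rw [hT' i.castSucc]
      ring
    constructor
    · intro h j
      rw [← h1]
      exact h _
    · intro h j
      refine Fin.lastCases ?_ (fun j => ?_) j
      · rw [Fin.sum_univ_castSucc, hT, mul_zero, add_zero]
        have h2 : ∀ b : Fin n → k, ∑ i : Fin n, b i * T i.castSucc (Fin.last n) =
            ∑ j, (∑ i : Fin n, b i * T i.castSucc j.castSucc) * a₀ j := by
          intro b
          simp only [← ha₀, Finset.mul_sum, Finset.sum_mul]
          rw [Finset.sum_comm]
          simp only [mul_assoc]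
        -- An alternating form vanishes on the diagonal. The induction on the size avoids dividing
        -- by 2, so the characteristic plays no role.
        have h3 : ∑ j, (∑ i : Fin n, a₀ i * T i.castSucc j.castSucc) * a₀ j = 0 := by
          have : ∀ n (T : Fin n → Fin n → k) (a : Fin n → k), (∀ i, T i i = 0) →
              (∀ i j, T j i = -T i j) → ∑ j, (∑ i, a i * T i j) * a j = 0 := by
            intro n
            induction n with
            | zero => intros; simp
            | succ n ih =>
              intro T a hT hT'
              rw [Fin.sum_univ_castSucc]
              simp only [Fin.sum_univ_castSucc (n := n), hT, add_mul, Finset.sum_add_distrib]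
              rw [ih (fun i j => T i.castSucc j.castSucc) (fun i => a i.castSucc) (fun i => hT _)
                fun i j => hT' _ _, Finset.sum_mul, mul_zero, zero_mul, add_zero, zero_add,
                ← Finset.sum_add_distrib]
              refine Finset.sum_eq_zero fun i _ => ?_
              rw [hT' i.castSucc]
              ring
          exact this n _ a₀ (fun i => hT _) fun i j => hT' _ _
        have h4 := (h2 fun i => a i.castSucc + a (Fin.last n) * a₀ i).trans
          (Finset.sum_eq_zero fun j _ => mul_eq_zero_of_left (h j) _)
        simp only [add_mul, Finset.sum_add_distrib, mul_assoc] at h4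
        rwa [← Finset.mul_sum, h2 a₀, h3, mul_zero, add_zero] at h4
      · rw [h1]
        exact h j
  rw [← Nat.card_prod]
  refine Nat.card_congr
    { toFun := fun a => (⟨_, (key a).1 a.2⟩, (a : Fin (n + 1) → k) (Fin.last n))
      invFun := fun b => ⟨Fin.snoc (fun i => (b.1 : Fin n → k) i - b.2 * a₀ i) b.2,
        (key _).2 (by simp)⟩
      left_inv := fun a => by
        ext i
        refine Fin.lastCases ?_ (fun i => ?_) i <;> simp
      right_inv := fun b => by
        ext <;> simp }

/-- Kernel vectors of the bordered matrix have last coordinate 0, as otherwise the new column would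
be in the range. They are cut out of the old kernel by one linear form, which is nonzero at the
vector `z` detecting the new column. The corank drops by one. -/
theorem card_leftKer_snoc_of_notMem_range {n : ℕ} {T : Fin (n + 1) → Fin (n + 1) → k}
    (hT' : ∀ i j, T j i = -T i j)
    (h : ¬∃ a : Fin n → k, ∀ i : Fin n,
      ∑ j : Fin n, T i.castSucc j.castSucc * a j = T i.castSucc (Fin.last n)) :
    Nat.card (leftKer T) * Nat.card k =
      Nat.card (leftKer fun i j : Fin n => T i.castSucc j.castSucc) := by
  obtain ⟨z, hz, hz'⟩ := exists_mem_leftKer_of_notMem_range h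
  let f : (leftKer fun i j : Fin n => T i.castSucc j.castSucc) →+ k :=
    { toFun := fun a => ∑ i : Fin n, (a : Fin n → k) i * T i.castSucc (Fin.last n)
      map_zero' := by simp
      map_add' := fun a b => by simp [add_mul, Finset.sum_add_distrib] }
  have hf : Function.Surjective f := by
    intro y
    refine ⟨(y / ∑ i : Fin n, z i * T i.castSucc (Fin.last n)) • ⟨z, hz⟩, ?_⟩
    change ∑ i : Fin n, (_ * z i) * _ = y
    simp only [mul_assoc]
    rw [← Finset.mul_sum, div_mul_cancel₀ _ hz']
  rw [← card_ker_mul_card f hf]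
  congr 1
  have hlast : ∀ a ∈ leftKer T, a (Fin.last n) = 0 := by
    intro a ha
    by_contra h0
    refine h ⟨fun i => -a i.castSucc / a (Fin.last n), fun j => ?_⟩
    have h1 := ha j.castSucc
    rw [Fin.sum_univ_castSucc, hT' j.castSucc] at h1
    have h2 : ∀ i : Fin n, T j.castSucc i.castSucc * (-a i.castSucc / a (Fin.last n)) =
        (a i.castSucc * T i.castSucc j.castSucc) * (a (Fin.last n))⁻¹ := by
      intro i
      rw [hT' i.castSucc]
      field_simp
    simp only [h2]
    rw [← Finset.sum_mul, mul_inv_eq_iff_eq_mul₀ h0]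
    linear_combination h1
  refine Nat.card_congr
    { toFun := fun a => ⟨⟨fun i => (a : Fin (n + 1) → k) i.castSucc, fun j => ?_⟩, ?_⟩
      invFun := fun b => ⟨Fin.snoc (b.1 : Fin n → k) 0, fun j => ?_⟩
      left_inv := fun a => ?_
      right_inv := fun b => ?_ }
  · have := a.2 j.castSucc
    rwa [Fin.sum_univ_castSucc, hlast _ a.2, zero_mul, add_zero] at this
  · have := a.2 (Fin.last n)
    rwa [Fin.sum_univ_castSucc, hlast _ a.2, zero_mul, add_zero] at this
  · refine Fin.lastCases ?_ (fun j => ?_) j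
    · have hb : ∑ i : Fin n, (b.1 : Fin n → k) i * T i.castSucc (Fin.last n) = 0 := b.2
      simpa [Fin.sum_univ_castSucc] using hb
    · simpa [Fin.sum_univ_castSucc] using b.1.2 j
  · ext i
    refine Fin.lastCases ?_ (fun i => ?_) i
    · simp [hlast _ a.2]
    · simp
  · ext
    simp

variable [FiniteDimensional k W] {B : W →ₗ[k] W →ₗ[k] k}

/-- A functional that kills the image gives a combination of the `x i` orthogonal to everything;
nondegeneracy makes the combination zero and independence kills its coefficients. -/
theorem pairing_surjective (hB : ∀ y, (∀ x, B x y = 0) → y = 0) {n : ℕ} {x : Fin n → W}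
    (hx : LinearIndependent k x) (hB' : ∀ x, B x x = 0) :
    Function.Surjective fun w => fun i => B (x i) w := by
  let φ : W →ₗ[k] (Fin n → k) := LinearMap.pi fun i => B (x i)
  change Function.Surjective φ
  rw [← LinearMap.range_eq_top]
  by_contra hne
  obtain ⟨f, hf, hf'⟩ := Submodule.exists_le_ker_of_lt_top _ (lt_top_iff_ne_top.2 hne)
  have hrep : ∀ w : Fin n → k, f w = ∑ i, f (Pi.single i 1) * w i := by
    intro w
    conv_lhs => rw [pi_eq_sum_univ' w]
    simp [mul_comm, Pi.single]
  have halt : LinearMap.IsAlt B := hB'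
  have h0 : ∑ i, f (Pi.single i 1) • x i = 0 := by
    refine hB _ fun w => ?_
    have h1 : f (φ w) = 0 := hf' ⟨w, rfl⟩
    rw [hrep] at h1
    rw [← halt.neg, neg_eq_zero, map_sum, LinearMap.sum_apply]
    simpa [φ] using h1
  have h2 := Fintype.linearIndependent_iff.1 hx _ h0
  exact hf (LinearMap.ext fun w => by rw [hrep]; simp [h2])

/-- The prescribed pairings with the `x i` are `n` independent affine conditions, which leave `|W| /
|k| ^ n` vectors. Those in the span of `x` correspond to the solutions `a` of `T a = v`, an empty
set or a translate of the kernel of `T`; their number is `b`. -/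
theorem card_extend_tuple (hB : ∀ y, (∀ x, B x y = 0) → y = 0) (hB' : ∀ x, B x x = 0) {n : ℕ}
    {x : Fin n → W} {T : Fin n → Fin n → k} (hx : x ∈ gramTuples B T)
    (hT' : ∀ i j, T j i = -T i j) (v : Fin n → k) (b : ℕ)
    (hb : ((∃ a : Fin n → k, ∀ i, ∑ j, T i j * a j = v i) ∧ b = Nat.card (leftKer T)) ∨
      (¬(∃ a : Fin n → k, ∀ i, ∑ j, T i j * a j = v i) ∧ b = 0)) :
    (Nat.card {w // w ∉ Submodule.span k (Set.range x) ∧ ∀ i, B (x i) w = v i} : ℝ) =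
      (Nat.card k : ℝ) ^ Module.finrank k W / (Nat.card k : ℝ) ^ n - b := by
  classical
  have : Finite W := Module.finite_of_finite k
  let φ : W →+ (Fin n → k) := (LinearMap.pi fun i => B (x i)).toAddMonoidHom
  have hφ : Function.Surjective φ := pairing_surjective hB hx.1 hB'
  obtain ⟨w₀, hw₀⟩ := hφ v
  have h1 := card_ker_mul_card φ hφ
  rw [← card_fibre_eq_card_ker φ w₀, hw₀, Nat.card_fun, Nat.card_eq_fintype_card (α := Fin n),
    Fintype.card_fin, Module.natCard_eq_pow_finrank (K := k) (V := W)] at h1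
  have hq : (Nat.card k : ℝ) ^ n ≠ 0 := by
    have : 0 < Nat.card k := Nat.card_pos
    positivity
  have h2 : Nat.card {w // φ w = v} =
      Nat.card {w // w ∉ Submodule.span k (Set.range x) ∧ ∀ i, B (x i) w = v i} +
      Nat.card {w // w ∈ Submodule.span k (Set.range x) ∧ ∀ i, B (x i) w = v i} := by
    have h5 := Set.ncard_inter_add_ncard_sdiff_eq_ncard {w | φ w = v}
      (Submodule.span k (Set.range x) : Set W) (Set.toFinite _)
    rw [add_comm] at h5
    refine h5.symm.trans ?_
    rw [← Nat.card_coe_set_eq, ← Nat.card_coe_set_eq]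
    congr 1 <;> refine Nat.card_congr (Equiv.subtypeEquivRight fun w => ?_) <;>
      exact and_comm.trans (and_congr_right fun _ => funext_iff)
  have h3 : Nat.card {w // w ∈ Submodule.span k (Set.range x) ∧ ∀ i, B (x i) w = v i} = b := by
    have h4 : Nat.card {w // w ∈ Submodule.span k (Set.range x) ∧ ∀ i, B (x i) w = v i} =
        Nat.card {a : Fin n → k // ∀ i, ∑ j, T i j * a j = v i} := by
      let g : {a : Fin n → k // ∀ i, ∑ j, T i j * a j = v i} →
          {w // w ∈ Submodule.span k (Set.range x) ∧ ∀ i, B (x i) w = v i} := fun a =>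
        ⟨∑ j, a.1 j • x j,
          sum_mem fun i _ => Submodule.smul_mem _ _ (Submodule.subset_span ⟨i, rfl⟩), fun i => by
            rw [← a.2 i, map_sum]
            refine Finset.sum_congr rfl fun j _ => ?_
            rw [map_smul, hx.2, smul_eq_mul, mul_comm]⟩
      refine (Nat.card_congr (Equiv.ofBijective g ⟨?_, ?_⟩)).symm
      · intro a a' haa'
        replace haa' : ∑ j, a.1 j • x j = ∑ j, a'.1 j • x j := congrArg Subtype.val haa'
        ext i
        have := Fintype.linearIndependent_iff.1 hx.1 (fun i => a.1 i - a'.1 i)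
          (by simp [sub_smul, Finset.sum_sub_distrib, haa']) i
        exact sub_eq_zero.1 this
      · rintro ⟨w, hw, hw'⟩
        obtain ⟨a, rfl⟩ := (Submodule.mem_span_range_iff_exists_fun k).1 hw
        refine ⟨⟨a, fun i => ?_⟩, rfl⟩
        rw [← hw' i, map_sum]
        refine Finset.sum_congr rfl fun j _ => ?_
        rw [map_smul, hx.2, smul_eq_mul, mul_comm]
    rw [h4]
    rcases hb with ⟨⟨a₀, ha₀⟩, rfl⟩ | ⟨hne, rfl⟩
    · refine Nat.card_congr
        { toFun := fun a => ⟨a.1 - a₀, fun j => ?_⟩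
          invFun := fun a => ⟨a.1 + a₀, fun j => ?_⟩
          left_inv := fun a => by simp
          right_inv := fun a => by simp }
      · have h5 := (a.2 j).trans (ha₀ j).symm
        rw [← sub_eq_zero, ← Finset.sum_sub_distrib] at h5
        rw [← neg_eq_zero, ← h5, ← Finset.sum_neg_distrib]
        refine Finset.sum_congr rfl fun i _ => ?_
        rw [hT' j, Pi.sub_apply]
        ring
      · rw [← ha₀ j, ← sub_eq_zero, ← Finset.sum_sub_distrib, ← neg_eq_zero, ← a.2 j,
          ← Finset.sum_neg_distrib]
        refine Finset.sum_congr rfl fun i _ => ?_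
        rw [hT' j, Pi.add_apply]
        ring
    · rw [Nat.card_eq_zero]
      exact Or.inl ⟨fun a => hne ⟨a.1, a.2⟩⟩
  rw [h2, h3] at h1
  rw [eq_sub_iff_add_eq, eq_div_iff hq]
  exact_mod_cast h1

/-- Vectors are added one at a time. Bordering an alternating matrix changes the corank by 1 or -1,
so `n + t` grows by 2 or 0 and stays even. It grows exactly when the new column lies in the range of
the old matrix; besides a power of `q` the step then contributes `1 - q ^ (n + t') / q ^ dim W`,
with `t'` the old corank. In the other case no vector of the span is excluded and only a power of
`q` appears. -/
theorem card_gramTuples (hB : ∀ y, (∀ x, B x y = 0) → y = 0) (hB' : ∀ x, B x x = 0) {n : ℕ}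
    (T : Fin n → Fin n → k) (hT : ∀ i, T i i = 0) (hT' : ∀ i j, T j i = -T i j) (t : ℕ)
    (ht : Nat.card (leftKer T) = Nat.card k ^ t) :
    Even (n + t) ∧ (Nat.card (gramTuples B T) : ℝ) =
      (Nat.card k : ℝ) ^ (Module.finrank k W * n) / (Nat.card k : ℝ) ^ (n * (n - 1) / 2) *
        ∏ j ∈ Finset.range ((n + t) / 2),
          (1 - (Nat.card k : ℝ) ^ (2 * j) / (Nat.card k : ℝ) ^ Module.finrank k W) := by
  have hq1 : 1 < Nat.card k := Finite.one_lt_card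
  have hq0 : (Nat.card k : ℝ) ≠ 0 := by positivity
  induction n generalizing t with
  | zero =>
    have h1 : Nat.card (leftKer T) = 1 := by
      rw [Nat.card_eq_one_iff_unique]
      exact ⟨inferInstance, ⟨0⟩⟩
    rw [h1] at ht
    have h2 : t = 0 := by
      by_contra h0
      exact (Nat.one_lt_pow h0 hq1).ne ht
    subst h2
    have h3 : Nat.card (gramTuples B T) = 1 := by
      rw [Nat.card_eq_one_iff_unique]
      exact ⟨inferInstance, ⟨⟨0, linearIndependent_empty_type, fun i => i.elim0⟩⟩⟩
    simp [h3]
  | succ n ih =>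
    have : Finite W := Module.finite_of_finite k
    set T' : Fin n → Fin n → k := fun i j => T i.castSucc j.castSucc with hT'def
    set v : Fin n → k := fun i => T i.castSucc (Fin.last n) with hv
    obtain ⟨t', ht'⟩ : ∃ t', Nat.card (leftKer T') = Nat.card k ^ t' :=
      ⟨_, Module.natCard_eq_pow_finrank (K := k) (V := leftKer T')⟩
    obtain ⟨hev, hcard⟩ := ih T' (fun i => hT _) (fun i j => hT' _ _) t' ht'
    have hstep : ∀ C : ℝ, (∀ x ∈ gramTuples B T',
        (Nat.card {w // w ∉ Submodule.span k (Set.range x) ∧ ∀ i, B (x i) w = v i} : ℝ) = C) →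
        (Nat.card (gramTuples B T) : ℝ) = Nat.card (gramTuples B T') * C := by
      intro C hC
      have e : (Σ x : gramTuples B T',
          {w // w ∉ Submodule.span k (Set.range (x : Fin n → W)) ∧
            ∀ i, B ((x : Fin n → W) i) w = v i}) ≃ gramTuples B T := by
        have hmem : ∀ x ∈ gramTuples B T', ∀ w, (w ∉ Submodule.span k (Set.range x) ∧
            ∀ i, B (x i) w = v i) → (Fin.snoc x w : Fin (n + 1) → W) ∈ gramTuples B T := by
          intro x hx w hw
          refine ⟨linearIndependent_finSnoc.2 ⟨hx.1, hw.1⟩, fun i j => ?_⟩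
          refine Fin.lastCases ?_ (fun i => ?_) i <;> refine Fin.lastCases ?_ (fun j => ?_) j
          · simp [hB', hT]
          · have halt : LinearMap.IsAlt B := hB'
            simp only [Fin.snoc_last, Fin.snoc_castSucc]
            rw [← halt.neg, hw.2 j, hT' j.castSucc]
          · simpa using hw.2 i
          · simpa using hx.2 i j
        refine Equiv.ofBijective (fun z => ⟨Fin.snoc z.1.1 z.2.1, hmem _ z.1.2 _ z.2.2⟩)
          ⟨?_, fun y => ?_⟩
        · rintro ⟨⟨x, hx⟩, ⟨w, hw⟩⟩ ⟨⟨x', hx'⟩, ⟨w', hw'⟩⟩ h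
          replace h : (Fin.snoc x w : Fin (n + 1) → W) = Fin.snoc x' w' := congrArg Subtype.val h
          have h1 : x = x' := by simpa using congrArg Fin.init h
          have h2 : w = w' := by simpa using congrFun h (Fin.last n)
          subst h1 h2
          rfl
        · exact ⟨⟨⟨Fin.init y.1, (linearIndependent_finSucc'.1 y.2.1).1,
              fun i j => y.2.2 _ _⟩, ⟨y.1 (Fin.last n), (linearIndependent_finSucc'.1 y.2.1).2,
              fun i => y.2.2 _ _⟩⟩, by simp⟩
      have : Fintype (gramTuples B T') := Fintype.ofFinite _
      rw [← Nat.card_congr e, Nat.card_sigma, Nat.cast_sum,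
        Finset.sum_congr rfl fun x _ => hC x.1 x.2]
      simp
    by_cases hmem : ∃ a : Fin n → k, ∀ i, ∑ j, T' i j * a j = v i
    · obtain ⟨a₀, ha₀⟩ := hmem
      have h1 := card_leftKer_snoc_of_mem_range hT hT' a₀ ha₀
      rw [ht, ht', ← pow_succ] at h1
      obtain rfl : t = t' + 1 := Nat.pow_right_injective hq1 h1
      obtain ⟨e, he⟩ := hev
      refine ⟨⟨e + 1, by omega⟩, ?_⟩
      rw [hstep _ fun x hx => card_extend_tuple hB hB' hx (fun i j => hT' _ _) v _
        (Or.inl ⟨⟨a₀, ha₀⟩, rfl⟩), hcard, ht', Nat.cast_pow,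
        show (n + 1 + (t' + 1)) / 2 = e + 1 by omega, show (n + t') / 2 = e by omega,
        Finset.prod_range_succ,
        show (n + 1) * (n + 1 - 1) / 2 = n * (n - 1) / 2 + n by
          rw [Nat.add_sub_cancel, ← Nat.triangle_succ, Nat.add_sub_cancel]]
      -- The `q ^ t'` excluded vectors, divided by `q ^ (dim W - n)`, give the exponent `n + t' = 2
      -- e` of the new factor.
      have h2 : (Nat.card k : ℝ) ^ (2 * e) = (Nat.card k : ℝ) ^ n * (Nat.card k : ℝ) ^ t' := by
        rw [← pow_add]
        congr 1
        omega
      rw [h2, mul_add, mul_one, pow_add, pow_add]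
      field_simp
    · have h1 := card_leftKer_snoc_of_notMem_range hT' hmem
      rw [ht, ht', ← pow_succ] at h1
      obtain rfl : t + 1 = t' := Nat.pow_right_injective hq1 h1
      obtain ⟨e, he⟩ := hev
      refine ⟨⟨e, by omega⟩, ?_⟩
      rw [hstep _ fun x hx => card_extend_tuple hB hB' hx (fun i j => hT' _ _) v _
        (Or.inr ⟨hmem, rfl⟩), hcard,
        show (n + 1 + t) / 2 = e by omega, show (n + (t + 1)) / 2 = e by omega,
        show (n + 1) * (n + 1 - 1) / 2 = n * (n - 1) / 2 + n by
          rw [Nat.add_sub_cancel, ← Nat.triangle_succ, Nat.add_sub_cancel]]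
      rw [Nat.cast_zero, sub_zero, mul_add, mul_one, pow_add, pow_add]
      field_simp

end Symplectic

theorem cosetCount_eq_ncard {A X : Type*} [AddCommGroup A] {B : AddSubgroup A} {S : Set A}
    (ρ : A → X) (hρ : ∀ x ∈ S, ∀ y ∈ S, ρ x = ρ y ↔ y - x ∈ B) :
    cosetCount B S = (ρ '' S).ncard := by
  have key : ∀ z ∈ (QuotientAddGroup.mk : A → A ⧸ B) '' S, ∃ x ∈ S, QuotientAddGroup.mk x = z :=
    fun z hz => hz
  choose! g hg hg' using key
  have h1 : Set.InjOn (fun z => ρ (g z)) ((QuotientAddGroup.mk : A → A ⧸ B) '' S) := by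
    intro z hz w hw hzw
    rw [← hg' z hz, ← hg' w hw]
    exact mk_eq_iff.2 ((hρ _ (hg z hz) _ (hg w hw)).1 hzw)
  rw [cosetCount, ← h1.ncard_image]
  congr 1
  ext y
  constructor
  · rintro ⟨z, hz, rfl⟩
    exact ⟨_, hg z hz, rfl⟩
  · rintro ⟨x, hx, rfl⟩
    have hz : (QuotientAddGroup.mk x : A ⧸ B) ∈ (QuotientAddGroup.mk : A → A ⧸ B) '' S :=
      ⟨x, hx, rfl⟩
    exact ⟨_, hz, (hρ _ (hg _ hz) _ hx).2 (mk_eq_iff.1 (hg' _ hz))⟩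

/-! ### Self-dual lattices and primitive families. -/

section Lattices

variable {R E : Type*} [CommRing R] [IsDomain R] [IsDiscreteValuationRing R] [Field E]
  [Algebra R E] [IsFractionRing R E] {c : E →+* E} {u : R}
variable {W : Type*} [AddCommGroup W] [Module E W] [Module R W] [IsScalarTower R E W]

/-- The module `u ^ k M`. -/
def scale (E : Type*) [Field E] [Algebra R E] [Module E W] [IsScalarTower R E W] (u : R)
    (M : Submodule R W) (k : ℤ) : Submodule R W where
  carrier := {w | algebraMap R E u ^ (-k) • w ∈ M}
  zero_mem' := by simp
  add_mem' := fun ha hb => by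
    rw [Set.mem_ofPred_eq, smul_add]
    exact add_mem ha hb
  smul_mem' := fun r a ha => by
    rw [Set.mem_ofPred_eq, ← algebraMap_smul E r a, smul_comm, algebraMap_smul]
    exact M.smul_mem r ha

theorem mem_scale {M : Submodule R W} {k : ℤ} {w : W} :
    w ∈ scale E u M k ↔ algebraMap R E u ^ (-k) • w ∈ M := Iff.rfl

theorem scale_zero {M : Submodule R W} : scale E u M 0 = M := by
  ext
  simp [mem_scale]

/-- `M` is its own dual with respect to the pairing `h` with values in `u⁻¹ R`. -/
def IsSelfDual (u : R) (h : W →ₗ[E] W →ₛₗ[c] E) (M : Submodule R W) : Prop :=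
  ∀ y, y ∈ M ↔ ∀ x ∈ M, h y x ∈ pw E u (-1)

/-- The family `x` is linearly independent modulo `u M`. -/
def IsPrimitive (u : R) (M : Submodule R W) {n : ℕ} (x : Fin n → W) : Prop :=
  ∀ a : Fin n → R, (∃ y ∈ M, ∑ i, a i • x i = u • y) → ∀ i, u ∣ a i

/-- Families with `i`-th member in `u ^ (k i) M`. -/
def tupleGroup (E : Type*) [Field E] [Algebra R E] [Module E W] [IsScalarTower R E W] (u : R)
    (M : Submodule R W) {n : ℕ} (k : Fin n → ℤ) : AddSubgroup (Fin n → W) where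
  carrier := {x | ∀ i, x i ∈ scale E u M (k i)}
  zero_mem' := fun _ => zero_mem _
  add_mem' := fun ha hb i => add_mem (ha i) (hb i)
  neg_mem' := fun ha i => neg_mem (ha i)

/-- Primitive families in `M` whose Gram matrix is congruent to `T` modulo `u ^ p`. -/
def gramSet (u : R) (h : W →ₗ[E] W →ₛₗ[c] E) (M : Submodule R W) {n : ℕ} (T : Fin n → Fin n → E)
    (p : Fin n → Fin n → ℤ) : Set (Fin n → W) :=
  {x | (∀ i, x i ∈ M) ∧ IsPrimitive u M x ∧ ∀ i j, h (x i) (x j) - T i j ∈ pw E u (p i j)}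

namespace IsRamifiedInvolution

variable {h : W →ₗ[E] W →ₛₗ[c] E} {M : Submodule R W}

theorem scale_anti (hc : IsRamifiedInvolution c u) {k l : ℤ} (hkl : k ≤ l) :
    scale E u M l ≤ scale E u M k := by
  intro w hw
  obtain ⟨i, rfl⟩ := Int.le.dest hkl
  rw [mem_scale] at hw ⊢
  have : algebraMap R E u ^ (-k) • w = (u ^ i : R) • algebraMap R E u ^ (-(k + i)) • w := by
    rw [← algebraMap_smul E (u ^ i), smul_smul, map_pow, ← zpow_natCast, ← zpow_add₀ hc.ne_zero]
    congr 2
    ring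
  rw [this]
  exact M.smul_mem _ hw

theorem zpow_smul_mem_scale (hc : IsRamifiedInvolution c u) {k : ℤ} (l : ℤ) {w : W} :
    algebraMap R E u ^ l • w ∈ scale E u M (l + k) ↔ w ∈ scale E u M k := by
  rw [mem_scale, mem_scale, smul_smul, ← zpow_add₀ hc.ne_zero]
  ring_nf

theorem pairing_mem (hc : IsRamifiedInvolution c u)
    (hM : ∀ x ∈ M, ∀ y ∈ M, h x y ∈ pw E u (-1)) {k l : ℤ} {x y : W} (hx : x ∈ scale E u M k)
    (hy : y ∈ scale E u M l) : h x y ∈ pw E u (k + l - 1) := by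
  have h1 := hM _ hx _ hy
  rw [LinearMap.map_smul₂, LinearMap.map_smulₛₗ, smul_eq_mul, smul_eq_mul] at h1
  have h2 := hc.mul_mem (hc.c_mem ((hc.zpow_mul_mem l 0).2 (mem_pw_zero.2 ⟨1, map_one _⟩)))
    ((hc.zpow_mul_mem k (-1)).2 h1)
  have hu := hc.ne_zero
  have h3 : c (algebraMap R E u ^ l) * c (algebraMap R E u ^ (-l)) = 1 := by
    rw [← map_mul, ← zpow_add₀ hu, add_neg_cancel, zpow_zero, map_one]
  have h4 : algebraMap R E u ^ k * algebraMap R E u ^ (-k) = 1 := by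
    rw [← zpow_add₀ hu, add_neg_cancel, zpow_zero]
  convert h2 using 1
  · congr 1
    ring
  · rw [mul_one]
    linear_combination (-(h x) y) * h3 -
      c (algebraMap R E u ^ l) * c (algebraMap R E u ^ (-l)) * (h x) y * h4

theorem isPrimitive_congr (hc : IsRamifiedInvolution c u) {n : ℕ} {x y : Fin n → W}
    (hx : IsPrimitive u M x) (hxy : ∀ i, y i - x i ∈ scale E u M 1) : IsPrimitive u M y := by
  rintro a ⟨z, hz, haz⟩
  refine hx a ⟨z - ∑ i, a i • algebraMap R E u ^ (-1 : ℤ) • (y i - x i),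
    sub_mem hz (sum_mem fun i _ => M.smul_mem _ (hxy i)), ?_⟩
  rw [smul_sub, ← haz, Finset.smul_sum, ← Finset.sum_sub_distrib]
  refine Finset.sum_congr rfl fun i _ => ?_
  have : u • a i • algebraMap R E u ^ (-1 : ℤ) • (y i - x i) = a i • (y i - x i) := by
    rw [smul_comm, ← algebraMap_smul E u, smul_smul, zpow_neg_one, mul_inv_cancel₀ hc.ne_zero,
      one_smul]
  rw [this, smul_sub, sub_sub_cancel]

/-- By Nakayama it suffices to reach all values modulo `u`. A functional killing the image there
yields a combination of the `x i` whose quotient by `u` still pairs `M` into `u⁻¹ R`. Self-duality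
puts this quotient in `M`, and primitivity makes the coefficients vanish modulo `u`. -/
theorem exists_pairing_eq (hc : IsRamifiedInvolution c u) (hh : ∀ x y, h y x = c (h x y))
    (hM : IsSelfDual u h M) {n : ℕ} {x : Fin n → W} (hx : IsPrimitive u M x)
    (hxM : ∀ i, x i ∈ M) (t : Fin n → E) (ht : ∀ i, t i ∈ pw E u (-1)) :
    ∃ y ∈ M, ∀ i, h y (x i) = t i := by
  have hu := hc.ne_zero
  -- The vectors of values of `M` on the family, rescaled by `u` so as to lie in `R ^ n`; the claim
  -- is that `N` is everything.
  let N : Submodule R (Fin n → R) :=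
    { carrier := {v | ∃ y ∈ M, ∀ i, h y (x i) = algebraMap R E u ^ (-1 : ℤ) * algebraMap R E (v i)}
      zero_mem' := ⟨0, zero_mem _, fun i => by simp⟩
      add_mem' := by
        rintro v w ⟨y, hy, hy'⟩ ⟨z, hz, hz'⟩
        exact ⟨y + z, add_mem hy hz, fun i => by simp [hy', hz', mul_add]⟩
      smul_mem' := by
        rintro r v ⟨y, hy, hy'⟩
        refine ⟨r • y, M.smul_mem r hy, fun i => ?_⟩
        rw [← algebraMap_smul E r y, LinearMap.map_smul₂, hy', Pi.smul_apply, smul_eq_mul,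
          smul_eq_mul, map_mul]
        ring }
  let k := IsLocalRing.ResidueField R
  let N' : Submodule k (Fin n → k) :=
    { carrier := {w | ∃ v ∈ N, ∀ i, IsLocalRing.residue R (v i) = w i}
      zero_mem' := ⟨0, zero_mem _, fun i => by simp⟩
      add_mem' := by
        rintro v w ⟨y, hy, hy'⟩ ⟨z, hz, hz'⟩
        exact ⟨y + z, add_mem hy hz, fun i => by simp [hy', hz']⟩
      smul_mem' := by
        rintro r v ⟨y, hy, hy'⟩
        obtain ⟨r, rfl⟩ := IsLocalRing.residue_surjective r
        exact ⟨r • y, N.smul_mem r hy, fun i => by simp [hy']⟩ }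
  have hN' : N' = ⊤ := by
    by_contra hne
    obtain ⟨f, hf, hf'⟩ := Submodule.exists_le_ker_of_lt_top _ (lt_top_iff_ne_top.2 hne)
    have hrep : ∀ w : Fin n → k, f w = ∑ i, f (Pi.single i 1) * w i := by
      intro w
      conv_lhs => rw [pi_eq_sum_univ' w]
      simp [mul_comm, Pi.single]
    have hlift : ∀ i, ∃ a : R, IsLocalRing.residue R a = f (Pi.single i 1) := fun i =>
      IsLocalRing.residue_surjective _
    choose a ha using hlift
    -- The form is conjugate-linear in its second variable, so the combination must use the
    -- conjugates of the `a i`, which agree with the `a i` modulo `u`.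
    have hca : ∀ i, ∃ b : R, c (algebraMap R E (a i)) = algebraMap R E (a i + u * b) := fun i =>
      hc.residue _
    choose b hb using hca
    have hdvd : ∀ i, u ∣ a i + u * b i := by
      refine hx (fun i => a i + u * b i) ⟨algebraMap R E u ^ (-1 : ℤ) •
        ∑ i, (a i + u * b i) • x i, ?_, ?_⟩
      · rw [hM]
        intro y hy
        rw [LinearMap.map_smul₂, smul_eq_mul]
        refine hc.zpow_mul_mem' (k := 0) _ ?_
        rw [hh, hc.c_mem_iff, map_sum]
        have hyi : ∀ i, ∃ v : R, h y (x i) = algebraMap R E u ^ (-1 : ℤ) * algebraMap R E v := fun i =>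
          (hM y).1 hy _ (hxM i)
        choose v hv using hyi
        have h0 : IsLocalRing.residue R (∑ i, a i * v i) = 0 := by
          have : f (fun i => IsLocalRing.residue R (v i)) = 0 := hf' ⟨v, ⟨y, hy, hv⟩, fun i => rfl⟩
          rw [hrep] at this
          rw [← this, map_sum]
          exact Finset.sum_congr rfl fun i _ => by rw [map_mul, ha]
        rw [IsLocalRing.residue_eq_zero_iff, hc.maximalIdeal_eq, Ideal.mem_span_singleton] at h0
        obtain ⟨d, hd⟩ := h0
        refine ⟨d, ?_⟩
        have : ∀ i, h y ((a i + u * b i) • x i) =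
            algebraMap R E u ^ (-1 : ℤ) * algebraMap R E (a i * v i) := by
          intro i
          rw [← algebraMap_smul E (a i + u * b i), LinearMap.map_smulₛₗ, ← hb, hc.involutive, hv,
            smul_eq_mul, map_mul]
          ring
        simp only [this]
        rw [← Finset.mul_sum, ← map_sum, hd, map_mul, zpow_neg_one, zpow_zero, ← mul_assoc,
          inv_mul_cancel₀ hu]
      · rw [← algebraMap_smul E u, smul_smul, zpow_neg_one, mul_inv_cancel₀ hu, one_smul]
    refine hf (LinearMap.ext fun w => ?_)
    rw [hrep, LinearMap.zero_apply]
    refine Finset.sum_eq_zero fun i _ => ?_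
    rw [← ha, (IsLocalRing.residue_eq_zero_iff _).2, zero_mul]
    rw [hc.maximalIdeal_eq, Ideal.mem_span_singleton]
    exact (dvd_add_left (dvd_mul_right u _)).1 (hdvd i)
  have hN : (⊤ : Submodule R (Fin n → R)) ≤ N := by
    refine Submodule.le_of_le_smul_of_le_jacobson_bot (I := IsLocalRing.maximalIdeal R)
      Module.Finite.fg_top (IsLocalRing.maximalIdeal_le_jacobson _) ?_
    intro v _
    have : (fun i => IsLocalRing.residue R (v i)) ∈ N' := hN' ▸ Submodule.mem_top
    obtain ⟨w, hw, hw'⟩ := this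
    rw [← add_sub_cancel w v]
    refine Submodule.add_mem_sup hw ?_
    have hd : ∀ i, ∃ d, v i - w i = u * d := by
      intro i
      have := sub_eq_zero.2 (hw' i).symm
      rwa [← map_sub, IsLocalRing.residue_eq_zero_iff, hc.maximalIdeal_eq,
        Ideal.mem_span_singleton] at this
    choose d hd using hd
    have : v - w = u • d := by
      ext i
      exact hd i
    rw [this]
    refine Submodule.smul_mem_smul ?_ Submodule.mem_top
    rw [hc.maximalIdeal_eq]
    exact Ideal.mem_span_singleton_self u
  choose v hv using ht
  obtain ⟨y, hy, hy'⟩ := hN (Submodule.mem_top (x := v))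
  exact ⟨y, hy, fun i => by rw [hy', hv]⟩

end IsRamifiedInvolution

end Lattices

/-! ### Lifting solutions of Gram equations to higher congruence levels. -/

section Lifting

variable {R E : Type*} [CommRing R] [IsDomain R] [IsDiscreteValuationRing R] [Field E]
  [Algebra R E] [IsFractionRing R E] {c : E →+* E} {u : R}
variable {W : Type*} [AddCommGroup W] [Module E W] [Module R W] [IsScalarTower R E W]

theorem mem_scale_zero {M : Submodule R W} {w : W} : w ∈ scale E u M 0 ↔ w ∈ M := by
  rw [scale_zero]

theorem mem_tupleGroup {M : Submodule R W} {n : ℕ} {k : Fin n → ℤ} {x : Fin n → W} :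
    x ∈ tupleGroup E u M k ↔ ∀ i, x i ∈ scale E u M (k i) := Iff.rfl

namespace IsRamifiedInvolution

variable {h : W →ₗ[E] W →ₛₗ[c] E} {M : Submodule R W}

theorem hermMatrices_anti (hc : IsRamifiedInvolution c u) {n : ℕ} {p p' : Fin n → Fin n → ℤ}
    (hp : ∀ i j, p i j ≤ p' i j) : hermMatrices c u p' ≤ hermMatrices c u p :=
  fun _ hS i j => ⟨(hS i j).1, hc.anti (hp i j) (hS i j).2⟩

theorem relIndex_hermMatrices_ne_zero [Finite (IsLocalRing.ResidueField R)]
    (hc : IsRamifiedInvolution c u) {n : ℕ} {p p' : Fin n → Fin n → ℤ}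
    (hp : ∀ i j, p i j = p j i) (hp' : ∀ i j, p' i j = p' j i) (hpp' : ∀ i j, p i j ≤ p' i j) :
    (hermMatrices c u p').relIndex (hermMatrices c u p) ≠ 0 := by
  have hq : Nat.card (IsLocalRing.ResidueField R) ≠ 0 := Nat.card_pos.ne'
  have hfix : ∀ i, ∃ ε : ℕ, (fixedPw c u (p' i i)).relIndex (fixedPw c u (p i i)) =
      Nat.card (IsLocalRing.ResidueField R) ^ ε := by
    intro i
    have key : ∀ k l : ℤ, Even k → k ≤ l → ∃ ε : ℕ, (fixedPw c u l).relIndex (fixedPw c u k) =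
        Nat.card (IsLocalRing.ResidueField R) ^ ε := by
      intro k l hk hkl
      obtain ⟨d, hd⟩ := Int.le.dest hkl
      rcases Int.even_or_odd l with hl | hl
      · obtain ⟨e, he⟩ : Even (l - k) := hl.sub hk
        exact ⟨e.toNat, hc.relIndex_fixedPw_even hk _ (by omega)⟩
      · rw [hc.fixedPw_odd hl]
        obtain ⟨e, he⟩ : Even (l + 1 - k) := hl.add_one.sub hk
        exact ⟨e.toNat, hc.relIndex_fixedPw_even hk _ (by omega)⟩
    rcases Int.even_or_odd (p i i) with hk | hk
    · exact key _ _ hk (hpp' i i)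
    · rcases (hpp' i i).eq_or_lt with he | hlt
      · exact ⟨0, by rw [he, AddSubgroup.relIndex_self, pow_zero]⟩
      · rw [hc.fixedPw_odd hk]
        exact key _ _ hk.add_one hlt
  choose ε hε using hfix
  rw [hc.relIndex_hermMatrices p p' hp hp' (fun i j => (p' i j - p i j).toNat) ε
    (fun i j _ => by have := hpp' i j; omega) hε]
  exact pow_ne_zero _ hq

theorem relIndex_tupleGroup {ι : Type*} [Fintype ι] (b : Module.Basis ι E W)
    (hb : ∀ w, w ∈ M ↔ ∀ j, b.repr w j ∈ pw E u 0) (hc : IsRamifiedInvolution c u) {n : ℕ}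
    {k l : Fin n → ℤ} (δ : Fin n → ℕ) (hδ : ∀ i, l i = k i + δ i) :
    (tupleGroup E u M l).relIndex (tupleGroup E u M k) =
      Nat.card (IsLocalRing.ResidueField R) ^ (Fintype.card ι * ∑ i, δ i) := by
  have hs : ∀ w (k : ℤ), w ∈ scale E u M k ↔ ∀ j, b.repr w j ∈ pw E u k := by
    intro w k
    rw [mem_scale, hb]
    refine forall_congr' fun j => ?_
    rw [map_smul, Finsupp.smul_apply, smul_eq_mul, ← hc.zpow_mul_mem (-k) k, neg_add_cancel]
  let φ : (Fin n → W) →+ (Fin n × ι → E) :=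
    { toFun := fun x s => b.repr (x s.1) s.2
      map_zero' := by ext; simp
      map_add' := fun x y => by ext; simp }
  rw [relIndex_eq_prod (tupleGroup E u M k) (tupleGroup E u M l)
    (fun s : Fin n × ι => (pw E u (k s.1)).toAddSubgroup)
    (fun s : Fin n × ι => (pw E u (l s.1)).toAddSubgroup) φ
    (fun x hx s => (hs _ _).1 (hx s.1) s.2)
    (fun x hx => ⟨fun h s => (hs _ _).1 (h s.1) s.2, fun h i => (hs _ _).2 fun j => h (i, j)⟩)]
  · rw [Fintype.prod_prod_type, Finset.mul_sum, ← Finset.prod_pow_eq_pow_sum]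
    refine Finset.prod_congr rfl fun i _ => ?_
    rw [Finset.prod_congr rfl fun j _ => hc.relIndex_pw (δ i) (hδ i), Finset.prod_const,
      ← pow_mul, mul_comm]
    rfl
  · intro y hy
    refine ⟨fun i => b.equivFun.symm fun j => y (i, j), fun i => (hs _ _).2 fun j => ?_, ?_⟩
    · rw [← b.equivFun_apply, LinearEquiv.apply_symm_apply]
      exact hy (i, j)
    · ext ⟨i, j⟩
      change b.repr _ _ = _
      rw [← b.equivFun_apply, LinearEquiv.apply_symm_apply]

variable [Finite (IsLocalRing.ResidueField R)]

theorem finiteMod_tupleGroup {ι : Type*} [Fintype ι] (b : Module.Basis ι E W)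
    (hb : ∀ w, w ∈ M ↔ ∀ j, b.repr w j ∈ pw E u 0) (hc : IsRamifiedInvolution c u) {n : ℕ} (L : ℕ)
    {S : Set (Fin n → W)} (hS : ∀ x ∈ S, ∀ i, x i ∈ M) :
    FiniteMod (tupleGroup E u M fun _ => (L : ℤ)) S := by
  refine finiteMod_of_relIndex (H := tupleGroup E u M fun _ => 0) ?_ fun x hx i => ?_
  · rw [relIndex_tupleGroup b hb hc (fun _ => L) fun _ => (zero_add _).symm]
    exact pow_ne_zero _ Nat.card_pos.ne'
  · rw [scale_zero]
    exact hS x hx i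

/-- A Newton step: replacing `x i` by `x i + u ^ K δ i`, with `h (δ i) (x j)` equal to `u ^ (-K) S i
j / 2` modulo integers, changes the Gram matrix by `S` modulo `u ^ K`. The two cross terms give `S /
2` each because `S` is hermitian, and the quadratic term lies in `u ^ (2 K - 1) R`, hence in `u ^ K
R`. -/
theorem cosetCount_gramSet_le {ι : Type*} [Fintype ι] (b : Module.Basis ι E W)
    (hb : ∀ w, w ∈ M ↔ ∀ j, b.repr w j ∈ pw E u 0) (hc : IsRamifiedInvolution c u)
    (hh : ∀ x y, h y x = c (h x y)) (hM : IsSelfDual u h M) {n : ℕ} {K L : ℕ} (hK : 1 ≤ K)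
    (hL : 1 ≤ L) (T S : Fin n → Fin n → E) (hS : S ∈ hermMatrices c u fun _ _ => (K : ℤ) - 1) :
    cosetCount (tupleGroup E u M fun _ => (L : ℤ)) (gramSet u h M T fun _ _ => (K : ℤ)) ≤
      cosetCount (tupleGroup E u M fun _ => (L : ℤ))
        (gramSet u h M (T + S) fun _ _ => (K : ℤ)) := by
  have hu := hc.ne_zero
  have hM' : ∀ x ∈ M, ∀ y ∈ M, h x y ∈ pw E u (-1) := fun x hx => (hM x).1 hx
  set B₁ : AddSubgroup (Fin n → W) := tupleGroup E u M fun _ => 1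
  -- The correction `δ` is a function of the class of `x` modulo `u M` alone. Since `K ≥ 1` the step
  -- preserves this class, so `δ` can be recovered from the image and the step is injective on
  -- cosets.
  have key : ∀ z : (Fin n → W) ⧸ B₁, ∃ δ : Fin n → W,
      (∃ x, QuotientAddGroup.mk x = z ∧ x ∈ gramSet u h M T fun _ _ => (K : ℤ)) →
      (∀ i, δ i ∈ M) ∧ ∃ x : Fin n → W, QuotientAddGroup.mk x = z ∧ ∀ i j, h (δ i) (x j) =
        algebraMap R E u ^ (-(K : ℤ)) * (S i j / 2) := by
    intro z
    by_cases hz : ∃ x, QuotientAddGroup.mk x = z ∧ x ∈ gramSet u h M T fun _ _ => (K : ℤ)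
    · obtain ⟨x, rfl, hx⟩ := hz
      have := fun i => hc.exists_pairing_eq hh hM hx.2.1 hx.1
        (fun j => algebraMap R E u ^ (-(K : ℤ)) * (S i j / 2))
        fun j => hc.zpow_mul_mem' (-1) (hc.half_mem (hS i j).2)
      choose δ hδ hδ' using this
      exact ⟨δ, fun _ => ⟨hδ, x, rfl, hδ'⟩⟩
    · exact ⟨0, fun h => absurd h hz⟩
  choose δ hδ using key
  have hδM : ∀ x ∈ gramSet u h M T fun _ _ => (K : ℤ), ∀ i, δ (QuotientAddGroup.mk x) i ∈ M :=
    fun x hx => (hδ _ ⟨x, rfl, hx⟩).1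
  have hsc : ∀ x ∈ gramSet u h M T fun _ _ => (K : ℤ), ∀ i,
      algebraMap R E u ^ (K : ℤ) • δ (QuotientAddGroup.mk x) i ∈ scale E u M K := by
    intro x hx i
    have := (hc.zpow_smul_mem_scale (K : ℤ)).2 (mem_scale_zero.2 (hδM x hx i))
    rwa [add_zero] at this
  refine cosetCount_le (hc.finiteMod_tupleGroup b hb _ fun x hx => hx.1)
    (fun x i => x i + algebraMap R E u ^ (K : ℤ) • δ (QuotientAddGroup.mk x) i) ?_ ?_
  · intro x hx
    have h1 : ∀ i j, h (δ (QuotientAddGroup.mk x) i) (x j) -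
        algebraMap R E u ^ (-(K : ℤ)) * (S i j / 2) ∈ pw E u 0 := by
      intro i j
      obtain ⟨y, hy, hy'⟩ := (hδ _ ⟨x, rfl, hx⟩).2
      rw [← hy', ← map_sub]
      have h2 : x j - y j ∈ scale E u M 1 := mk_eq_iff.1 hy j
      have h3 := hc.pairing_mem hM' (mem_scale_zero.2 (hδM x hx i)) h2
      simpa using h3
    have h4 : ∀ i j, algebraMap R E u ^ (K : ℤ) * h (δ (QuotientAddGroup.mk x) i) (x j) - S i j / 2 ∈
        pw E u K := by
      intro i j
      have := hc.zpow_mul_mem' (l := K) K (h1 i j)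
      rwa [mul_sub, ← mul_assoc, ← zpow_add₀ hu, add_neg_cancel, zpow_zero, one_mul] at this
    refine ⟨fun i => add_mem (hx.1 i) ?_, hc.isPrimitive_congr hx.2.1 fun i => ?_, fun i j => ?_⟩
    · rw [← scale_zero (E := E) (u := u) (M := M)]
      exact hc.scale_anti (Nat.cast_nonneg K) (hsc x hx i)
    · rw [add_sub_cancel_left]
      exact hc.scale_anti (by exact_mod_cast hK) (hsc x hx i)
    · have h5 := hc.anti (l := (K : ℤ) + K - 1) (k := K)
        (by have : (1 : ℤ) ≤ K := by exact_mod_cast hK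
            linarith) (hc.pairing_mem hM' (hsc x hx i) (hsc x hx j))
      have h6 := hc.c_mem (h4 j i)
      have h7 := add_mem (add_mem (add_mem (hx.2.2 i j) (h4 i j)) h6) h5
      convert h7 using 1
      have h8 : c (S j i) = S i j := ((hS j i).1).symm
      have h9 := hc.two_ne_zero
      simp only [map_add, LinearMap.add_apply, Pi.add_apply, map_sub, map_div₀, map_ofNat, h8,
        LinearMap.map_smulₛₗ, LinearMap.smul_apply, RingHom.id_apply, smul_eq_mul, map_mul,
        map_zpow₀, ← hh]
      field_simp
      ring
  · intro x hx y hy hxy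
    have h1 : (QuotientAddGroup.mk x : (Fin n → W) ⧸ B₁) = QuotientAddGroup.mk y := by
      refine mk_eq_iff.2 fun i => ?_
      have h2 := hc.scale_anti (k := 1) (show (1 : ℤ) ≤ L by exact_mod_cast hL) (hxy i)
      have h3 := hc.scale_anti (k := 1) (by exact_mod_cast hK)
        (sub_mem (hsc y hy i) (hsc x hx i))
      have h4 := sub_mem h2 h3
      convert h4 using 1
      simp only [Pi.sub_apply]
      abel
    intro i
    have := hxy i
    simp only [Pi.sub_apply, h1, add_sub_add_right_eq_sub] at this
    exact this

theorem cosetCount_gramSet_eq {ι : Type*} [Fintype ι] (b : Module.Basis ι E W)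
    (hb : ∀ w, w ∈ M ↔ ∀ j, b.repr w j ∈ pw E u 0) (hc : IsRamifiedInvolution c u)
    (hh : ∀ x y, h y x = c (h x y)) (hM : IsSelfDual u h M) {n : ℕ} {K L : ℕ} (hK : 1 ≤ K)
    (hL : 1 ≤ L) (T S : Fin n → Fin n → E) (hS : S ∈ hermMatrices c u fun _ _ => (K : ℤ) - 1) :
    cosetCount (tupleGroup E u M fun _ => (L : ℤ)) (gramSet u h M (T + S) fun _ _ => (K : ℤ)) =
      cosetCount (tupleGroup E u M fun _ => (L : ℤ)) (gramSet u h M T fun _ _ => (K : ℤ)) := by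
  refine le_antisymm ?_ (hc.cosetCount_gramSet_le b hb hh hM hK hL T S hS)
  have := hc.cosetCount_gramSet_le b hb hh hM hK hL (T + S) (-S) (neg_mem hS)
  rwa [add_neg_cancel_right] at this

theorem gram_congr (hc : IsRamifiedInvolution c u) (hM : IsSelfDual u h M) {n : ℕ} {p L : ℕ}
    (hpL : p + 1 ≤ L) {x y : Fin n → W} (hx : ∀ i, x i ∈ M) (hy : ∀ i, y i ∈ M)
    (hxy : y - x ∈ tupleGroup E u M fun _ => (L : ℤ)) (i j : Fin n) :
    h (y i) (y j) - h (x i) (x j) ∈ pw E u p := by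
  have hM' : ∀ x ∈ M, ∀ y ∈ M, h x y ∈ pw E u (-1) := fun x hx => (hM x).1 hx
  have hpL' : (p : ℤ) + 1 ≤ L := by exact_mod_cast hpL
  have h1 := hc.pairing_mem hM' (hxy i) (mem_scale_zero.2 (hy j))
  have h2 := hc.pairing_mem hM' (mem_scale_zero.2 (hx i)) (hxy j)
  have h3 := add_mem (hc.anti (k := p) (by linarith) h1) (hc.anti (k := p) (by linarith) h2)
  convert h3 using 1
  simp

/-- Solutions at level `p` are sorted by the error of their Gram matrix, a hermitian matrix with
entries in `u ^ p` taken modulo `u ^ P`; by `hC` all fibres have the same size. Pairings of `M` lie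
in `u⁻¹ R`, which is why `P + 1 ≤ L` is needed for the error to be constant on cosets. -/
theorem cosetCount_gramSet_mul {ι : Type*} [Fintype ι] (b : Module.Basis ι E W)
    (hb : ∀ w, w ∈ M ↔ ∀ j, b.repr w j ∈ pw E u 0) (hc : IsRamifiedInvolution c u)
    (hh : ∀ x y, h y x = c (h x y)) (hM : IsSelfDual u h M) {n : ℕ} {P L : ℕ} (hL : P + 1 ≤ L)
    (p : Fin n → Fin n → ℤ) (hp : ∀ i j, p i j = p j i) (hpP : ∀ i j, p i j ≤ P)
    (T : Fin n → Fin n → E) (hT : ∀ i j, T j i = c (T i j)) (C : ℕ)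
    (hC : ∀ S ∈ hermMatrices c u p, cosetCount (tupleGroup E u M fun _ => (L : ℤ))
      (gramSet u h M (T + S) fun _ _ => (P : ℤ)) = C) :
    cosetCount (tupleGroup E u M fun _ => (L : ℤ)) (gramSet u h M T p) =
      (hermMatrices c u fun _ _ => (P : ℤ)).relIndex (hermMatrices c u p) * C := by
  refine cosetCount_eq_mul_of_fibres (hc.relIndex_hermMatrices_ne_zero hp (fun _ _ => rfl) hpP)
    (hc.finiteMod_tupleGroup b hb _ fun x hx => hx.1) (fun x i j => h (x i) (x j) - T i j)
    (fun x hx i j => ⟨?_, hx.2.2 i j⟩) (fun x hx y hy hxy i j => ⟨?_, ?_⟩) C fun S hS => ?_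
  · change h (x j) (x i) - T j i = c (h (x i) (x j) - T i j)
    rw [map_sub, ← hh, ← hT]
  · simp only [Pi.sub_apply, sub_sub_sub_cancel_right, map_sub]
    rw [← hh, ← hh]
  · simp only [Pi.sub_apply, sub_sub_sub_cancel_right]
    exact hc.gram_congr hM hL hx.1 hy.1 hxy i j
  · rw [← hC S hS]
    congr 1
    ext x
    constructor
    · rintro ⟨hx, hx'⟩
      refine ⟨hx.1, hx.2.1, fun i j => ?_⟩
      rw [Pi.add_apply, Pi.add_apply, ← sub_sub]
      exact (hx' i j).2
    · intro hx
      refine ⟨⟨hx.1, hx.2.1, fun i j => ?_⟩, fun i j => ⟨?_, ?_⟩⟩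
      · have h1 := add_mem (hc.anti (hpP i j) (hx.2.2 i j)) (hS i j).2
        rwa [Pi.add_apply, Pi.add_apply, ← sub_sub, sub_add_cancel] at h1
      · simp only [Pi.sub_apply, map_sub]
        rw [← hh, ← hT, ← (hS i j).1]
      · have := hx.2.2 i j
        rwa [Pi.add_apply, Pi.add_apply, ← sub_sub] at this

/-- Induction on `P`: whatever the target matrix, the count at level `P` is the same index times the
count at level `P + 1`, and the index can be cancelled. At level 0 an integral change `S` is
invisible. -/
theorem cosetCount_gramSet_congr {ι : Type*} [Fintype ι] (b : Module.Basis ι E W)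
    (hb : ∀ w, w ∈ M ↔ ∀ j, b.repr w j ∈ pw E u 0) (hc : IsRamifiedInvolution c u)
    (hh : ∀ x y, h y x = c (h x y)) (hM : IsSelfDual u h M) {n : ℕ} {P L : ℕ} (hL : P + 1 ≤ L)
    (T S : Fin n → Fin n → E) (hT : ∀ i j, T j i = c (T i j))
    (hS : S ∈ hermMatrices c u fun _ _ => 0) :
    cosetCount (tupleGroup E u M fun _ => (L : ℤ)) (gramSet u h M (T + S) fun _ _ => (P : ℤ)) =
      cosetCount (tupleGroup E u M fun _ => (L : ℤ)) (gramSet u h M T fun _ _ => (P : ℤ)) := by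
  induction P with
  | zero =>
    congr 1
    ext x
    refine and_congr_right fun _ => and_congr_right fun _ => forall_congr' fun i =>
      forall_congr' fun j => ?_
    rw [Pi.add_apply, Pi.add_apply, ← sub_sub]
    exact Submodule.sub_mem_iff_left _ (hS i j).2
  | succ P ih =>
    have hstep : ∀ T : Fin n → Fin n → E, (∀ i j, T j i = c (T i j)) → cosetCount
        (tupleGroup E u M fun _ => (L : ℤ)) (gramSet u h M T fun _ _ => (P : ℤ)) =
        (hermMatrices c u fun _ _ : Fin n => ((P + 1 : ℕ) : ℤ)).relIndex
          (hermMatrices c u fun _ _ => (P : ℤ)) * cosetCount (tupleGroup E u M fun _ => (L : ℤ))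
        (gramSet u h M T fun _ _ => ((P + 1 : ℕ) : ℤ)) := fun T hT =>
      hc.cosetCount_gramSet_mul b hb hh hM hL _ (fun _ _ => rfl)
        (fun _ _ => by push_cast; linarith) T hT _ fun S hS =>
        hc.cosetCount_gramSet_eq b hb hh hM (Nat.le_add_left _ _) (le_trans (by omega) hL) T S
          (by simpa using hS)
    have h1 := ih (by omega)
    rw [hstep T hT, hstep (T + S) fun i j => by
      rw [Pi.add_apply, Pi.add_apply, Pi.add_apply, Pi.add_apply, map_add, hT, (hS i j).1]] at h1
    exact Nat.eq_of_mul_eq_mul_left (Nat.pos_of_ne_zero (hc.relIndex_hermMatrices_ne_zero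
      (fun _ _ => rfl) (fun _ _ => rfl) fun _ _ => by push_cast; linarith)) h1

theorem cosetCount_gramSet {ι : Type*} [Fintype ι] (b : Module.Basis ι E W)
    (hb : ∀ w, w ∈ M ↔ ∀ j, b.repr w j ∈ pw E u 0) (hc : IsRamifiedInvolution c u)
    (hh : ∀ x y, h y x = c (h x y)) (hM : IsSelfDual u h M) {n : ℕ} {P L : ℕ} (hL : P + 1 ≤ L)
    (p : Fin n → Fin n → ℤ) (hp : ∀ i j, p i j = p j i) (hp0 : ∀ i j, 0 ≤ p i j)
    (hpP : ∀ i j, p i j ≤ P) (T : Fin n → Fin n → E) (hT : ∀ i j, T j i = c (T i j)) :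
    cosetCount (tupleGroup E u M fun _ => (L : ℤ)) (gramSet u h M T p) =
      (hermMatrices c u fun _ _ => (P : ℤ)).relIndex (hermMatrices c u p) *
        cosetCount (tupleGroup E u M fun _ => (L : ℤ)) (gramSet u h M T fun _ _ => (P : ℤ)) :=
  hc.cosetCount_gramSet_mul b hb hh hM hL p hp hpP T hT _ fun S hS =>
    hc.cosetCount_gramSet_congr b hb hh hM hL T S hT (hc.hermMatrices_anti hp0 hS)

end IsRamifiedInvolution

end Lifting

/-- The bilinear form with Gram matrix `G`. -/
def gramForm {k ι : Type*} [Field k] [Fintype ι] (G : ι → ι → k) :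
    (ι → k) →ₗ[k] (ι → k) →ₗ[k] k :=
  LinearMap.mk₂ k (fun v w => ∑ i, ∑ j, v i * w j * G i j)
    (fun v v' w => by simp [add_mul, Finset.sum_add_distrib])
    (fun r v w => by simp [Finset.mul_sum, mul_assoc])
    (fun v w w' => by simp [mul_add, add_mul, Finset.sum_add_distrib])
    (fun r v w => by simp [Finset.mul_sum, mul_assoc, mul_left_comm])

theorem gramForm_apply {k ι : Type*} [Field k] [Fintype ι] (G : ι → ι → k) (v w : ι → k) :
    gramForm G v w = ∑ i, ∑ j, v i * w j * G i j := rfl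

/-! ### Reduction modulo the uniformizer. -/

section Reduction

variable {R E : Type*} [CommRing R] [IsDomain R] [IsDiscreteValuationRing R] [Field E]
  [Algebra R E] [IsFractionRing R E] {c : E →+* E} {u : R}
variable {W : Type*} [AddCommGroup W] [Module E W] [Module R W] [IsScalarTower R E W]

open Classical in
/-- The residue class of an integral element of `E` (with value `0` on the other elements). -/
def fracResidue (R : Type*) {E : Type*} [CommRing R] [IsDomain R] [IsDiscreteValuationRing R]
    [Field E] [Algebra R E] (x : E) : IsLocalRing.ResidueField R :=
  if hx : ∃ a : R, algebraMap R E a = x then IsLocalRing.residue R hx.choose else 0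

theorem fracResidue_algebraMap (a : R) :
    fracResidue R (algebraMap R E a) = IsLocalRing.residue R a := by
  have hx : ∃ b : R, algebraMap R E b = algebraMap R E a := ⟨a, rfl⟩
  rw [fracResidue, dif_pos hx, FaithfulSMul.algebraMap_injective R E hx.choose_spec]

theorem fracResidue_add {x y : E} (hx : x ∈ pw E u 0) (hy : y ∈ pw E u 0) :
    fracResidue R (x + y) = fracResidue R x + fracResidue R y := by
  obtain ⟨a, rfl⟩ := mem_pw_zero.1 hx
  obtain ⟨b, rfl⟩ := mem_pw_zero.1 hy
  rw [← map_add, fracResidue_algebraMap, fracResidue_algebraMap, fracResidue_algebraMap, map_add]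

theorem fracResidue_mul {x y : E} (hx : x ∈ pw E u 0) (hy : y ∈ pw E u 0) :
    fracResidue R (x * y) = fracResidue R x * fracResidue R y := by
  obtain ⟨a, rfl⟩ := mem_pw_zero.1 hx
  obtain ⟨b, rfl⟩ := mem_pw_zero.1 hy
  rw [← map_mul, fracResidue_algebraMap, fracResidue_algebraMap, fracResidue_algebraMap, map_mul]

theorem fracResidue_neg {x : E} (hx : x ∈ pw E u 0) :
    fracResidue R (-x) = -fracResidue R x := by
  obtain ⟨a, rfl⟩ := mem_pw_zero.1 hx
  rw [← map_neg, fracResidue_algebraMap, fracResidue_algebraMap, map_neg]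

theorem fracResidue_zero : fracResidue R (0 : E) = 0 := by
  rw [← map_zero (algebraMap R E), fracResidue_algebraMap, map_zero]

theorem fracResidue_sum {ι : Type*} (s : Finset ι) {f : ι → E} (hf : ∀ i, f i ∈ pw E u 0) :
    fracResidue R (∑ i ∈ s, f i) = ∑ i ∈ s, fracResidue R (f i) := by
  classical
  induction s using Finset.induction_on with
  | empty => simp [fracResidue_zero]
  | insert i s hi ih =>
    rw [Finset.sum_insert hi, Finset.sum_insert hi,
      fracResidue_add (hf i) (sum_mem fun j _ => hf j), ih]

namespace IsRamifiedInvolution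

theorem fracResidue_eq_zero (hc : IsRamifiedInvolution c u) {x : E} (hx : x ∈ pw E u 0) :
    fracResidue R x = 0 ↔ x ∈ pw E u 1 := by
  obtain ⟨a, rfl⟩ := mem_pw_zero.1 hx
  rw [fracResidue_algebraMap, IsLocalRing.residue_eq_zero_iff, hc.maximalIdeal_eq,
    Ideal.mem_span_singleton]
  constructor
  · rintro ⟨b, rfl⟩
    exact ⟨b, by rw [map_mul, zpow_one]⟩
  · rintro ⟨b, hb⟩
    rw [zpow_one, ← map_mul] at hb
    exact ⟨b, FaithfulSMul.algebraMap_injective R E hb⟩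

theorem fracResidue_eq_iff (hc : IsRamifiedInvolution c u) {x y : E} (hx : x ∈ pw E u 0)
    (hy : y ∈ pw E u 0) : fracResidue R x = fracResidue R y ↔ y - x ∈ pw E u 1 := by
  rw [← hc.fracResidue_eq_zero (sub_mem hy hx), sub_eq_add_neg, fracResidue_add hy (neg_mem hx),
    fracResidue_neg hx, ← sub_eq_add_neg, sub_eq_zero, eq_comm]

theorem fracResidue_c (hc : IsRamifiedInvolution c u) {x : E} (hx : x ∈ pw E u 0) :
    fracResidue R (c x) = fracResidue R x := by
  rw [eq_comm, hc.fracResidue_eq_iff hx (hc.c_mem hx)]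
  exact hc.c_sub_mem Even.zero hx

theorem fracResidue_smul_uniformizer (hc : IsRamifiedInvolution c u) {T : E}
    (hT : T ∈ pw E u (-1)) : algebraMap R E u * T ∈ pw E u 0 := by
  have := hc.zpow_mul_mem' (l := 1) 0 hT
  rwa [zpow_one] at this

/-- Conjugation is invisible on residues but changes the sign of the factor `u`. This turns
hermitian matrices into skew-symmetric ones. -/
theorem fracResidue_conj (hc : IsRamifiedInvolution c u) {T : E} (hT : T ∈ pw E u (-1)) :
    fracResidue R (algebraMap R E u * c T) = -fracResidue R (algebraMap R E u * T) := by
  have h1 := hc.fracResidue_smul_uniformizer hT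
  rw [← hc.fracResidue_c h1, ← fracResidue_neg (hc.c_mem h1), map_mul, hc.map_uniformizer,
    neg_mul, neg_neg]

theorem fracResidue_fixed (hc : IsRamifiedInvolution c u) {T : E} (hT : T ∈ pw E u (-1))
    (hT' : c T = T) : fracResidue R (algebraMap R E u * T) = 0 := by
  rw [hc.fracResidue_eq_zero (hc.fracResidue_smul_uniformizer hT)]
  have h1 : T ∈ fixedPw c u (-1) := mem_fixedPw.2 ⟨hT, hT'⟩
  rw [hc.fixedPw_odd (by decide)] at h1
  have := hc.zpow_mul_mem' (l := 1) 1 (mem_fixedPw.1 h1).1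
  rwa [zpow_one] at this

variable {h : W →ₗ[E] W →ₛₗ[c] E} {M : Submodule R W}

theorem mem_scale_iff_repr {ι : Type*} [Fintype ι] (b : Module.Basis ι E W)
    (hb : ∀ w, w ∈ M ↔ ∀ j, b.repr w j ∈ pw E u 0) (hc : IsRamifiedInvolution c u) (w : W)
    (k : ℤ) : w ∈ scale E u M k ↔ ∀ j, b.repr w j ∈ pw E u k := by
  rw [mem_scale, hb]
  refine forall_congr' fun j => ?_
  rw [map_smul, Finsupp.smul_apply, smul_eq_mul, ← hc.zpow_mul_mem (-k) k, neg_add_cancel]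

theorem mem_scale_one_iff (hc : IsRamifiedInvolution c u) {w : W} :
    w ∈ scale E u M 1 ↔ ∃ y ∈ M, w = u • y := by
  rw [mem_scale, zpow_neg_one]
  constructor
  · intro hw
    exact ⟨_, hw, by rw [← algebraMap_smul E u, smul_smul, mul_inv_cancel₀ hc.ne_zero, one_smul]⟩
  · rintro ⟨y, hy, rfl⟩
    rwa [← algebraMap_smul E u, smul_smul, inv_mul_cancel₀ hc.ne_zero, one_smul]

/-- Reducing `u h` modulo `u` gives an alternating form on `M / u M`, nondegenerate because `M` is
self-dual. Primitive families become independent families, so the cosets modulo `u` are counted by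
`card_gramTuples`. -/
theorem cosetCount_gramSet_zero [Finite (IsLocalRing.ResidueField R)] {ι : Type*} [Fintype ι]
    (b : Module.Basis ι E W) (hb : ∀ w, w ∈ M ↔ ∀ j, b.repr w j ∈ pw E u 0)
    (hc : IsRamifiedInvolution c u) (hh : ∀ x y, h y x = c (h x y)) (hM : IsSelfDual u h M) {n : ℕ}
    (T : Fin n → Fin n → E) (hT : ∀ i j, T j i = c (T i j)) (hT' : ∀ i j, T i j ∈ pw E u (-1))
    (t : ℕ) (ht : Nat.card (leftKer fun i j => fracResidue R (algebraMap R E u * T i j)) =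
      Nat.card (IsLocalRing.ResidueField R) ^ t) :
    Even (n + t) ∧ (cosetCount (tupleGroup E u M fun _ => 1) (gramSet u h M T fun _ _ => 0) : ℝ) =
      (Nat.card (IsLocalRing.ResidueField R) : ℝ) ^ (Fintype.card ι * n) /
        (Nat.card (IsLocalRing.ResidueField R) : ℝ) ^ (n * (n - 1) / 2) *
        ∏ j ∈ Finset.range ((n + t) / 2), (1 - (Nat.card (IsLocalRing.ResidueField R) : ℝ) ^ (2 * j) /
          (Nat.card (IsLocalRing.ResidueField R) : ℝ) ^ Fintype.card ι) := by
  classical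
  let k := IsLocalRing.ResidueField R
  have hM' : ∀ x ∈ M, ∀ y ∈ M, h x y ∈ pw E u (-1) := fun x hx => (hM x).1 hx
  let G : ι → ι → k := fun i j => fracResidue R (algebraMap R E u * h (b i) (b j))
  let ω : (ι → k) →ₗ[k] (ι → k) →ₗ[k] k := gramForm G
  have hω : ∀ v w, ω v w = ∑ i, ∑ j, v i * w j * G i j := gramForm_apply G
  let ρ : W → ι → k := fun w j => fracResidue R (b.repr w j)
  have hbM : ∀ i, b i ∈ M := fun i => (hb _).2 fun j => by
    rw [b.repr_self, Finsupp.single_apply]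
    split_ifs
    · exact mem_pw_zero.2 ⟨1, map_one _⟩
    · exact zero_mem _
  have hρω : ∀ x ∈ M, ∀ y ∈ M, ω (ρ x) (ρ y) = fracResidue R (algebraMap R E u * h x y) := by
    intro x hx y hy
    rw [hb] at hx hy
    have h1 : algebraMap R E u * h x y = ∑ i, ∑ j, b.repr x i * c (b.repr y j) *
        (algebraMap R E u * h (b i) (b j)) := by
      conv_lhs => rw [← b.sum_repr x, ← b.sum_repr y]
      simp only [map_sum, LinearMap.sum_apply, LinearMap.map_smulₛₗ,
        smul_eq_mul, Finset.mul_sum, LinearMap.smul_apply, RingHom.id_apply]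
      rw [Finset.sum_comm]
      refine Finset.sum_congr rfl fun i _ => Finset.sum_congr rfl fun j _ => ?_
      ring
    have h2 : ∀ i j, b.repr x i * c (b.repr y j) ∈ pw E u 0 := fun i j =>
      hc.mul_mem (k := 0) (l := 0) (hx i) (hc.c_mem (hy j))
    have h3 := fun i j => hc.fracResidue_smul_uniformizer (hM' _ (hbM i) _ (hbM j))
    have h4 : ∀ i j, b.repr x i * c (b.repr y j) * (algebraMap R E u * h (b i) (b j)) ∈
        pw E u 0 := fun i j => hc.mul_mem (k := 0) (l := 0) (h2 i j) (h3 i j)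
    rw [h1, fracResidue_sum _ fun i => sum_mem fun j _ => h4 i j, hω]
    refine Finset.sum_congr rfl fun i _ => ?_
    rw [fracResidue_sum _ (h4 i)]
    refine Finset.sum_congr rfl fun j _ => ?_
    rw [fracResidue_mul (h2 i j) (h3 i j), fracResidue_mul (hx i) (hc.c_mem (hy j)),
      hc.fracResidue_c (hy j)]
  have hρsurj : ∀ v : ι → k, ∃ x ∈ M, ρ x = v := by
    intro v
    choose a ha using fun i => IsLocalRing.residue_surjective (R := R) (v i)
    have hr : ∀ j, b.repr (b.equivFun.symm fun i => algebraMap R E (a i)) j = algebraMap R E (a j) := by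
      intro j
      rw [← b.equivFun_apply, LinearEquiv.apply_symm_apply]
    refine ⟨b.equivFun.symm fun i => algebraMap R E (a i), (hb _).2 fun j => ?_, ?_⟩
    · rw [hr]
      exact mem_pw_zero.2 ⟨_, rfl⟩
    · ext j
      change fracResidue R _ = _
      rw [hr, fracResidue_algebraMap, ha]
  have hρeq : ∀ x ∈ M, ∀ y ∈ M, ρ x = ρ y ↔ y - x ∈ scale E u M 1 := by
    intro x hx y hy
    rw [mem_scale_iff_repr b hb hc, funext_iff]
    rw [hb] at hx hy
    refine forall_congr' fun j => ?_
    rw [map_sub, Finsupp.sub_apply]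
    exact hc.fracResidue_eq_iff (hx j) (hy j)
  have hρprim : ∀ x : Fin n → W, (∀ i, x i ∈ M) →
      (IsPrimitive u M x ↔ LinearIndependent k fun i => ρ (x i)) := by
    intro x hx
    have h1 : ∀ a : Fin n → R, ρ (∑ i, a i • x i) = ∑ i, IsLocalRing.residue R (a i) • ρ (x i) := by
      intro a
      ext j
      have h2 : b.repr (∑ i, a i • x i) j = ∑ i, algebraMap R E (a i) * b.repr (x i) j := by
        rw [map_sum, Finsupp.finsetSum_apply]
        refine Finset.sum_congr rfl fun i _ => ?_
        rw [← algebraMap_smul E (a i), map_smul, Finsupp.smul_apply, smul_eq_mul]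
      have h3 : ∀ i, b.repr (x i) j ∈ pw E u 0 := fun i => (hb _).1 (hx i) j
      have h4 : ∀ i, algebraMap R E (a i) ∈ pw E u 0 := fun i => mem_pw_zero.2 ⟨_, rfl⟩
      change fracResidue R _ = _
      rw [h2, fracResidue_sum _ fun i => hc.mul_mem (k := 0) (l := 0) (h4 i) (h3 i),
        Finset.sum_apply]
      refine Finset.sum_congr rfl fun i _ => ?_
      rw [fracResidue_mul (h4 i) (h3 i), fracResidue_algebraMap, Pi.smul_apply, smul_eq_mul]
    have h2 : ∀ a : Fin n → R, (∃ y ∈ M, ∑ i, a i • x i = u • y) ↔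
        ∑ i, IsLocalRing.residue R (a i) • ρ (x i) = 0 := by
      intro a
      have h3 : ρ 0 = 0 := by
        ext j
        change fracResidue R (b.repr 0 j) = 0
        rw [map_zero, Finsupp.zero_apply, fracResidue_zero]
      rw [← hc.mem_scale_one_iff, ← h1, eq_comm, ← h3, hρeq 0 (zero_mem _) _
        (sum_mem fun i _ => M.smul_mem _ (hx i)), sub_zero]
    have h3 : ∀ a : R, u ∣ a ↔ IsLocalRing.residue R a = 0 := by
      intro a
      rw [IsLocalRing.residue_eq_zero_iff, hc.maximalIdeal_eq, Ideal.mem_span_singleton]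
    rw [Fintype.linearIndependent_iff]
    constructor
    · intro hp v hv i
      choose a ha using fun i => IsLocalRing.residue_surjective (R := R) (v i)
      simp only [← ha] at hv ⊢
      exact (h3 _).1 (hp a ((h2 a).2 hv) i)
    · intro hp a ha i
      exact (h3 _).2 (hp _ ((h2 a).1 ha) i)
  have hcount : cosetCount (tupleGroup E u M fun _ => 1) (gramSet u h M T fun _ _ => 0) =
      Nat.card (gramTuples ω fun i j : Fin n => fracResidue R (algebraMap R E u * T i j)) := by
    rw [cosetCount_eq_ncard (fun x i => ρ (x i)), Nat.card_coe_set_eq]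
    · congr 1
      have h1 : ∀ x : Fin n → W, (∀ i, x i ∈ M) → ((∀ i j, h (x i) (x j) - T i j ∈ pw E u 0) ↔
          ∀ i j, ω (ρ (x i)) (ρ (x j)) = fracResidue R (algebraMap R E u * T i j)) := by
        intro x hx
        refine forall_congr' fun i => forall_congr' fun j => ?_
        rw [hρω _ (hx i) _ (hx j), eq_comm, hc.fracResidue_eq_iff
          (hc.fracResidue_smul_uniformizer (hT' i j))
          (hc.fracResidue_smul_uniformizer (hM' _ (hx i) _ (hx j))), ← mul_sub,
          ← zpow_one (algebraMap R E u)]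
        exact (hc.zpow_mul_mem 1 0).symm
      ext v
      constructor
      · rintro ⟨x, ⟨hx, hp, hg⟩, rfl⟩
        exact ⟨(hρprim x hx).1 hp, (h1 x hx).1 hg⟩
      · rintro ⟨hp, hg⟩
        choose x hx hxv using fun i => hρsurj (v i)
        obtain rfl : (fun i => ρ (x i)) = v := funext hxv
        exact ⟨x, ⟨hx, (hρprim x hx).2 hp, (h1 x hx).2 hg⟩, rfl⟩
    · intro x hx y hy
      rw [funext_iff, mem_tupleGroup]
      exact forall_congr' fun i => hρeq _ (hx.1 i) _ (hy.1 i)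
  have hfix : ∀ x ∈ M, h x x ∈ pw E u (-1) ∧ c (h x x) = h x x := fun x hx =>
    ⟨hM' x hx x hx, (hh x x).symm⟩
  have := card_gramTuples (B := ω) (n := n) (fun w hw => ?_) (fun v => ?_)
    (fun i j => fracResidue R (algebraMap R E u * T i j))
    (fun i => hc.fracResidue_fixed (hT' i i) (hT i i).symm)
    (fun i j => by rw [hT i j, hc.fracResidue_conj (hT' i j)]) t ht
  · rw [hcount]
    rw [Module.finrank_fintype_fun_eq_card] at this
    exact this
  · obtain ⟨y, hy, rfl⟩ := hρsurj w
    have h1 : algebraMap R E u ^ (-1 : ℤ) • y ∈ M := by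
      rw [hM]
      intro x hx
      rw [LinearMap.map_smul₂, smul_eq_mul]
      refine hc.zpow_mul_mem' (k := 0) _ ?_
      rw [hh, hc.c_mem_iff]
      have h2 := hw (ρ x)
      rw [hρω x hx y hy, hc.fracResidue_eq_zero
        (hc.fracResidue_smul_uniformizer (hM' _ hx _ hy)), ← zpow_one (algebraMap R E u)] at h2
      exact (hc.zpow_mul_mem 1 0).1 h2
    have h2 : ρ 0 = ρ y := (hρeq 0 (zero_mem _) y hy).2 (by rw [sub_zero]; exact h1)
    rw [← h2]
    ext j
    change fracResidue R (b.repr 0 j) = 0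
    rw [map_zero, Finsupp.zero_apply, fracResidue_zero]
  · obtain ⟨x, hx, rfl⟩ := hρsurj v
    rw [hρω x hx x hx]
    exact hc.fracResidue_fixed (hfix x hx).1 (hfix x hx).2

/-- The count of `cosetCount_gramSet_zero` is transported: the modulus passes from `u` to `u ^ (2
N)`, and the level of the Gram condition from 0 to `2 N - 1` and from there to `2 N - 1 - a i - a
j`. Each passage costs a power of `q`; the last one contributes `q ^ (n ∑ a i)`. -/
theorem cosetCount_gramSet_of_invariants [Finite (IsLocalRing.ResidueField R)] {ι : Type*}
    [Fintype ι] (b : Module.Basis ι E W) (hb : ∀ w, w ∈ M ↔ ∀ j, b.repr w j ∈ pw E u 0)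
    (hc : IsRamifiedInvolution c u) (hh : ∀ x y, h y x = c (h x y)) (hM : IsSelfDual u h M) {n : ℕ}
    (T : Fin n → Fin n → E) (hT : ∀ i j, T j i = c (T i j)) (hT' : ∀ i j, T i j ∈ pw E u (-1))
    (t : ℕ) (ht : Nat.card (leftKer fun i j => fracResidue R (algebraMap R E u * T i j)) =
      Nat.card (IsLocalRing.ResidueField R) ^ t) (a : Fin n → ℕ) (N : ℕ) (hN : 1 ≤ N)
    (haN : ∀ i j, a i + a j + 1 ≤ 2 * N) :
    (cosetCount (tupleGroup E u M fun _ => ((2 * N : ℕ) : ℤ))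
      (gramSet u h M T fun i j => 2 * N - 1 - a i - a j) : ℝ) =
      (Nat.card (IsLocalRing.ResidueField R) : ℝ) ^ (n * ∑ i, a i) *
      ((Nat.card (IsLocalRing.ResidueField R) : ℝ) ^ (N * (2 * Fintype.card ι * n)) /
        (Nat.card (IsLocalRing.ResidueField R) : ℝ) ^ (N * n ^ 2)) *
        ∏ j ∈ Finset.range ((n + t) / 2), (1 - (Nat.card (IsLocalRing.ResidueField R) : ℝ) ^ (2 * j) /
          (Nat.card (IsLocalRing.ResidueField R) : ℝ) ^ Fintype.card ι) := by
  set q := Nat.card (IsLocalRing.ResidueField R) with hqdef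
  have hq : (q : ℝ) ≠ 0 := by
    have : 0 < q := Nat.card_pos
    positivity
  have hP : ((2 * N - 1 : ℕ) : ℤ) = 2 * N - 1 := by omega
  have h1 := hc.cosetCount_gramSet b hb hh hM (P := 2 * N - 1) (L := 2 * N) (by omega)
    (fun i j => 2 * N - 1 - a i - a j) (fun i j => by ring)
    (fun i j => by have := haN i j; omega) (fun i j => by omega) T hT
  have h2 := hc.cosetCount_gramSet b hb hh hM (P := 2 * N - 1) (L := 2 * N) (by omega)
    (fun _ _ => 0) (fun i j => rfl) (fun i j => le_rfl) (fun i j => by omega) T hT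
  have h3 : cosetCount (tupleGroup E u M fun _ => ((2 * N : ℕ) : ℤ)) (gramSet u h M T fun _ _ => 0) =
      q ^ (Fintype.card ι * (n * (2 * N - 1))) *
        cosetCount (tupleGroup E u M fun _ => 1) (gramSet u h M T fun _ _ => 0) := by
    have hri := relIndex_tupleGroup (n := n) b hb hc (k := fun _ => 1)
      (l := fun _ => ((2 * N : ℕ) : ℤ)) (fun _ => 2 * N - 1) (fun i => by omega)
    rw [Finset.sum_const, Finset.card_univ, Fintype.card_fin, smul_eq_mul] at hri
    rw [← hri]
    have hle : tupleGroup E u M (fun _ : Fin n => ((2 * N : ℕ) : ℤ)) ≤ tupleGroup E u M fun _ => 1 :=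
      fun x hx i => hc.scale_anti (show (1 : ℤ) ≤ ((2 * N : ℕ) : ℤ) by omega) (hx i)
    refine cosetCount_relIndex hle ?_
      (hc.finiteMod_tupleGroup b hb _ fun x hx => hx.1) ?_
    · rw [hri]
      exact pow_ne_zero _ Nat.card_pos.ne'
    · intro x hx y hy
      have hxy : ∀ i, (x + y) i ∈ M := fun i => add_mem (hx.1 i)
        (mem_scale_zero.1 (hc.scale_anti zero_le_one (hy i)))
      refine ⟨hxy, hc.isPrimitive_congr hx.2.1 fun i => ?_, fun i j => ?_⟩
      · simpa using hy i
      · have h4 := hc.gram_congr hM (p := 0) (L := 1) le_rfl hx.1 hxy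
          (by simpa using hy) i j
        have h5 := add_mem h4 (hx.2.2 i j)
        rw [sub_add_sub_cancel] at h5
        exact h5
  have h4 : (hermMatrices c u fun _ _ : Fin n => ((2 * N - 1 : ℕ) : ℤ)).relIndex
      (hermMatrices c u fun i j => 2 * N - 1 - a i - a j) = q ^ (n * ∑ i, a i) := by
    rw [hc.relIndex_hermMatrices _ _ (fun i j => by ring) (fun _ _ => rfl) (fun i j => a i + a j) a
      (fun i j _ => by push_cast; omega) (fun i => hc.relIndex_fixedPw_odd ⟨N - a i - 1, by ring⟩ _
        (by omega)), sum_pairs_add]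
  have h5 : (hermMatrices c u fun _ _ : Fin n => ((2 * N - 1 : ℕ) : ℤ)).relIndex
      (hermMatrices c u fun i j => 0) = q ^ (n * (n - 1) / 2 * (2 * N - 1) + n * N) := by
    rw [hc.relIndex_hermMatrices _ _ (fun i j => rfl) (fun _ _ => rfl) (fun i j => 2 * N - 1)
      (fun _ => N) (fun i j _ => by simp) (fun i => ?_), sum_pairs_const]
    -- `u ^ (2 N - 1) R` and `u ^ (2 N) R` contain the same fixed elements, so a diagonal entry
    -- contributes exactly the exponent `N`.
    rw [hc.fixedPw_odd ⟨N - 1, by omega⟩, hc.relIndex_fixedPw_even Even.zero N (by omega)]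
  have h6 := (hc.cosetCount_gramSet_zero b hb hh hM T hT hT' t ht).2
  rw [← hqdef] at h6
  rw [h1, h4]
  rw [h3, h5] at h2
  have h7 : (q : ℝ) ^ (Fintype.card ι * (n * (2 * N - 1))) *
      cosetCount (tupleGroup E u M fun _ => 1) (gramSet u h M T fun _ _ => 0) =
      (q : ℝ) ^ (n * (n - 1) / 2 * (2 * N - 1) + n * N) *
      cosetCount (tupleGroup E u M fun _ => ((2 * N : ℕ) : ℤ))
        (gramSet u h M T fun _ _ => ((2 * N - 1 : ℕ) : ℤ)) := by exact_mod_cast h2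
  rw [h6] at h7
  rw [Nat.cast_mul, Nat.cast_pow, mul_assoc]
  congr 1
  set X := (cosetCount (tupleGroup E u M fun _ => ((2 * N : ℕ) : ℤ))
        (gramSet u h M T fun _ _ => ((2 * N - 1 : ℕ) : ℤ)) : ℝ)
  set Q := ∏ j ∈ Finset.range ((n + t) / 2), (1 - (q : ℝ) ^ (2 * j) / (q : ℝ) ^ Fintype.card ι)
  obtain ⟨e, he⟩ : ∃ e, n * (n - 1) = 2 * e :=
    (Nat.even_mul_pred_self n).exists_two_nsmul _ |>.imp fun e h => by simpa using h
  have he' : n ^ 2 = 2 * e + n := by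
    rw [← he, Nat.mul_sub_one, sq, Nat.sub_add_cancel (Nat.le_mul_self n)]
  rw [he, Nat.mul_div_cancel_left _ two_pos] at h7
  obtain ⟨N, rfl⟩ : ∃ N', N = N' + 1 := ⟨N - 1, by omega⟩
  rw [show 2 * (N + 1) - 1 = 2 * N + 1 by omega] at h7
  rw [he', ← mul_left_cancel_iff_of_pos (a := (q : ℝ) ^ (e * (2 * N + 1) + n * (N + 1)))
    (by have : 0 < q := Nat.card_pos
        positivity)]
  rw [← h7]
  have e1 : (N + 1) * (2 * e + n) = (e * (2 * N + 1) + n * (N + 1)) + e := by ring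
  have e2 : (N + 1) * (2 * Fintype.card ι * n) =
      Fintype.card ι * (n * (2 * N + 1)) + Fintype.card ι * n := by ring
  rw [e1, e2, pow_add _ (e * (2 * N + 1) + n * (N + 1)) e,
    pow_add _ (Fintype.card ι * (n * (2 * N + 1)))]
  field_simp

end IsRamifiedInvolution

end Reduction

/-! ### Sorting approximate isometries by the preimage of the target lattice. -/

section Decomposition

variable {R E : Type*} [CommRing R] [IsDomain R] [IsDiscreteValuationRing R] [Field E]
  [Algebra R E] [IsFractionRing R E] {c : E →+* E} {u : R}
variable {V : Type*} [AddCommGroup V] [Module E V] [Module R V] [IsScalarTower R E V]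
variable {W : Type*} [AddCommGroup W] [Module E W] [Module R W] [IsScalarTower R E W]

/-- The dual of `L` with respect to pairings with values in `u⁻¹ R`. -/
def pwDual (u : R) (h : V →ₗ[E] V →ₛₗ[c] E) (L : Submodule R V) : Submodule R V where
  carrier := {x | ∀ y ∈ L, h x y ∈ pw E u (-1)}
  zero_mem' := fun y _ => by simp
  add_mem' := fun ha hb y hy => by
    rw [map_add, LinearMap.add_apply]
    exact add_mem (ha y hy) (hb y hy)
  smul_mem' := fun r a ha y hy => by
    rw [← algebraMap_smul E r a, LinearMap.map_smul₂, algebraMap_smul]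
    exact Submodule.smul_mem _ _ (ha y hy)

/-- Linear maps which send `L` to `u ^ k M`. -/
def homGroup (E : Type*) [Field E] [Algebra R E] [Module E V] [IsScalarTower R E V] [Module E W]
    [IsScalarTower R E W] (u : R) (L : Submodule R V) (M : Submodule R W) (k : ℤ) :
    AddSubgroup (V →ₗ[E] W) where
  carrier := {f | ∀ x ∈ L, f x ∈ scale E u M k}
  zero_mem' := fun _ _ => zero_mem _
  add_mem' := fun ha hb x hx => add_mem (ha x hx) (hb x hx)
  neg_mem' := fun ha x hx => neg_mem (ha x hx)

/-- Linear maps `L → M` which are isometric modulo `u ^ (2 N) (u⁻¹ R)`. -/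
def approxIsometries (u : R) (h : V →ₗ[E] V →ₛₗ[c] E) (h' : W →ₗ[E] W →ₛₗ[c] E)
    (L : Submodule R V) (M : Submodule R W) (N : ℕ) : Set (V →ₗ[E] W) :=
  {f | (∀ x ∈ L, f x ∈ M) ∧ ∀ x ∈ L, ∀ y ∈ L, h' (f x) (f y) - h x y ∈ pw E u (2 * N - 1)}

/-- The modules between `L` and its dual on which the pairing is integral. -/
def overModules (u : R) (h : V →ₗ[E] V →ₛₗ[c] E) (L : Submodule R V) : Set (Submodule R V) :=
  {L' | L ≤ L' ∧ L' ≤ pwDual u h L'}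

namespace IsRamifiedInvolution

variable {h : V →ₗ[E] V →ₛₗ[c] E} {h' : W →ₗ[E] W →ₛₗ[c] E} {L : Submodule R V}
  {M : Submodule R W}

theorem zpow_mul_mem_iff (hc : IsRamifiedInvolution c u) {l k j : ℤ} {x : E}
    (hj : l + k = j) : algebraMap R E u ^ l * x ∈ pw E u j ↔ x ∈ pw E u k := by
  subst hj
  exact hc.zpow_mul_mem l k

theorem c_zpow_mul_mem_iff (hc : IsRamifiedInvolution c u) {l k j : ℤ} {x : E}
    (hj : l + k = j) : c (algebraMap R E u ^ l) * x ∈ pw E u j ↔ x ∈ pw E u k := by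
  rw [← hc.c_mem_iff, map_mul, hc.involutive, hc.zpow_mul_mem_iff hj, hc.c_mem_iff]

theorem pairing_zpow_smul (hc : IsRamifiedInvolution c u) {k l j i : ℤ} {x y : V} {x' y' : W}
    (hj : k + l + i = j) :
    h' (algebraMap R E u ^ k • x') (algebraMap R E u ^ l • y') -
      h (algebraMap R E u ^ k • x) (algebraMap R E u ^ l • y) ∈ pw E u j ↔
      h' x' y' - h x y ∈ pw E u i := by
  rw [LinearMap.map_smul₂, LinearMap.map_smul₂, LinearMap.map_smulₛₗ, LinearMap.map_smulₛₗ]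
  simp only [smul_eq_mul]
  rw [← mul_sub, ← mul_sub, hc.zpow_mul_mem_iff (k := l + i) (by omega),
    hc.c_zpow_mul_mem_iff rfl]

theorem exists_npow_smul_mem {n : ℕ} (e : Module.Basis (Fin n) E V) {a : Fin n → ℕ}
    (he : ∀ v, v ∈ L ↔ ∀ i, e.repr v i ∈ pw E u (a i)) (hc : IsRamifiedInvolution c u) (v : V) :
    ∃ j : ℕ, algebraMap R E u ^ (j : ℤ) • v ∈ L := by
  choose d hd using fun i => hc.exists_mem (e.repr v i)
  refine ⟨∑ i, (d i + a i), (he _).2 fun i => ?_⟩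
  rw [map_smul, Finsupp.smul_apply, smul_eq_mul]
  have h1 : d i + a i ≤ ∑ i, (d i + a i) :=
    Finset.single_le_sum (f := fun i => d i + a i) (fun _ _ => Nat.zero_le _) (Finset.mem_univ i)
  exact hc.anti (by omega) (hc.zpow_mul_mem' (l := ((∑ i, (d i + a i) : ℕ) : ℤ)) _ (hd i) rfl)

/-- Powers of `u` are stripped off one at a time. If `z = u ^ (j + 1) x` is in the dual, then `f z`
lies in `u M`, so `h' (f z) (f y)` is integral. The isometry relation at `u ^ d z ∈ L` transfers
this to `h z y`, so that `u⁻¹ z` is again in the dual. The bound `d + 1 ≤ N` keeps the error `u ^ (2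
N - 1 - d)` integral. -/
theorem mem_pwDual_of_map_mem (hc : IsRamifiedInvolution c u)
    (hM : ∀ x ∈ M, ∀ y ∈ M, h' x y ∈ pw E u (-1)) {d N : ℕ}
    (hd : ∀ x ∈ pwDual u h L, algebraMap R E u ^ (d : ℤ) • x ∈ L) (hN : d + 1 ≤ N)
    {f : V →ₗ[E] W} (hf : f ∈ approxIsometries u h h' L M N) {x : V} (j : ℕ)
    (hj : algebraMap R E u ^ (j : ℤ) • x ∈ pwDual u h L) (hx : f x ∈ M) : x ∈ pwDual u h L := by
  induction j with
  | zero => simpa using hj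
  | succ j ih =>
    refine ih fun y hy => ?_
    set z := algebraMap R E u ^ ((j + 1 : ℕ) : ℤ) • x with hz
    have h1 := hf.2 _ (hd z hj) y hy
    rw [map_smul] at h1
    have h2 : h' (f z) (f y) - h z y ∈ pw E u (2 * N - 1 - d) := by
      rw [← hc.pairing_zpow_smul (k := d) (l := 0) (j := 2 * N - 1) (by ring)]
      simpa using h1
    have h3 : h' (f z) (f y) ∈ pw E u 0 := by
      rw [hz, map_smul, LinearMap.map_smul₂, smul_eq_mul]
      exact hc.anti (by push_cast; omega)
        (hc.zpow_mul_mem' (l := ((j + 1 : ℕ) : ℤ)) _ (hM _ hx _ (hf.1 y hy)) rfl)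
    have h4 := sub_mem h3 (hc.anti (k := 0) (by omega) h2)
    rw [sub_sub_cancel] at h4
    have h5 : algebraMap R E u ^ (j : ℤ) • x = algebraMap R E u ^ (-1 : ℤ) • z := by
      rw [hz, smul_smul, ← zpow_add₀ hc.ne_zero]
      congr 2
      push_cast
      ring
    rw [h5, LinearMap.map_smul₂, smul_eq_mul]
    exact hc.zpow_mul_mem' _ h4

/-- Multiplication by `u ^ d` moves both vectors into `L`, at the cost of an error in `u ^ (2 N - 1
- 2 d) R`, which is inside `u⁻¹ R`. -/
theorem pairing_mem_of_map_mem (hc : IsRamifiedInvolution c u)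
    (hM : ∀ x ∈ M, ∀ y ∈ M, h' x y ∈ pw E u (-1)) {d N : ℕ}
    (hd : ∀ x ∈ pwDual u h L, algebraMap R E u ^ (d : ℤ) • x ∈ L) (hN : d + 1 ≤ N)
    {f : V →ₗ[E] W} (hf : f ∈ approxIsometries u h h' L M N) {x y : V} (hx : x ∈ pwDual u h L)
    (hy : y ∈ pwDual u h L) (hfx : f x ∈ M) (hfy : f y ∈ M) : h x y ∈ pw E u (-1) := by
  have h1 := hf.2 _ (hd x hx) _ (hd y hy)
  rw [map_smul f, map_smul f, hc.pairing_zpow_smul (i := 2 * N - 1 - d - d) (by ring)] at h1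
  have h2 := sub_mem (hM _ hfx _ hfy) (hc.anti (k := -1) (by omega) h1)
  rwa [sub_sub_cancel] at h2

/-- It is by this preimage that approximate isometries are sorted: every vector has a multiple in
the dual of `L`, so the two preceding descents apply to all vectors that `f` maps into `M`. -/
theorem comap_mem_overModules (hc : IsRamifiedInvolution c u)
    (hM : ∀ x ∈ M, ∀ y ∈ M, h' x y ∈ pw E u (-1)) {d N : ℕ}
    (hd : ∀ x ∈ pwDual u h L, algebraMap R E u ^ (d : ℤ) • x ∈ L) (hN : d + 1 ≤ N)
    (hL : ∀ v, ∃ j : ℕ, algebraMap R E u ^ (j : ℤ) • v ∈ pwDual u h L)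
    {f : V →ₗ[E] W} (hf : f ∈ approxIsometries u h h' L M N) :
    M.comap (f.restrictScalars R) ∈ overModules u h L := by
  refine ⟨fun x hx => hf.1 x hx, fun x hx y hy => ?_⟩
  obtain ⟨i, hi⟩ := hL x
  obtain ⟨j, hj⟩ := hL y
  exact hc.pairing_mem_of_map_mem hM hd hN hf (hc.mem_pwDual_of_map_mem hM hd hN hf i hi hx)
    (hc.mem_pwDual_of_map_mem hM hd hN hf j hj hy) hx hy

/-- The preimage lies in the dual of `L`, and on this dual `g - f` takes values in `u ^ (2 N - d)
M`, which is contained in `M`. -/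
theorem comap_le_comap (hc : IsRamifiedInvolution c u)
    (hM : ∀ x ∈ M, ∀ y ∈ M, h' x y ∈ pw E u (-1)) {d N : ℕ}
    (hd : ∀ x ∈ pwDual u h L, algebraMap R E u ^ (d : ℤ) • x ∈ L) (hN : d + 1 ≤ N)
    (hL : ∀ v, ∃ j : ℕ, algebraMap R E u ^ (j : ℤ) • v ∈ pwDual u h L)
    {f g : V →ₗ[E] W} (hf : f ∈ approxIsometries u h h' L M N)
    (hfg : g - f ∈ homGroup E u L M (2 * N : ℕ)) :
    M.comap (f.restrictScalars R) ≤ M.comap (g.restrictScalars R) := by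
  intro x hx
  obtain ⟨i, hi⟩ := hL x
  have h1 := hfg _ (hd _ (hc.mem_pwDual_of_map_mem hM hd hN hf i hi hx))
  rw [map_smul, LinearMap.sub_apply,
    show ((2 * N : ℕ) : ℤ) = d + (2 * N - d) by push_cast; ring, hc.zpow_smul_mem_scale] at h1
  have h2 := mem_scale_zero.1 (hc.scale_anti (k := 0) (by omega) h1)
  have h3 := add_mem h2 (show f x ∈ M from hx)
  rwa [sub_add_cancel] at h3

variable [Finite (IsLocalRing.ResidueField R)]

section Adapted

variable {n : ℕ} (e : Module.Basis (Fin n) E V) {a : Fin n → ℕ} {L' : Submodule R V}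

/-- The vectors `u ^ a i • e i` form a basis of `L`. The preimage of `M` contains `L'` when all `f
(e i)` lie in `M`, and primitivity says that it is no larger. Dividing by `u ^ (a i + a j)` moves
the isometry condition from `L` to the `e i`. -/
theorem approx_iff_gramSet (he : ∀ v, v ∈ L ↔ ∀ i, e.repr v i ∈ pw E u (a i))
    (he' : ∀ v, v ∈ L' ↔ ∀ i, e.repr v i ∈ pw E u 0) (hc : IsRamifiedInvolution c u)
    {N : ℕ} (f : V →ₗ[E] W) :
    (f ∈ approxIsometries u h h' L M N ∧ M.comap (f.restrictScalars R) = L') ↔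
      (fun i => f (e i)) ∈ gramSet u h' M (fun i j => h (e i) (e j))
        fun i j => 2 * N - 1 - a i - a j := by
  have hu := hc.ne_zero
  have hone : (1 : E) ∈ pw E u 0 := mem_pw_zero.2 ⟨1, map_one _⟩
  have he'i : ∀ i, e i ∈ L' := fun i => (he' _).2 fun j => by
    rw [e.repr_self, Finsupp.single_apply]
    split_ifs
    exacts [hone, zero_mem _]
  have hei : ∀ i, algebraMap R E u ^ (a i : ℤ) • e i ∈ L := fun i => (he _).2 fun j => by
    rw [map_smul, e.repr_self, Finsupp.smul_apply, Finsupp.single_apply, smul_eq_mul]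
    split_ifs with hij
    · subst hij
      exact hc.zpow_mul_mem' _ hone (by ring)
    · rw [mul_zero]
      exact zero_mem _
  have hint : ∀ b : Fin n → R, (∃ y ∈ M, ∑ i, b i • f (e i) = u • y) ↔
      f (algebraMap R E u ^ (-1 : ℤ) • ∑ i, b i • e i) ∈ M := by
    intro b
    have hsum : ∑ i, b i • f (e i) = f (∑ i, b i • e i) := by
      rw [map_sum]
      refine Finset.sum_congr rfl fun i _ => ?_
      rw [← algebraMap_smul E (b i) (e i), map_smul, algebraMap_smul]
    rw [← hc.mem_scale_one_iff, mem_scale, map_smul, hsum]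
  have hdvd : ∀ b : Fin n → R, algebraMap R E u ^ (-1 : ℤ) • ∑ i, b i • e i ∈ L' ↔
      ∀ i, u ∣ b i := by
    intro b
    rw [he']
    refine forall_congr' fun i => ?_
    have : e.repr (∑ i, b i • e i) i = algebraMap R E (b i) := by
      simp only [← algebraMap_smul E (b _) (e _)]
      rw [e.repr_sum_self]
    rw [map_smul, Finsupp.smul_apply, smul_eq_mul, this, hc.zpow_mul_mem_iff (k := 1) (by norm_num)]
    constructor
    · rintro ⟨d, hd⟩
      rw [zpow_one, ← map_mul] at hd
      exact ⟨d, FaithfulSMul.algebraMap_injective R E hd⟩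
    · rintro ⟨d, hd⟩
      exact ⟨d, by rw [hd, map_mul, zpow_one]⟩
  constructor
  · rintro ⟨hf, hfL'⟩
    refine ⟨fun i => ?_, fun b hb => (hdvd b).1 ?_, fun i j => ?_⟩
    · have := he'i i
      rw [← hfL'] at this
      exact this
    · rw [← hfL']
      exact (hint b).1 hb
    · have := hf.2 _ (hei i) _ (hei j)
      rwa [map_smul f, map_smul f, hc.pairing_zpow_smul (i := 2 * N - 1 - a i - a j) (by ring)] at this
  · rintro ⟨hfM, hp, hg⟩
    have hfL : L' ≤ M.comap (f.restrictScalars R) := by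
      intro v hv
      rw [he'] at hv
      choose b hb using fun i => mem_pw_zero.1 (hv i)
      have : f v = ∑ i, b i • f (e i) := by
        conv_lhs => rw [← e.sum_repr v, map_sum]
        refine Finset.sum_congr rfl fun i _ => ?_
        rw [map_smul, ← hb, algebraMap_smul]
      change f v ∈ M
      rw [this]
      exact sum_mem fun i _ => M.smul_mem _ (hfM i)
    have hLL' : L ≤ L' := fun v hv => (he' v).2 fun i =>
      hc.anti (Nat.cast_nonneg _) ((he v).1 hv i)
    refine ⟨⟨fun x hx => hfL (hLL' hx), fun x hx y hy => ?_⟩, le_antisymm ?_ hfL⟩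
    · have h1 : h' (f x) (f y) - h x y = ∑ j, ∑ i, c (e.repr y j) * (e.repr x i *
          (h' (f (e i)) (f (e j)) - h (e i) (e j))) := by
        conv_lhs => rw [← e.sum_repr x, ← e.sum_repr y]
        simp only [map_sum, LinearMap.sum_apply, LinearMap.map_smulₛₗ, LinearMap.smul_apply,
          RingHom.id_apply, smul_eq_mul, ← Finset.sum_sub_distrib, Finset.mul_sum]
        refine Finset.sum_congr rfl fun j _ => ?_
        refine Finset.sum_congr rfl fun i _ => ?_
        ring
      rw [h1]
      refine sum_mem fun j _ => sum_mem fun i _ => ?_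
      have h2 := hc.mul_mem (hc.c_mem ((he y).1 hy j)) (hc.mul_mem ((he x).1 hx i) (hg i j))
      convert h2 using 2
      ring
    -- If `u ^ (j + 1) v` is in `L'` and `f v` is in `M`, primitivity makes the coordinates of `u ^
    -- (j + 1) v` divisible by `u`, so `u ^ j v` is in `L'`; this descends to `v`.
    · intro v hv
      have hL' := hc.exists_npow_smul_mem e (a := fun _ => 0) (L := L') (u := u)
        (by simpa using he') v
      obtain ⟨j, hj⟩ := hL'
      induction j with
      | zero => simpa using hj
      | succ j ih =>
        refine ih ?_
        rw [he'] at hj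
        choose b hb using fun i => mem_pw_zero.1 (hj i)
        have h1 : algebraMap R E u ^ ((j + 1 : ℕ) : ℤ) • v = ∑ i, b i • e i := by
          rw [← e.sum_repr (algebraMap R E u ^ ((j + 1 : ℕ) : ℤ) • v)]
          refine Finset.sum_congr rfl fun i _ => ?_
          rw [← hb, algebraMap_smul]
        have h2 : algebraMap R E u ^ (j : ℤ) • v =
            algebraMap R E u ^ (-1 : ℤ) • ∑ i, b i • e i := by
          rw [← h1, smul_smul, ← zpow_add₀ hu]
          congr 2
          push_cast
          ring
        rw [h2, hdvd]
        refine hp b ((hint b).2 ?_)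
        rw [← h2, map_smul, zpow_natCast, ← map_pow, algebraMap_smul]
        exact M.smul_mem _ hv

theorem homGroup_iff_tupleGroup (he : ∀ v, v ∈ L ↔ ∀ i, e.repr v i ∈ pw E u (a i))
    (hc : IsRamifiedInvolution c u) (k : ℤ) (f : V →ₗ[E] W) :
    (fun i => f (e i)) ∈ tupleGroup E u M (fun i => k - a i) ↔ f ∈ homGroup E u L M k := by
  have hone : (1 : E) ∈ pw E u 0 := mem_pw_zero.2 ⟨1, map_one _⟩
  constructor
  · intro hf v hv
    rw [← e.sum_repr v, map_sum]
    refine sum_mem fun i _ => ?_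
    obtain ⟨b, hb⟩ := (he v).1 hv i
    rw [map_smul, hb, mul_smul]
    have := (hc.zpow_smul_mem_scale (a i : ℤ)).2 ((scale E u M _).smul_mem b (hf i))
    rw [add_sub_cancel] at this
    rwa [← algebraMap_smul E b] at this
  · intro hf i
    have h1 : algebraMap R E u ^ (a i : ℤ) • e i ∈ L := (he _).2 fun j => by
      rw [map_smul, e.repr_self, Finsupp.smul_apply, Finsupp.single_apply, smul_eq_mul]
      split_ifs with hij
      · subst hij
        exact hc.zpow_mul_mem' _ hone (by ring)
      · rw [mul_zero]
        exact zero_mem _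
    have h2 := hf _ h1
    rw [map_smul, ← add_sub_cancel (a i : ℤ) k, hc.zpow_smul_mem_scale] at h2
    exact h2

/-- Evaluation on `e` turns maps modulo `u ^ (2 N)` into tuples modulo `u ^ (2 N - a i)`. Refining
to the uniform modulus `u ^ (2 N)` accounts for the denominator `q ^ (card ι * ∑ a i)`, which
together with `q ^ (n * ∑ a i)` becomes the power of `X` in the Siegel series. -/
theorem cosetCount_approx_adapted {ι : Type*} [Fintype ι]
    (b : Module.Basis ι E W) (hb : ∀ w, w ∈ M ↔ ∀ j, b.repr w j ∈ pw E u 0)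
    (he : ∀ v, v ∈ L ↔ ∀ i, e.repr v i ∈ pw E u (a i))
    (he' : ∀ v, v ∈ L' ↔ ∀ i, e.repr v i ∈ pw E u 0) (hc : IsRamifiedInvolution c u)
    (hh : ∀ x y, h y x = c (h x y)) (hh' : ∀ x y, h' y x = c (h' x y)) (hM : IsSelfDual u h' M)
    (hL' : L' ≤ pwDual u h L') (t : ℕ)
    (ht : Nat.card (leftKer fun i j => fracResidue R (algebraMap R E u * h (e i) (e j))) =
      Nat.card (IsLocalRing.ResidueField R) ^ t) {N : ℕ} (hN : ∀ i, a i + 1 ≤ N) (hN1 : 1 ≤ N) :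
    (cosetCount (homGroup E u L M (2 * N : ℕ))
      {f ∈ approxIsometries u h h' L M N | M.comap (f.restrictScalars R) = L'} : ℝ) =
      (Nat.card (IsLocalRing.ResidueField R) : ℝ) ^ (n * ∑ i, a i) /
        (Nat.card (IsLocalRing.ResidueField R) : ℝ) ^ (Fintype.card ι * ∑ i, a i) *
      ((Nat.card (IsLocalRing.ResidueField R) : ℝ) ^ (N * (2 * Fintype.card ι * n)) /
        (Nat.card (IsLocalRing.ResidueField R) : ℝ) ^ (N * n ^ 2)) *
        ∏ j ∈ Finset.range ((n + t) / 2), (1 - (Nat.card (IsLocalRing.ResidueField R) : ℝ) ^ (2 * j) /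
          (Nat.card (IsLocalRing.ResidueField R) : ℝ) ^ Fintype.card ι) := by
  have hM' : ∀ x ∈ M, ∀ y ∈ M, h' x y ∈ pw E u (-1) := fun x hx => (hM x).1 hx
  have hone : (1 : E) ∈ pw E u 0 := mem_pw_zero.2 ⟨1, map_one _⟩
  have he'i : ∀ i, e i ∈ L' := fun i => (he' _).2 fun j => by
    rw [e.repr_self, Finsupp.single_apply]
    split_ifs
    exacts [hone, zero_mem _]
  set G := gramSet u h' M (fun i j => h (e i) (e j)) fun i j => 2 * N - 1 - a i - a j with hG
  let Φ : (V →ₗ[E] W) →+ (Fin n → W) :=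
    { toFun := fun f i => f (e i)
      map_zero' := rfl
      map_add' := fun _ _ => rfl }
  have h1 : Φ '' {f ∈ approxIsometries u h h' L M N | M.comap (f.restrictScalars R) = L'} = G := by
    ext x
    constructor
    · rintro ⟨f, hf, rfl⟩
      exact (approx_iff_gramSet e he he' hc f).1 hf
    · intro hx
      have hx' : Φ (e.constr E x) = x := by
        ext i
        exact e.constr_basis E x i
      refine ⟨e.constr E x, (approx_iff_gramSet e he he' hc _).2 ?_, hx'⟩
      change Φ (e.constr E x) ∈ G
      rwa [hx']
  have h2 := cosetCount_image (homGroup E u L M (2 * N : ℕ))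
    (tupleGroup E u M fun i => ((2 * N : ℕ) : ℤ) - a i)
    {f ∈ approxIsometries u h h' L M N | M.comap (f.restrictScalars R) = L'} Φ
    (fun f => homGroup_iff_tupleGroup e he hc _ f)
  have hri := relIndex_tupleGroup (n := n) b hb hc (k := fun i => ((2 * N : ℕ) : ℤ) - a i)
    (l := fun _ => ((2 * N : ℕ) : ℤ)) a (fun i => by ring)
  have hle : tupleGroup E u M (fun _ : Fin n => ((2 * N : ℕ) : ℤ)) ≤
      tupleGroup E u M fun i => ((2 * N : ℕ) : ℤ) - a i := fun x hx i =>
    hc.scale_anti (show ((2 * N : ℕ) : ℤ) - a i ≤ ((2 * N : ℕ) : ℤ) by omega) (hx i)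
  have h3 := cosetCount_relIndex hle (S := G) (by rw [hri]; exact pow_ne_zero _ Nat.card_pos.ne')
    (hc.finiteMod_tupleGroup b hb _ fun x hx => hx.1) (by
      intro x hx y hy
      have hy1 : ∀ i, y i ∈ scale E u M 1 := fun i =>
        hc.scale_anti (by have := hN i; push_cast; omega) (hy i)
      have hy0 : ∀ i, y i ∈ scale E u M 0 := fun i => hc.scale_anti zero_le_one (hy1 i)
      refine ⟨fun i => add_mem (hx.1 i) (mem_scale_zero.1 (hy0 i)),
        hc.isPrimitive_congr hx.2.1 fun i => by simpa using hy1 i, fun i j => ?_⟩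
      have hx0 : ∀ i, x i ∈ scale E u M 0 := fun i => mem_scale_zero.2 (hx.1 i)
      have e1 := hc.pairing_mem hM' (hy i) (hx0 j)
      have e2 := hc.pairing_mem hM' (hx0 i) (hy j)
      have e3 := hc.pairing_mem hM' (hy i) (hy0 j)
      have e4 := add_mem (add_mem (add_mem (hx.2.2 i j)
        (hc.anti (k := 2 * N - 1 - a i - a j) (by push_cast; omega) e1))
        (hc.anti (k := 2 * N - 1 - a i - a j) (by push_cast; omega) e2))
        (hc.anti (k := 2 * N - 1 - a i - a j) (by push_cast; omega) e3)
      convert e4 using 1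
      simp only [Pi.add_apply, map_add, LinearMap.add_apply]
      ring)
  have h4 := cosetCount_gramSet_of_invariants b hb hc hh' hM (fun i j => h (e i) (e j))
    (fun i j => hh _ _) (fun i j => hL' (he'i i) _ (he'i j)) t ht a N hN1
    (fun i j => by have := hN i; have := hN j; omega)
  rw [← h2, h1]
  rw [← hG, h3, hri] at h4
  push_cast at h4
  have hq : (Nat.card (IsLocalRing.ResidueField R) : ℝ) ≠ 0 := by
    have : 0 < Nat.card (IsLocalRing.ResidueField R) := Nat.card_pos
    positivity
  rw [div_mul_eq_mul_div, div_mul_eq_mul_div, eq_div_iff (pow_ne_zero _ hq), ← h4, mul_comm]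
  push_cast
  rfl

end Adapted

end IsRamifiedInvolution

end Decomposition

/-! ### Adapted bases of pairs of lattices. -/

section LatticeBases

variable {R E : Type*} [CommRing R] [IsDomain R] [IsDiscreteValuationRing R] [Field E]
  [Algebra R E] [IsFractionRing R E] {c : E →+* E} {u : R}
variable {V : Type*} [AddCommGroup V] [Module E V] [Module R V] [IsScalarTower R E V]

theorem repr_extendOfIsLattice {κ : Type*} {L : Submodule R V} [Submodule.IsLattice E L]
    [Fintype κ] (b : Module.Basis κ R L) (x : L) (i : κ) :
    (b.extendOfIsLattice E).repr (x : V) i = algebraMap R E (b.repr x i) := by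
  classical
  have h1 : (x : V) = ∑ j, algebraMap R E (b.repr x j) • b.extendOfIsLattice E j := by
    conv_lhs => rw [← b.sum_repr x]
    rw [AddSubmonoidClass.coe_finsetSum]
    refine Finset.sum_congr rfl fun j _ => ?_
    rw [Module.Basis.extendOfIsLattice_apply, algebraMap_smul]
    rfl
  conv_lhs => rw [h1]
  rw [Module.Basis.repr_sum_self]

namespace IsRamifiedInvolution

/-- Smith normal form over `R`: the elementary divisors are units times powers of `u`, and the units
do not affect membership. -/
theorem exists_adapted_basis (hc : IsRamifiedInvolution c u) {L L' : Submodule R V}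
    [Submodule.IsLattice E L] [Submodule.IsLattice E L'] (hle : L ≤ L') {n : ℕ}
    [FiniteDimensional E V] (hn : Module.finrank E V = n) :
    ∃ (e : Module.Basis (Fin n) E V) (a : Fin n → ℕ),
      (∀ v, v ∈ L' ↔ ∀ i, e.repr v i ∈ pw E u 0) ∧ ∀ v, v ∈ L ↔ ∀ i, e.repr v i ∈ pw E u (a i) := by
  have hfin : ∀ (N : Submodule R V) [Submodule.IsLattice E N], Module.finrank R N = n := by
    intro N _
    rw [← hn, Module.finrank, Module.finrank, Submodule.IsLattice.rank' E N]
  have : Module.Free R L' := Submodule.IsLattice.free E L'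
  let b₀ : Module.Basis (Fin n) R L' := Module.finBasisOfFinrankEq R L' (hfin L')
  obtain ⟨b, α, b', hb⟩ := Submodule.exists_smith_normal_form_of_rank_eq (N := L.submoduleOf L')
    b₀ (by rw [(Submodule.submoduleOfEquivOfLe hle).finrank_eq, hfin, hfin])
  have hα : ∀ i, α i ≠ 0 := by
    intro i hi
    have h1 := hb i
    rw [hi, zero_smul] at h1
    exact b'.ne_zero i (Subtype.ext h1)
  choose a w hw using fun i =>
    IsDiscreteValuationRing.eq_unit_mul_pow_irreducible (hα i) hc.irreducible
  have hbe : ∀ i, (b.extendOfIsLattice E) i = (b i : V) := fun i =>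
    Module.Basis.extendOfIsLattice_apply E b i
  refine ⟨b.extendOfIsLattice E, a, fun v => ⟨fun hv i => ?_, fun hv => ?_⟩,
    fun v => ⟨fun hv i => ?_, fun hv => ?_⟩⟩
  · exact mem_pw_zero.2 ⟨_, (repr_extendOfIsLattice b ⟨v, hv⟩ i).symm⟩
  · rw [← (b.extendOfIsLattice E).sum_repr v]
    refine sum_mem fun i _ => ?_
    obtain ⟨r, hr⟩ := mem_pw_zero.1 (hv i)
    rw [← hr, algebraMap_smul, hbe]
    exact L'.smul_mem _ (b i).2
  · have h1 : (⟨v, hle hv⟩ : L') = ∑ j, (b'.repr ⟨⟨v, hle hv⟩, hv⟩ j * α j) • b j := by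
      have := congrArg (fun z : L.submoduleOf L' => (z : L')) (b'.sum_repr ⟨⟨v, hle hv⟩, hv⟩)
      refine this.symm.trans ?_
      simp only [AddSubmonoidClass.coe_finsetSum, Submodule.coe_smul, hb, mul_smul]
    have h2 : b.repr ⟨v, hle hv⟩ i = b'.repr ⟨⟨v, hle hv⟩, hv⟩ i * α i := by
      conv_lhs => rw [h1]
      rw [Module.Basis.repr_sum_self]
    rw [repr_extendOfIsLattice b ⟨v, hle hv⟩ i, h2, hw i]
    refine ⟨b'.repr ⟨⟨v, hle hv⟩, hv⟩ i * w i, ?_⟩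
    rw [zpow_natCast, ← map_pow, ← map_mul]
    congr 1
    ring
  · rw [← (b.extendOfIsLattice E).sum_repr v]
    refine sum_mem fun i _ => ?_
    obtain ⟨r, hr⟩ := hv i
    have h1 : ((b' i : L') : V) ∈ L := (b' i).2
    have h2 : ((b.extendOfIsLattice E).repr v i) • (b.extendOfIsLattice E i) =
        (r * (w i)⁻¹.1) • ((b' i : L') : V) := by
      rw [hr, hbe, hb i, Submodule.coe_smul, smul_smul, zpow_natCast, ← map_pow, ← map_mul,
        algebraMap_smul, hw i]
      congr 1
      rw [← mul_assoc, mul_assoc r, Units.inv_mul]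
      ring
    rw [h2]
    exact L.smul_mem _ h1

theorem isLattice_of_repr (hc : IsRamifiedInvolution c u) {n : ℕ} (e : Module.Basis (Fin n) E V)
    (k : Fin n → ℤ) {L : Submodule R V} (hL : ∀ v, v ∈ L ↔ ∀ i, e.repr v i ∈ pw E u (k i)) :
    Submodule.IsLattice E L := by
  have hmem : ∀ i, algebraMap R E u ^ k i • e i ∈ L := fun i => (hL _).2 fun j => by
    rw [map_smul, e.repr_self, Finsupp.smul_apply, Finsupp.single_apply, smul_eq_mul]
    split_ifs with hij
    · subst hij
      exact ⟨1, by rw [map_one]⟩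
    · rw [mul_zero]
      exact zero_mem _
  have hspan : L = Submodule.span R (Set.range fun i => algebraMap R E u ^ k i • e i) := by
    refine le_antisymm (fun v hv => ?_) (Submodule.span_le.2 ?_)
    · rw [← e.sum_repr v]
      refine sum_mem fun i _ => ?_
      obtain ⟨r, hr⟩ := (hL v).1 hv i
      rw [hr, mul_comm, mul_smul, algebraMap_smul]
      exact Submodule.smul_mem _ _ (Submodule.subset_span ⟨i, rfl⟩)
    · rintro _ ⟨i, rfl⟩
      exact hmem i
  refine ⟨?_, ?_⟩
  · rw [hspan]
    exact Submodule.fg_span (Set.finite_range _)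
  · rw [eq_top_iff, ← e.span_eq, Submodule.span_le]
    rintro _ ⟨i, rfl⟩
    have : e i = algebraMap R E u ^ (-k i) • algebraMap R E u ^ k i • e i := by
      rw [smul_smul, ← zpow_add₀ hc.ne_zero, neg_add_cancel, zpow_zero, one_smul]
    rw [this]
    exact Submodule.smul_mem _ _ (Submodule.subset_span (hmem i))

end IsRamifiedInvolution

/-- The quotient of two lattices in terms of an adapted basis. -/
theorem nonempty_quotient_equiv {n : ℕ}
    (e : Module.Basis (Fin n) E V) (a : Fin n → ℕ) {L L' : Submodule R V}
    (he' : ∀ v, v ∈ L' ↔ ∀ i, e.repr v i ∈ pw E u 0)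
    (he : ∀ v, v ∈ L ↔ ∀ i, e.repr v i ∈ pw E u (a i)) :
    Nonempty ((L' ⧸ L.submoduleOf L') ≃ₗ[R] (∀ i, R ⧸ Ideal.span {u ^ a i})) := by
  have hrepr : ∀ (r : Fin n → R) i, e.repr (∑ j, r j • e j) i = algebraMap R E (r i) := by
    intro r i
    simp only [← algebraMap_smul E (r _) (e _)]
    rw [e.repr_sum_self]
  let f : (Fin n → R) →ₗ[R] V := Fintype.linearCombination R e
  have hf : ∀ r, f r = ∑ j, r j • e j := fun r => rfl
  have hfL : ∀ r, f r ∈ L' := fun r => (he' _).2 fun i =>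
    mem_pw_zero.2 ⟨r i, by rw [hf, hrepr]⟩
  let φ : (Fin n → R) →ₗ[R] (L' ⧸ L.submoduleOf L') :=
    (L.submoduleOf L').mkQ ∘ₗ f.codRestrict L' hfL
  let ψ : (Fin n → R) →ₗ[R] (∀ i, R ⧸ Ideal.span {u ^ a i}) :=
    LinearMap.pi fun i => (Ideal.span {u ^ a i}).mkQ ∘ₗ LinearMap.proj i
  have hφ : Function.Surjective φ := by
    intro z
    obtain ⟨⟨v, hv⟩, rfl⟩ := Submodule.mkQ_surjective _ z
    choose r hr using fun i => mem_pw_zero.1 ((he' v).1 hv i)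
    refine ⟨r, ?_⟩
    change (L.submoduleOf L').mkQ _ = _
    congr 1
    apply Subtype.ext
    change f r = v
    rw [hf, ← e.sum_repr v]
    refine Finset.sum_congr rfl fun i _ => ?_
    rw [← hr, algebraMap_smul]
  have hψ : Function.Surjective ψ := by
    intro z
    choose r hr using fun i => Submodule.mkQ_surjective (Ideal.span {u ^ a i}) (z i)
    exact ⟨r, funext hr⟩
  have hker : LinearMap.ker φ = LinearMap.ker ψ := by
    ext r
    have h1 : r ∈ LinearMap.ker φ ↔ f r ∈ L := by
      rw [LinearMap.mem_ker]
      change (L.submoduleOf L').mkQ _ = 0 ↔ _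
      rw [← LinearMap.mem_ker, Submodule.ker_mkQ]
      rfl
    rw [h1, he, LinearMap.mem_ker, funext_iff]
    refine forall_congr' fun i => ?_
    change _ ↔ (Ideal.span {u ^ a i}).mkQ (r i) = 0
    rw [← LinearMap.mem_ker, Submodule.ker_mkQ, Ideal.mem_span_singleton, hf, hrepr]
    constructor
    · rintro ⟨d, hd⟩
      refine ⟨d, FaithfulSMul.algebraMap_injective R E ?_⟩
      rw [hd, map_mul, map_pow, zpow_natCast]
    · rintro ⟨d, hd⟩
      exact ⟨d, by rw [hd, map_mul, map_pow, zpow_natCast]⟩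
  exact ⟨(φ.quotKerEquivOfSurjective hφ).symm.trans
    ((Submodule.quotEquivOfEq _ _ hker).trans (ψ.quotKerEquivOfSurjective hψ))⟩

theorem length_quotient_adapted (hu : Irreducible u) {n : ℕ} (a : Fin n → ℕ) {Q : Type*}
    [AddCommGroup Q] [Module R Q] (f : Q ≃ₗ[R] (∀ i, R ⧸ Ideal.span {u ^ a i})) :
    Module.length R Q = (∑ i, a i : ℕ) := by
  rw [f.length_eq, Module.length_pi_of_fintype]
  push_cast
  refine Finset.sum_congr rfl fun i _ => ?_
  have := IsDiscreteValuationRing.length_quotient_pow_maximalIdeal (R := R) (a i)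
  rwa [(IsDiscreteValuationRing.irreducible_iff_uniformizer u).1 hu,
    Ideal.span_singleton_pow] at this

/-- The number of elements killed by `u`. -/
theorem card_ker_lsmul (hu : Irreducible u) {n : ℕ} (a : Fin n → ℕ) {Q : Type*}
    [AddCommGroup Q] [Module R Q] (f : Q ≃ₗ[R] (∀ i, R ⧸ Ideal.span {u ^ a i})) :
    Nat.card (LinearMap.ker (LinearMap.lsmul R Q u)) =
      Nat.card (IsLocalRing.ResidueField R) ^ Nat.card {i // a i ≠ 0} := by
  classical
  have h1 : ∀ i, Nat.card {z : R ⧸ Ideal.span {u ^ a i} // u • z = 0} =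
      if a i ≠ 0 then Nat.card (IsLocalRing.ResidueField R) else 1 := by
    intro i
    split_ifs with hi
    · obtain ⟨k, hk⟩ := Nat.exists_eq_succ_of_ne_zero hi
      rw [hk]
      let g : R →ₗ[R] R ⧸ Ideal.span {u ^ (k + 1)} :=
        (Ideal.span {u ^ (k + 1)}).mkQ ∘ₗ LinearMap.mulLeft R (u ^ k)
      have hg0 : ∀ x : R, (Ideal.span {u ^ (k + 1)}).mkQ x = 0 ↔ u ^ (k + 1) ∣ x := fun x => by
        rw [← LinearMap.mem_ker, Submodule.ker_mkQ, Ideal.mem_span_singleton]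
      have hk0 : u ^ k ≠ 0 := pow_ne_zero _ hu.ne_zero
      have hker : LinearMap.ker g = IsLocalRing.maximalIdeal R := by
        ext x
        rw [LinearMap.mem_ker, (IsDiscreteValuationRing.irreducible_iff_uniformizer u).1 hu,
          Ideal.mem_span_singleton]
        change (Ideal.span {u ^ (k + 1)}).mkQ (u ^ k * x) = 0 ↔ _
        rw [hg0, pow_succ, mul_dvd_mul_iff_left hk0]
      have hrange : ∀ z, z ∈ LinearMap.range g ↔ u • z = 0 := by
        intro z
        constructor
        · rintro ⟨x, rfl⟩
          rw [← map_smul]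
          change (Ideal.span {u ^ (k + 1)}).mkQ (u ^ k * (u • x)) = 0
          rw [hg0, smul_eq_mul, ← mul_assoc, ← pow_succ]
          exact dvd_mul_right _ _
        · intro hz
          obtain ⟨x, rfl⟩ := Submodule.mkQ_surjective _ z
          rw [← map_smul, hg0, smul_eq_mul, pow_succ', mul_dvd_mul_iff_left hu.ne_zero] at hz
          obtain ⟨y, rfl⟩ := hz
          exact ⟨y, rfl⟩
      rw [← Nat.card_congr (Equiv.subtypeEquivRight hrange)]
      refine (Nat.card_congr ?_).symm
      exact ((Submodule.quotEquivOfEq _ _ hker).symm.trans g.quotKerEquivRange).toEquiv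
    · rw [not_not] at hi
      rw [hi, Nat.card_eq_one_iff_unique]
      have : Subsingleton (R ⧸ Ideal.span {u ^ 0}) := by
        rw [pow_zero, Ideal.span_singleton_one]
        exact Ideal.Quotient.subsingleton_iff.2 rfl
      exact ⟨⟨fun x y => Subtype.ext (Subsingleton.elim _ _)⟩, ⟨⟨0, smul_zero _⟩⟩⟩
  let g : LinearMap.ker (LinearMap.lsmul R Q u) ≃
      ∀ i, {z : R ⧸ Ideal.span {u ^ a i} // u • z = 0} :=
    { toFun := fun z i => ⟨f z i, by
        have h2 : u • (z : Q) = 0 := z.2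
        rw [← Pi.smul_apply, ← map_smul, h2, map_zero, Pi.zero_apply]⟩
      invFun := fun y => ⟨f.symm fun i => (y i : R ⧸ Ideal.span {u ^ a i}), by
        change u • _ = (0 : Q)
        rw [← map_smul, ← f.symm.map_zero]
        congr 1
        ext i
        exact (y i).2⟩
      left_inv := fun z => Subtype.ext (f.symm_apply_apply _)
      right_inv := fun y => funext fun i => Subtype.ext (by
        change f (f.symm _) i = _
        rw [LinearEquiv.apply_symm_apply]) }
  rw [Nat.card_congr g, Nat.card_pi, Finset.prod_congr rfl fun i _ => h1 i, Finset.prod_ite,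
    Finset.prod_const, Finset.prod_const_one, mul_one, Nat.card_eq_fintype_card (α := {i // a i ≠ 0}),
    Fintype.card_subtype]

end LatticeBases

/-! ### Discriminant modules and finiteness of integral overlattices. -/

section Invariants

variable {R E : Type*} [CommRing R] [IsDomain R] [IsDiscreteValuationRing R] [Field E]
  [Algebra R E] [IsFractionRing R E] {c : E →+* E} {u : R}
variable {V : Type*} [AddCommGroup V] [Module E V] [Module R V] [IsScalarTower R E V]
variable {h : V →ₗ[E] V →ₛₗ[c] E} {L : Submodule R V}

namespace IsRamifiedInvolution

/-- The kernel of the pairing modulo `u` is the `u`-torsion of the discriminant module. -/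
theorem card_leftKer_eq (hc : IsRamifiedInvolution c u)
    (hL : L ≤ pwDual u h L) {n : ℕ} (e : Module.Basis (Fin n) E V)
    (he : ∀ v, v ∈ L ↔ ∀ i, e.repr v i ∈ pw E u 0) :
    Nat.card (leftKer fun i j => fracResidue R (algebraMap R E u * h (e i) (e j))) =
      Nat.card (LinearMap.ker
        (LinearMap.lsmul R (pwDual u h L ⧸ L.submoduleOf (pwDual u h L)) u)) := by
  have hu := hc.ne_zero
  set D := pwDual u h L with hD
  have hone : (1 : E) ∈ pw E u 0 := mem_pw_zero.2 ⟨1, map_one _⟩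
  have hei : ∀ i, e i ∈ L := fun i => (he _).2 fun j => by
    rw [e.repr_self, Finsupp.single_apply]
    split_ifs
    exacts [hone, zero_mem _]
  -- `S` consists of the `x ∈ L` with `u⁻¹ x` in the dual. Reduction modulo `u` maps it onto the
  -- radical of the reduced form, and division by `u` maps it onto the `u`-torsion of the
  -- discriminant module. Both maps have kernel `S ∩ u L`, so the two images have the same
  -- cardinality.
  let S : Submodule R V :=
    { carrier := {x | x ∈ L ∧ algebraMap R E u ^ (-1 : ℤ) • x ∈ D}
      zero_mem' := ⟨zero_mem _, by rw [smul_zero]; exact zero_mem _⟩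
      add_mem' := fun hx hy => ⟨add_mem hx.1 hy.1, by rw [smul_add]; exact add_mem hx.2 hy.2⟩
      smul_mem' := fun r x hx => ⟨L.smul_mem r hx.1, by
        rw [smul_comm]
        exact D.smul_mem r hx.2⟩ }
  let ρ : S →+ (Fin n → IsLocalRing.ResidueField R) :=
    { toFun := fun x i => fracResidue R (e.repr (x : V) i)
      map_zero' := by
        ext i
        simp [fracResidue_zero]
      map_add' := fun x y => by
        ext i
        rw [Submodule.coe_add, map_add, Finsupp.add_apply,
          fracResidue_add ((he _).1 x.2.1 i) ((he _).1 y.2.1 i), Pi.add_apply] }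
  let π : S →+ (D ⧸ L.submoduleOf D) :=
    { toFun := fun x => (L.submoduleOf D).mkQ ⟨algebraMap R E u ^ (-1 : ℤ) • (x : V), x.2.2⟩
      map_zero' := by
        rw [← map_zero (L.submoduleOf D).mkQ]
        congr 1
        exact Subtype.ext (smul_zero _)
      map_add' := fun x y => by
        rw [← map_add]
        congr 1
        exact Subtype.ext (smul_add _ _ _) }
  have hπ0 : ∀ d : D, (L.submoduleOf D).mkQ d = 0 ↔ (d : V) ∈ L := fun d => by
    rw [← LinearMap.mem_ker, Submodule.ker_mkQ]
    rfl
  have hker : ρ.ker = π.ker := by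
    ext x
    rw [AddMonoidHom.mem_ker, AddMonoidHom.mem_ker]
    change _ ↔ (L.submoduleOf D).mkQ _ = 0
    rw [hπ0, funext_iff]
    change _ ↔ algebraMap R E u ^ (-1 : ℤ) • (x : V) ∈ L
    rw [← mem_scale, mem_scale_iff_repr e he hc]
    exact forall_congr' fun i => hc.fracResidue_eq_zero ((he _).1 x.2.1 i)
  have hpair : ∀ x ∈ L, ∀ j, fracResidue R (algebraMap R E u * h x (e j)) =
      ∑ i, fracResidue R (e.repr x i) * fracResidue R (algebraMap R E u * h (e i) (e j)) := by
    intro x hx j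
    have h1 : algebraMap R E u * h x (e j) =
        ∑ i, e.repr x i * (algebraMap R E u * h (e i) (e j)) := by
      conv_lhs => rw [← e.sum_repr x]
      rw [map_sum, LinearMap.sum_apply, Finset.mul_sum]
      refine Finset.sum_congr rfl fun i _ => ?_
      rw [LinearMap.map_smul₂, smul_eq_mul]
      ring
    have h2 : ∀ i, algebraMap R E u * h (e i) (e j) ∈ pw E u 0 := fun i => by
      have := hc.zpow_mul_mem' (l := 1) 0 (hL (hei i) _ (hei j)) (by norm_num)
      rwa [zpow_one] at this
    rw [h1, fracResidue_sum _ fun i => by simpa using hc.mul_mem ((he x).1 hx i) (h2 i)]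
    exact Finset.sum_congr rfl fun i _ => fracResidue_mul ((he x).1 hx i) (h2 i)
  have hS : ∀ x, x ∈ L → (x ∈ S ↔ ∀ j, fracResidue R (algebraMap R E u * h x (e j)) = 0) := by
    intro x hx
    have h2 : ∀ i, algebraMap R E u * h x (e i) ∈ pw E u 0 := fun i => by
      have := hc.zpow_mul_mem' (l := 1) 0 (hL hx _ (hei i)) (by norm_num)
      rwa [zpow_one] at this
    have h3 : ∀ j, fracResidue R (algebraMap R E u * h x (e j)) = 0 ↔ h x (e j) ∈ pw E u 0 := by
      intro j
      rw [hc.fracResidue_eq_zero (h2 j)]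
      conv_lhs => rw [← zpow_one (algebraMap R E u)]
      exact hc.zpow_mul_mem_iff (by norm_num)
    simp only [h3]
    have h4 : ∀ y, h (algebraMap R E u ^ (-1 : ℤ) • x) y ∈ pw E u (-1) ↔ h x y ∈ pw E u 0 := by
      intro y
      rw [LinearMap.map_smul₂, smul_eq_mul, hc.zpow_mul_mem_iff (k := 0) (by norm_num)]
    constructor
    · intro h5 j
      rw [← h4]
      exact h5.2 _ (hei j)
    · refine fun h5 => ⟨hx, fun y hy => ?_⟩
      rw [h4, ← e.sum_repr y, map_sum]
      refine sum_mem fun i _ => ?_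
      rw [LinearMap.map_smulₛₗ, smul_eq_mul]
      simpa using hc.mul_mem (hc.c_mem ((he y).1 hy i)) (h5 i)
  have hρr : (ρ.range : Set (Fin n → IsLocalRing.ResidueField R)) =
      leftKer fun i j => fracResidue R (algebraMap R E u * h (e i) (e j)) := by
    ext b
    constructor
    · rintro ⟨x, rfl⟩ j
      change ∑ i, fracResidue R (e.repr (x : V) i) * _ = 0
      rw [← hpair _ x.2.1]
      exact (hS _ x.2.1).1 x.2 j
    · intro hb
      choose r hr using fun i => IsLocalRing.residue_surjective (b i)
      have h1 : ∀ i, e.repr (∑ j, r j • e j) i = algebraMap R E (r i) := by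
        intro i
        simp only [← algebraMap_smul E (r _) (e _)]
        rw [e.repr_sum_self]
      have h2 : ∑ j, r j • e j ∈ L := sum_mem fun j _ => L.smul_mem _ (hei j)
      have h3 : ∀ i, fracResidue R (e.repr (∑ j, r j • e j) i) = b i := fun i => by
        rw [h1, fracResidue_algebraMap, hr]
      refine ⟨⟨∑ j, r j • e j, (hS _ h2).2 fun j => ?_⟩, funext h3⟩
      rw [hpair _ h2]
      simp only [h3]
      exact hb j
  have hπr : (π.range : Set (D ⧸ L.submoduleOf D)) =
      LinearMap.ker (LinearMap.lsmul R (D ⧸ L.submoduleOf D) u) := by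
    have hsmul : ∀ v : V, u • algebraMap R E u ^ (-1 : ℤ) • v = v := fun v => by
      rw [← algebraMap_smul E u, smul_smul, zpow_neg_one, mul_inv_cancel₀ hu, one_smul]
    ext z
    constructor
    · rintro ⟨x, rfl⟩
      change u • (L.submoduleOf D).mkQ _ = 0
      rw [← map_smul, hπ0]
      change u • algebraMap R E u ^ (-1 : ℤ) • (x : V) ∈ L
      rw [hsmul]
      exact x.2.1
    · intro hz
      obtain ⟨d, rfl⟩ := Submodule.mkQ_surjective _ z
      have hz' : u • (L.submoduleOf D).mkQ d = 0 := hz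
      rw [← map_smul, hπ0] at hz'
      have h1 : algebraMap R E u ^ (-1 : ℤ) • u • (d : V) = d := by
        rw [← algebraMap_smul E u, smul_smul, zpow_neg_one, inv_mul_cancel₀ hu, one_smul]
      refine ⟨⟨u • (d : V), hz', by rw [h1]; exact d.2⟩, ?_⟩
      change (L.submoduleOf D).mkQ _ = _
      congr 1
      exact Subtype.ext h1
  have e1 := AddSubgroup.index_ker ρ
  have e2 := AddSubgroup.index_ker π
  rw [hker, e2] at e1
  rw [← SetLike.coe_sort_coe, ← SetLike.coe_sort_coe, ← hρr, ← hπr]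
  exact e1.symm

/-- The dual of a lattice is a lattice. -/
theorem isLattice_pwDual (hc : IsRamifiedInvolution c u) [FiniteDimensional E V]
    (hnd : ∀ x, (∀ y, h x y = 0) → x = 0) [Submodule.IsLattice E L] :
    Submodule.IsLattice E (pwDual u h L) := by
  obtain ⟨e, a, he, -⟩ := hc.exists_adapted_basis (le_refl L) rfl
  have hone : (1 : E) ∈ pw E u 0 := mem_pw_zero.2 ⟨1, map_one _⟩
  have hei : ∀ i, e i ∈ L := fun i => (he _).2 fun j => by
    rw [e.repr_self, Finsupp.single_apply]
    split_ifs
    exacts [hone, zero_mem _]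
  let Ψ : V →ₗ[E] (Fin (Module.finrank E V) → E) := LinearMap.pi fun i => h.flip (e i)
  have hΨ : ∀ x i, Ψ x i = h x (e i) := fun x i => rfl
  have hexp : ∀ x y, h x y = ∑ i, c (e.repr y i) * h x (e i) := fun x y => by
    conv_lhs => rw [← e.sum_repr y]
    rw [map_sum]
    refine Finset.sum_congr rfl fun i _ => ?_
    rw [LinearMap.map_smulₛₗ, smul_eq_mul]
  have hinj : Function.Injective Ψ := by
    rw [← LinearMap.ker_eq_bot, LinearMap.ker_eq_bot']
    intro x hx
    refine hnd x fun y => ?_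
    rw [hexp]
    refine Finset.sum_eq_zero fun i _ => ?_
    rw [← hΨ, hx, Pi.zero_apply, mul_zero]
  -- Pairing with a basis of `L` is bijective by nondegeneracy. In the resulting coordinates the
  -- dual is `(u⁻¹ R) ^ n`.
  let Ψ' := LinearEquiv.ofInjectiveOfFinrankEq Ψ hinj (by simp)
  refine hc.isLattice_of_repr (Module.Basis.ofEquivFun Ψ') (fun _ => -1) fun v => ?_
  have hr : ∀ i, (Module.Basis.ofEquivFun Ψ').repr v i = h v (e i) := fun i => rfl
  simp only [hr]
  refine ⟨fun hv i => hv _ (hei i), fun hv y hy => ?_⟩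
  rw [hexp]
  refine sum_mem fun i _ => ?_
  simpa using hc.mul_mem (hc.c_mem ((he y).1 hy i)) (hv i)

theorem pwDual_anti {L L' : Submodule R V} (hle : L ≤ L') : pwDual u h L' ≤ pwDual u h L :=
  fun _ hx y hy => hx y (hle hy)

theorem isLattice_of_mem_overModules (hc : IsRamifiedInvolution c u) [FiniteDimensional E V]
    (hnd : ∀ x, (∀ y, h x y = 0) → x = 0) [Submodule.IsLattice E L] {L' : Submodule R V}
    (hL' : L' ∈ overModules u h L) : Submodule.IsLattice E L' := by
  have := hc.isLattice_pwDual (h := h) (L := L) hnd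
  have h1 : L' ≤ pwDual u h L := hL'.2.trans (pwDual_anti hL'.1)
  have h2 : IsNoetherian R (pwDual u h L) :=
    have : Module.Finite R (pwDual u h L) := Submodule.IsLattice.finite E _
    inferInstance
  have h3 : IsNoetherian R L' := isNoetherian_of_le h1
  exact Submodule.IsLattice.of_le_of_isLattice_of_fg E hL'.1 (Module.Finite.iff_fg.1 inferInstance)

theorem finite_quotient (hc : IsRamifiedInvolution c u) [FiniteDimensional E V]
    [Finite (IsLocalRing.ResidueField R)] {L L' : Submodule R V}
    [Submodule.IsLattice E L] [Submodule.IsLattice E L'] (hle : L ≤ L') :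
    Finite (L' ⧸ L.submoduleOf L') := by
  obtain ⟨e, a, he', he⟩ := hc.exists_adapted_basis hle rfl
  obtain ⟨f⟩ := nonempty_quotient_equiv e a he' he
  have h1 : ∀ i, Finite (R ⧸ Ideal.span {u ^ a i}) := fun i => by
    have : Finite (R ⧸ Ideal.span {u}) := by
      rw [← hc.maximalIdeal_eq]
      exact inferInstanceAs (Finite (IsLocalRing.ResidueField R))
    rw [← Ideal.span_singleton_pow]
    exact Ideal.finite_quotient_pow (Submodule.fg_span_singleton u) _
  exact Finite.of_equiv _ f.symm.toEquiv

/-- Each member lies between `L` and the dual of `L`, so it is determined by its image in the finite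
discriminant module of `L`. -/
theorem finite_overModules (hc : IsRamifiedInvolution c u) [FiniteDimensional E V]
    [Finite (IsLocalRing.ResidueField R)] (hnd : ∀ x, (∀ y, h x y = 0) → x = 0)
    [Submodule.IsLattice E L] : (overModules u h L).Finite := by
  by_cases hLD : L ≤ pwDual u h L
  swap
  · convert Set.finite_empty
    refine Set.eq_empty_of_forall_notMem fun L' hL' => hLD ?_
    exact hL'.1.trans (hL'.2.trans (pwDual_anti hL'.1))
  have := hc.isLattice_pwDual (h := h) (L := L) hnd
  have hfin := hc.finite_quotient hLD
  let F : Submodule R V → Set (pwDual u h L ⧸ L.submoduleOf (pwDual u h L)) :=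
    fun L' => (L.submoduleOf (pwDual u h L)).mkQ '' {x | (x : V) ∈ L'}
  refine Set.Finite.of_finite_image (f := F) (Set.toFinite _) ?_
  have key : ∀ L₁ ∈ overModules u h L, ∀ L₂ ∈ overModules u h L, F L₁ = F L₂ → L₁ ≤ L₂ := by
    intro L₁ h₁ L₂ h₂ h12 x hx
    have hxD : x ∈ pwDual u h L := pwDual_anti h₁.1 (h₁.2 hx)
    have h3 : (L.submoduleOf (pwDual u h L)).mkQ ⟨x, hxD⟩ ∈ F L₂ := by
      rw [← h12]
      exact ⟨⟨x, hxD⟩, hx, rfl⟩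
    obtain ⟨y, hy, hyx⟩ := h3
    rw [← sub_eq_zero, ← map_sub, ← LinearMap.mem_ker, Submodule.ker_mkQ] at hyx
    have h4 : (y : V) - x ∈ L₂ := h₂.1 hyx
    have h5 := sub_mem (show (y : V) ∈ L₂ from hy) h4
    rwa [sub_sub_cancel] at h5
  exact fun L₁ h₁ L₂ h₂ h12 => le_antisymm (key L₁ h₁ L₂ h₂ h12) (key L₂ h₂ L₁ h₁ h12.symm)

/-- An exponent bounding the discriminant module. -/
theorem exists_zpow_smul_pwDual_le (hc : IsRamifiedInvolution c u) [FiniteDimensional E V]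
    (hnd : ∀ x, (∀ y, h x y = 0) → x = 0) [Submodule.IsLattice E L] (hLD : L ≤ pwDual u h L) :
    ∃ d : ℕ, ∀ x ∈ pwDual u h L, algebraMap R E u ^ (d : ℤ) • x ∈ L := by
  have := hc.isLattice_pwDual (h := h) (L := L) hnd
  obtain ⟨e, a, he', he⟩ := hc.exists_adapted_basis hLD rfl
  refine ⟨∑ i, a i, fun x hx => (he _).2 fun i => ?_⟩
  rw [map_smul, Finsupp.smul_apply, smul_eq_mul]
  have h1 : a i ≤ ∑ i, a i :=
    Finset.single_le_sum (f := fun i => a i) (fun _ _ => Nat.zero_le _) (Finset.mem_univ i)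
  refine hc.anti (by exact_mod_cast h1) (hc.zpow_mul_mem' (l := ((∑ i, a i : ℕ) : ℤ)) (k := 0) _
    ((he' x).1 hx i) (add_zero _))

/-- Fundamental invariants exist. -/
theorem exists_monotone_quotient_equiv (hc : IsRamifiedInvolution c u) [FiniteDimensional E V]
    {L L' : Submodule R V} [Submodule.IsLattice E L] [Submodule.IsLattice E L'] (hle : L ≤ L')
    {n : ℕ} (hn : Module.finrank E V = n) :
    ∃ a : Fin n → ℕ, Monotone a ∧
      Nonempty ((L' ⧸ L.submoduleOf L') ≃ₗ[R] (∀ i, R ⧸ Ideal.span {u ^ a i})) := by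
  obtain ⟨e, a, he', he⟩ := hc.exists_adapted_basis hle hn
  refine ⟨a ∘ Tuple.sort a, Tuple.monotone_sort a, ?_⟩
  refine nonempty_quotient_equiv (e.reindex (Tuple.sort a).symm) _ (fun v => ?_) fun v => ?_
  · rw [he', ← (Tuple.sort a).forall_congr_right]
    simp
  · rw [he, ← (Tuple.sort a).forall_congr_right]
    simp

end IsRamifiedInvolution

end Invariants

/-! ### Isotropic families in self-dual lattices. -/

section Split

variable {R E : Type*} [CommRing R] [IsDomain R] [IsDiscreteValuationRing R] [Field E]
  [Algebra R E] [IsFractionRing R E] {c : E →+* E} {u : R}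
variable {V : Type*} [AddCommGroup V] [Module E V] [Module R V] [IsScalarTower R E V]
variable {h : V →ₗ[E] V →ₛₗ[c] E} {L : Submodule R V}

namespace IsRamifiedInvolution

/-- In a relation over `R` all coefficients are divisible by `u`; dividing and repeating makes them
divisible by every power of `u`. -/
theorem linearIndependent_of_isPrimitive (hc : IsRamifiedInvolution c u) {n : ℕ} {x : Fin n → V}
    (hx : IsPrimitive u L x) : LinearIndependent E x := by
  rw [← LinearIndependent.iff_fractionRing R E, Fintype.linearIndependent_iff]
  intro g hg
  have hT : ∀ v : V, u • v = 0 → v = 0 := fun v hv => by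
    rw [← algebraMap_smul E u, smul_eq_zero] at hv
    exact hv.resolve_left hc.ne_zero
  have key : ∀ k : ℕ, ∀ g : Fin n → R, ∑ i, g i • x i = 0 → ∀ i, u ^ k ∣ g i := by
    intro k
    induction k with
    | zero => exact fun g _ i => by rw [pow_zero]; exact one_dvd _
    | succ k ih =>
      intro g hg
      choose g' hg' using hx g ⟨0, zero_mem _, by rw [hg, smul_zero]⟩
      have h1 : ∑ i, g' i • x i = 0 := by
        refine hT _ ?_
        rw [Finset.smul_sum, ← hg]
        exact Finset.sum_congr rfl fun i _ => by rw [smul_smul, ← hg']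
      intro i
      rw [hg' i, pow_succ']
      exact mul_dvd_mul_left u (ih g' h1 i)
  intro i
  by_contra hi
  obtain ⟨k, w, hk⟩ := IsDiscreteValuationRing.eq_unit_mul_pow_irreducible hi hc.irreducible
  have h1 := key (k + 1) g hg i
  rw [hk, pow_succ, mul_comm (w : R), mul_dvd_mul_iff_left (pow_ne_zero _ hc.irreducible.ne_zero)]
    at h1
  exact hc.irreducible.not_isUnit (isUnit_of_dvd_unit h1 w.isUnit)

/-- If no vector of `K = L ∩ x^⊥` extended the family, `K` would be contained in the span `X` of `x`
plus `u K`, and Nakayama would give `K ≤ X`. But the orthogonal complement of `x` has dimension at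
least `dim V - k > k`. -/
theorem exists_primitive_orthogonal (hc : IsRamifiedInvolution c u) [FiniteDimensional E V]
    [Submodule.IsLattice E L] {k : ℕ} (hk : 2 * k < Module.finrank E V) {x : Fin k → V}
    (hxL : ∀ i, x i ∈ L) (hx : IsPrimitive u L x) (hxx : ∀ i j, h (x i) (x j) = 0) :
    ∃ z ∈ L, (∀ i, h z (x i) = 0) ∧ IsPrimitive u L (Fin.snoc x z : Fin (k + 1) → V) := by
  by_contra! hcon
  have hu := hc.ne_zero
  let Ψ : V →ₗ[E] (Fin k → E) := LinearMap.pi fun i => h.flip (x i)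
  have hΨ : ∀ y, y ∈ LinearMap.ker Ψ ↔ ∀ i, h y (x i) = 0 := fun y => by
    rw [LinearMap.mem_ker, funext_iff]
    rfl
  let K : Submodule R V := L ⊓ (LinearMap.ker Ψ).restrictScalars R
  let X : Submodule R V := Submodule.span R (Set.range x)
  have hXK : X ≤ K := by
    refine Submodule.span_le.2 ?_
    rintro _ ⟨i, rfl⟩
    exact ⟨hxL i, (hΨ _).2 fun j => hxx i j⟩
  have hKX : K ≤ X ⊔ IsLocalRing.maximalIdeal R • K := by
    rintro z ⟨hzL, hzΨ⟩
    have hz0 := (hΨ z).1 hzΨ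
    have h1 := hcon z hzL hz0
    unfold IsPrimitive at h1
    push Not at h1
    obtain ⟨b, ⟨y, hy, hby⟩, i, hi⟩ := h1
    rw [Fin.sum_univ_castSucc] at hby
    simp only [Fin.snoc_castSucc, Fin.snoc_last] at hby
    have hunit : IsUnit (b (Fin.last k)) := by
      by_contra hnu
      have h2 : u ∣ b (Fin.last k) := by
        rw [← Ideal.mem_span_singleton, ← hc.maximalIdeal_eq]
        exact (IsLocalRing.mem_maximalIdeal _).2 hnu
      obtain ⟨d, hd⟩ := h2
      have h3 := hx (fun i => b i.castSucc) ⟨y - d • z, sub_mem hy (L.smul_mem d hzL), by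
        rw [smul_sub, ← hby, hd, mul_smul, add_sub_cancel_right]⟩
      refine hi ?_
      induction i using Fin.lastCases with
      | last => exact ⟨d, hd⟩
      | cast i => exact h3 i
    obtain ⟨w, hw⟩ := hunit
    have h2 : z = -((w⁻¹ : Rˣ) : R) • ∑ i : Fin k, b i.castSucc • x i +
        u • ((w⁻¹ : Rˣ) : R) • y := by
      rw [smul_comm, ← hby, smul_add, ← hw, smul_smul ((w⁻¹ : Rˣ) : R) (w : R) z, Units.inv_mul,
        one_smul, neg_smul]
      abel
    have h3 : ∑ i : Fin k, b i.castSucc • x i ∈ X :=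
      sum_mem fun i _ => X.smul_mem _ (Submodule.subset_span ⟨i, rfl⟩)
    have h4 : -((w⁻¹ : Rˣ) : R) • ∑ i : Fin k, b i.castSucc • x i ∈ X := X.smul_mem _ h3
    have h5 : ((w⁻¹ : Rˣ) : R) • y ∈ K := by
      refine ⟨L.smul_mem _ hy, (hΨ _).2 fun i => ?_⟩
      have h6 := (hΨ _).1 (hXK h4).2 i
      have h7 := hz0 i
      rw [h2, map_add, LinearMap.add_apply, h6, zero_add, ← algebraMap_smul E u,
        LinearMap.map_smul₂, smul_eq_mul] at h7
      exact (mul_eq_zero.1 h7).resolve_left hu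
    rw [h2]
    refine Submodule.add_mem_sup h4 (Submodule.smul_mem_smul ?_ h5)
    rw [hc.maximalIdeal_eq]
    exact Ideal.mem_span_singleton_self u
  have hKfg : K.FG := by
    have : IsNoetherian R L :=
      have : Module.Finite R L := Submodule.IsLattice.finite E _
      inferInstance
    have h3 : IsNoetherian R K := isNoetherian_of_le (inf_le_left : K ≤ L)
    exact Module.Finite.iff_fg.1 inferInstance
  have hle : K ≤ X := Submodule.le_of_le_smul_of_le_jacobson_bot hKfg
    (by rw [IsLocalRing.jacobson_eq_maximalIdeal _ bot_ne_top]) hKX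
  have hker : LinearMap.ker Ψ ≤ Submodule.span E (Set.range x) := by
    intro v hv
    obtain ⟨e, a, he, -⟩ := hc.exists_adapted_basis (le_refl L) rfl
    obtain ⟨j, hj⟩ := hc.exists_npow_smul_mem e (L := L) (a := fun _ => 0) (by simpa using he) v
    have h1 : algebraMap R E u ^ (j : ℤ) • v ∈ K :=
      ⟨hj, Submodule.smul_mem (LinearMap.ker Ψ) _ hv⟩
    have h2 : algebraMap R E u ^ (j : ℤ) • v ∈ Submodule.span E (Set.range x) :=
      Submodule.span_le_restrictScalars R E _ (hle h1)
    have h3 := Submodule.smul_mem _ (algebraMap R E u ^ (-j : ℤ)) h2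
    rwa [smul_smul, ← zpow_add₀ hu, neg_add_cancel, zpow_zero, one_smul] at h3
  have h1 := Submodule.finrank_mono hker
  have h2 : Module.finrank E (Submodule.span E (Set.range x)) ≤ k :=
    (finrank_range_le_card (R := E) x).trans_eq (Fintype.card_fin k)
  have h3 := LinearMap.finrank_range_add_finrank_ker Ψ
  have h4 : Module.finrank E (LinearMap.range Ψ) ≤ k := by
    simpa using Submodule.finrank_le (LinearMap.range Ψ)
  omega

/-- A self dual lattice has isotropic primitive families of any length up to half the dimension. -/
theorem exists_isotropic (hc : IsRamifiedInvolution c u) [FiniteDimensional E V]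
    [Submodule.IsLattice E L] (hh : ∀ x y, h y x = c (h x y)) (hL : IsSelfDual u h L)
    (hsqrt : ∀ D ∈ pw E u 2, c D = D → ∃ w, c w = w ∧ w ^ 2 = 1 + D ∧ w - 1 ∈ pw E u 1)
    (k : ℕ) (hk : 2 * k ≤ Module.finrank E V) :
    ∃ x : Fin k → V, (∀ i, x i ∈ L) ∧ IsPrimitive u L x ∧ ∀ i j, h (x i) (x j) = 0 := by
  induction k with
  | zero => exact ⟨Fin.elim0, fun i => i.elim0, fun _ _ i => i.elim0, fun i => i.elim0⟩
  | succ k ih =>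
    obtain ⟨x, hxL, hx, hxx⟩ := ih (by omega)
    obtain ⟨z, hzL, hzx, hz⟩ := hc.exists_primitive_orthogonal (by omega) hxL hx hxx
    have hu := hc.ne_zero
    -- A partner `y` of `z`, orthogonal to the `x i`. Adding a multiple of `y` corrects the value `h
    -- z z` without disturbing the other relations.
    obtain ⟨y, hyL, hy⟩ := hc.exists_pairing_eq hh hL hz
      (fun i => by
        induction i using Fin.lastCases with
        | last => simpa using hzL
        | cast i => simpa using hxL i)
      (Fin.snoc (fun _ => 0) (-(algebraMap R E u)⁻¹) : Fin (k + 1) → E)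
      (fun i => by
        induction i using Fin.lastCases with
        | last => exact ⟨-1, by simp⟩
        | cast i => simp)
    have hyx : ∀ i, h y (x i) = 0 := fun i => by simpa using hy i.castSucc
    have hyz : h y z = -(algebraMap R E u)⁻¹ := by simpa using hy (Fin.last k)
    have hzy : h z y = (algebraMap R E u)⁻¹ := by
      rw [hh y z, hyz, map_neg, map_inv₀, hc.map_uniformizer, inv_neg, neg_neg]
    have hfix : ∀ v ∈ L, h v v ∈ pw E u 0 ∧ c (h v v) = h v v := by
      intro v hv
      rw [← mem_fixedPw, ← show (-1 : ℤ) + 1 = 0 by norm_num, ← hc.fixedPw_odd (by decide),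
        mem_fixedPw]
      exact ⟨(hL v).1 hv v hv, (hh v v).symm⟩
    obtain ⟨ha, hca⟩ := hfix z hzL
    obtain ⟨hd, hcd⟩ := hfix y hyL
    set a := h z z with ha_def
    set d := h y y with hd_def
    have hD : algebraMap R E u ^ (2 : ℤ) * (a * d) ∈ pw E u 2 :=
      hc.zpow_mul_mem' 2 (by simpa using hc.mul_mem ha hd) (by norm_num)
    have hcD : c (algebraMap R E u ^ (2 : ℤ) * (a * d)) = algebraMap R E u ^ (2 : ℤ) * (a * d) := by
      rw [map_mul, map_mul, hca, hcd, map_zpow₀, hc.map_uniformizer, Even.neg_zpow (by decide)]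
    obtain ⟨w, hcw, hw2, hw1⟩ := hsqrt _ hD hcD
    have hw0 : ∃ b : Rˣ, algebraMap R E b = 1 + w := by
      obtain ⟨b, hb⟩ := hw1
      obtain ⟨t, ht⟩ := hc.two
      have h1 : IsUnit (2 + u * b) := by
        by_contra hnu
        have h2 := (IsLocalRing.mem_maximalIdeal _).2 hnu
        rw [hc.maximalIdeal_eq, Ideal.mem_span_singleton] at h2
        have h3 : u ∣ 2 := (dvd_add_left (dvd_mul_right _ _)).1 h2
        exact hc.irreducible.not_isUnit (isUnit_of_dvd_unit h3 hc.two)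
      refine ⟨h1.unit, ?_⟩
      rw [IsUnit.unit_spec, map_add, map_mul, map_ofNat, ← zpow_one (algebraMap R E u), ← hb]
      ring
    obtain ⟨b, hb⟩ := hw0
    have hb0 : 1 + w ≠ 0 := by
      rw [← hb, Ne, FaithfulSMul.algebraMap_eq_zero_iff]
      exact b.ne_zero
    -- For fixed `ν` the vector `z + u ν y` is isotropic exactly when `u² d ν² + 2 ν - a = 0`. With
    -- `w² = 1 + u² a d` a root is `a / (1 + w)`. In this form it makes sense even for `d = 0`, and
    -- it is integral because `1 + w`, congruent to 2 modulo `u`, is a unit.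
    obtain ⟨ν, hν0, hcν, hν⟩ : ∃ ν ∈ pw E u 0, c ν = ν ∧
        algebraMap R E u ^ 2 * d * ν ^ 2 + 2 * ν - a = 0 := by
      refine ⟨a / (1 + w), ?_, ?_, ?_⟩
      · have h1 : (1 + w)⁻¹ = algebraMap R E (b⁻¹ : Rˣ) := by
          refine inv_eq_of_mul_eq_one_right ?_
          rw [← hb, ← map_mul, Units.mul_inv, map_one]
        rw [div_eq_mul_inv, h1, mul_comm, ← Algebra.smul_def]
        exact Submodule.smul_mem _ _ ha
      · rw [map_div₀, hca, map_add, map_one, hcw]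
      · field_simp
        rw [zpow_ofNat] at hw2
        linear_combination (-a) * hw2
    obtain ⟨ν', hν'⟩ := mem_pw_zero.1 hν0
    have hyν : (algebraMap R E u * ν) • y = u • ν' • y := by
      rw [← hν', mul_smul, algebraMap_smul, algebraMap_smul]
    refine ⟨(Fin.snoc x (z + (algebraMap R E u * ν) • y) : Fin (k + 1) → V), fun i => ?_, ?_,
      ?_⟩
    · induction i using Fin.lastCases with
      | last =>
        rw [Fin.snoc_last, hyν]
        exact add_mem hzL (L.smul_mem _ (L.smul_mem _ hyL))
      | cast i => simpa using hxL i
    · refine hc.isPrimitive_congr hz fun i => ?_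
      induction i using Fin.lastCases with
      | last =>
        rw [Fin.snoc_last, Fin.snoc_last, add_sub_cancel_left, hc.mem_scale_one_iff]
        exact ⟨_, L.smul_mem ν' hyL, hyν⟩
      | cast i =>
        rw [Fin.snoc_castSucc, Fin.snoc_castSucc, sub_self]
        exact zero_mem _
    · have h1 : ∀ i, h (z + (algebraMap R E u * ν) • y) (x i) = 0 := fun i => by
        rw [map_add, LinearMap.add_apply, LinearMap.map_smul₂, hzx, hyx, smul_zero, add_zero]
      intro i j
      induction i using Fin.lastCases with
      | last =>
        induction j using Fin.lastCases with
        | last =>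
          rw [Fin.snoc_last]
          simp only [map_add, LinearMap.add_apply, LinearMap.map_smulₛₗ, LinearMap.smul_apply,
            RingHom.id_apply, smul_eq_mul, map_mul, hcν, hc.map_uniformizer, ← ha_def, ← hd_def, hyz, hzy]
          field_simp
          linear_combination (-1 : E) * hν
        | cast j =>
          rw [Fin.snoc_last, Fin.snoc_castSucc]
          exact h1 j
      | cast i =>
        induction j using Fin.lastCases with
        | last =>
          rw [Fin.snoc_last, Fin.snoc_castSucc, hh, h1, map_zero]
        | cast j =>
          rw [Fin.snoc_castSucc, Fin.snoc_castSucc]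
          exact hxx i j

/-- A space with a self dual lattice has a totally isotropic subspace of half the dimension. -/
theorem exists_isotropic_subspace (hc : IsRamifiedInvolution c u) [FiniteDimensional E V]
    [Submodule.IsLattice E L] (hh : ∀ x y, h y x = c (h x y)) (hL : IsSelfDual u h L)
    (hsqrt : ∀ D ∈ pw E u 2, c D = D → ∃ w, c w = w ∧ w ^ 2 = 1 + D ∧ w - 1 ∈ pw E u 1)
    (r : ℕ) (hr : Module.finrank E V = 2 * r) :
    ∃ W : Submodule E V, Module.finrank E V = 2 * Module.finrank E W ∧
      ∀ x ∈ W, ∀ y ∈ W, h x y = 0 := by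
  obtain ⟨x, -, hx, hxx⟩ := hc.exists_isotropic hh hL hsqrt r hr.ge
  refine ⟨Submodule.span E (Set.range x), ?_, fun a ha b hb => ?_⟩
  · rw [finrank_span_eq_card (hc.linearIndependent_of_isPrimitive hx), hr, Fintype.card_fin]
  · induction ha using Submodule.span_induction with
    | mem a ha =>
      obtain ⟨i, rfl⟩ := ha
      induction hb using Submodule.span_induction with
      | mem b hb =>
        obtain ⟨j, rfl⟩ := hb
        exact hxx i j
      | zero => simp
      | add b b' _ _ h1 h2 => rw [map_add, h1, h2, add_zero]
      | smul s b _ h1 => rw [LinearMap.map_smulₛₗ, h1, smul_zero]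
    | zero => simp
    | add a a' _ _ h1 h2 => rw [map_add, LinearMap.add_apply, h1, h2, add_zero]
    | smul s a _ h1 => rw [LinearMap.map_smul₂, h1, smul_zero]

end IsRamifiedInvolution

end Split

theorem FiniteMod.of_image {A A' : Type*} [AddCommGroup A] [AddCommGroup A'] {B : AddSubgroup A}
    {B' : AddSubgroup A'} {S : Set A} (e : A →+ A') (hB : ∀ x, e x ∈ B' ↔ x ∈ B)
    (hS : FiniteMod B' (e '' S)) : FiniteMod B S := by
  let g := QuotientAddGroup.map B B' e (show B ≤ B'.comap e from fun x hx => (hB x).2 hx)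
  have hinj : Function.Injective g := by
    rw [injective_iff_map_eq_zero]
    intro z hz
    obtain ⟨x, rfl⟩ := QuotientAddGroup.mk_surjective z
    change (QuotientAddGroup.mk (e x) : A' ⧸ B') = 0 at hz
    rw [QuotientAddGroup.eq_zero_iff, hB] at hz
    exact (QuotientAddGroup.eq_zero_iff x).2 hz
  refine Set.Finite.of_finite_image (f := g) (Set.Finite.subset hS ?_) hinj.injOn
  rintro _ ⟨_, ⟨x, hx, rfl⟩, rfl⟩
  exact ⟨e x, ⟨x, hx, rfl⟩, rfl⟩

/-! ### The number of all approximate isometries. -/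

section Total

variable {R E : Type*} [CommRing R] [IsDomain R] [IsDiscreteValuationRing R] [Field E]
  [Algebra R E] [IsFractionRing R E] {c : E →+* E} {u : R}
variable {V : Type*} [AddCommGroup V] [Module E V] [Module R V] [IsScalarTower R E V]
variable {W : Type*} [AddCommGroup W] [Module E W] [Module R W] [IsScalarTower R E W]
variable {h : V →ₗ[E] V →ₛₗ[c] E} {h' : W →ₗ[E] W →ₛₗ[c] E} {L : Submodule R V}
  {M : Submodule R W}

namespace IsRamifiedInvolution

variable [Finite (IsLocalRing.ResidueField R)] [FiniteDimensional E V]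

theorem finiteMod_approxIsometries {ι : Type*} [Fintype ι] (b : Module.Basis ι E W)
    (hb : ∀ w, w ∈ M ↔ ∀ j, b.repr w j ∈ pw E u 0) (hc : IsRamifiedInvolution c u)
    [Submodule.IsLattice E L] (N : ℕ) :
    FiniteMod (homGroup E u L M (2 * N : ℕ)) (approxIsometries u h h' L M N) := by
  obtain ⟨e, a, he, -⟩ := hc.exists_adapted_basis (le_refl L) rfl
  let Φ : (V →ₗ[E] W) →+ (Fin (Module.finrank E V) → W) :=
    { toFun := fun f i => f (e i)
      map_zero' := rfl
      map_add' := fun _ _ => rfl }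
  have hei : ∀ i, e i ∈ L := fun i => (he _).2 fun j => by
    rw [e.repr_self, Finsupp.single_apply]
    split_ifs
    exacts [mem_pw_zero.2 ⟨1, map_one _⟩, zero_mem _]
  refine FiniteMod.of_image (B' := tupleGroup E u M fun _ => ((2 * N : ℕ) : ℤ) - (0 : ℕ)) Φ
    (fun f => homGroup_iff_tupleGroup e (a := fun _ => 0) (by simpa using he) hc _ f) ?_
  refine hc.finiteMod_tupleGroup b hb _ ?_
  rintro _ ⟨f, hf, rfl⟩ i
  exact hf.1 _ (hei i)

/-- Adds the contributions of `cosetCount_approx_adapted` over the finitely many integral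
overlattices. Both the sorting, through the exponent `d` of the discriminant module, and each single
contribution only ask for `N` to be large. -/
theorem eventually_cosetCount_approxIsometries {ι : Type*} [Fintype ι] (b : Module.Basis ι E W)
    (hb : ∀ w, w ∈ M ↔ ∀ j, b.repr w j ∈ pw E u 0) (hc : IsRamifiedInvolution c u)
    (hh : ∀ x y, h y x = c (h x y)) (hnd : ∀ x, (∀ y, h x y = 0) → x = 0)
    (hh' : ∀ x y, h' y x = c (h' x y)) (hM : IsSelfDual u h' M) [Submodule.IsLattice E L]
    {n : ℕ} (hn : Module.finrank E V = n) (Y : Finset (Submodule R V))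
    (hY : ∀ L', L' ∈ Y ↔ L' ∈ overModules u h L) (t : Submodule R V → ℕ)
    (ht : ∀ L' ∈ overModules u h L, ∃ a : Fin n → ℕ, t L' = Nat.card {i // a i ≠ 0} ∧
      Nonempty ((pwDual u h L' ⧸ L'.submoduleOf (pwDual u h L')) ≃ₗ[R]
        (∀ i, R ⧸ Ideal.span {u ^ a i}))) :
    ∃ N₀ : ℕ, ∀ N ≥ N₀,
    (cosetCount (homGroup E u L M (2 * N : ℕ)) (approxIsometries u h h' L M N) : ℝ) =
      ((Nat.card (IsLocalRing.ResidueField R) : ℝ) ^ (N * (2 * Fintype.card ι * n)) /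
        (Nat.card (IsLocalRing.ResidueField R) : ℝ) ^ (N * n ^ 2)) * ∑ L' ∈ Y,
      ((Nat.card (IsLocalRing.ResidueField R) : ℝ) ^
          (n * (Module.length R (L' ⧸ L.submoduleOf L')).toNat) /
        (Nat.card (IsLocalRing.ResidueField R) : ℝ) ^
          (Fintype.card ι * (Module.length R (L' ⧸ L.submoduleOf L')).toNat)) *
        ∏ j ∈ Finset.range ((n + t L') / 2),
          (1 - (Nat.card (IsLocalRing.ResidueField R) : ℝ) ^ (2 * j) /
          (Nat.card (IsLocalRing.ResidueField R) : ℝ) ^ Fintype.card ι) := by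
  classical
  have hM' : ∀ x ∈ M, ∀ y ∈ M, h' x y ∈ pw E u (-1) := fun x hx => (hM x).1 hx
  by_cases hLD : L ≤ pwDual u h L
  swap
  -- If `L` is not integral, there is no integral overlattice and, as the pairing of `M` lies in
  -- `u⁻¹ R`, no approximate isometry: both sides are 0.
  · have hY0 : Y = ∅ := Finset.eq_empty_of_forall_notMem fun L' hL' => by
      rw [hY] at hL'
      exact hLD (hL'.1.trans (hL'.2.trans (pwDual_anti hL'.1)))
    refine ⟨0, fun N _ => ?_⟩
    have hS : approxIsometries u h h' L M N = ∅ := by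
      refine Set.eq_empty_of_forall_notMem fun f hf => hLD fun x hx y hy => ?_
      have h1 := sub_mem (hM' _ (hf.1 x hx) _ (hf.1 y hy))
        (hc.anti (k := -1) (by omega) (hf.2 x hx y hy))
      rwa [sub_sub_cancel] at h1
    rw [hY0, Finset.sum_empty, mul_zero, hS]
    simp [cosetCount]
  obtain ⟨d, hd⟩ := hc.exists_zpow_smul_pwDual_le hnd hLD
  have hpL : ∀ v, ∃ j : ℕ, algebraMap R E u ^ (j : ℤ) • v ∈ pwDual u h L := fun v => by
    obtain ⟨e, a, he, -⟩ := hc.exists_adapted_basis (le_refl L) rfl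
    obtain ⟨j, hj⟩ := hc.exists_npow_smul_mem e (L := L) (a := fun _ => 0) (by simpa using he) v
    exact ⟨j, hLD hj⟩
  have hloc : ∀ L' ∈ overModules u h L, ∃ N₀ : ℕ, ∀ N ≥ N₀,
      (cosetCount (homGroup E u L M (2 * N : ℕ))
      {f ∈ approxIsometries u h h' L M N | M.comap (f.restrictScalars R) = L'} : ℝ) =
      (Nat.card (IsLocalRing.ResidueField R) : ℝ) ^
          (n * (Module.length R (L' ⧸ L.submoduleOf L')).toNat) /
        (Nat.card (IsLocalRing.ResidueField R) : ℝ) ^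
          (Fintype.card ι * (Module.length R (L' ⧸ L.submoduleOf L')).toNat) *
      ((Nat.card (IsLocalRing.ResidueField R) : ℝ) ^ (N * (2 * Fintype.card ι * n)) /
        (Nat.card (IsLocalRing.ResidueField R) : ℝ) ^ (N * n ^ 2)) *
        ∏ j ∈ Finset.range ((n + t L') / 2),
          (1 - (Nat.card (IsLocalRing.ResidueField R) : ℝ) ^ (2 * j) /
          (Nat.card (IsLocalRing.ResidueField R) : ℝ) ^ Fintype.card ι) := by
    intro L' hL'
    have hlat := hc.isLattice_of_mem_overModules hnd hL'
    obtain ⟨e, a, he', he⟩ := hc.exists_adapted_basis hL'.1 hn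
    obtain ⟨f⟩ := nonempty_quotient_equiv e a he' he
    obtain ⟨a', ha', ⟨g⟩⟩ := ht L' hL'
    have hlen := length_quotient_adapted hc.irreducible a f
    have hker : Nat.card (leftKer fun i j => fracResidue R (algebraMap R E u * h (e i) (e j))) =
      Nat.card (IsLocalRing.ResidueField R) ^ t L' := by
      rw [hc.card_leftKer_eq hL'.2 e he', card_ker_lsmul hc.irreducible a' g, ha']
    refine ⟨1 + ∑ i, a i, fun N hN => ?_⟩
    rw [hlen, ENat.toNat_natCast]
    refine cosetCount_approx_adapted e b hb he he' hc hh hh' hM hL'.2 (t L') hker (fun i => ?_)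
      (by omega)
    have h1 : a i ≤ ∑ i, a i :=
      Finset.single_le_sum (f := fun i => a i) (fun _ _ => Nat.zero_le _) (Finset.mem_univ i)
    omega
  choose! N₀ hN₀ using hloc
  refine ⟨d + 1 + ∑ L' ∈ Y, N₀ L', fun N hN => ?_⟩
  rw [cosetCount_eq_sum (finiteMod_approxIsometries b hb hc N)
    (fun f : V →ₗ[E] W => M.comap (f.restrictScalars R)) (fun f hf g hg hfg => le_antisymm
      (hc.comap_le_comap hM' hd (by omega) hpL hf hfg)
      (hc.comap_le_comap hM' hd (by omega) hpL hg (by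
        rw [← neg_sub]
        exact neg_mem hfg)))
    Y (fun f hf => (hY _).2 (hc.comap_mem_overModules hM' hd (by omega) hpL hf)),
    Nat.cast_sum, Finset.mul_sum]
  refine Finset.sum_congr rfl fun L' hL' => ?_
  have h1 : N₀ L' ≤ ∑ L' ∈ Y, N₀ L' :=
    Finset.single_le_sum (f := fun i => N₀ i) (fun _ _ => Nat.zero_le _) hL'
  rw [hN₀ L' ((hY _).1 hL') N (by omega)]
  ring

end IsRamifiedInvolution

end Total

/-! ### The ring of integers of a ramified quadratic extension. -/

section RamifiedExtension

variable {OF F : Type*} [CommRing OF] [IsDomain OF] [IsDiscreteValuationRing OF]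
  [Field F] [CharZero F] [Algebra OF F] [IsFractionRing OF F]
  {E : Type*} [Field E] [Algebra F E] [Algebra OF E] [IsScalarTower OF F E]

/-- `E / F` is a ramified quadratic extension with involution `c`, the residue characteristic is odd
and `u` is a uniformizer with `c u = - u`. -/
structure IsRamifiedQuadratic (c : E ≃ₐ[F] E) (u : integralClosure OF E) : Prop where
  two : IsUnit (2 : OF)
  finrank : Module.finrank F E = 2
  ne_refl : c ≠ AlgEquiv.refl
  irreducible : Irreducible u
  map_uniformizer : c (u : E) = -(u : E)
  ramified : (IsLocalRing.maximalIdeal OF).map (algebraMap OF (integralClosure OF E)) =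
    Ideal.span {u} ^ 2

theorem isUnit_two_of_odd_card [Finite (IsLocalRing.ResidueField OF)]
    (hodd : Odd (Nat.card (IsLocalRing.ResidueField OF))) : IsUnit (2 : OF) := by
  by_contra h2
  have h3 : IsLocalRing.residue OF 2 = 0 :=
    (IsLocalRing.residue_eq_zero_iff _).2 ((IsLocalRing.mem_maximalIdeal _).2 h2)
  rw [map_ofNat] at h3
  have : Fintype (IsLocalRing.ResidueField OF) := Fintype.ofFinite _
  have h4 : ((Nat.card (IsLocalRing.ResidueField OF) : ℕ) : IsLocalRing.ResidueField OF) = 0 := by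
    rw [Nat.card_eq_fintype_card]
    exact Nat.cast_card_eq_zero _
  obtain ⟨k, hk⟩ := hodd
  rw [hk, Nat.cast_add, Nat.cast_mul, Nat.cast_ofNat, h3, zero_mul, zero_add, Nat.cast_one] at h4
  exact one_ne_zero h4

namespace IsRamifiedQuadratic

variable {c : E ≃ₐ[F] E} {u : integralClosure OF E}

theorem isGalois (hE : IsRamifiedQuadratic c u) : FiniteDimensional F E ∧ IsGalois F E := by
  have : Algebra.IsQuadraticExtension F E := ⟨hE.finrank⟩
  exact ⟨inferInstance, inferInstance⟩

theorem uniformizer_ne_zero (hE : IsRamifiedQuadratic c u) : (u : E) ≠ 0 := fun h =>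
  hE.irreducible.ne_zero (Subtype.ext h)

theorem eq_refl_or_eq (hE : IsRamifiedQuadratic c u) (σ : E ≃ₐ[F] E) :
    σ = AlgEquiv.refl ∨ σ = c := by
  obtain ⟨_, _⟩ := hE.isGalois
  have h1 : Nat.card (E ≃ₐ[F] E) = 2 := (IsGalois.card_aut_eq_finrank F E).trans hE.finrank
  by_contra! h2
  have h3 : ({AlgEquiv.refl, c, σ} : Set (E ≃ₐ[F] E)).ncard = 3 := by
    rw [Set.ncard_eq_three]
    exact ⟨_, _, _, hE.ne_refl.symm, h2.1.symm, h2.2.symm, rfl⟩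
  have h4 := Set.ncard_le_card ({AlgEquiv.refl, c, σ} : Set (E ≃ₐ[F] E))
  omega

theorem mem_range_of_fixed (hE : IsRamifiedQuadratic c u) {x : E} (hx : c x = x) :
    ∃ a : F, algebraMap F E a = x := by
  obtain ⟨_, _⟩ := hE.isGalois
  refine (IsGalois.mem_range_algebraMap_iff_fixed x).2 fun σ => ?_
  obtain rfl | rfl := hE.eq_refl_or_eq σ
  exacts [rfl, hx]

theorem involutive (hE : IsRamifiedQuadratic c u) (x : E) : c (c x) = x := by
  obtain h1 | h1 := hE.eq_refl_or_eq (c.trans c)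
  · exact DFunLike.congr_fun h1 x
  · exfalso
    refine hE.ne_refl (AlgEquiv.ext fun y => ?_)
    exact c.injective (DFunLike.congr_fun h1 y)

theorem algebraMap_trace (hE : IsRamifiedQuadratic c u) (x : E) :
    algebraMap F E (Algebra.trace F E x) = x + c x := by
  classical
  obtain ⟨_, _⟩ := hE.isGalois
  rw [trace_eq_sum_automorphisms]
  have h1 : (Finset.univ : Finset (E ≃ₐ[F] E)) = {AlgEquiv.refl, c} := by
    ext σ
    simpa using hE.eq_refl_or_eq σ
  change ∑ σ : E ≃ₐ[F] E, σ x = _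
  rw [h1, Finset.sum_pair hE.ne_refl.symm]
  rfl

theorem charZero (_ : IsRamifiedQuadratic c u) : CharZero E :=
  charZero_of_injective_algebraMap (algebraMap F E).injective

theorem c_algebraMap (c : E ≃ₐ[F] E) (a : OF) : c (algebraMap OF E a) = algebraMap OF E a := by
  rw [IsScalarTower.algebraMap_apply OF F E, AlgEquiv.commutes]

theorem algebraMap_injective {c : E ≃ₐ[F] E} {u : integralClosure OF E}
    (_ : IsRamifiedQuadratic c u) : Function.Injective (algebraMap OF E) := by
  rw [IsScalarTower.algebraMap_eq OF F E]
  exact (algebraMap F E).injective.comp (IsFractionRing.injective OF F)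

/-- Integral elements fixed by the involution. -/
theorem exists_of_isIntegral_of_fixed (hE : IsRamifiedQuadratic c u) {x : E} (hx : c x = x)
    (hi : IsIntegral OF x) : ∃ a : OF, algebraMap OF E a = x := by
  obtain ⟨b, rfl⟩ := hE.mem_range_of_fixed hx
  rw [isIntegral_algebraMap_iff (algebraMap F E).injective] at hi
  obtain ⟨a, rfl⟩ := (IsIntegrallyClosed.isIntegral_iff (K := F)).1 hi
  exact ⟨a, IsScalarTower.algebraMap_apply OF F E a⟩

/-- The element `u ^ 2` is fixed by `c`, hence comes from `OF`. The unit relating it to a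
uniformizer of `OF`, and the inverse of this unit, are fixed as well and therefore also come from
`OF`. -/
theorem exists_uniformizer (hE : IsRamifiedQuadratic c u) :
    ∃ ϖ : OF, algebraMap OF E ϖ = (u : E) ^ 2 ∧ Irreducible ϖ := by
  obtain ⟨ϖ, hϖ⟩ := hE.exists_of_isIntegral_of_fixed (x := (u : E) ^ 2)
    (by rw [map_pow, hE.map_uniformizer, neg_sq]) (u.2.pow 2)
  refine ⟨ϖ, hϖ, ?_⟩
  obtain ⟨π, hπ⟩ := IsDiscreteValuationRing.exists_irreducible OF
  have h1 := hE.ramified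
  rw [(IsDiscreteValuationRing.irreducible_iff_uniformizer π).1 hπ, Ideal.map_span,
    Set.image_singleton, Ideal.span_singleton_pow, Ideal.span_singleton_eq_span_singleton] at h1
  obtain ⟨η, hη⟩ := h1
  have h2 : algebraMap OF E π * (η : integralClosure OF E) = (u : E) ^ 2 :=
    congrArg (fun z : integralClosure OF E => (z : E)) hη
  have hπ0 : algebraMap OF E π ≠ 0 := by
    rw [Ne, map_eq_zero_iff _ hE.algebraMap_injective]
    exact hπ.ne_zero
  have hfix : c ((η : integralClosure OF E) : E) = (η : integralClosure OF E) := by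
    have h3 := congrArg c h2
    rw [map_mul, c_algebraMap, map_pow, hE.map_uniformizer, neg_sq, ← h2] at h3
    exact mul_left_cancel₀ hπ0 h3
  have hηη : ((η : integralClosure OF E) : E) * ((η⁻¹ : (integralClosure OF E)ˣ) :
      integralClosure OF E) = 1 :=
    congrArg (fun z : integralClosure OF E => (z : E)) η.mul_inv
  have hfix' : c (((η⁻¹ : (integralClosure OF E)ˣ) : integralClosure OF E) : E) =
      ((η⁻¹ : (integralClosure OF E)ˣ) : integralClosure OF E) := by
    have h3 := congrArg c hηη
    rw [map_mul, hfix, map_one, ← hηη] at h3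
    exact mul_left_cancel₀ (left_ne_zero_of_mul_eq_one hηη) h3
  obtain ⟨a, ha⟩ := hE.exists_of_isIntegral_of_fixed hfix (η : integralClosure OF E).2
  obtain ⟨b, hb⟩ := hE.exists_of_isIntegral_of_fixed hfix' ((η⁻¹ : (integralClosure OF E)ˣ) :
      integralClosure OF E).2
  have hab : a * b = 1 := hE.algebraMap_injective (by
    rw [map_mul, ha, hb, hηη, map_one])
  have hpi : ϖ = π * a := hE.algebraMap_injective (by
    rw [map_mul, ha, h2, hϖ])
  have hass : Associated π ϖ := ⟨⟨a, b, hab, by rw [mul_comm, hab]⟩, hpi.symm⟩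
  exact hass.irreducible hπ

theorem exists_decomposition (hE : IsRamifiedQuadratic c u) (x : E) :
    ∃ a b : F, x = algebraMap F E a + algebraMap F E b * u := by
  have := hE.charZero
  have hu := hE.uniformizer_ne_zero
  obtain ⟨a, ha⟩ := hE.mem_range_of_fixed (x := (x + c x) / 2) (by
    rw [map_div₀, map_add, hE.involutive, map_ofNat, add_comm])
  obtain ⟨b, hb⟩ := hE.mem_range_of_fixed (x := (x - c x) / (2 * u)) (by
    rw [map_div₀, map_sub, hE.involutive, map_mul, hE.map_uniformizer, map_ofNat]
    field_simp
    ring)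
  refine ⟨a, b, ?_⟩
  rw [ha, hb]
  field_simp
  ring

theorem decomposition_unique (hE : IsRamifiedQuadratic c u) {a b : F}
    (hab : algebraMap F E a + algebraMap F E b * u = 0) : a = 0 ∧ b = 0 := by
  have := hE.charZero
  have hu := hE.uniformizer_ne_zero
  have h1 := congrArg c hab
  rw [map_add, map_mul, AlgEquiv.commutes, AlgEquiv.commutes, hE.map_uniformizer, map_zero] at h1
  have h2 : algebraMap F E a = 0 := by
    have : (2 : E) * algebraMap F E a = 0 := by linear_combination hab + h1
    exact (mul_eq_zero.1 this).resolve_left two_ne_zero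
  have h3 : algebraMap F E b * u = 0 := by rw [h2, zero_add] at hab; exact hab
  exact ⟨(map_eq_zero _).1 h2, (map_eq_zero _).1 ((mul_eq_zero.1 h3).resolve_right hu)⟩

/-- `O_E = O_F ⊕ O_F u`. -/
theorem isIntegral_iff (hE : IsRamifiedQuadratic c u) (x : E) :
    IsIntegral OF x ↔ ∃ a b : OF, x = algebraMap OF E a + algebraMap OF E b * u := by
  have := hE.charZero
  have hu := hE.uniformizer_ne_zero
  constructor
  · intro hx
    obtain ⟨ϖ, hϖ, hϖi⟩ := hE.exists_uniformizer
    obtain ⟨a, b, hab⟩ := hE.exists_decomposition x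
    have hcx : IsIntegral OF (c x) := IsIntegral.map (c.toAlgHom.restrictScalars OF) hx
    have hc : c x = algebraMap F E a - algebraMap F E b * u := by
      rw [hab, map_add, map_mul, AlgEquiv.commutes, AlgEquiv.commutes, hE.map_uniformizer]
      ring
    obtain ⟨a', ha'⟩ := hE.exists_of_isIntegral_of_fixed (x := x + c x)
      (by rw [map_add, hE.involutive, add_comm]) (hx.add hcx)
    obtain ⟨t, ht⟩ := hE.two
    have ht2 : algebraMap OF E ((t⁻¹ : OFˣ) : OF) * 2 = 1 := by
      have := congrArg (algebraMap OF E) t.inv_mul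
      rwa [map_mul, ht, map_ofNat, map_one] at this
    have hta : algebraMap OF E ((t⁻¹ : OFˣ) * a') = algebraMap F E a := by
      rw [map_mul, ha', hc, hab]
      linear_combination (algebraMap F E a) * ht2
    have hy : IsIntegral OF (algebraMap F E (b ^ 2 * algebraMap OF F ϖ)) := by
      have h1 : IsIntegral OF (x - algebraMap OF E ((t⁻¹ : OFˣ) * a')) :=
        hx.sub isIntegral_algebraMap
      have h2 : algebraMap F E (b ^ 2 * algebraMap OF F ϖ) =
          (x - algebraMap OF E ((t⁻¹ : OFˣ) * a')) ^ 2 := by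
        rw [map_mul, ← IsScalarTower.algebraMap_apply OF F E, hta, hϖ, hab, map_pow]
        ring
      rw [h2]
      exact h1.pow 2
    rw [isIntegral_algebraMap_iff (algebraMap F E).injective] at hy
    obtain ⟨w, hw⟩ := (IsIntegrallyClosed.isIntegral_iff (K := F)).1 hy
    -- Uses that `w = b² ϖ` is integral. If `z = b⁻¹` is integral, then `w z² = ϖ` is irreducible,
    -- and `z` has to be a unit.
    have hbint : ∃ b' : OF, algebraMap OF F b' = b := by
      obtain h1 | h1 := ValuationRing.isInteger_or_isInteger OF b
      · exact h1
      · obtain ⟨z, hz⟩ := h1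
        by_cases hb0 : b = 0
        · exact ⟨0, by rw [hb0, map_zero]⟩
        have hzb : algebraMap OF F z * b = 1 := by
          rw [hz, inv_mul_cancel₀ hb0]
        have h3 : w * z ^ 2 = ϖ := IsFractionRing.injective OF F (by
          rw [map_mul, map_pow, hw]
          linear_combination (algebraMap OF F ϖ) * (algebraMap OF F z * b + 1) * hzb)
        by_cases hzu : IsUnit z
        · obtain ⟨z', rfl⟩ := hzu
          refine ⟨(z'⁻¹ : OFˣ), ?_⟩
          have h4 : algebraMap OF F z' * algebraMap OF F (z'⁻¹ : OFˣ) = 1 := by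
            rw [← map_mul, Units.mul_inv, map_one]
          exact mul_left_cancel₀ (left_ne_zero_of_mul_eq_one hzb) (h4.trans hzb.symm)
        · exfalso
          rw [sq, ← mul_assoc] at h3
          obtain h5 | h5 := hϖi.isUnit_or_isUnit h3.symm
          · exact hzu (isUnit_of_mul_isUnit_right h5)
          · exact hzu h5
    obtain ⟨b', rfl⟩ := hbint
    exact ⟨_, b', by rw [hta, hab, ← IsScalarTower.algebraMap_apply OF F E]⟩
  · rintro ⟨a, b, rfl⟩
    exact isIntegral_algebraMap.add (isIntegral_algebraMap.mul u.2)

theorem exists_repr (hE : IsRamifiedQuadratic c u) (x : integralClosure OF E) :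
    ∃ a b : OF, x = algebraMap OF _ a + algebraMap OF _ b * u := by
  obtain ⟨a, b, hab⟩ := (hE.isIntegral_iff (x : E)).1 x.2
  exact ⟨a, b, Subtype.ext hab⟩

theorem repr_unique (hE : IsRamifiedQuadratic c u) {a b a' b' : OF}
    (hab : (algebraMap OF E a + algebraMap OF E b * u : E) =
      algebraMap OF E a' + algebraMap OF E b' * u) : a = a' ∧ b = b' := by
  have h1 := hE.decomposition_unique (a := algebraMap OF F (a - a')) (b := algebraMap OF F (b - b'))
    (by
      rw [← IsScalarTower.algebraMap_apply OF F E, ← IsScalarTower.algebraMap_apply OF F E,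
        map_sub, map_sub]
      linear_combination hab)
  constructor
  · exact sub_eq_zero.1 (IsFractionRing.injective OF F (h1.1.trans (map_zero _).symm))
  · exact sub_eq_zero.1 (IsFractionRing.injective OF F (h1.2.trans (map_zero _).symm))

/-- The norm of this element is `ε ^ 2 - b ^ 2 ϖ`, a unit of `OF`. -/
theorem isUnit_add (hE : IsRamifiedQuadratic c u) (ε : OFˣ) (b : OF) :
    IsUnit (algebraMap OF (integralClosure OF E) ε + algebraMap OF _ b * u) := by
  obtain ⟨ϖ, hϖ, hϖi⟩ := hE.exists_uniformizer
  have h1 : IsUnit ((ε : OF) ^ 2 - b ^ 2 * ϖ) := by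
    by_contra hnu
    have h2 := (IsLocalRing.mem_maximalIdeal _).2 hnu
    have h3 : b ^ 2 * ϖ ∈ IsLocalRing.maximalIdeal OF :=
      Ideal.mul_mem_left _ _ ((IsLocalRing.mem_maximalIdeal _).2 hϖi.not_isUnit)
    have h4 := add_mem h2 h3
    rw [sub_add_cancel] at h4
    exact (IsLocalRing.mem_maximalIdeal _).1 h4 (ε.isUnit.pow 2)
  have h2 : algebraMap OF (integralClosure OF E) ((ε : OF) ^ 2 - b ^ 2 * ϖ) =
      (algebraMap OF (integralClosure OF E) ε + algebraMap OF _ b * u) *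
      (algebraMap OF (integralClosure OF E) ε - algebraMap OF _ b * u) := by
    have h3 : algebraMap OF (integralClosure OF E) ϖ = u ^ 2 := Subtype.ext hϖ
    rw [map_sub, map_mul, h3, map_pow, map_pow]
    ring
  exact isUnit_of_mul_isUnit_left (h2 ▸ h1.map _)

/-- In `a + b u` the first term has even and the second odd valuation, so one of them dominates.
Factoring it out leaves an element covered by `isUnit_add`. -/
theorem isDiscreteValuationRing (hE : IsRamifiedQuadratic c u) :
    IsDiscreteValuationRing (integralClosure OF E) := by
  refine IsDiscreteValuationRing.ofHasUnitMulPowIrreducibleFactorization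
    ⟨u, hE.irreducible, fun {x} hx => ?_⟩
  obtain ⟨ϖ, hϖ, hϖi⟩ := hE.exists_uniformizer
  have hϖu : algebraMap OF (integralClosure OF E) ϖ = u ^ 2 := Subtype.ext hϖ
  obtain ⟨a, b, rfl⟩ := hE.exists_repr x
  have hodd : ∀ (i : ℕ) (a' : OF) (ε : OFˣ), ∃ n, Associated (u ^ n)
      (algebraMap OF (integralClosure OF E) (ϖ ^ (i + 1) * a') +
        algebraMap OF _ (ε * ϖ ^ i) * u) := by
    intro i a' ε
    obtain ⟨w, hw⟩ := hE.isUnit_add ε a'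
    refine ⟨2 * i + 1, w, ?_⟩
    rw [hw, map_mul, map_mul, map_pow, map_pow, hϖu]
    ring
  have heven : ∀ (i : ℕ) (b' : OF) (ε : OFˣ), ∃ n, Associated (u ^ n)
      (algebraMap OF (integralClosure OF E) (ε * ϖ ^ i) +
        algebraMap OF _ (ϖ ^ i * b') * u) := by
    intro i b' ε
    obtain ⟨w, hw⟩ := hE.isUnit_add ε b'
    refine ⟨2 * i, w, ?_⟩
    rw [hw, map_mul, map_mul, map_pow, hϖu]
    ring
  by_cases ha : a = 0
  · have hb : b ≠ 0 := by
      rintro rfl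
      apply hx
      rw [ha, map_zero, zero_mul, add_zero]
    obtain ⟨j, ε, rfl⟩ := IsDiscreteValuationRing.eq_unit_mul_pow_irreducible hb hϖi
    have := hodd j 0 ε
    rwa [mul_zero, ← ha] at this
  obtain ⟨i, δ, hi⟩ := IsDiscreteValuationRing.eq_unit_mul_pow_irreducible ha hϖi
  by_cases hb : b = 0
  · have := heven i 0 δ
    rwa [mul_zero, ← hb, ← hi] at this
  obtain ⟨j, ε, hj⟩ := IsDiscreteValuationRing.eq_unit_mul_pow_irreducible hb hϖi
  by_cases hij : i ≤ j
  · obtain ⟨k, rfl⟩ := Nat.exists_eq_add_of_le hij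
    have := heven i (ε * ϖ ^ k) δ
    rwa [← hi, show ϖ ^ i * (ε * ϖ ^ k) = b by rw [hj]; ring] at this
  · obtain ⟨k, rfl⟩ := Nat.exists_eq_add_of_le (show j + 1 ≤ i by omega)
    have := hodd j (δ * ϖ ^ k) ε
    rwa [← hj, show ϖ ^ (j + 1) * (δ * ϖ ^ k) = a by rw [hi]; ring] at this

theorem isFractionRing (hE : IsRamifiedQuadratic c u) :
    IsFractionRing (integralClosure OF E) E := by
  obtain ⟨_, _⟩ := hE.isGalois
  exact integralClosure.isFractionRing_of_finite_extension F E

theorem isRamifiedInvolution (hE : IsRamifiedQuadratic c u) :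
    IsRamifiedInvolution (c : E →+* E) u where
  irreducible := hE.irreducible
  involutive := hE.involutive
  map_uniformizer := hE.map_uniformizer
  residue := fun x => by
    obtain ⟨a, b, rfl⟩ := hE.exists_repr x
    refine ⟨algebraMap OF _ (-2 * b), ?_⟩
    change c (algebraMap OF E a + algebraMap OF E b * u) =
      (algebraMap OF E a + algebraMap OF E b * u) + u * algebraMap OF E (-2 * b)
    rw [map_add, map_mul, c_algebraMap, c_algebraMap, hE.map_uniformizer, map_mul, map_neg,
      map_ofNat]
    ring
  two := by
    have := hE.two.map (algebraMap OF (integralClosure OF E))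
    rwa [map_ofNat] at this

end IsRamifiedQuadratic

end RamifiedExtension

/-! ### The hyperbolic hermitian space and its standard lattice. -/

section HyperbolicSpace

variable {R E : Type*} [CommRing R] [Field E] [Algebra R E]

/-- The hermitian form on `E ^ (2 s)` extending the pairing of `H_s`. -/
def hypForm (c : E →+* E) (u : R) (s : ℕ) :
    (Fin s ⊕ Fin s → E) →ₗ[E] (Fin s ⊕ Fin s → E) →ₛₗ[c] E :=
  LinearMap.mk₂'ₛₗ (RingHom.id E) c
    (fun x y => ∑ i, ((algebraMap R E u)⁻¹ * (x (.inl i) * c (y (.inr i))) -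
      (algebraMap R E u)⁻¹ * (x (.inr i) * c (y (.inl i)))))
    (fun x x' y => by
      rw [← Finset.sum_add_distrib]
      exact Finset.sum_congr rfl fun i _ => by simp only [Pi.add_apply]; ring)
    (fun a x y => by
      rw [RingHom.id_apply, smul_eq_mul, Finset.mul_sum]
      exact Finset.sum_congr rfl fun i _ => by simp only [Pi.smul_apply, smul_eq_mul]; ring)
    (fun x y y' => by
      rw [← Finset.sum_add_distrib]
      exact Finset.sum_congr rfl fun i _ => by simp only [Pi.add_apply, map_add]; ring)
    (fun a x y => by
      rw [smul_eq_mul, Finset.mul_sum]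
      exact Finset.sum_congr rfl fun i _ => by
        simp only [Pi.smul_apply, smul_eq_mul, map_mul]; ring)

theorem hypForm_apply (c : E →+* E) (u : R) (s : ℕ) (x y : Fin s ⊕ Fin s → E) :
    hypForm c u s x y = ∑ i, ((algebraMap R E u)⁻¹ * (x (.inl i) * c (y (.inr i))) -
      (algebraMap R E u)⁻¹ * (x (.inr i) * c (y (.inl i)))) := rfl

/-- The vectors with integral coordinates. -/
def stdLattice (R E : Type*) [CommRing R] [Field E] [Algebra R E] (ι : Type*) :
    Submodule R (ι → E) where
  carrier := {x | ∀ j, ∃ a, algebraMap R E a = x j}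
  zero_mem' := fun _ => ⟨0, map_zero _⟩
  add_mem' := fun hx hy j => by
    obtain ⟨a, ha⟩ := hx j
    obtain ⟨b, hb⟩ := hy j
    exact ⟨a + b, by rw [map_add, ha, hb, Pi.add_apply]⟩
  smul_mem' := fun r x hx j => by
    obtain ⟨a, ha⟩ := hx j
    exact ⟨r * a, by rw [map_mul, ha, Pi.smul_apply, Algebra.smul_def]⟩

variable {c : E →+* E} {u : R}

theorem mem_stdLattice {ι : Type*} {x : ι → E} :
    x ∈ stdLattice R E ι ↔ ∀ j, ∃ a, algebraMap R E a = x j := Iff.rfl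

variable [IsDomain R] [IsDiscreteValuationRing R] [IsFractionRing R E]

theorem mem_stdLattice_iff_repr {ι : Type*} [Fintype ι] (w : ι → E) :
    w ∈ stdLattice R E ι ↔ ∀ j, (Pi.basisFun E ι).repr w j ∈ pw E u 0 := by
  rw [mem_stdLattice]
  exact forall_congr' fun j => by rw [mem_pw_zero, Pi.basisFun_repr]

theorem IsRamifiedInvolution.hypForm_conj (hc : IsRamifiedInvolution c u) (s : ℕ)
    (x y : Fin s ⊕ Fin s → E) : hypForm c u s y x = c (hypForm c u s x y) := by
  rw [hypForm_apply, hypForm_apply, map_sum]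
  refine Finset.sum_congr rfl fun i _ => ?_
  rw [map_sub, map_mul, map_mul, map_mul, map_mul, map_inv₀, hc.map_uniformizer, hc.involutive,
    hc.involutive, inv_neg]
  ring

/-- Pairing with the standard vectors returns the coordinates up to a factor `u⁻¹` and a sign. -/
theorem IsRamifiedInvolution.isSelfDual_stdLattice (hc : IsRamifiedInvolution c u) (s : ℕ) :
    IsSelfDual u (hypForm c u s) (stdLattice R E (Fin s ⊕ Fin s)) := by
  classical
  intro y
  have hu := hc.ne_zero
  constructor
  · intro hy x hx
    rw [hypForm_apply]
    refine sum_mem fun i _ => ?_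
    have h1 : ∀ a ∈ pw E u 0, (algebraMap R E u)⁻¹ * a ∈ pw E u (-1) := fun a ha => by
      rw [← zpow_neg_one]
      exact hc.zpow_mul_mem' _ ha (by norm_num)
    have h2 : ∀ j k, y j * c (x k) ∈ pw E u 0 := fun j k => by
      simpa using hc.mul_mem (k := 0) (l := 0) (mem_pw_zero.2 (hy j)) (hc.c_mem (mem_pw_zero.2 (hx k)))
    exact sub_mem (h1 _ (h2 _ _)) (h1 _ (h2 _ _))
  · intro hy j
    have hsingle : ∀ k, Pi.single k (1 : E) ∈ stdLattice R E (Fin s ⊕ Fin s) := fun k l => by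
      by_cases hkl : l = k
      · exact ⟨1, by rw [hkl, Pi.single_eq_same, map_one]⟩
      · exact ⟨0, by rw [Pi.single_eq_of_ne hkl, map_zero]⟩
    have h1 : ∀ a, (algebraMap R E u)⁻¹ * a ∈ pw E u (-1) → a ∈ pw E u 0 := fun a ha => by
      rw [← zpow_neg_one] at ha
      exact (hc.zpow_mul_mem_iff (k := 0) (by norm_num)).1 ha
    rw [← mem_pw_zero (u := u)]
    cases j with
    | inl i =>
      have h2 := hy _ (hsingle (.inr i))
      rw [hypForm_apply, Finset.sum_eq_single i] at h2
      · refine h1 _ ?_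
        simpa using h2
      · intro k _ hk
        simp [hk]
      · simp
    | inr i =>
      have h2 := hy _ (hsingle (.inl i))
      rw [hypForm_apply, Finset.sum_eq_single i] at h2
      · refine h1 _ ?_
        rw [← neg_mem_iff]
        simpa using h2
      · intro k _ hk
        simp [hk]
      · simp

end HyperbolicSpace

/-! ### Residue fields, square roots and the trace dual. -/

section RamifiedExtension

variable {OF F : Type*} [CommRing OF] [IsDomain OF] [IsDiscreteValuationRing OF]
  [Field F] [CharZero F] [Algebra OF F] [IsFractionRing OF F]
  {E : Type*} [Field E] [Algebra F E] [Algebra OF E] [IsScalarTower OF F E]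

namespace IsRamifiedQuadratic

variable {c : E ≃ₐ[F] E} {u : integralClosure OF E}

theorem card_residueField [IsDiscreteValuationRing (integralClosure OF E)]
    (hE : IsRamifiedQuadratic c u) :
    Nat.card (IsLocalRing.ResidueField (integralClosure OF E)) =
      Nat.card (IsLocalRing.ResidueField OF) := by
  obtain ⟨ϖ, hϖ, hϖi⟩ := hE.exists_uniformizer
  have hϖu : algebraMap OF (integralClosure OF E) ϖ = u ^ 2 := Subtype.ext hϖ
  let f : OF →+* IsLocalRing.ResidueField (integralClosure OF E) :=
    (IsLocalRing.residue _).comp (algebraMap OF _)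
  have hu0 : IsLocalRing.residue (integralClosure OF E) u = 0 :=
    (IsLocalRing.residue_eq_zero_iff _).2 ((IsLocalRing.mem_maximalIdeal _).2
      hE.irreducible.not_isUnit)
  have hsurj : Function.Surjective f := by
    intro z
    obtain ⟨x, rfl⟩ := IsLocalRing.residue_surjective z
    obtain ⟨a, b, rfl⟩ := hE.exists_repr x
    refine ⟨a, ?_⟩
    rw [map_add, map_mul, hu0, mul_zero, add_zero]
    rfl
  have hker : RingHom.ker f = IsLocalRing.maximalIdeal OF := by
    ext a
    rw [RingHom.mem_ker]
    constructor
    · intro ha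
      by_contra hau
      have h1 : IsUnit a := by
        by_contra h
        exact hau ((IsLocalRing.mem_maximalIdeal _).2 h)
      have h2 := h1.map f
      rw [ha] at h2
      exact not_isUnit_zero h2
    · intro ha
      rw [(IsDiscreteValuationRing.irreducible_iff_uniformizer ϖ).1 hϖi,
        Ideal.mem_span_singleton] at ha
      obtain ⟨b, rfl⟩ := ha
      change IsLocalRing.residue _ (algebraMap OF _ (ϖ * b)) = 0
      rw [map_mul, hϖu, map_mul, map_pow, hu0]
      ring
  exact (Nat.card_congr ((Ideal.quotEquivOfEq hker.symm).trans
    (RingHom.quotientKerEquivOfSurjective hsurj)).toEquiv).symm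

/-- A square root of `1 + D` for small fixed `D`. -/
theorem exists_sqrt [IsAdicComplete (IsLocalRing.maximalIdeal OF) OF]
    (hE : IsRamifiedQuadratic c u) (D : E) (hD : D ∈ pw E u 2) (hcD : c D = D) :
    ∃ w, c w = w ∧ w ^ 2 = 1 + D ∧ w - 1 ∈ pw E u 1 := by
  obtain ⟨ϖ, hϖ, hϖi⟩ := hE.exists_uniformizer
  have hϖu : algebraMap OF (integralClosure OF E) ϖ = u ^ 2 := Subtype.ext hϖ
  have hu := hE.uniformizer_ne_zero
  obtain ⟨a, ha⟩ := hD
  rw [zpow_ofNat] at ha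
  change D = (u : E) ^ 2 * (a : E) at ha
  obtain ⟨a', ha'⟩ := hE.exists_of_isIntegral_of_fixed (x := (a : E)) (by
    have h1 := hcD
    rw [ha, map_mul, map_pow, hE.map_uniformizer, neg_sq] at h1
    exact mul_left_cancel₀ (pow_ne_zero 2 hu) h1) a.2
  -- Hensel's lemma at the approximate root 1, where the derivative 2 is a unit.
  have hen := IsAdicComplete.henselianRing OF (IsLocalRing.maximalIdeal OF)
  have hϖm : ϖ ∈ IsLocalRing.maximalIdeal OF := (IsLocalRing.mem_maximalIdeal _).2 hϖi.not_isUnit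
  obtain ⟨w, hw, hw1⟩ := hen.is_henselian (X ^ 2 - C (1 + ϖ * a'))
    (monic_X_pow_sub_C _ two_ne_zero) 1 (by
      rw [eval_sub, eval_pow, eval_X, eval_C, one_pow, sub_add_cancel_left, neg_mem_iff]
      exact Ideal.mul_mem_right _ _ hϖm) (by
      rw [derivative_sub, derivative_C, sub_zero, derivative_X_pow]
      simpa using hE.two.map _)
  rw [IsRoot.def, eval_sub, eval_pow, eval_X, eval_C, sub_eq_zero] at hw
  refine ⟨algebraMap OF E w, c_algebraMap c w, ?_, ?_⟩
  · rw [← map_pow, hw, map_add, map_mul, map_one, hϖ, ha, ha']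
  · rw [(IsDiscreteValuationRing.irreducible_iff_uniformizer ϖ).1 hϖi,
      Ideal.mem_span_singleton] at hw1
    obtain ⟨b, hb⟩ := hw1
    refine ⟨u * algebraMap OF _ b, ?_⟩
    change _ = (u : E) ^ (1 : ℤ) * ((u : E) * algebraMap OF E b)
    rw [← map_one (algebraMap OF E), ← map_sub, hb, map_mul, hϖ, zpow_one]
    ring

/-- The inverse different is `u⁻¹ R`: the trace of `u⁻¹ (x + y u)` is `2 y`, and conversely `z` is
recovered from the traces of `z` and `u z`. This identifies trace duals with `pwDual`. -/
theorem trace_mem_iff (hE : IsRamifiedQuadratic c u) (z : E) :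
    z ∈ pw E u (-1) ↔ ∀ r : integralClosure OF E,
      Algebra.trace F E (r * z) ∈ (algebraMap OF F).range := by
  have hchar := hE.charZero
  have hu := hE.uniformizer_ne_zero
  obtain ⟨ϖ, hϖ, -⟩ := hE.exists_uniformizer
  have htr : ∀ (x : E) (a : OF), Algebra.trace F E x = algebraMap OF F a ↔
      x + c x = algebraMap OF E a := fun x a => by
    rw [← hE.algebraMap_trace, IsScalarTower.algebraMap_apply OF F E,
      (algebraMap F E).injective.eq_iff]
  constructor
  · rintro ⟨a, rfl⟩ r
    obtain ⟨x, y, hxy⟩ := hE.exists_repr (r * a)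
    have h1 : (r : E) * a = algebraMap OF E x + algebraMap OF E y * u :=
      congrArg (fun z : integralClosure OF E => (z : E)) hxy
    refine ⟨2 * y, ((htr _ _).2 ?_).symm⟩
    have h2 : (r : E) * ((u : E) ^ (-1 : ℤ) * (a : E)) = algebraMap OF E x * (u : E)⁻¹ +
        algebraMap OF E y := by
      rw [zpow_neg_one]
      field_simp
      linear_combination h1
    change (r : E) * ((u : E) ^ (-1 : ℤ) * (a : E)) + c ((r : E) * ((u : E) ^ (-1 : ℤ) * (a : E))) = _
    rw [h2, map_add, map_mul, map_inv₀, c_algebraMap, c_algebraMap, hE.map_uniformizer, inv_neg,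
      map_mul, map_ofNat]
    ring
  · intro hz
    obtain ⟨a, ha⟩ := hz 1
    obtain ⟨b, hb⟩ := hz u
    have ha' := (htr _ _).1 ha.symm
    have hb' := (htr _ _).1 hb.symm
    rw [map_mul c, hE.map_uniformizer] at hb'
    change (1 : E) * z + c ((1 : E) * z) = _ at ha'
    rw [one_mul] at ha'
    obtain ⟨t, ht⟩ := hE.two
    have ht2 : algebraMap OF E ((t⁻¹ : OFˣ) : OF) * 2 = 1 := by
      have := congrArg (algebraMap OF E) t.inv_mul
      rwa [map_mul, ht, map_ofNat, map_one] at this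
    refine ⟨algebraMap OF _ ((t⁻¹ : OFˣ) : OF) * (algebraMap OF _ b + algebraMap OF _ a * u), ?_⟩
    change z = (u : E) ^ (-1 : ℤ) * (algebraMap OF E ((t⁻¹ : OFˣ) : OF) *
      (algebraMap OF E b + algebraMap OF E a * u))
    rw [← ha', ← hb', zpow_neg_one]
    field_simp
    linear_combination (-z) * ht2

variable {V : Type*} [AddCommGroup V] [Module E V]

theorem dual_eq_pwDual (hE : IsRamifiedQuadratic c u) (h : V →ₗ[E] V →ₛₗ[(c : E →+* E)] E)
    (L : Submodule (integralClosure OF E) V) : dual OF h L = pwDual u h L := by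
  ext x
  change (∀ y ∈ L, _) ↔ ∀ y ∈ L, h x y ∈ pw E u (-1)
  refine ⟨fun hx y hy => ?_, fun hx y hy => ?_⟩
  · rw [hE.trace_mem_iff]
    intro r
    have hi : c (r : E) ∈ integralClosure OF E :=
      IsIntegral.map (c.toAlgHom.restrictScalars OF) r.2
    have key : (r : E) * h x y = h x ((⟨c (r : E), hi⟩ : integralClosure OF E) • y) := by
      change _ = h x (c (r : E) • y)
      rw [LinearMap.map_smulₛₗ, smul_eq_mul]
      change _ = c (c (r : E)) * _
      rw [hE.involutive]
    rw [key]
    exact hx _ (L.smul_mem _ hy)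
  · have h1 := hE.trace_mem_iff (h x y) |>.1 (hx y hy) 1
    change Algebra.trace F E ((1 : E) * h x y) ∈ _ at h1
    rwa [one_mul] at h1

end IsRamifiedQuadratic

end RamifiedExtension

/-- Algebra homomorphisms out of a presented algebra. -/
def algHomEquivSolutions {A S ι : Type*} [CommRing A] [CommRing S] [Algebra A S]
    (G : Set (MvPolynomial ι A)) :
    ((MvPolynomial ι A ⧸ Ideal.span G) →ₐ[A] S) ≃
      {y : ι → S // ∀ P ∈ G, MvPolynomial.aeval y P = 0} where
  toFun φ := ⟨fun i => φ (Ideal.Quotient.mkₐ A _ (MvPolynomial.X i)), fun P hP => by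
    have h1 : MvPolynomial.aeval (fun i => φ (Ideal.Quotient.mkₐ A _ (MvPolynomial.X i))) P =
        φ (Ideal.Quotient.mkₐ A (Ideal.span G) P) := by
      rw [← AlgHom.comp_apply φ, MvPolynomial.aeval_unique (φ.comp (Ideal.Quotient.mkₐ A _))]
      rfl
    rw [h1, Ideal.Quotient.mkₐ_eq_mk, Ideal.Quotient.eq_zero_iff_mem.2 (Ideal.subset_span hP),
      map_zero]⟩
  invFun y := Ideal.Quotient.liftₐ _ (MvPolynomial.aeval y.1) (by
    intro P hP
    have h1 : Ideal.span G ≤ RingHom.ker (MvPolynomial.aeval y.1 : MvPolynomial ι A →ₐ[A] S) :=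
      Ideal.span_le.2 fun Q hQ => y.2 Q hQ
    exact h1 hP)
  left_inv φ := by
    refine Ideal.Quotient.algHom_ext _ ?_
    ext i
    exact MvPolynomial.aeval_X _ i
  right_inv y := by
    ext i
    exact MvPolynomial.aeval_X _ i

/-! ### Points of the scheme of hermitian homomorphisms as classes of approximate isometries. -/

section RamifiedExtension

variable {OF F : Type*} [CommRing OF] [IsDomain OF] [IsDiscreteValuationRing OF]
  [Field F] [CharZero F] [Algebra OF F] [IsFractionRing OF F]
  {E : Type*} [Field E] [Algebra F E] [Algebra OF E] [IsScalarTower OF F E]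
  [IsDiscreteValuationRing (integralClosure OF E)] [IsFractionRing (integralClosure OF E) E]
  {c : E ≃ₐ[F] E} {u : integralClosure OF E}
  {V : Type*} [AddCommGroup V] [Module E V]
  {h : V →ₗ[E] V →ₛₗ[(c : E →+* E)] E} {L : Submodule (integralClosure OF E) V} {s : ℕ}

/-- The inclusion of `H_s` into the hyperbolic space. -/
def hypInclusion (OF E : Type*) [CommRing OF] [Field E] [Algebra OF E] (s : ℕ) :
    (Fin s → integralClosure OF E × integralClosure OF E) →ₗ[integralClosure OF E]
      (Fin s ⊕ Fin s → E) where
  toFun x := Sum.elim (fun i => ((x i).1 : E)) fun i => ((x i).2 : E)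
  map_add' x y := by
    ext j
    cases j <;> rfl
  map_smul' r x := by
    ext j
    cases j <;> rfl

theorem hypInclusion_injective : Function.Injective (hypInclusion OF E s) := by
  intro x y hxy
  ext i
  · exact congrFun hxy (.inl i)
  · exact congrFun hxy (.inr i)

theorem mem_stdLattice_iff_hypInclusion {w : Fin s ⊕ Fin s → E} :
    w ∈ stdLattice (integralClosure OF E) E (Fin s ⊕ Fin s) ↔ ∃ x, hypInclusion OF E s x = w := by
  constructor
  · intro hw
    choose a ha using hw
    refine ⟨fun i => (a (.inl i), a (.inr i)), ?_⟩
    ext j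
    cases j <;> exact ha _
  · rintro ⟨x, rfl⟩ j
    cases j
    exacts [⟨(x _).1, rfl⟩, ⟨(x _).2, rfl⟩]

theorem hypPairing_eq (x y : Fin s → integralClosure OF E × integralClosure OF E) :
    hypPairing c u s x y = hypForm (c : E →+* E) u s (hypInclusion OF E s x)
      (hypInclusion OF E s y) := rfl

section Extension

variable [FiniteDimensional E V] [Submodule.IsLattice E L]

theorem ext_on_lattice {W : Type*} [AddCommGroup W] [Module E W] {f g : V →ₗ[E] W}
    (hfg : ∀ v ∈ L, f v = g v) : f = g :=
  LinearMap.ext_on (Submodule.IsLattice.span_eq_top (A := E) (M := L)) fun v hv => hfg v hv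

theorem exists_extension (f : L →ₗ[integralClosure OF E]
    (Fin s → integralClosure OF E × integralClosure OF E)) :
    ∃ g : V →ₗ[E] (Fin s ⊕ Fin s → E), ∀ v : L, g v = hypInclusion OF E s (f v) := by
  have : Module.Free (integralClosure OF E) L := Submodule.IsLattice.free E L
  have : Module.Finite (integralClosure OF E) L := Submodule.IsLattice.finite E L
  let b := Module.finBasis (integralClosure OF E) L
  refine ⟨(b.extendOfIsLattice E).constr E fun i => hypInclusion OF E s (f (b i)), fun v => ?_⟩
  conv_rhs => rw [← b.sum_repr v]
  rw [map_sum, map_sum, Module.Basis.constr_apply_fintype]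
  refine Finset.sum_congr rfl fun i _ => ?_
  rw [Module.Basis.equivFun_apply, repr_extendOfIsLattice, map_smul f, map_smul, algebraMap_smul]

/-- The linear extension of a homomorphism of lattices. -/
def extension (f : L →ₗ[integralClosure OF E]
    (Fin s → integralClosure OF E × integralClosure OF E)) :
    V →ₗ[E] (Fin s ⊕ Fin s → E) := (exists_extension f).choose

theorem extension_apply (f : L →ₗ[integralClosure OF E]
    (Fin s → integralClosure OF E × integralClosure OF E)) (v : L) :
    extension f (v : V) = hypInclusion OF E s (f v) := (exists_extension f).choose_spec v

theorem exists_extension_eq {g : V →ₗ[E] (Fin s ⊕ Fin s → E)}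
    (hg : ∀ v ∈ L, g v ∈ stdLattice (integralClosure OF E) E (Fin s ⊕ Fin s)) :
    ∃ f : L →ₗ[integralClosure OF E] (Fin s → integralClosure OF E × integralClosure OF E),
      extension f = g := by
  choose f hf using fun v : L => mem_stdLattice_iff_hypInclusion.1 (hg v v.2)
  refine ⟨{ toFun := f, map_add' := fun x y => ?_, map_smul' := fun r x => ?_ }, ?_⟩
  · apply hypInclusion_injective
    rw [map_add, hf, hf, hf, Submodule.coe_add, map_add]
  · apply hypInclusion_injective
    rw [RingHom.id_apply, map_smul, hf, hf, Submodule.coe_smul, ← algebraMap_smul E r (x : V),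
      map_smul, algebraMap_smul]
  · refine ext_on_lattice (L := L) fun v hv => ?_
    rw [extension_apply _ ⟨v, hv⟩]
    exact hf ⟨v, hv⟩

variable {d : ℕ} (β : Fin d → (L →ₗ[integralClosure OF E]
    (Fin s → integralClosure OF E × integralClosure OF E)))

/-- The linear map with given coordinates. -/
def coordHom : (Fin d → OF) →+ (V →ₗ[E] (Fin s ⊕ Fin s → E)) where
  toFun x := ∑ i, algebraMap OF E (x i) • extension (β i)
  map_zero' := by simp
  map_add' x y := by simp [add_smul, Finset.sum_add_distrib]

theorem coordHom_apply (x : Fin d → OF) (v : V) :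
    coordHom β x v = ∑ i, algebraMap OF E (x i) • extension (β i) v := by
  change (∑ i, algebraMap OF E (x i) • extension (β i)) v = _
  rw [LinearMap.sum_apply]
  rfl

theorem coordHom_eq_extension (x : Fin d → OF) :
    coordHom β x = extension (∑ i, algebraMap OF (integralClosure OF E) (x i) • β i) := by
  refine ext_on_lattice (L := L) fun v hv => ?_
  rw [extension_apply _ ⟨v, hv⟩, coordHom_apply, LinearMap.sum_apply, map_sum]
  refine Finset.sum_congr rfl fun i _ => ?_
  rw [extension_apply _ ⟨v, hv⟩, LinearMap.smul_apply, map_smul]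
  rfl

variable {β}

theorem coordHom_mem (x : Fin d → OF) {v : V} (hv : v ∈ L) :
    coordHom β x v ∈ stdLattice (integralClosure OF E) E (Fin s ⊕ Fin s) := by
  rw [coordHom_eq_extension, extension_apply _ ⟨v, hv⟩]
  exact mem_stdLattice_iff_hypInclusion.2 ⟨_, rfl⟩

theorem exists_coordHom_eq (hβ : IsHomBasis OF β) {g : V →ₗ[E] (Fin s ⊕ Fin s → E)}
    (hg : ∀ v ∈ L, g v ∈ stdLattice (integralClosure OF E) E (Fin s ⊕ Fin s)) :
    ∃ x, coordHom β x = g := by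
  obtain ⟨f, rfl⟩ := exists_extension_eq hg
  obtain ⟨x, hx, -⟩ := hβ f
  exact ⟨x, by rw [coordHom_eq_extension, ← hx]⟩

theorem coordHom_injective (hβ : IsHomBasis OF β) : Function.Injective (coordHom β) := by
  intro x y hxy
  rw [coordHom_eq_extension, coordHom_eq_extension] at hxy
  refine (hβ (∑ i, algebraMap OF (integralClosure OF E) (x i) • β i)).unique rfl ?_
  ext1 v
  apply hypInclusion_injective
  rw [← extension_apply, ← extension_apply, hxy]

/-- The ideal `𝔪 ^ N` is generated by `ϖ ^ N`, which is `u ^ (2 N)` in `E`. This is where the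
modulus `u ^ (2 N)` comes from. -/
theorem coordHom_mem_homGroup (hE : IsRamifiedQuadratic c u) (hβ : IsHomBasis OF β) (N : ℕ)
    (x : Fin d → OF) : coordHom β x ∈ homGroup E u L
      (stdLattice (integralClosure OF E) E (Fin s ⊕ Fin s)) (2 * N : ℕ) ↔
      ∀ i, x i ∈ IsLocalRing.maximalIdeal OF ^ N := by
  obtain ⟨ϖ, hϖ, hϖi⟩ := hE.exists_uniformizer
  have hu := hE.uniformizer_ne_zero
  have hmem : ∀ a : OF, a ∈ IsLocalRing.maximalIdeal OF ^ N ↔ ϖ ^ N ∣ a := fun a => by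
    rw [(IsDiscreteValuationRing.irreducible_iff_uniformizer ϖ).1 hϖi, Ideal.span_singleton_pow,
      Ideal.mem_span_singleton]
  have hpow : algebraMap OF E (ϖ ^ N) = (u : E) ^ ((2 * N : ℕ) : ℤ) := by
    rw [map_pow, hϖ, zpow_natCast, pow_mul]
  simp only [hmem]
  constructor
  · intro hx
    obtain ⟨y, hy⟩ := exists_coordHom_eq (β := β) hβ
      (g := ((u : E) ^ (-((2 * N : ℕ) : ℤ))) • coordHom β x) (fun v hv => by
        have := hx v hv
        rwa [mem_scale] at this)
    have h1 : coordHom β x = coordHom β (fun i => ϖ ^ N * y i) := by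
      have h2 : coordHom β (fun i => ϖ ^ N * y i) =
          (u : E) ^ ((2 * N : ℕ) : ℤ) • coordHom β y := by
        ext1 v
        rw [LinearMap.smul_apply, coordHom_apply, coordHom_apply, Finset.smul_sum]
        refine Finset.sum_congr rfl fun i _ => ?_
        rw [map_mul, hpow, mul_smul]
      rw [h2, hy, smul_smul, ← zpow_add₀ hu, add_neg_cancel, zpow_zero, one_smul]
    intro i
    rw [coordHom_injective hβ h1]
    exact dvd_mul_right _ _
  · intro hx v hv
    choose y hy using hx
    have h1 : coordHom β x v = (u : E) ^ ((2 * N : ℕ) : ℤ) • coordHom β y v := by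
      rw [coordHom_apply, coordHom_apply, Finset.smul_sum]
      refine Finset.sum_congr rfl fun i _ => ?_
      rw [hy, map_mul, hpow, mul_smul]
    rw [mem_scale, h1, smul_smul]
    change ((u : E) ^ (-((2 * N : ℕ) : ℤ)) * (u : E) ^ ((2 * N : ℕ) : ℤ)) • _ ∈ _
    rw [← zpow_add₀ hu, neg_add_cancel, zpow_zero, one_smul]
    exact coordHom_mem y hv

end Extension

section Values

variable [FiniteDimensional E V] [Submodule.IsLattice E L]

/-- The module of values is a fractional ideal. -/
theorem exists_valueModule_eq (hE : IsRamifiedQuadratic c u) (hs : 0 < s) :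
    ∃ p : ℕ, 1 ≤ p ∧ (L ≤ pwDual u h L → p = 1) ∧
      valueModule OF (fun x y : L => h x y) (hypPairing (OF := OF) c u s) = pw E u (-p : ℤ) := by
  classical
  have hc := hE.isRamifiedInvolution
  have hu := hE.uniformizer_ne_zero
  set I := valueModule OF (fun x y : L => h x y) (hypPairing (OF := OF) c u s) with hI
  have hhyp : ∀ x y, hypPairing (OF := OF) c u s x y ∈ pw E u (-1) := fun x y => by
    rw [hypPairing_eq]
    exact (hc.isSelfDual_stdLattice s _).1 (mem_stdLattice_iff_hypInclusion.2 ⟨x, rfl⟩) _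
      (mem_stdLattice_iff_hypInclusion.2 ⟨y, rfl⟩)
  -- A single hyperbolic plane already takes the value `u⁻¹`, so the exponent `p` is at least 1.
  have hone : ∃ z ∈ I, z ∉ pw E u 0 := by
    refine ⟨(u : E)⁻¹, ?_, ?_⟩
    · have h1 := right_mem OF (fun x y : L => h x y) (hypPairing (OF := OF) c u s)
        (Pi.single ⟨0, hs⟩ (1, 0)) (Pi.single ⟨0, hs⟩ (0, 1))
      have h2 : hypPairing (OF := OF) c u s (Pi.single ⟨0, hs⟩ (1, 0))
          (Pi.single ⟨0, hs⟩ (0, 1)) = (u : E)⁻¹ := by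
        rw [hypPairing, Finset.sum_eq_single ⟨0, hs⟩]
        · simp
        · intro k _ hk
          simp [hk]
        · simp
      rwa [h2] at h1
    · intro h1
      obtain ⟨a, ha⟩ := mem_pw_zero.1 h1
      refine hE.irreducible.not_isUnit (IsUnit.of_mul_eq_one a (Subtype.ext ?_))
      change (u : E) * (a : E) = 1
      change (a : E) = _ at ha
      rw [ha, mul_inv_cancel₀ hu]
  have hbound : ∃ d : ℕ, I ≤ pw E u (-d : ℤ) := by
    obtain ⟨e, a, he, -⟩ := hc.exists_adapted_basis (le_refl L) rfl
    choose d hd using fun i j => hc.exists_mem (h (e i) (e j))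
    set D := ∑ i, ∑ j, d i j with hD
    refine ⟨1 + D, Submodule.span_le.2 ?_⟩
    rintro z (⟨x, y, rfl⟩ | ⟨x, y, rfl⟩)
    · have h1 : h (x : V) y = ∑ i, ∑ j, c (e.repr y i) * (e.repr x j * h (e j) (e i)) := by
        conv_lhs => rw [← e.sum_repr (x : V), ← e.sum_repr (y : V)]
        simp only [map_sum, LinearMap.sum_apply, LinearMap.map_smulₛₗ, LinearMap.smul_apply,
          RingHom.id_apply, smul_eq_mul, Finset.mul_sum]
        rfl
      change h (x : V) y ∈ _
      rw [h1]
      refine sum_mem fun i _ => sum_mem fun j _ => ?_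
      have h2 : d j i ≤ D :=
        (Finset.single_le_sum (f := fun i => d j i) (fun _ _ => Nat.zero_le _)
          (Finset.mem_univ i)).trans (Finset.single_le_sum (f := fun j => ∑ i, d j i)
          (fun _ _ => Nat.zero_le _) (Finset.mem_univ j))
      refine hc.anti (k := -((1 + D : ℕ) : ℤ)) (l := 0 + (0 + -(d j i : ℤ)))
        (by omega) ?_
      exact hc.mul_mem (hc.c_mem ((he _).1 y.2 i)) (hc.mul_mem ((he _).1 x.2 j) (hd j i))
    · exact hc.anti (by omega) (hhyp x y)
  obtain ⟨z₀, hz₀, hz₀'⟩ := hone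
  let p := Nat.find hbound
  have hp : I ≤ pw E u (-p : ℤ) := Nat.find_spec hbound
  have hp1 : 1 ≤ p := by
    by_contra hp0
    have : p = 0 := by omega
    rw [this] at hp
    exact hz₀' (by simpa using hp hz₀)
  refine ⟨p, hp1, fun hL => ?_, le_antisymm hp ?_⟩
  · have h1 : I ≤ pw E u (-(1 : ℕ) : ℤ) := Submodule.span_le.2 (by
      rintro z (⟨x, y, rfl⟩ | ⟨x, y, rfl⟩)
      · exact hL x.2 _ y.2
      · exact hhyp x y)
    have h2 : p ≤ 1 := Nat.find_min' hbound h1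
    omega
  · have h1 : ¬ I ≤ pw E u (-(p - 1 : ℕ) : ℤ) := Nat.find_min hbound (by
      change p - 1 < p
      omega)
    obtain ⟨z, hz, hz'⟩ := SetLike.not_le_iff_exists.1 h1
    obtain ⟨a, ha⟩ := hp hz
    have hau : IsUnit a := by
      by_contra hnu
      have h2 := (IsLocalRing.mem_maximalIdeal _).2 hnu
      rw [hc.maximalIdeal_eq, Ideal.mem_span_singleton] at h2
      obtain ⟨b, rfl⟩ := h2
      refine hz' ⟨b, ?_⟩
      rw [ha, map_mul, ← mul_assoc, ← zpow_add_one₀ hc.ne_zero]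
      congr 2
      omega
    obtain ⟨w, rfl⟩ := hau
    rintro _ ⟨b, rfl⟩
    have h2 : algebraMap (integralClosure OF E) E u ^ (-p : ℤ) *
        algebraMap (integralClosure OF E) E b = (b * ((w⁻¹ : (integralClosure OF E)ˣ) :
          integralClosure OF E)) • z := by
      rw [ha, Algebra.smul_def, map_mul]
      have h3 : algebraMap (integralClosure OF E) E ((w⁻¹ : (integralClosure OF E)ˣ) :
          integralClosure OF E) * algebraMap (integralClosure OF E) E w = 1 := by
        rw [← map_mul, Units.inv_mul, map_one]
      linear_combination (-(algebraMap (integralClosure OF E) E u ^ (-p : ℤ) *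
        algebraMap (integralClosure OF E) E b)) * h3
    rw [h2]
    exact I.smul_mem _ hz

/-- Coordinates on a fractional ideal. -/
theorem exists_functionals (hE : IsRamifiedQuadratic c u)
    {I : Submodule (integralClosure OF E) E} {p : ℕ} (hI : I = pw E u (-p : ℤ)) :
    ∃ ev₁ ev₂ : I →ₗ[OF] OF, ∀ z : I, (z : E) = algebraMap OF E (ev₁ z) * (u : E) ^ (-p : ℤ) +
      algebraMap OF E (ev₂ z) * (u : E) ^ (1 - p : ℤ) := by
  have hu := hE.uniformizer_ne_zero
  have hup : (u : E) ^ (1 - p : ℤ) = (u : E) ^ (-p : ℤ) * u := by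
    rw [← zpow_add_one₀ hu]
    congr 1
    ring
  have hmem : ∀ a b : OF, algebraMap OF E a * (u : E) ^ (-p : ℤ) +
      algebraMap OF E b * (u : E) ^ (1 - p : ℤ) ∈ I := fun a b => by
    rw [hI]
    refine ⟨algebraMap OF _ a + algebraMap OF _ b * u, ?_⟩
    change _ = (u : E) ^ (-p : ℤ) * (algebraMap OF E a + algebraMap OF E b * u)
    rw [hup]
    ring
  let f : (OF × OF) →ₗ[OF] I :=
    { toFun := fun x => ⟨_, hmem x.1 x.2⟩
      map_add' := fun x y => Subtype.ext (by
        change algebraMap OF E (x.1 + y.1) * _ + algebraMap OF E (x.2 + y.2) * _ =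
          (algebraMap OF E x.1 * _ + algebraMap OF E x.2 * _) +
          (algebraMap OF E y.1 * _ + algebraMap OF E y.2 * _)
        rw [map_add, map_add]
        ring)
      map_smul' := fun r x => Subtype.ext (by
        change algebraMap OF E (r * x.1) * _ + algebraMap OF E (r * x.2) * _ =
          r • (algebraMap OF E x.1 * _ + algebraMap OF E x.2 * _)
        rw [map_mul, map_mul, Algebra.smul_def]
        ring) }
  have hf : Function.Bijective f := by
    constructor
    · intro x y hxy
      have h1 : algebraMap OF E x.1 * (u : E) ^ (-p : ℤ) + algebraMap OF E x.2 * (u : E) ^ (1 - p : ℤ)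
          = algebraMap OF E y.1 * (u : E) ^ (-p : ℤ) + algebraMap OF E y.2 * (u : E) ^ (1 - p : ℤ) :=
        congrArg (fun z : I => (z : E)) hxy
      rw [hup] at h1
      have h2 := hE.repr_unique (a := x.1) (b := x.2) (a' := y.1) (b' := y.2)
        (mul_left_cancel₀ (zpow_ne_zero (-p : ℤ) hu) (by linear_combination h1))
      exact Prod.ext h2.1 h2.2
    · intro z
      have hz : (z : E) ∈ pw E u (-p : ℤ) := hI.le z.2
      obtain ⟨x, hx⟩ := hz
      obtain ⟨a, b, rfl⟩ := hE.exists_repr x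
      refine ⟨(a, b), Subtype.ext ?_⟩
      rw [hx]
      change algebraMap OF E a * (u : E) ^ (-p : ℤ) + algebraMap OF E b * (u : E) ^ (1 - p : ℤ) =
        (u : E) ^ (-p : ℤ) * (algebraMap OF E a + algebraMap OF E b * u)
      rw [hup]
      ring
  let g := LinearEquiv.ofBijective f hf
  refine ⟨LinearMap.fst OF OF OF ∘ₗ g.symm.toLinearMap, LinearMap.snd OF OF OF ∘ₗ g.symm.toLinearMap,
    fun z => ?_⟩
  exact congrArg (fun z : I => (z : E)) (g.apply_symm_apply z).symm

/-- Since `I` is free over `OF` with basis `u ^ (-p)`, `u ^ (1 - p)`, functionals separate the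
elements of `I` modulo `𝔪 ^ N I`. Equations tested on all functionals thus express a congruence
modulo `u ^ (2 N) I`. -/
theorem forall_functional_mem_iff (hE : IsRamifiedQuadratic c u)
    {I : Submodule (integralClosure OF E) E} {p : ℕ} (hI : I = pw E u (-p : ℤ)) (N : ℕ) (z : I) :
    (∀ ev : I →ₗ[OF] OF, ev z ∈ IsLocalRing.maximalIdeal OF ^ N) ↔ (z : E) ∈ pw E u (2 * N - p) := by
  obtain ⟨ϖ, hϖ, hϖi⟩ := hE.exists_uniformizer
  have hu := hE.uniformizer_ne_zero
  have hc := hE.isRamifiedInvolution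
  have hmem : ∀ a : OF, a ∈ IsLocalRing.maximalIdeal OF ^ N ↔ ϖ ^ N ∣ a := fun a => by
    rw [(IsDiscreteValuationRing.irreducible_iff_uniformizer ϖ).1 hϖi, Ideal.span_singleton_pow,
      Ideal.mem_span_singleton]
  have hpow : algebraMap OF E (ϖ ^ N) = (u : E) ^ (2 * N : ℤ) := by
    rw [map_pow, hϖ, zpow_mul, zpow_natCast, zpow_ofNat]
  have hsplit : (u : E) ^ (2 * N - p : ℤ) = (u : E) ^ (2 * N : ℤ) * (u : E) ^ (-p : ℤ) := by
    rw [← zpow_add₀ hu, sub_eq_add_neg]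
  constructor
  · intro hz
    obtain ⟨ev₁, ev₂, hev⟩ := exists_functionals hE hI
    obtain ⟨a, ha⟩ := (hmem _).1 (hz ev₁)
    obtain ⟨b, hb⟩ := (hmem _).1 (hz ev₂)
    refine ⟨algebraMap OF _ a + algebraMap OF _ b * u, ?_⟩
    change _ = (u : E) ^ (2 * N - p : ℤ) * (algebraMap OF E a + algebraMap OF E b * u)
    rw [hev z, ha, hb, map_mul, map_mul, hpow, hsplit, sub_eq_add_neg (1 : ℤ), add_comm (1 : ℤ),
      zpow_add_one₀ hu]
    ring
  · rintro ⟨a, ha⟩ ev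
    have h1 : (u : E) ^ (-p : ℤ) * (a : E) ∈ I := by
      rw [hI]
      exact ⟨a, rfl⟩
    have h2 : z = ϖ ^ N • (⟨_, h1⟩ : I) := Subtype.ext (by
      rw [ha]
      change (u : E) ^ (2 * N - p : ℤ) * (a : E) = ϖ ^ N • ((u : E) ^ (-p : ℤ) * (a : E))
      rw [Algebra.smul_def, hpow, hsplit, mul_assoc])
    rw [hmem, h2, map_smul, smul_eq_mul]
    exact dvd_mul_right _ _

end Values

section Count

variable [FiniteDimensional E V] [Submodule.IsLattice E L] {d : ℕ}
  {β : Fin d → (L →ₗ[integralClosure OF E]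
    (Fin s → integralClosure OF E × integralClosure OF E))}

theorem aeval_hermRelation {S : Type*} [CommRing S] [Algebra OF S] (x : Fin d → S) (v w : L)
    (ev : valueModule OF (fun x y : L => h x y) (hypPairing (OF := OF) c u s) →ₗ[OF] OF) :
    MvPolynomial.aeval x (hermRelation OF (fun x y : L => h x y) (hypPairing (OF := OF) c u s)
      β v w ev) = ∑ i, ∑ j, algebraMap OF S (ev ⟨_, right_mem OF (fun x y : L => h x y)
        (hypPairing (OF := OF) c u s) (β i v) (β j w)⟩) * (x i * x j) -
        algebraMap OF S (ev ⟨_, left_mem OF (fun x y : L => h x y) (hypPairing (OF := OF) c u s)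
        v w⟩) := by
  rw [hermRelation, map_sub, map_sum]
  simp only [map_sum, map_mul, MvPolynomial.aeval_C, MvPolynomial.aeval_X]

theorem pairing_coordHom_mem (x : Fin d → OF) (v w : L) :
    hypForm (c : E →+* E) u s (coordHom β x v) (coordHom β x w) - h v w ∈
      valueModule OF (fun x y : L => h x y) (hypPairing (OF := OF) c u s) := by
  refine sub_mem ?_ (left_mem OF (fun x y : L => h x y) _ v w)
  rw [coordHom_eq_extension, extension_apply, extension_apply, ← hypPairing_eq]
  exact right_mem OF (fun x y : L => h x y) (hypPairing (OF := OF) c u s) _ _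

theorem aeval_hermRelation_coordHom (x : Fin d → OF) (v w : L)
    (ev : valueModule OF (fun x y : L => h x y) (hypPairing (OF := OF) c u s) →ₗ[OF] OF) :
    MvPolynomial.aeval x (hermRelation OF (fun x y : L => h x y) (hypPairing (OF := OF) c u s)
      β v w ev) = ev ⟨_, pairing_coordHom_mem (h := h) (β := β) (c := c) (u := u) x v w⟩ := by
  rw [aeval_hermRelation]
  have h1 : (⟨_, pairing_coordHom_mem (h := h) (β := β) (c := c) (u := u) x v w⟩ :
      valueModule OF (fun x y : L => h x y) (hypPairing (OF := OF) c u s)) =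
      ∑ i, ∑ j, (x i * x j) • (⟨_, right_mem OF (fun x y : L => h x y)
        (hypPairing (OF := OF) c u s) (β i v) (β j w)⟩ : valueModule OF (fun x y : L => h x y)
          (hypPairing (OF := OF) c u s)) -
      ⟨_, left_mem OF (fun x y : L => h x y) (hypPairing (OF := OF) c u s) v w⟩ := by
    apply Subtype.ext
    rw [Submodule.coe_sub]
    simp only [AddSubmonoidClass.coe_finsetSum, Submodule.coe_smul_of_tower]
    congr 1
    rw [coordHom_apply, coordHom_apply]
    simp only [map_sum, LinearMap.sum_apply, LinearMap.map_smulₛₗ, LinearMap.smul_apply,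
      RingHom.id_apply, smul_eq_mul, Finset.mul_sum]
    rw [Finset.sum_comm]
    refine Finset.sum_congr rfl fun i _ => Finset.sum_congr rfl fun j _ => ?_
    rw [extension_apply, extension_apply, ← hypPairing_eq, Algebra.smul_def, map_mul]
    change c (algebraMap OF E (x j)) * _ = _
    rw [IsRamifiedQuadratic.c_algebraMap]
    ring
  rw [h1, map_sub, map_sum]
  simp only [map_sum, map_smul, smul_eq_mul]
  congr 1
  refine Finset.sum_congr rfl fun i _ => Finset.sum_congr rfl fun j _ => ?_
  rw [mul_comm]
  rfl

/-- A point over `OF / 𝔪 ^ N` is a class of coordinate vectors solving the equations modulo `𝔪 ^ N`,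
and `coordHom` identifies coordinate vectors with the linear maps that send `L` into the standard
lattice. -/
theorem hermCount_eq_cosetCount (hE : IsRamifiedQuadratic c u) (hβ : IsHomBasis OF β) {p : ℕ}
    (hp : valueModule OF (fun x y : L => h x y) (hypPairing (OF := OF) c u s) = pw E u (-p : ℤ))
    (N : ℕ) :
    hermCount OF (fun x y : L => h x y) (hypPairing (OF := OF) c u s) β N =
      cosetCount (homGroup E u L (stdLattice (integralClosure OF E) E (Fin s ⊕ Fin s)) (2 * N : ℕ))
        {f | (∀ x ∈ L, f x ∈ stdLattice (integralClosure OF E) E (Fin s ⊕ Fin s)) ∧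
          ∀ x ∈ L, ∀ y ∈ L, hypForm (c : E →+* E) u s (f x) (f y) - h x y ∈
            pw E u (2 * N - p)} := by
  let A := OF ⧸ IsLocalRing.maximalIdeal OF ^ N
  let G := {P | ∃ v w ev, P = hermRelation OF (fun x y : L => h x y)
    (hypPairing (OF := OF) c u s) β v w ev}
  let B : AddSubgroup (Fin d → OF) :=
    { carrier := {x | ∀ i, x i ∈ IsLocalRing.maximalIdeal OF ^ N}
      zero_mem' := fun _ => zero_mem _
      add_mem' := fun hx hy i => add_mem (hx i) (hy i)
      neg_mem' := fun hx i => neg_mem (hx i) }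
  let S' : Set (Fin d → OF) := {x | ∀ P ∈ G, MvPolynomial.aeval x P ∈ IsLocalRing.maximalIdeal OF ^ N}
  let ρ : (Fin d → OF) → (Fin d → A) := fun x i => Ideal.Quotient.mk _ (x i)
  have hae : ∀ (x : Fin d → OF) (P : MvPolynomial (Fin d) OF),
      MvPolynomial.aeval (ρ x) P = Ideal.Quotient.mk (IsLocalRing.maximalIdeal OF ^ N)
        (MvPolynomial.aeval x P) := by
    intro x P
    have h1 : ρ x = (algebraMap OF A) ∘ x := rfl
    rw [h1, MvPolynomial.aeval_algebraMap_apply]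
    rfl
  have h1 : ρ '' S' = {y | ∀ P ∈ G, MvPolynomial.aeval y P = 0} := by
    ext y
    constructor
    · rintro ⟨x, hx, rfl⟩ P hP
      rw [hae]
      exact Ideal.Quotient.eq_zero_iff_mem.2 (hx P hP)
    · intro hy
      choose x hx using fun i => Ideal.Quotient.mk_surjective (y i)
      have hx' : ρ x = y := funext hx
      refine ⟨x, fun P hP => Ideal.Quotient.eq_zero_iff_mem.1 ?_, hx'⟩
      rw [← hae, hx']
      exact hy P hP
  have h2 : hermCount OF (fun x y : L => h x y) (hypPairing (OF := OF) c u s) β N =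
      cosetCount B S' := by
    rw [cosetCount_eq_ncard ρ fun x _ y _ => ?_, h1]
    · rw [← Nat.card_coe_set_eq]
      exact Nat.card_congr (algHomEquivSolutions G)
    · rw [funext_iff]
      refine forall_congr' fun i => ?_
      change Ideal.Quotient.mk _ (x i) = Ideal.Quotient.mk _ (y i) ↔ y i - x i ∈ _
      rw [eq_comm, Ideal.Quotient.eq]
  rw [h2, ← cosetCount_image B _ S' (coordHom β) fun x => coordHom_mem_homGroup hE hβ N x]
  congr 1
  have h3 : ∀ x : Fin d → OF, x ∈ S' ↔ ∀ v ∈ L, ∀ w ∈ L,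
      hypForm (c : E →+* E) u s (coordHom β x v) (coordHom β x w) - h v w ∈
        pw E u (2 * N - p) := by
    intro x
    constructor
    · intro hx v hv w hw
      rw [← forall_functional_mem_iff hE hp N ⟨_, pairing_coordHom_mem (h := h) (β := β) (c := c)
        (u := u) x ⟨v, hv⟩ ⟨w, hw⟩⟩]
      intro ev
      rw [← aeval_hermRelation_coordHom]
      exact hx _ ⟨_, _, _, rfl⟩
    · rintro hx _ ⟨v, w, ev, rfl⟩
      rw [aeval_hermRelation_coordHom]
      exact (forall_functional_mem_iff hE hp N _).2 (hx v v.2 w w.2) ev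
  ext f
  constructor
  · rintro ⟨x, hx, rfl⟩
    exact ⟨fun v hv => coordHom_mem x hv, (h3 x).1 hx⟩
  · rintro ⟨hf, hf'⟩
    obtain ⟨x, rfl⟩ := exists_coordHom_eq hβ hf
    exact ⟨x, (h3 x).2 hf', rfl⟩

/-- For integral `L` the value module is `u⁻¹ R` and the two conditions coincide. Otherwise both
sets are empty as soon as `2 N - p ≥ -1`, since a map into a lattice with pairing in `u⁻¹ R` cannot
be isometric on `L` modulo `u⁻¹ R`. -/
theorem eventually_hermCount_eq (hE : IsRamifiedQuadratic c u) (hβ : IsHomBasis OF β) (hs : 0 < s) :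
    ∃ N₀ : ℕ, ∀ N ≥ N₀, hermCount OF (fun x y : L => h x y) (hypPairing (OF := OF) c u s) β N =
      cosetCount (homGroup E u L (stdLattice (integralClosure OF E) E (Fin s ⊕ Fin s)) (2 * N : ℕ))
        (approxIsometries u h (hypForm (c : E →+* E) u s) L
          (stdLattice (integralClosure OF E) E (Fin s ⊕ Fin s)) N) := by
  have hc := hE.isRamifiedInvolution
  obtain ⟨p, hp1, hpL, hp⟩ := exists_valueModule_eq (h := h) (L := L) hE hs
  by_cases hL : L ≤ pwDual u h L
  · refine ⟨0, fun N _ => ?_⟩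
    rw [hermCount_eq_cosetCount hE hβ hp N, hpL hL]
    rfl
  · refine ⟨p, fun N hN => ?_⟩
    have key : ∀ k : ℤ, -1 ≤ k → ∀ f : V →ₗ[E] (Fin s ⊕ Fin s → E),
        (∀ x ∈ L, f x ∈ stdLattice (integralClosure OF E) E (Fin s ⊕ Fin s)) →
        ¬ ∀ x ∈ L, ∀ y ∈ L, hypForm (c : E →+* E) u s (f x) (f y) - h x y ∈ pw E u k := by
      intro k hk f hf hf'
      refine hL fun x hx y hy => ?_
      have h1 := sub_mem ((hc.isSelfDual_stdLattice s _).1 (hf x hx) _ (hf y hy))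
        (hc.anti hk (hf' x hx y hy))
      rwa [sub_sub_cancel] at h1
    rw [hermCount_eq_cosetCount hE hβ hp N]
    congr 1
    rw [approxIsometries]
    ext f
    exact ⟨fun hf => absurd hf.2 (key _ (by omega) f hf.1),
      fun hf => absurd hf.2 (key _ (by omega) f hf.1)⟩

end Count

end RamifiedExtension

/-! ### Krull dimension of the scheme of pairs of matrices with `X Zᵀ = T`. -/

section Dimension

/-- Lying over and going up lift chains of primes; incomparability keeps chains strict under
contraction. -/
theorem ringKrullDim_eq_of_isIntegral {A B : Type*} [CommRing A] [CommRing B] [Algebra A B]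
    [Algebra.IsIntegral A B] [FaithfulSMul A B] : ringKrullDim A = ringKrullDim B := by
  refine le_antisymm ?_ ?_
  · refine iSup_le fun l => ?_
    obtain ⟨P, hP⟩ := Algebra.IsIntegral.comap_surjective A B l.head
    have : P.asIdeal.LiesOver l.head.asIdeal := ⟨by rw [← hP]; rfl⟩
    obtain ⟨l', hl', -⟩ := Ideal.exists_ltSeries_of_hasGoingUp (S := B) l P.asIdeal
    rw [← hl']
    exact le_iSup (fun p : LTSeries (PrimeSpectrum B) => (p.length : WithBot ℕ∞)) l'
  · refine Order.krullDim_le_of_strictMono (PrimeSpectrum.comap (algebraMap A B)) fun P Q hPQ => ?_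
    exact Ideal.IsIntegral.comap_lt_comap (R := A) hPQ

variable {k C : Type*} [Field k] [CommRing C] [Algebra k C] {n : ℕ} {ι : Type*} [Fintype ι]

/-- A minor of `X` is nonzero when `X * Zᵀ` is invertible. -/
theorem exists_det_submatrix_notMem {X Z : Matrix (Fin n) ι C} {P : Ideal C} [P.IsPrime]
    (hXZ : IsUnit (X * Z.transpose).det) :
    ∃ f : Fin n → ι, Function.Injective f ∧ (X.submatrix id f).det ∉ P := by
  classical
  by_contra! hcon
  have h0 : ∀ f : Fin n → ι, (X.submatrix id f).det ∈ P := by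
    intro f
    by_cases hf : Function.Injective f
    · exact hcon f hf
    · rw [Function.not_injective_iff] at hf
      obtain ⟨i, j, hij, hne⟩ := hf
      rw [Matrix.det_zero_of_column_eq hne fun l => by
        simp only [Matrix.submatrix_apply, id, hij]]
      exact zero_mem _
  -- Cauchy–Binet before grouping the choices of columns. If all maximal minors of `X` were in `P`,
  -- so would be a unit.
  have h1 : (X * Z.transpose).det =
      ∑ f : Fin n → ι, (∏ i, Z i (f i)) * (X.submatrix id f).det := by
    rw [← Matrix.det_transpose]
    have h2 : (X * Z.transpose).transpose = Matrix.of fun i => ∑ a, Z i a • fun j => X j a := by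
      ext i j
      simp only [Matrix.transpose_apply, Matrix.mul_apply, Matrix.of_apply, Finset.sum_apply,
        Pi.smul_apply, smul_eq_mul]
      exact Finset.sum_congr rfl fun a _ => mul_comm _ _
    rw [h2]
    have h3 := (Matrix.detRowAlternating (R := C) (n := Fin n)).toMultilinearMap.map_sum
      (fun i a => Z i a • fun j => X j a)
    refine h3.trans (Finset.sum_congr rfl fun f _ => ?_)
    rw [MultilinearMap.map_smul_univ, smul_eq_mul, ← Matrix.det_transpose (X.submatrix id f)]
    rfl
  refine ‹P.IsPrime›.ne_top (P.eq_top_of_isUnit_mem ?_ hXZ)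
  rw [h1]
  exact sum_mem fun f _ => P.mul_mem_left _ (h0 f)

variable {κ : Type*} [Fintype κ] (e : Fin n ⊕ κ ≃ ι)

/-- The generic invertible minor. -/
def genericMinor (k : Type*) [Field k] (e : Fin n ⊕ κ ≃ ι) :
    Matrix (Fin n) (Fin n) (MvPolynomial ((Fin n × ι) ⊕ (Fin n × κ)) k) :=
  Matrix.of fun i j => MvPolynomial.X (.inl (i, e (.inl j)))

/-- The part of `X * Zᵀ` which does not involve the chosen minor, subtracted from `T`. -/
def genericRest (T : Matrix (Fin n) (Fin n) k) (e : Fin n ⊕ κ ≃ ι) :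
    Matrix (Fin n) (Fin n) (MvPolynomial ((Fin n × ι) ⊕ (Fin n × κ)) k) :=
  Matrix.of fun i j => MvPolynomial.C (T i j) -
    ∑ b, MvPolynomial.X (.inl (i, e (.inr b))) * MvPolynomial.X (.inr (j, b))

/-- The parametrization of the entries of `X` and of the free entries of `Z`. -/
def paramHom (k : Type*) [Field k] {C : Type*} [CommRing C] [Algebra k C] (e : Fin n ⊕ κ ≃ ι)
    (X Z : Matrix (Fin n) ι C) :
    MvPolynomial ((Fin n × ι) ⊕ (Fin n × κ)) k →ₐ[k] C :=
  MvPolynomial.aeval (Sum.elim (fun p => X p.1 p.2) fun p => Z p.1 (e (.inr p.2)))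

theorem paramHom_genericMinor (X Z : Matrix (Fin n) ι C) :
    (genericMinor k e).map (paramHom k e X Z) = X.submatrix id fun i => e (.inl i) := by
  ext i j
  simp [genericMinor, paramHom]

theorem mul_transpose_eq (X Z : Matrix (Fin n) ι C) (i j : Fin n) :
    (X * Z.transpose) i j = ((X.submatrix id fun i => e (.inl i)) *
      (Z.submatrix id fun i => e (.inl i)).transpose) i j +
      ∑ b, X i (e (.inr b)) * Z j (e (.inr b)) := by
  rw [Matrix.mul_apply, ← e.sum_comp, Fintype.sum_sum_type, Matrix.mul_apply]
  rfl

theorem paramHom_genericRest {T : Matrix (Fin n) (Fin n) k} (X Z : Matrix (Fin n) ι C)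
    (hXZ : X * Z.transpose = T.map (algebraMap k C)) :
    (genericRest T e).map (paramHom k e X Z) = (X.submatrix id fun i => e (.inl i)) *
      (Z.submatrix id fun i => e (.inl i)).transpose := by
  ext i j
  have h1 := congrFun (congrFun hXZ i) j
  rw [mul_transpose_eq e, Matrix.map_apply] at h1
  rw [Matrix.map_apply, ← sub_eq_of_eq_add h1.symm]
  simp [genericRest, paramHom]

/-- Up to powers of the minor, the ring is generated by `X` and the free entries of `Z`. -/
theorem exists_pow_mul_mem_range {T : Matrix (Fin n) (Fin n) k} (X Z : Matrix (Fin n) ι C)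
    (hXZ : X * Z.transpose = T.map (algebraMap k C))
    (hgen : Algebra.adjoin k (Set.range (fun p : Fin n × ι => X p.1 p.2) ∪
      Set.range (fun p : Fin n × ι => Z p.1 p.2)) = ⊤) (z : C) :
    ∃ (K : ℕ) (w : MvPolynomial ((Fin n × ι) ⊕ (Fin n × κ)) k),
      paramHom k e X Z (genericMinor k e).det ^ K * z = paramHom k e X Z w := by
  have hz : z ∈ Algebra.adjoin k (Set.range (fun p : Fin n × ι => X p.1 p.2) ∪
      Set.range (fun p : Fin n × ι => Z p.1 p.2)) := by
    rw [hgen]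
    trivial
  set g := paramHom k e X Z with hg
  induction hz using Algebra.adjoin_induction with
  | mem x hx =>
    obtain ⟨p, rfl⟩ | ⟨p, rfl⟩ := hx
    · exact ⟨0, MvPolynomial.X (.inl p), by simp [hg, paramHom]⟩
    · obtain ⟨j, a⟩ := p
      obtain ⟨a, rfl⟩ := e.surjective a
      cases a with
      | inr b => exact ⟨0, MvPolynomial.X (.inr (j, b)), by simp [hg, paramHom]⟩
      | inl i =>
        refine ⟨1, ((genericMinor k e).adjugate * genericRest T e) i j, ?_⟩
        have h1 : ((genericMinor k e).adjugate * genericRest T e).map g =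
            (X.submatrix id fun i => e (.inl i)).det •
              (Z.submatrix id fun i => e (.inl i)).transpose := by
          rw [Matrix.map_mul]
          have h2 : (genericMinor k e).adjugate.map g =
              (X.submatrix id fun i => e (.inl i)).adjugate := by
            rw [← paramHom_genericMinor (k := k) e X Z]
            exact RingHom.map_adjugate g.toRingHom _
          rw [h2, hg, paramHom_genericRest e X Z hXZ, ← Matrix.mul_assoc, Matrix.adjugate_mul,
            Matrix.smul_mul, Matrix.one_mul]
        have h3 : g (genericMinor k e).det = (X.submatrix id fun i => e (.inl i)).det := by
          rw [← paramHom_genericMinor (k := k) e X Z]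
          exact RingHom.map_det g.toRingHom _
        rw [pow_one, h3]
        exact (congrFun (congrFun h1 i) j).symm
  | algebraMap r => exact ⟨0, algebraMap k _ r, by rw [pow_zero, one_mul, AlgHom.commutes]⟩
  | add x y _ _ hx hy =>
    obtain ⟨K, w, hw⟩ := hx
    obtain ⟨K', w', hw'⟩ := hy
    refine ⟨K + K', (genericMinor k e).det ^ K' * w + (genericMinor k e).det ^ K * w', ?_⟩
    rw [map_add, map_mul, map_mul, map_pow, map_pow, ← hw, ← hw']
    ring
  | mul x y _ _ hx hy =>
    obtain ⟨K, w, hw⟩ := hx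
    obtain ⟨K', w', hw'⟩ := hy
    refine ⟨K + K', w * w', ?_⟩
    rw [map_mul, ← hw, ← hw']
    ring

theorem ringKrullDim_mvPolynomial_field (k : Type*) [Field k] (τ : Type*) [Fintype τ] :
    ringKrullDim (MvPolynomial τ k) = (Fintype.card τ : ℕ) := by
  rw [MvPolynomial.ringKrullDim_of_isNoetherianRing, ringKrullDim_eq_zero_of_field, zero_add,
    Nat.card_eq_fintype_card]

/-- Given a chain of primes, some maximal minor of `X` avoids the last prime and hence all of them.
Away from this minor the relation determines the corresponding block of `Z`
(`exists_pow_mul_mem_range`), so contraction to the polynomial ring in the remaining entries keeps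
the chain strict. -/
theorem ringKrullDim_le_of_generated {T : Matrix (Fin n) (Fin n) k} (hT : IsUnit T.det)
    (X Z : Matrix (Fin n) ι C) (hXZ : X * Z.transpose = T.map (algebraMap k C))
    (hgen : Algebra.adjoin k (Set.range (fun p : Fin n × ι => X p.1 p.2) ∪
      Set.range (fun p : Fin n × ι => Z p.1 p.2)) = ⊤) :
    ringKrullDim C ≤ (n * Fintype.card ι + n * (Fintype.card ι - n) : ℕ) := by
  classical
  refine iSup_le fun l => ?_
  have hdet : IsUnit (X * Z.transpose).det := by
    rw [hXZ]
    have := hT.map (algebraMap k C)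
    rwa [RingHom.map_det] at this
  obtain ⟨f, hf, hfP⟩ := exists_det_submatrix_notMem (P := l.last.asIdeal) hdet
  let κ := {a // a ∉ Set.range f}
  let e : Fin n ⊕ κ ≃ ι :=
    ((Equiv.ofInjective f hf).sumCongr (Equiv.refl κ)).trans (Equiv.Set.sumCompl (Set.range f))
  have he : ∀ i, e (.inl i) = f i := fun i => rfl
  set g := paramHom k e X Z with hg
  have hδ : g (genericMinor k e).det = (X.submatrix id f).det := by
    have h1 := paramHom_genericMinor (k := k) e X Z
    have h2 : (X.submatrix id fun i => e (.inl i)) = X.submatrix id f := rfl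
    rw [← h2, ← h1]
    exact RingHom.map_det g.toRingHom _
  have hlast : ∀ i, (l i).asIdeal ≤ l.last.asIdeal := fun i =>
    l.monotone (Fin.le_last i)
  have hmono : StrictMono fun i => PrimeSpectrum.comap g.toRingHom (l i) := by
    intro i j hij
    have h1 : l i < l j := l.strictMono hij
    refine lt_of_le_not_ge (fun w hw => h1.le hw) fun hle => ?_
    obtain ⟨z, hz, hz'⟩ := SetLike.not_le_iff_exists.1 (show ¬ (l j).asIdeal ≤ (l i).asIdeal from
      not_le_of_gt h1)
    obtain ⟨K, w, hw⟩ := exists_pow_mul_mem_range e X Z hXZ hgen z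
    rw [← hg, hδ] at hw
    have h2 : g w ∈ (l j).asIdeal := hw ▸ Ideal.mul_mem_left _ _ hz
    have h3 : g w ∈ (l i).asIdeal := hle h2
    rw [← hw] at h3
    obtain h4 | h4 := (l i).isPrime.mem_or_mem h3
    · exact hfP (hlast i ((l i).isPrime.mem_of_pow_mem _ h4))
    · exact hz' h4
  let l' : LTSeries (PrimeSpectrum (MvPolynomial ((Fin n × ι) ⊕ (Fin n × κ)) k)) :=
    LTSeries.mk l.length _ hmono
  have h1 : (l'.length : WithBot ℕ∞) ≤
      ringKrullDim (MvPolynomial ((Fin n × ι) ⊕ (Fin n × κ)) k) :=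
    le_iSup (fun p : LTSeries (PrimeSpectrum (MvPolynomial ((Fin n × ι) ⊕ (Fin n × κ)) k)) =>
      (p.length : WithBot ℕ∞)) l'
  rw [ringKrullDim_mvPolynomial_field] at h1
  have h2 : Fintype.card κ = Fintype.card ι - n := by
    have := Fintype.card_congr e
    rw [Fintype.card_sum, Fintype.card_fin] at this
    omega
  rw [Fintype.card_sum, Fintype.card_prod, Fintype.card_prod, Fintype.card_fin, h2] at h1
  exact h1

/-- A chain of the required length is given by kernels of points with values in the fraction field
of the polynomial ring: the free entries are specialized one after the other, and the relation is
solved for the rest. The index types are in `Type` so that this field lies in the universe over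
which `huniv` ranges. -/
theorem le_ringKrullDim_of_universal.{w, w'} {k : Type w} {C : Type w'} [Field k] [CommRing C] [Algebra k C] {ι κ : Type}
    [Fintype ι] [Fintype κ] (e : Fin n ⊕ κ ≃ ι) {T : Matrix (Fin n) (Fin n) k}
    (X Z : Matrix (Fin n) ι C) (hXZ : X * Z.transpose = T.map (algebraMap k C))
    (hgen : Algebra.adjoin k (Set.range (fun p : Fin n × ι => X p.1 p.2) ∪
      Set.range (fun p : Fin n × ι => Z p.1 p.2)) = ⊤)
    (huniv : ∀ (K : Type w) [Field K] [Algebra k K] (X' Z' : Matrix (Fin n) ι K),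
      X' * Z'.transpose = T.map (algebraMap k K) →
        ∃ φ : C →ₐ[k] K, X.map φ = X' ∧ Z.map φ = Z') :
    ((n * Fintype.card ι + n * Fintype.card κ : ℕ) : WithBot ℕ∞) ≤ ringKrullDim C := by
  classical
  let τ := (Fin n × ι) ⊕ (Fin n × κ)
  let S := MvPolynomial τ k
  let K := FractionRing S
  obtain ⟨N, hN⟩ : ∃ N, N = Fintype.card τ := ⟨_, rfl⟩
  let ε : τ ≃ Fin N := Fintype.equivFinOfCardEq hN.symm
  -- The point of specialization turns the chosen minor into the identity matrix, so its determinant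
  -- stays nonzero at every stage.
  let a : τ → k := Sum.elim (fun p => if p.2 = e (.inl p.1) then 1 else 0) fun _ => 0
  let ψ : ℕ → S →ₐ[k] S := fun i => MvPolynomial.aeval fun j =>
    if (ε j : ℕ) < i then MvPolynomial.C (a j) else MvPolynomial.X j
  have hψX : ∀ i j, ψ i (MvPolynomial.X j) =
      if (ε j : ℕ) < i then MvPolynomial.C (a j) else MvPolynomial.X j := fun i j =>
    MvPolynomial.aeval_X _ _
  have hψψ : ∀ i i', i ≤ i' → (ψ i').comp (ψ i) = ψ i' := by
    intro i i' hii'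
    refine MvPolynomial.algHom_ext fun j => ?_
    rw [AlgHom.comp_apply, hψX]
    by_cases hj : (ε j : ℕ) < i
    · rw [if_pos hj, hψX, if_pos (hj.trans_le hii'), ← MvPolynomial.algebraMap_eq, AlgHom.commutes]
    · rw [if_neg hj]
  set δ := (genericMinor k e).det with hδ
  have hψN : ψ N δ = 1 := by
    have h1 : (genericMinor k e).map (ψ N) = 1 := by
      ext1 i j
      rw [Matrix.map_apply, genericMinor, Matrix.of_apply, hψX, if_pos (ε _).2, Matrix.one_apply]
      simp only [a, Sum.elim_inl, EmbeddingLike.apply_eq_iff_eq, Sum.inl.injEq, eq_comm (a := i)]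
      split_ifs <;> simp
    have h2 : ψ N δ = ((genericMinor k e).map (ψ N)).det := RingHom.map_det (ψ N : S →+* S) _
    rw [h2, h1, Matrix.det_one]
  have hψδ : ∀ i, i ≤ N → ψ i δ ≠ 0 := by
    intro i hi h0
    have h1 := DFunLike.congr_fun (hψψ i N hi) δ
    rw [AlgHom.comp_apply, h0, map_zero, hψN] at h1
    exact zero_ne_one h1
  let ιK : S →ₐ[k] K := Algebra.algHom k S K
  have hιK : Function.Injective ιK := IsFractionRing.injective S K
  have hpt : ∀ i, i ≤ N → ∃ φ : C →ₐ[k] K, φ.comp (paramHom k e X Z) = ιK.comp (ψ i) := by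
    intro i hi
    let θ : S →ₐ[k] K := ιK.comp (ψ i)
    let A : Matrix (Fin n) (Fin n) K := (genericMinor k e).map θ
    have hA : IsUnit A.det := by
      have h2 : θ δ = A.det := RingHom.map_det (θ : S →+* K) _
      rw [← h2, isUnit_iff_ne_zero]
      exact fun h => hψδ i hi (hιK (h.trans (map_zero _).symm))
    -- The block of `Z` forced by the relation once the minor is invertible.
    let D : Matrix (Fin n) (Fin n) K := (A⁻¹ * (genericRest T e).map θ).transpose
    let X' : Matrix (Fin n) ι K := Matrix.of fun j a => θ (MvPolynomial.X (.inl (j, a)))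
    let Z' : Matrix (Fin n) ι K := Matrix.of fun j a =>
      Sum.elim (fun i => D j i) (fun b => θ (MvPolynomial.X (.inr (j, b)))) (e.symm a)
    have hZl : (Z'.submatrix id fun i => e (.inl i)) = D := by
      ext j i
      simp [Z']
    have hXl : (X'.submatrix id fun i => e (.inl i)) = A := by
      ext j i
      rfl
    have hrel : X' * Z'.transpose = T.map (algebraMap k K) := by
      ext i j
      rw [mul_transpose_eq e, hZl, hXl, Matrix.transpose_transpose, ← Matrix.mul_assoc,
        Matrix.mul_nonsing_inv _ hA, Matrix.one_mul, Matrix.map_apply, Matrix.map_apply,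
        genericRest, Matrix.of_apply, map_sub, map_sum]
      simp only [map_mul, X', Z', Matrix.of_apply, Equiv.symm_apply_apply, Sum.elim_inr]
      rw [sub_add_cancel, ← MvPolynomial.algebraMap_eq, AlgHom.commutes]
    obtain ⟨φ, hφX, hφZ⟩ := huniv K X' Z' hrel
    refine ⟨φ, MvPolynomial.algHom_ext fun j => ?_⟩
    rw [AlgHom.comp_apply, paramHom, MvPolynomial.aeval_X]
    cases j with
    | inl p => exact congrFun (congrFun hφX p.1) p.2
    | inr p =>
      refine (congrFun (congrFun hφZ p.1) (e (.inr p.2))).trans ?_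
      simp [Z', θ]
  choose φ hφ using hpt
  have hker : ∀ (i : ℕ) (hi : i ≤ N) (z : C) (K' : ℕ) (w : S),
      paramHom k e X Z δ ^ K' * z = paramHom k e X Z w → (φ i hi z = 0 ↔ ψ i w = 0) := by
    intro i hi z K' w hw
    have h1 := congrArg (φ i hi) hw
    have h2 : ∀ y, φ i hi (paramHom k e X Z y) = ιK (ψ i y) := fun y =>
      DFunLike.congr_fun (hφ i hi) y
    rw [map_mul, map_pow, h2, h2] at h1
    have h3 : ιK (ψ i δ) ≠ 0 := fun h => hψδ i hi (hιK (h.trans (map_zero _).symm))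
    constructor
    · intro hz
      rw [hz, mul_zero] at h1
      exact hιK (h1.symm.trans (map_zero _).symm)
    · intro hw0
      rw [hw0, map_zero] at h1
      exact (mul_eq_zero.1 h1).resolve_left (pow_ne_zero _ h3)
  let p : Fin (N + 1) → PrimeSpectrum C := fun i =>
    ⟨RingHom.ker (φ i (Nat.lt_succ_iff.1 i.2)), RingHom.ker_isPrime _⟩
  have hp : StrictMono p := by
    intro i j hij
    have hij' : (i : ℕ) < j := hij
    refine lt_of_le_not_ge (fun z hz => ?_) fun hle => ?_
    · obtain ⟨K', w, hw⟩ := exists_pow_mul_mem_range e X Z hXZ hgen z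
      have h1 := (hker i (Nat.lt_succ_iff.1 i.2) z K' w hw).1 hz
      refine (hker j (Nat.lt_succ_iff.1 j.2) z K' w hw).2 ?_
      rw [← hψψ i j hij'.le, AlgHom.comp_apply, h1, map_zero]
    -- With `x` the variable numbered `i`, the element `X x - C (a x)` dies at stage `j > i` but
    -- survives at stage `i`, so the inclusion is strict.
    · let x := ε.symm ⟨i, by have := j.2; omega⟩
      have hx : (ε x : ℕ) = i := by simp [x]
      have h2 := hker j (Nat.lt_succ_iff.1 j.2) _ 0 (MvPolynomial.X x - MvPolynomial.C (a x))
        (by rw [pow_zero, one_mul])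
      have h3 := hker i (Nat.lt_succ_iff.1 i.2) _ 0 (MvPolynomial.X x - MvPolynomial.C (a x))
        (by rw [pow_zero, one_mul])
      have h4 := h3.1 (hle (h2.2 (by
        rw [map_sub, hψX, if_pos (by omega), ← MvPolynomial.algebraMap_eq, AlgHom.commutes,
          sub_self])))
      rw [map_sub, hψX, if_neg (by omega), ← MvPolynomial.algebraMap_eq, AlgHom.commutes] at h4
      have h5 := congrArg (MvPolynomial.eval fun _ => a x + 1) h4
      rw [MvPolynomial.algebraMap_eq, map_sub, MvPolynomial.eval_X, MvPolynomial.eval_C, map_zero,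
        add_sub_cancel_left] at h5
      exact one_ne_zero h5
  have h1 : N = n * Fintype.card ι + n * Fintype.card κ := by
    rw [hN, Fintype.card_sum, Fintype.card_prod, Fintype.card_prod, Fintype.card_fin]
  rw [← h1]
  exact le_iSup (fun p : LTSeries (PrimeSpectrum C) => (p.length : WithBot ℕ∞))
    (LTSeries.mk N p hp)

end Dimension

/-! ### Coordinates on the module of homomorphisms over E. -/

section RamifiedExtension

variable {OF F : Type*} [CommRing OF] [IsDomain OF] [IsDiscreteValuationRing OF]
  [Field F] [CharZero F] [Algebra OF F] [IsFractionRing OF F]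
  {E : Type*} [Field E] [Algebra F E] [Algebra OF E] [IsScalarTower OF F E]
  [IsDiscreteValuationRing (integralClosure OF E)] [IsFractionRing (integralClosure OF E) E]
  {c : E ≃ₐ[F] E} {u : integralClosure OF E}
  {V : Type*} [AddCommGroup V] [Module E V]
  {h : V →ₗ[E] V →ₛₗ[(c : E →+* E)] E} {L : Submodule (integralClosure OF E) V} {s : ℕ}

theorem IsRamifiedQuadratic.nonempty_equiv_prod (hE : IsRamifiedQuadratic c u) :
    Nonempty ((OF × OF) ≃ₗ[OF] integralClosure OF E) := by
  let f : (OF × OF) →ₗ[OF] integralClosure OF E :=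
    { toFun := fun x => algebraMap OF _ x.1 + algebraMap OF _ x.2 * u
      map_add' := fun x y => by
        rw [Prod.fst_add, Prod.snd_add, map_add, map_add]
        ring
      map_smul' := fun r x => by
        rw [RingHom.id_apply, Prod.smul_fst, Prod.smul_snd, smul_eq_mul, smul_eq_mul, map_mul,
          map_mul, Algebra.smul_def]
        ring }
  refine ⟨LinearEquiv.ofBijective f ⟨fun x y hxy => ?_, fun z => ?_⟩⟩
  · have h1 := hE.repr_unique (a := x.1) (b := x.2) (a' := y.1) (b' := y.2)
      (congrArg (fun z : integralClosure OF E => (z : E)) hxy)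
    exact Prod.ext h1.1 h1.2
  · obtain ⟨a, b, rfl⟩ := hE.exists_repr z
    exact ⟨(a, b), rfl⟩

section

variable [FiniteDimensional E V] [Submodule.IsLattice E L]

theorem exists_isHomBasis (hE : IsRamifiedQuadratic c u) (L : Submodule (integralClosure OF E) V)
    [Submodule.IsLattice E L] (s : ℕ) :
    ∃ β : Fin (2 * (Module.finrank E V * (2 * s))) → (L →ₗ[integralClosure OF E]
      (Fin s → integralClosure OF E × integralClosure OF E)), IsHomBasis OF β := by
  obtain ⟨f⟩ := hE.nonempty_equiv_prod
  have : Module.Free OF (integralClosure OF E) := Module.Free.of_equiv f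
  have : Module.Finite OF (integralClosure OF E) := Module.Finite.equiv f
  have : Module.Free (integralClosure OF E) L := Submodule.IsLattice.free E L
  have : Module.Finite (integralClosure OF E) L := Submodule.IsLattice.finite E L
  let H := L →ₗ[integralClosure OF E] (Fin s → integralClosure OF E × integralClosure OF E)
  have : Module.Free OF H := Module.Free.trans (S := integralClosure OF E)
  have : Module.Finite (integralClosure OF E) H := Module.Finite.linearMap _ _ _ _
  have : Module.Finite OF H := Module.Finite.trans (integralClosure OF E) _
  have h1 : Module.finrank OF (integralClosure OF E) = 2 := by
    rw [← f.finrank_eq, Module.finrank_prod, Module.finrank_self]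
  have h2 : Module.finrank (integralClosure OF E) L = Module.finrank E V :=  by
    rw [Module.finrank, Module.finrank, Submodule.IsLattice.rank' E L]
  have h3 : Module.finrank OF H = 2 * (Module.finrank E V * (2 * s)) := by
    rw [← Module.finrank_mul_finrank OF (integralClosure OF E) H, h1, Module.finrank_linearMap, h2,
      Module.finrank_pi_fintype, Finset.sum_const, Module.finrank_prod, Module.finrank_self,
      Finset.card_univ, Fintype.card_fin, smul_eq_mul, mul_comm s]
  let b : Module.Basis (Fin (2 * (Module.finrank E V * (2 * s)))) OF H :=
    Module.finBasisOfFinrankEq OF H h3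
  have hsmul : ∀ (a : OF) (g : H), algebraMap OF (integralClosure OF E) a • g = a • g :=
    fun a g => algebraMap_smul _ a g
  refine ⟨b, fun f => ⟨b.repr f, ?_, fun x hx => ?_⟩⟩
  · simp_rw [hsmul]
    exact (b.sum_repr f).symm
  · have h4 : f = ∑ i, x i • b i := hx.trans (Finset.sum_congr rfl fun i _ => hsmul (x i) (b i))
    ext i
    rw [h4, b.repr_sum_self]

/-- Functionals on a fractional ideal in terms of the trace. -/
theorem exists_functional_eq (hE : IsRamifiedQuadratic c u)
    {I : Submodule (integralClosure OF E) E} {p : ℕ} (hI : I = pw E u (-p : ℤ))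
    (ev : I →ₗ[OF] OF) : ∃ α : E, ∀ z : I, algebraMap OF E (ev z) = α * z + c α * c z := by
  have := hE.charZero
  have hu := hE.uniformizer_ne_zero
  obtain ⟨ev₁, ev₂, hev⟩ := exists_functionals hE hI
  have h0 : (u : E) ^ (-p : ℤ) ∈ I := hI ▸ ⟨1, by rw [map_one, mul_one]; rfl⟩
  have hup : (u : E) ^ (1 - p : ℤ) = (u : E) ^ (-p : ℤ) * u := by
    rw [← zpow_add_one₀ hu]
    congr 1
    ring
  have h1 : (u : E) ^ (1 - p : ℤ) ∈ I := hI ▸ ⟨u, hup⟩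
  set e₀ := ev ⟨_, h0⟩
  set e₁ := ev ⟨_, h1⟩
  set U := (u : E) ^ (-p : ℤ) with hU
  have hU0 : U ≠ 0 := zpow_ne_zero _ hu
  refine ⟨algebraMap OF E e₀ / (2 * U) + algebraMap OF E e₁ / (2 * (U * u)), fun z => ?_⟩
  have h2 : z = ev₁ z • (⟨_, h0⟩ : I) + ev₂ z • (⟨_, h1⟩ : I) := Subtype.ext (by
    rw [hev z]
    change _ = ev₁ z • (u : E) ^ (-p : ℤ) + ev₂ z • (u : E) ^ (1 - p : ℤ)
    rw [Algebra.smul_def, Algebra.smul_def])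
  have h3 : ev z = ev₁ z * e₀ + ev₂ z * e₁ := by
    conv_lhs => rw [h2]
    rw [map_add, map_smul, map_smul]
    rfl
  have hcU : c U ≠ 0 := by rwa [Ne, map_eq_zero_iff c c.injective]
  rw [h3, hev z, hup]
  simp only [map_add, map_mul, map_div₀, IsRamifiedQuadratic.c_algebraMap, hE.map_uniformizer,
    map_ofNat]
  field_simp
  ring

variable {d : ℕ} (β : Fin d → (L →ₗ[integralClosure OF E]
    (Fin s → integralClosure OF E × integralClosure OF E)))

/-- The conjugate coordinates dual to the coordinates with respect to the hyperbolic form. -/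
def conjCoord (c : E ≃ₐ[F] E) (u : integralClosure OF E) {s : ℕ} (y : Fin s ⊕ Fin s → E) :
    Fin s ⊕ Fin s → E :=
  Sum.elim (fun t => (u : E)⁻¹ * c (y (.inr t))) fun t => -((u : E)⁻¹ * c (y (.inl t)))

theorem hypForm_eq_sum_conjCoord (x y : Fin s ⊕ Fin s → E) :
    hypForm (c : E →+* E) u s x y = ∑ a, x a * conjCoord c u y a := by
  rw [hypForm_apply, Fintype.sum_sum_type, ← Finset.sum_add_distrib]
  refine Finset.sum_congr rfl fun i _ => ?_
  simp only [conjCoord, Sum.elim_inl, Sum.elim_inr]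
  change (u : E)⁻¹ * (x (.inl i) * c (y (.inr i))) - (u : E)⁻¹ * (x (.inr i) * c (y (.inl i))) = _
  ring

variable {n : ℕ} (e : Module.Basis (Fin n) E V)

/-- The matrix which expresses the entries of a homomorphism and of its conjugate in terms of
coordinates. -/
def coordMatrix (c : E ≃ₐ[F] E) (u : integralClosure OF E) :
    Matrix (Fin d) ((Fin n × (Fin s ⊕ Fin s)) ⊕ (Fin n × (Fin s ⊕ Fin s))) E :=
  Matrix.of fun i => Sum.elim (fun p => extension (β i) (e p.1) p.2)
    fun p => conjCoord c u (extension (β i) (e p.1)) p.2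

variable {β}

/-- Clearing denominators, independence of the `β i` over `OF` gives independence of their matrices
over `F`. A relation over `E` valid for both the matrices and their conjugates remains valid for the
matrices after conjugating its coefficients; sum and difference isolate the `F`-components `y` and
`w` along 1 and `u`. -/
theorem eq_zero_of_vecMul_coordMatrix (hE : IsRamifiedQuadratic c u) (hβ : IsHomBasis OF β)
    (v : Fin d → E) (hv : Matrix.vecMul v (coordMatrix β e c u) = 0) : v = 0 := by
  have hu := hE.uniformizer_ne_zero
  have hchar := hE.charZero
  choose y w hyw using fun i => hE.exists_decomposition (v i)
  have hx : ∀ j a, ∑ i, v i * extension (β i) (e j) a = 0 := fun j a =>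
    congrFun hv (.inl (j, a))
  have hz : ∀ j a, ∑ i, v i * c (extension (β i) (e j) a) = 0 := by
    intro j a
    cases a with
    | inl t =>
      have h1 : ∑ i, v i * -((u : E)⁻¹ * c (extension (β i) (e j) (.inl t))) = 0 :=
        congrFun hv (.inr (j, .inr t))
      have h2 : -(u : E)⁻¹ * ∑ i, v i * c (extension (β i) (e j) (.inl t)) = 0 := by
        rw [← h1, Finset.mul_sum]
        exact Finset.sum_congr rfl fun i _ => by ring
      exact (mul_eq_zero.1 h2).resolve_left (neg_ne_zero.2 (inv_ne_zero hu))
    | inr t =>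
      have h1 : ∑ i, v i * ((u : E)⁻¹ * c (extension (β i) (e j) (.inr t))) = 0 :=
        congrFun hv (.inr (j, .inl t))
      have h2 : (u : E)⁻¹ * ∑ i, v i * c (extension (β i) (e j) (.inr t)) = 0 := by
        rw [← h1, Finset.mul_sum]
        exact Finset.sum_congr rfl fun i _ => by ring
      exact (mul_eq_zero.1 h2).resolve_left (inv_ne_zero hu)
  have hz' : ∀ j a, ∑ i, c (v i) * extension (β i) (e j) a = 0 := by
    intro j a
    have h1 := congrArg c (hz j a)
    rw [map_zero, map_sum] at h1
    simpa only [map_mul, hE.involutive] using h1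
  have key : ∀ y : Fin d → F, (∀ j a, ∑ i, algebraMap F E (y i) * extension (β i) (e j) a = 0) →
      y = 0 := by
    intro y hy
    obtain ⟨⟨t, ht⟩, hty⟩ := IsLocalization.exist_integer_multiples_of_finite
      (nonZeroDivisors OF) y
    choose y' hy' using hty
    have ht0 : algebraMap OF F t ≠ 0 := by
      rw [Ne, FaithfulSMul.algebraMap_eq_zero_iff]
      exact nonZeroDivisors.ne_zero ht
    have h1 : coordHom β y' = 0 := by
      refine e.ext fun j => ?_
      ext a
      rw [coordHom_apply, LinearMap.zero_apply, Finset.sum_apply, Pi.zero_apply]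
      have h2 : algebraMap F E (algebraMap OF F t) *
          ∑ i, algebraMap F E (y i) * extension (β i) (e j) a = 0 := by rw [hy, mul_zero]
      rw [← h2, Finset.mul_sum]
      refine Finset.sum_congr rfl fun i _ => ?_
      have h3 : algebraMap OF F (y' i) = algebraMap OF F t * y i := by
        rw [hy' i]
        exact Algebra.smul_def t (y i)
      rw [Pi.smul_apply, smul_eq_mul, IsScalarTower.algebraMap_apply OF F E, h3, map_mul, mul_assoc]
    have h2 : y' = 0 := coordHom_injective hβ (h1.trans (map_zero _).symm)
    ext i
    have h3 : algebraMap OF F t * y i = 0 := by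
      rw [← Algebra.smul_def]
      refine (hy' i).symm.trans ?_
      rw [h2, Pi.zero_apply, map_zero]
    exact (mul_eq_zero.1 h3).resolve_left ht0
  have hcv : ∀ i, c (v i) = algebraMap F E (y i) - algebraMap F E (w i) * u := fun i => by
    rw [hyw i, map_add, map_mul, AlgEquiv.commutes, AlgEquiv.commutes, hE.map_uniformizer]
    ring
  have hy0 : y = 0 := key y fun j a => by
    have h1 : (2 : E) * ∑ i, algebraMap F E (y i) * extension (β i) (e j) a =
        ∑ i, v i * extension (β i) (e j) a + ∑ i, c (v i) * extension (β i) (e j) a := by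
      rw [← Finset.sum_add_distrib, Finset.mul_sum]
      refine Finset.sum_congr rfl fun i _ => ?_
      rw [hcv i, hyw i]
      ring
    rw [hx, hz', add_zero] at h1
    exact (mul_eq_zero.1 h1).resolve_left two_ne_zero
  have hw0 : w = 0 := key w fun j a => by
    have h1 : (2 * u : E) * ∑ i, algebraMap F E (w i) * extension (β i) (e j) a =
        ∑ i, v i * extension (β i) (e j) a - ∑ i, c (v i) * extension (β i) (e j) a := by
      rw [← Finset.sum_sub_distrib, Finset.mul_sum]
      refine Finset.sum_congr rfl fun i _ => ?_
      rw [hcv i, hyw i]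
      ring
    rw [hx, hz', sub_zero] at h1
    exact (mul_eq_zero.1 h1).resolve_left (mul_ne_zero two_ne_zero hu)
  ext i
  rw [hyw i, hy0, hw0]
  simp

/-- Over `E` the coordinates of a homomorphism are thus equivalent to two independent matrices, one
for the map and one for its conjugate. The coordinate matrix is square by `hd`, so injectivity
suffices. -/
theorem exists_inverse_coordMatrix (hE : IsRamifiedQuadratic c u) (hβ : IsHomBasis OF β)
    (hd : d = 2 * (n * (2 * s))) :
    ∃ C : Matrix ((Fin n × (Fin s ⊕ Fin s)) ⊕ (Fin n × (Fin s ⊕ Fin s))) (Fin d) E,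
      coordMatrix β e c u * C = 1 ∧ C * coordMatrix β e c u = 1 := by
  classical
  have hcard : Fintype.card ((Fin n × (Fin s ⊕ Fin s)) ⊕ (Fin n × (Fin s ⊕ Fin s))) = d := by
    simp only [Fintype.card_sum, Fintype.card_prod, Fintype.card_fin]
    rw [hd]
    ring
  let ε := Fintype.equivFinOfCardEq hcard
  let B := (coordMatrix β e c u).submatrix id ε.symm
  have hB : IsUnit B := by
    rw [← Matrix.vecMul_injective_iff_isUnit]
    intro v w hvw
    rw [← sub_eq_zero]
    refine eq_zero_of_vecMul_coordMatrix e hE hβ _ ?_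
    have h1 : Matrix.vecMul (v - w) B = 0 := by
      rw [Matrix.sub_vecMul, sub_eq_zero]
      exact hvw
    ext t
    have h2 := congrFun h1 (ε t)
    simpa [B, Matrix.vecMul, dotProduct] using h2
  have hBdet : IsUnit B.det := (Matrix.isUnit_iff_isUnit_det B).1 hB
  have hB' : coordMatrix β e c u = B.submatrix id ε := by
    ext i t
    simp [B]
  refine ⟨B⁻¹.submatrix ε id, ?_, ?_⟩
  · rw [hB', Matrix.submatrix_mul_equiv, Matrix.mul_nonsing_inv _ hBdet, Matrix.submatrix_id_id]
  · rw [hB', ← Matrix.submatrix_mul _ _ ε id ε Function.bijective_id,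
      Matrix.nonsing_inv_mul _ hBdet, Matrix.submatrix_one_equiv]

end

end RamifiedExtension

/-! ### The generic fibre over E as a matrix equation. -/

section GenericFibre

universe w

variable {OF F : Type*} [CommRing OF] [IsDomain OF] [IsDiscreteValuationRing OF]
  [Field F] [CharZero F] [Algebra OF F] [IsFractionRing OF F]
  {E : Type w} [Field E] [Algebra F E] [Algebra OF E] [IsScalarTower OF F E]
  [IsDiscreteValuationRing (integralClosure OF E)] [IsFractionRing (integralClosure OF E) E]
  {c : E ≃ₐ[F] E} (u : integralClosure OF E)
  {V : Type*} [AddCommGroup V] [Module E V] [FiniteDimensional E V]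
  (h : V →ₗ[E] V →ₛₗ[(c : E →+* E)] E) {L : Submodule (integralClosure OF E) V}
  [Submodule.IsLattice E L] {s d n : ℕ}
  (β : Fin d → (L →ₗ[integralClosure OF E] (Fin s → integralClosure OF E × integralClosure OF E)))
  (e : Module.Basis (Fin n) E V) {S : Type*} [CommRing S] [Algebra E S]

/-- `ξ` satisfies the equations of the scheme of homomorphisms of hermitian modules. -/
def IsHermPoint (ξ : Fin d → S) : Prop :=
  ∀ v w, ∀ ev : valueModule OF (fun x y : L => h x y) (hypPairing (OF := OF) c u s) →ₗ[OF] OF,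
    ∑ i, ∑ j, algebraMap E S (algebraMap OF E (ev ⟨_, right_mem OF (fun x y : L => h x y)
      (hypPairing (OF := OF) c u s) (β i v) (β j w)⟩)) * (ξ i * ξ j) =
    algebraMap E S (algebraMap OF E (ev ⟨_, left_mem OF (fun x y : L => h x y)
      (hypPairing (OF := OF) c u s) v w⟩))

/-- The matrix of the homomorphism with coordinates `ξ`. -/
def pointMatrix (ξ : Fin d → S) : Matrix (Fin n) (Fin s ⊕ Fin s) S :=
  Matrix.of fun j a => ∑ i, ξ i * algebraMap E S (extension (β i) (e j) a)

/-- The conjugate matrix of the homomorphism with coordinates `ξ`. -/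
def conjPointMatrix (c : E ≃ₐ[F] E) (ξ : Fin d → S) : Matrix (Fin n) (Fin s ⊕ Fin s) S :=
  Matrix.of fun j a => ∑ i, ξ i * algebraMap E S (conjCoord c u (extension (β i) (e j)) a)

/-- The hermitian form pulled back along the homomorphism with coordinates `ξ`. -/
def pullbackForm (c : E ≃ₐ[F] E) (ξ : Fin d → S) : V →ₗ[E] V →ₛₗ[(c : E →+* E)] S :=
  LinearMap.mk₂'ₛₗ (RingHom.id E) (c : E →+* E)
    (fun v w => ∑ i, ∑ l, algebraMap E S (hypForm (c : E →+* E) u s (extension (β i) v)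
      (extension (β l) w)) * (ξ i * ξ l))
    (fun v v' w => by simp [add_mul, Finset.sum_add_distrib])
    (fun a v w => by simp [Algebra.smul_def (A := S), Finset.mul_sum, mul_assoc])
    (fun v w w' => by simp [add_mul, Finset.sum_add_distrib])
    (fun a v w => by simp [Algebra.smul_def (A := S), Finset.mul_sum, mul_assoc])

theorem pullbackForm_apply (ξ : Fin d → S) (v w : V) :
    pullbackForm u β c ξ v w = ∑ i, ∑ l, algebraMap E S (hypForm (c : E →+* E) u s
      (extension (β i) v) (extension (β l) w)) * (ξ i * ξ l) := rfl

theorem pointMatrix_mul_transpose (ξ : Fin d → S) (j k : Fin n) :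
    (pointMatrix β e ξ * (conjPointMatrix u β e c ξ).transpose) j k =
      pullbackForm u β c ξ (e j) (e k) := by
  rw [pullbackForm_apply, Matrix.mul_apply]
  simp only [pointMatrix, conjPointMatrix, Matrix.transpose_apply, Matrix.of_apply,
    hypForm_eq_sum_conjCoord, map_sum, map_mul, Finset.sum_mul, Finset.mul_sum]
  conv_rhs => rw [Finset.sum_comm]
  rw [Finset.sum_comm]
  refine Finset.sum_congr rfl fun i _ => ?_
  rw [Finset.sum_comm]
  exact Finset.sum_congr rfl fun l _ => Finset.sum_congr rfl fun a _ => by ring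

variable {u β h}

theorem IsHermPoint.pullbackForm_eq (hE : IsRamifiedQuadratic c u) {p : ℕ}
    (hI : valueModule OF (fun x y : L => h x y) (hypPairing (OF := OF) c u s) = pw E u (-p : ℤ))
    {ξ : Fin d → S} (hξ : IsHermPoint u h β ξ) (v w : L) :
    pullbackForm u β c ξ v w = algebraMap E S (h v w) := by
  obtain ⟨ev₁, ev₂, hev⟩ := exists_functionals hE hI
  have h1 := hev ⟨_, left_mem OF (fun x y : L => h x y) (hypPairing (OF := OF) c u s) v w⟩
  change h v w = _ at h1
  rw [h1, map_add, map_mul, map_mul, ← hξ v w ev₁, ← hξ v w ev₂, pullbackForm_apply]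
  simp only [Finset.sum_mul, ← Finset.sum_add_distrib]
  refine Finset.sum_congr rfl fun i _ => Finset.sum_congr rfl fun l _ => ?_
  have h2 := hev ⟨_, right_mem OF (fun x y : L => h x y) (hypPairing (OF := OF) c u s) (β i v)
    (β l w)⟩
  change hypPairing (OF := OF) c u s (β i v) (β l w) = _ at h2
  have h3 := congrArg (algebraMap E S) h2
  rw [map_add, map_mul, map_mul] at h3
  rw [extension_apply, extension_apply, ← hypPairing_eq, h3]
  ring

/-- Every functional on the value module has the form `z ↦ α z + c α * c z`, so the equation
attached to it combines the pullback identities for `(v, w)` and `(w, v)`. -/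
theorem isHermPoint_of_pullbackForm_eq (hE : IsRamifiedQuadratic c u)
    (hh : ∀ x y, h y x = c (h x y)) {p : ℕ}
    (hI : valueModule OF (fun x y : L => h x y) (hypPairing (OF := OF) c u s) = pw E u (-p : ℤ))
    {ξ : Fin d → S} (hξ : ∀ v w, pullbackForm u β c ξ v w = algebraMap E S (h v w)) :
    IsHermPoint u h β ξ := by
  intro v w ev
  obtain ⟨α, hα⟩ := exists_functional_eq hE hI ev
  simp only [hα]
  rw [← hh, map_add, map_mul, map_mul, ← hξ v w, ← hξ w v, pullbackForm_apply, pullbackForm_apply,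
    Finset.sum_comm (γ := Fin d) (f := fun i l => algebraMap E S (hypForm (c : E →+* E) u s
      (extension (β i) w) (extension (β l) v)) * (ξ i * ξ l))]
  simp only [Finset.mul_sum, ← Finset.sum_add_distrib]
  refine Finset.sum_congr rfl fun i _ => Finset.sum_congr rfl fun l _ => ?_
  rw [hE.isRamifiedInvolution.hypForm_conj s (extension (β i) v), extension_apply, extension_apply, ← hypPairing_eq, map_add,
    map_mul, map_mul]
  change _ = _ + _ * (algebraMap E S (c (hypPairing c u s ((β i) v) ((β l) w))) * _)
  ring

/-- The pulled back form is sesquilinear on `V`, so it is enough to compare Gram matrices on the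
basis `e`, where the equations read `X Zᵀ = T`. -/
theorem isHermPoint_iff (hE : IsRamifiedQuadratic c u) (hh : ∀ x y, h y x = c (h x y)) {p : ℕ}
    (hI : valueModule OF (fun x y : L => h x y) (hypPairing (OF := OF) c u s) = pw E u (-p : ℤ))
    (he : ∀ j, e j ∈ L) (ξ : Fin d → S) :
    IsHermPoint u h β ξ ↔ pointMatrix β e ξ * (conjPointMatrix u β e c ξ).transpose =
      (Matrix.of fun j k => h (e j) (e k)).map (algebraMap E S) := by
  constructor
  · intro hξ
    ext j k
    rw [pointMatrix_mul_transpose]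
    exact hξ.pullbackForm_eq hE hI ⟨_, he j⟩ ⟨_, he k⟩
  · intro hξ
    refine isHermPoint_of_pullbackForm_eq hE hh hI ?_
    have h1 : pullbackForm u β c ξ = LinearMap.mk₂'ₛₗ (RingHom.id E) (c : E →+* E)
        (fun v w => algebraMap E S (h v w)) (fun v v' w => by simp)
        (fun a v w => by simp [Algebra.smul_def]) (fun v w w' => by simp)
        (fun a v w => by simp [Algebra.smul_def]) := by
      refine e.ext fun j => e.ext fun k => ?_
      rw [← pointMatrix_mul_transpose, hξ]
      rfl
    intro v w
    rw [h1]
    rfl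

theorem vecMul_coordMatrix_map (ξ : Fin d → S) :
    Matrix.vecMul ξ ((coordMatrix β e c u).map (algebraMap E S)) =
      Sum.elim (fun p => pointMatrix β e ξ p.1 p.2) fun p => conjPointMatrix u β e c ξ p.1 p.2 := by
  ext t
  cases t <;> rfl

/-- `exists_inverse_coordMatrix` exchanges the coordinates `ξ` for the entries of `X` and `Z`,
subject only to `X Zᵀ = T`. Here `T` is invertible by nondegeneracy, and the upper and lower bounds
for the dimension agree. -/
theorem ringKrullDim_of_universal_hermPoint (hE : IsRamifiedQuadratic c u)
    (hh : ∀ x y, h y x = c (h x y)) (hnd : ∀ x, (∀ y, h x y = 0) → x = 0) {p : ℕ}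
    (hI : valueModule OF (fun x y : L => h x y) (hypPairing (OF := OF) c u s) = pw E u (-p : ℤ))
    (he : ∀ j, e j ∈ L) (hβ : IsHomBasis OF β) (hd : d = 2 * (n * (2 * s))) (hns : n ≤ 2 * s)
    (ξ : Fin d → S) (hξ : IsHermPoint u h β ξ) (hgen : Algebra.adjoin E (Set.range ξ) = ⊤)
    (huniv : ∀ (K : Type w) [Field K] [Algebra E K] (x : Fin d → K), IsHermPoint u h β x →
      ∃ φ : S →ₐ[E] K, ∀ i, φ (ξ i) = x i) :
    ringKrullDim S = (n * (2 * s) + n * (2 * s - n) : ℕ) := by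
  obtain ⟨C, hC, hC'⟩ := exists_inverse_coordMatrix e hE hβ hd
  have hcard : Fintype.card (Fin s ⊕ Fin s) = 2 * s := by
    rw [Fintype.card_sum, Fintype.card_fin, two_mul]
  have hT : IsUnit (Matrix.of fun j k => h (e j) (e k)).det := by
    rw [← Matrix.isUnit_iff_isUnit_det, ← Matrix.vecMul_injective_iff_isUnit]
    intro a b hab
    have h1 : ∑ j, (a j - b j) • e j = 0 := by
      refine hnd _ fun y => ?_
      have h2 : h (∑ j, (a j - b j) • e j) = 0 := by
        refine e.ext fun k => ?_
        have h3 := congrFun hab k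
        simp only [Matrix.vecMul, dotProduct, Matrix.of_apply] at h3
        rw [map_sum, LinearMap.sum_apply, LinearMap.zero_apply]
        simp only [map_smul, LinearMap.smul_apply, smul_eq_mul, sub_mul, Finset.sum_sub_distrib]
        rw [h3, sub_self]
      rw [h2, LinearMap.zero_apply]
    ext j
    exact sub_eq_zero.1 (Fintype.linearIndependent_iff.1 e.linearIndependent _ h1 j)
  have hXZ := (isHermPoint_iff e hE hh hI he ξ).1 hξ
  have hgen' : Algebra.adjoin E (Set.range (fun p : Fin n × (Fin s ⊕ Fin s) =>
      pointMatrix β e ξ p.1 p.2) ∪ Set.range (fun p : Fin n × (Fin s ⊕ Fin s) =>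
        conjPointMatrix u β e c ξ p.1 p.2)) = ⊤ := by
    rw [eq_top_iff, ← hgen]
    refine Algebra.adjoin_le ?_
    rintro _ ⟨i, rfl⟩
    have h1 : Matrix.vecMul (Matrix.vecMul ξ ((coordMatrix β e c u).map (algebraMap E S)))
        (C.map (algebraMap E S)) = ξ := by
      rw [Matrix.vecMul_vecMul, ← Matrix.map_mul, hC, Matrix.map_one _ (map_zero _) (map_one _),
        Matrix.vecMul_one]
    rw [← congrFun h1 i, vecMul_coordMatrix_map]
    refine sum_mem fun t _ => mul_mem ?_ (Subalgebra.algebraMap_mem _ _)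
    cases t with
    | inl p => exact Algebra.subset_adjoin (Or.inl ⟨p, rfl⟩)
    | inr p => exact Algebra.subset_adjoin (Or.inr ⟨p, rfl⟩)
  refine le_antisymm ?_ ?_
  · have h1 := ringKrullDim_le_of_generated hT _ _ hXZ hgen'
    rwa [hcard] at h1
  · have hcard' : Fintype.card (Fin n ⊕ Fin (2 * s - n)) = Fintype.card (Fin s ⊕ Fin s) := by
      rw [hcard, Fintype.card_sum, Fintype.card_fin, Fintype.card_fin]
      omega
    have h1 := le_ringKrullDim_of_universal (Fintype.equivOfCardEq hcard') _ _ hXZ hgen' (by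
      intro K _ _ X' Z' hXZ'
      let x : Fin d → K := Matrix.vecMul (Sum.elim (fun p => X' p.1 p.2) fun p => Z' p.1 p.2)
        (C.map (algebraMap E K))
      have h1 := vecMul_coordMatrix_map (β := β) (c := c) (u := u) e x
      rw [Matrix.vecMul_vecMul, ← Matrix.map_mul, hC', Matrix.map_one _ (map_zero _) (map_one _),
        Matrix.vecMul_one] at h1
      have hX : pointMatrix β e x = X' := by
        ext j a
        exact (congrFun h1 (.inl (j, a))).symm
      have hZ : conjPointMatrix u β e c x = Z' := by
        ext j a
        exact (congrFun h1 (.inr (j, a))).symm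
      obtain ⟨φ, hφ⟩ := huniv K x ((isHermPoint_iff e hE hh hI he x).2 (by rw [hX, hZ, hXZ']))
      refine ⟨φ, ?_, ?_⟩
      · rw [← hX]
        ext j a
        simp [pointMatrix, hφ]
      · rw [← hZ]
        ext j a
        simp [conjPointMatrix, hφ])
    rwa [hcard, Fintype.card_fin] at h1

end GenericFibre

/-! ### Base change of presented algebras. -/

section BaseChange

/-- A finite extension of the base field gives an integral injective extension of rings, which
preserves the Krull dimension. -/
theorem ringKrullDim_tensorProduct_eq {R K K' A : Type*} [CommRing R] [Field K] [Field K']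
    [CommRing A] [Algebra R K] [Algebra R K'] [Algebra K K'] [IsScalarTower R K K'] [Algebra R A]
    [FiniteDimensional K K'] : ringKrullDim (K ⊗[R] A) = ringKrullDim (K' ⊗[R] A) := by
  have h1 : ringKrullDim (K ⊗[R] A) = ringKrullDim ((K ⊗[R] A) ⊗[K] K') :=
    ringKrullDim_eq_of_isIntegral
  rw [h1, ringKrullDim_eq_of_ringEquiv (Algebra.TensorProduct.comm K (K ⊗[R] A) K').toRingEquiv]
  exact ringKrullDim_eq_of_ringEquiv
    (Algebra.TensorProduct.cancelBaseChange R K K' K' A).toRingEquiv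

variable {R σ : Type*} [CommRing R] {G : Set (MvPolynomial σ R)} {K : Type*} [Field K] [Algebra R K]

theorem aeval_one_tmul (P : MvPolynomial σ R) :
    MvPolynomial.aeval (fun i => (1 : K) ⊗ₜ[R]
      (Ideal.Quotient.mk (Ideal.span G) (MvPolynomial.X i))) P =
      (1 : K) ⊗ₜ[R] (Ideal.Quotient.mk (Ideal.span G) P) := by
  have h1 : MvPolynomial.aeval (fun i => (1 : K) ⊗ₜ[R]
      (Ideal.Quotient.mk (Ideal.span G) (MvPolynomial.X i))) =
      (Algebra.TensorProduct.includeRight : _ →ₐ[R] K ⊗[R] (MvPolynomial σ R ⧸ Ideal.span G)).comp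
        (Ideal.Quotient.mkₐ R (Ideal.span G)) := by
    refine MvPolynomial.algHom_ext fun i => ?_
    rw [MvPolynomial.aeval_X]
    rfl
  rw [h1]
  rfl

theorem adjoin_one_tmul_eq_top : Algebra.adjoin K (Set.range fun i : σ =>
    (1 : K) ⊗ₜ[R] (Ideal.Quotient.mk (Ideal.span G) (MvPolynomial.X i))) = ⊤ := by
  have h1 : Algebra.adjoin R (Set.range fun i : σ =>
      Ideal.Quotient.mk (Ideal.span G) (MvPolynomial.X i)) = ⊤ := by
    have h2 := (Algebra.map_top (Ideal.Quotient.mkₐ R (Ideal.span G)))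
    rw [← MvPolynomial.adjoin_range_X, AlgHom.map_adjoin, ← Set.range_comp,
      (AlgHom.range_eq_top _).2 (Ideal.Quotient.mkₐ_surjective R _)] at h2
    exact h2
  rw [← Algebra.TensorProduct.adjoin_one_tmul_image_eq_top _ h1, ← Set.range_comp]
  rfl

/-- Points of the base change of a presented algebra. -/
theorem exists_algHom_tensorProduct {K' : Type*} [Field K'] [Algebra K K'] (x : σ → K')
    (hx : ∀ P ∈ G, MvPolynomial.eval₂ ((algebraMap K K').comp (algebraMap R K)) x P = 0) :
    ∃ φ : K ⊗[R] (MvPolynomial σ R ⧸ Ideal.span G) →ₐ[K] K', ∀ i,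
      φ ((1 : K) ⊗ₜ[R] (Ideal.Quotient.mk (Ideal.span G) (MvPolynomial.X i))) = x i := by
  let : Algebra R K' := ((algebraMap K K').comp (algebraMap R K)).toAlgebra
  have : IsScalarTower R K K' := IsScalarTower.of_algebraMap_eq' rfl
  let φ := (algHomEquivSolutions (S := K') G).symm ⟨x, fun P hP => hx P hP⟩
  refine ⟨Algebra.TensorProduct.lift (Algebra.ofId K K') φ fun _ _ => Commute.all _ _,
    fun i => ?_⟩
  rw [Algebra.TensorProduct.lift_tmul, map_one, one_mul]
  exact MvPolynomial.aeval_X _ i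

end BaseChange

/-! ### The dimension of the generic fibre. -/

section GenericFibre

variable {OF F : Type*} [CommRing OF] [IsDomain OF] [IsDiscreteValuationRing OF]
  [Field F] [CharZero F] [Algebra OF F] [IsFractionRing OF F]
  {E : Type*} [Field E] [Algebra F E] [Algebra OF E] [IsScalarTower OF F E]
  [IsDiscreteValuationRing (integralClosure OF E)] [IsFractionRing (integralClosure OF E) E]
  {c : E ≃ₐ[F] E} {u : integralClosure OF E}
  {V : Type*} [AddCommGroup V] [Module E V] [FiniteDimensional E V]
  {h : V →ₗ[E] V →ₛₗ[(c : E →+* E)] E} {L : Submodule (integralClosure OF E) V}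
  [Submodule.IsLattice E L] {s d n : ℕ}
  {β : Fin d → (L →ₗ[integralClosure OF E] (Fin s → integralClosure OF E × integralClosure OF E))}

/-- The value is `2 n (2 s) - n ^ 2`, the rank of the module of homomorphisms minus the `n ^ 2`
conditions imposed by a hermitian Gram matrix. It is computed after base change to `E`. -/
theorem hermDim_eq (hE : IsRamifiedQuadratic c u)
    (hh : ∀ x y, h y x = c (h x y)) (hnd : ∀ x, (∀ y, h x y = 0) → x = 0)
    (hβ : IsHomBasis OF β) (hn : Module.finrank E V = n) (hd : d = 2 * (n * (2 * s)))
    (hns : n ≤ 2 * s) (hs : 0 < s) :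
    hermDim OF F (fun x y : L => h x y) (hypPairing (OF := OF) c u s) β =
      n * (2 * s) + n * (2 * s - n) := by
  have hc := hE.isRamifiedInvolution
  obtain ⟨p, -, -, hI⟩ := exists_valueModule_eq (h := h) (L := L) hE hs
  obtain ⟨e, a, he, -⟩ := hc.exists_adapted_basis (le_refl L) hn
  have heL : ∀ j, e j ∈ L := fun j => (he _).2 fun i => by
    rw [Module.Basis.repr_self, Finsupp.single_apply]
    split_ifs
    · exact mem_pw_zero.2 ⟨1, map_one _⟩
    · exact zero_mem _
  obtain ⟨_, _⟩ := hE.isGalois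
  rw [hermDim, ringKrullDim_tensorProduct_eq (K' := E)]
  have hdim := ringKrullDim_of_universal_hermPoint (S := E ⊗[OF] HermRing OF
    (fun x y : L => h x y) (hypPairing (OF := OF) c u s) β) e hE hh hnd hI heL hβ hd hns
    (fun i => (1 : E) ⊗ₜ[OF] (Ideal.Quotient.mk (hermIdeal OF (fun x y : L => h x y)
      (hypPairing (OF := OF) c u s) β) (MvPolynomial.X i))) ?_ adjoin_one_tmul_eq_top ?_
  · rw [hdim]
    rfl
  · intro v w ev
    have h1 := aeval_hermRelation (β := β) (fun i => (1 : E) ⊗ₜ[OF] (Ideal.Quotient.mk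
      (hermIdeal OF (fun x y : L => h x y) (hypPairing (OF := OF) c u s) β)
      (MvPolynomial.X i))) v w ev
    have h2 : Ideal.Quotient.mk (hermIdeal OF (fun x y : L => h x y)
        (hypPairing (OF := OF) c u s) β) (hermRelation OF (fun x y : L => h x y)
        (hypPairing (OF := OF) c u s) β v w ev) = 0 :=
      Ideal.Quotient.eq_zero_iff_mem.2 (Ideal.subset_span ⟨v, w, ev, rfl⟩)
    have h3 : (1 : E) ⊗ₜ[OF] Ideal.Quotient.mk (hermIdeal OF (fun x y : L => h x y)
        (hypPairing (OF := OF) c u s) β) (hermRelation OF (fun x y : L => h x y)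
        (hypPairing (OF := OF) c u s) β v w ev) = _ := (aeval_one_tmul _).symm.trans h1
    rw [h2, TensorProduct.tmul_zero] at h3
    simp only [← IsScalarTower.algebraMap_apply OF E]
    exact sub_eq_zero.1 h3.symm
  · intro K _ _ x hx
    refine exists_algHom_tensorProduct x ?_
    rintro _ ⟨v, w, ev, rfl⟩
    rw [hermRelation]
    simp only [MvPolynomial.eval₂_sub, MvPolynomial.eval₂_sum, MvPolynomial.eval₂_mul,
      MvPolynomial.eval₂_C, MvPolynomial.eval₂_X]
    exact sub_eq_zero.2 (hx v w ev)

end GenericFibre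

/-! ### The Siegel polynomial: values, uniqueness, derivative. -/

section SiegelPolynomial

variable {α : Type*}

/-- The polynomial `∑ X ^ (2 ℓ) ∏_{i < t / 2} (1 - q ^ (2 i) X ^ 2)`. -/
def siegelPolynomial (q : ℕ) (Y : Finset α) (ℓ t : α → ℕ) : ℤ[X] :=
  ∑ a ∈ Y, X ^ (2 * ℓ a) * ∏ i ∈ Finset.range (t a / 2), (1 - C ((q : ℤ) ^ (2 * i)) * X ^ 2)

/-- Among the `r + t a / 2` factors of a density term the first `r` form the normalizing product, by
`i = r + s - j`, and the others are `1 - q ^ (2 i) X ^ 2` at `X = q ^ (-s)`. The remaining powers of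
`q` combine to `X ^ (2 ℓ a)`. -/
theorem aeval_siegelPolynomial {q : ℕ} (hq : 1 < q) (Y : Finset α) (ℓ t : α → ℕ)
    (ht : ∀ a ∈ Y, Even (t a)) (r s : ℕ) :
    aeval (((q : ℝ) ^ s)⁻¹) (siegelPolynomial q Y ℓ t) =
      (∑ a ∈ Y, ((q : ℝ) ^ (2 * r * ℓ a) / (q : ℝ) ^ (2 * (r + s) * ℓ a)) *
        ∏ j ∈ Finset.range ((2 * r + t a) / 2), (1 - (q : ℝ) ^ (2 * j) / (q : ℝ) ^ (2 * (r + s)))) /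
      ∏ i ∈ Finset.Icc (s + 1) (r + s), (1 - ((q : ℝ) ^ (2 * i))⁻¹) := by
  have hq0 : (q : ℝ) ≠ 0 := by positivity
  have hq1 : (1 : ℝ) < q := by exact_mod_cast hq
  have h0 : ∏ i ∈ Finset.Icc (s + 1) (r + s), (1 - ((q : ℝ) ^ (2 * i))⁻¹) ≠ 0 := by
    refine Finset.prod_ne_zero_iff.2 fun i hi => ?_
    rw [Finset.mem_Icc] at hi
    have h1 : ((q : ℝ) ^ (2 * i))⁻¹ < 1 := inv_lt_one_of_one_lt₀ (one_lt_pow₀ hq1 (by omega))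
    exact (sub_pos.2 h1).ne'
  have h1 : ∏ j ∈ Finset.range r, (1 - (q : ℝ) ^ (2 * j) / (q : ℝ) ^ (2 * (r + s))) =
      ∏ i ∈ Finset.Icc (s + 1) (r + s), (1 - ((q : ℝ) ^ (2 * i))⁻¹) := by
    refine Finset.prod_bij (fun j _ => r + s - j) (fun j hj => ?_) (fun j hj k hk hjk => ?_)
      (fun i hi => ?_) fun j hj => ?_
    · rw [Finset.mem_range] at hj
      rw [Finset.mem_Icc]
      omega
    · rw [Finset.mem_range] at hj hk
      omega
    · rw [Finset.mem_Icc] at hi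
      exact ⟨r + s - i, by rw [Finset.mem_range]; omega, by omega⟩
    · rw [Finset.mem_range] at hj
      have h2 : 2 * (r + s) = 2 * j + 2 * (r + s - j) := by omega
      rw [h2, pow_add, div_mul_cancel_left₀ (pow_ne_zero _ hq0)]
  rw [eq_div_iff h0, siegelPolynomial, map_sum, Finset.sum_mul]
  refine Finset.sum_congr rfl fun a ha => ?_
  obtain ⟨k, hk⟩ := ht a ha
  have h2 : (2 * r + t a) / 2 = r + k := by omega
  have h3 : t a / 2 = k := by omega
  rw [h2, h3, Finset.prod_range_add, h1, map_mul, map_pow, aeval_X, map_prod]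
  have h4 : (q : ℝ) ^ (2 * r * ℓ a) / (q : ℝ) ^ (2 * (r + s) * ℓ a) =
      (((q : ℝ) ^ s)⁻¹) ^ (2 * ℓ a) := by
    rw [inv_pow, ← pow_mul, div_eq_iff (pow_ne_zero _ hq0), eq_inv_mul_iff_mul_eq₀
      (pow_ne_zero _ hq0), ← pow_add]
    congr 1
    ring
  have h5 : ∀ i, aeval (((q : ℝ) ^ s)⁻¹) (1 - C ((q : ℤ) ^ (2 * i)) * X ^ 2 : ℤ[X]) =
      1 - (q : ℝ) ^ (2 * (r + i)) / (q : ℝ) ^ (2 * (r + s)) := by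
    intro i
    have h6 : (q : ℝ) ^ (2 * (r + i)) / (q : ℝ) ^ (2 * (r + s)) =
        (q : ℝ) ^ (2 * i) * (((q : ℝ) ^ s)⁻¹) ^ 2 := by
      rw [inv_pow, ← pow_mul, div_eq_iff (pow_ne_zero _ hq0), mul_assoc, mul_comm s 2, mul_add,
        mul_add, pow_add, pow_add]
      field_simp
    rw [h6]
    simp
  simp only [h5]
  rw [h4]
  ring

theorem eq_of_aeval_inv_pow_eq {q : ℕ} (hq : 1 < q) {P Q : ℤ[X]}
    (hPQ : ∀ s : ℕ, aeval (((q : ℝ) ^ s)⁻¹) P = aeval (((q : ℝ) ^ s)⁻¹) Q) : P = Q := by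
  have hq1 : (1 : ℝ) < q := by exact_mod_cast hq
  refine Polynomial.map_injective (Int.castRingHom ℝ) Int.cast_injective ?_
  refine Polynomial.eq_of_infinite_eval_eq _ _ ((Set.infinite_range_of_injective
    (f := fun s : ℕ => (((q : ℝ) ^ s)⁻¹)) fun s s' hss => ?_).mono ?_)
  · exact pow_right_injective₀ (by positivity) hq1.ne' (inv_injective hss)
  · rintro _ ⟨s, rfl⟩
    have h1 := hPQ s
    rw [aeval_def, aeval_def, eval₂_eq_eval_map, eval₂_eq_eval_map] at h1
    exact h1

/-- The factor with `i = 0` is `1 - X ^ 2`, present because `2 ≤ t a`. It vanishes at 1 with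
derivative `-2`, so nothing else of the product rule survives. -/
theorem derivative_siegelPolynomial {q : ℕ} (Y : Finset α) (ℓ t : α → ℕ)
    (ht : ∀ a ∈ Y, Even (t a) ∧ 2 ≤ t a) :
    -(derivative (siegelPolynomial q Y ℓ t)).eval 1 =
      2 * ∑ a ∈ Y, ∏ i ∈ Finset.Icc 1 (t a / 2 - 1), (1 - (q : ℤ) ^ (2 * i)) := by
  rw [siegelPolynomial, derivative_sum, eval_finsetSum, ← Finset.sum_neg_distrib, Finset.mul_sum]
  refine Finset.sum_congr rfl fun a ha => ?_
  obtain ⟨k, hk⟩ : ∃ k, t a / 2 = k + 1 := ⟨t a / 2 - 1, by have := (ht a ha).2; omega⟩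
  rw [hk, Nat.add_sub_cancel, Finset.prod_range_succ', ← mul_assoc, derivative_mul, eval_add,
    eval_mul, eval_mul, eval_mul, eval_prod, ← Finset.Ico_add_one_right_eq_Icc,
    Finset.prod_Ico_eq_prod_range, Nat.add_sub_cancel]
  simp [add_comm 1, mul_comm]

end SiegelPolynomial

theorem IsRamifiedInvolution.card_leftKer_eq_pow {R E : Type*} [CommRing R] [IsDomain R]
    [IsDiscreteValuationRing R] [Field E] [Algebra R E] [IsFractionRing R E] {c : E →+* E} {u : R}
    {V : Type*} [AddCommGroup V] [Module E V] [Module R V] [IsScalarTower R E V]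
    {h : V →ₗ[E] V →ₛₗ[c] E} {L : Submodule R V} (hc : IsRamifiedInvolution c u)
    (hL : L ≤ pwDual u h L) {n : ℕ} (e : Module.Basis (Fin n) E V)
    (he : ∀ v, v ∈ L ↔ ∀ i, e.repr v i ∈ pw E u 0) (a : Fin n → ℕ)
    (f : (pwDual u h L ⧸ L.submoduleOf (pwDual u h L)) ≃ₗ[R] (∀ i, R ⧸ Ideal.span {u ^ a i})) :
    Nat.card (leftKer fun i j => fracResidue R (algebraMap R E u * h (e i) (e j))) =
      Nat.card (IsLocalRing.ResidueField R) ^ Nat.card {i // a i ≠ 0} := by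
  rw [hc.card_leftKer_eq hL e he, card_ker_lsmul hc.irreducible a f]

/-! ### Local densities and types of lattices. -/

section Density

variable {OF F : Type*} [CommRing OF] [IsDomain OF] [IsDiscreteValuationRing OF]
  [Field F] [CharZero F] [Algebra OF F] [IsFractionRing OF F]
  {E : Type*} [Field E] [Algebra F E] [Algebra OF E] [IsScalarTower OF F E]
  [IsDiscreteValuationRing (integralClosure OF E)] [IsFractionRing (integralClosure OF E) E]
  {c : E ≃ₐ[F] E} {u : integralClosure OF E}
  {V : Type*} [AddCommGroup V] [Module E V] [FiniteDimensional E V]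
  {h : V →ₗ[E] V →ₛₗ[(c : E →+* E)] E} {L : Submodule (integralClosure OF E) V}
  [Submodule.IsLattice E L] {s d n : ℕ}

/-- Any two bases parametrize the same linear maps, so comparing coordinates gives an isomorphism of
free `OF`-modules. -/
theorem IsHomBasis.card_eq
    {β : Fin d → (L →ₗ[integralClosure OF E] (Fin s → integralClosure OF E × integralClosure OF E))}
    (hβ : IsHomBasis OF β) (hE : IsRamifiedQuadratic c u) :
    d = 2 * (Module.finrank E V * (2 * s)) := by
  obtain ⟨β', hβ'⟩ := exists_isHomBasis hE L s
  have hinj := coordHom_injective hβ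
  have hinj' := coordHom_injective hβ'
  have hex : ∀ x, ∃ y, coordHom β' y = coordHom β x := fun x =>
    exists_coordHom_eq hβ' fun v hv => coordHom_mem x hv
  have hex' : ∀ x, ∃ y, coordHom β y = coordHom β' x := fun x =>
    exists_coordHom_eq hβ fun v hv => coordHom_mem x hv
  have hsmul : ∀ (r : OF) (x : Fin d → OF), coordHom β (r • x) = algebraMap OF E r • coordHom β x :=
    fun r x => by
      ext1 v
      simp only [LinearMap.smul_apply, coordHom_apply, Finset.smul_sum, Pi.smul_apply, smul_eq_mul,
        map_mul, mul_smul]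
  have hsmul' : ∀ (r : OF) x, coordHom β' (r • x) = algebraMap OF E r • coordHom β' x :=
    fun r x => by
      ext1 v
      simp only [LinearMap.smul_apply, coordHom_apply, Finset.smul_sum, Pi.smul_apply, smul_eq_mul,
        map_mul, mul_smul]
  choose f hf using hex
  choose g hg using hex'
  let φ : (Fin d → OF) ≃ₗ[OF] (Fin (2 * (Module.finrank E V * (2 * s))) → OF) :=
    { toFun := f
      invFun := g
      map_add' := fun x y => hinj' (by rw [map_add, hf, hf, hf, map_add])
      map_smul' := fun r x => hinj' (by rw [hf, RingHom.id_apply, hsmul', hf, hsmul])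
      left_inv := fun x => hinj (by rw [hg, hf])
      right_inv := fun x => hinj' (by rw [hf, hg]) }
  simpa using φ.finrank_eq

/-- For large `N` the count is `q ^ (N (4 s n - n ^ 2))` times the sum, and the exponent is `N`
times the dimension of the generic fibre, so the sequence is eventually constant. The limit does not
depend on the basis `β`, which makes the density unique. -/
theorem isLocalDensity_iff [Finite (IsLocalRing.ResidueField OF)]
    (hE : IsRamifiedQuadratic c u) (hh : ∀ x y, h y x = c (h x y))
    (hnd : ∀ x, (∀ y, h x y = 0) → x = 0) (hn : Module.finrank E V = n) (hns : n ≤ 2 * s)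
    (hs : 0 < s) (Y : Finset (Submodule (integralClosure OF E) V))
    (hY : ∀ L', L' ∈ Y ↔ L' ∈ overModules u h L) (t : Submodule (integralClosure OF E) V → ℕ)
    (ht : ∀ L' ∈ overModules u h L, ∃ a : Fin n → ℕ, t L' = Nat.card {i // a i ≠ 0} ∧
      Nonempty ((pwDual u h L' ⧸ L'.submoduleOf (pwDual u h L')) ≃ₗ[integralClosure OF E]
        (∀ i, integralClosure OF E ⧸ Ideal.span {u ^ a i}))) (δ : ℝ) :
    IsLocalDensity OF F (hypPairing (OF := OF) c u s) (fun x y : L => h x y) δ ↔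
      δ = ∑ L' ∈ Y, ((Nat.card (IsLocalRing.ResidueField OF) : ℝ) ^
          (n * (Module.length (integralClosure OF E) (L' ⧸ L.submoduleOf L')).toNat) /
        (Nat.card (IsLocalRing.ResidueField OF) : ℝ) ^
          (2 * s * (Module.length (integralClosure OF E) (L' ⧸ L.submoduleOf L')).toNat)) *
        ∏ j ∈ Finset.range ((n + t L') / 2),
          (1 - (Nat.card (IsLocalRing.ResidueField OF) : ℝ) ^ (2 * j) /
          (Nat.card (IsLocalRing.ResidueField OF) : ℝ) ^ (2 * s)) := by
  have hc := hE.isRamifiedInvolution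
  have hcard : Fintype.card (Fin s ⊕ Fin s) = 2 * s := by
    rw [Fintype.card_sum, Fintype.card_fin, two_mul]
  have hq : (Nat.card (IsLocalRing.ResidueField OF) : ℝ) ≠ 0 := by
    rw [Nat.cast_ne_zero]
    exact Nat.card_pos.ne'
  have : Finite (IsLocalRing.ResidueField (integralClosure OF E)) :=
    Nat.finite_of_card_ne_zero (by
      rw [hE.card_residueField]
      exact Nat.card_pos.ne')
  obtain ⟨N₀, hN₀⟩ := hc.eventually_cosetCount_approxIsometries (Pi.basisFun E (Fin s ⊕ Fin s))
    mem_stdLattice_iff_repr hh hnd (hc.hypForm_conj s) (hc.isSelfDual_stdLattice s) hn Y hY t ht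
  rw [hcard, hE.card_residueField] at hN₀
  set δ₀ := ∑ L' ∈ Y, ((Nat.card (IsLocalRing.ResidueField OF) : ℝ) ^
          (n * (Module.length (integralClosure OF E) (L' ⧸ L.submoduleOf L')).toNat) /
        (Nat.card (IsLocalRing.ResidueField OF) : ℝ) ^
          (2 * s * (Module.length (integralClosure OF E) (L' ⧸ L.submoduleOf L')).toNat)) *
        ∏ j ∈ Finset.range ((n + t L') / 2),
          (1 - (Nat.card (IsLocalRing.ResidueField OF) : ℝ) ^ (2 * j) /
          (Nat.card (IsLocalRing.ResidueField OF) : ℝ) ^ (2 * s))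
  have key : ∀ {d : ℕ} {β : Fin d → (L →ₗ[integralClosure OF E]
      (Fin s → integralClosure OF E × integralClosure OF E))}, IsHomBasis OF β →
      Filter.Tendsto (fun N : ℕ => (hermCount OF (fun x y : L => h x y)
        (hypPairing (OF := OF) c u s) β N : ℝ) /
          (Nat.card (IsLocalRing.ResidueField OF) : ℝ) ^ (N * hermDim OF F (fun x y : L => h x y)
            (hypPairing (OF := OF) c u s) β)) Filter.atTop (nhds δ₀) := by
    intro d β hβ
    obtain ⟨N₁, hN₁⟩ := eventually_hermCount_eq (h := h) hE hβ hs
    rw [hermDim_eq hE hh hnd hβ hn (hn ▸ hβ.card_eq hE) hns hs]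
    refine tendsto_const_nhds.congr' ?_
    filter_upwards [Filter.eventually_ge_atTop N₀, Filter.eventually_ge_atTop N₁] with N h0 h1
    rw [hN₁ N h1, hN₀ N h0, eq_div_iff (pow_ne_zero _ hq), mul_comm]
    congr 1
    rw [eq_div_iff (pow_ne_zero _ hq), ← pow_add]
    congr 1
    obtain ⟨k, hk⟩ := Nat.exists_eq_add_of_le hns
    rw [hk, Nat.add_sub_cancel_left]
    ring
  constructor
  · rintro ⟨d, β, hβ, hlim⟩
    exact tendsto_nhds_unique hlim (key hβ)
  · rintro rfl
    obtain ⟨β, hβ⟩ := exists_isHomBasis hE L s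
    exact ⟨_, β, hβ, key hβ⟩

/-- Invariants exist by sorting the exponents of an adapted basis, so the choice made in
`latticeType` has its defining property. -/
theorem latticeType_spec (hE : IsRamifiedQuadratic c u) (hnd : ∀ x, (∀ y, h x y = 0) → x = 0)
    (hL : L ≤ pwDual u h L) : (∃ a, IsFundamentalInvariants OF u h L a) ∧
      ∃ a : Fin (Module.finrank E V) → ℕ, latticeType OF u h L = Nat.card {i // a i ≠ 0} ∧
        Nonempty ((pwDual u h L ⧸ L.submoduleOf (pwDual u h L)) ≃ₗ[integralClosure OF E]
          (∀ i, integralClosure OF E ⧸ Ideal.span {u ^ a i})) := by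
  have hc := hE.isRamifiedInvolution
  have := hc.isLattice_pwDual (h := h) (L := L) hnd
  have hex : ∃ a, IsFundamentalInvariants OF u h L a := by
    obtain ⟨a, ha, ha'⟩ := hc.exists_monotone_quotient_equiv hL rfl
    rw [← hE.dual_eq_pwDual h L] at ha'
    exact ⟨a, ha, ha'⟩
  refine ⟨hex, _, rfl, ?_⟩
  have h1 := (Classical.epsilon_spec hex).2
  rwa [hE.dual_eq_pwDual h L] at h1

/-- The reduced Gram matrix of `L` is alternating, and its corank is the type, so the dimension
minus the type is an even rank. -/
theorem even_latticeType [Finite (IsLocalRing.ResidueField OF)] (hE : IsRamifiedQuadratic c u)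
    (hh : ∀ x y, h y x = c (h x y)) (hnd : ∀ x, (∀ y, h x y = 0) → x = 0)
    (hL : L ≤ pwDual u h L) : Even (Module.finrank E V + latticeType OF u h L) := by
  have hc := hE.isRamifiedInvolution
  have : Finite (IsLocalRing.ResidueField (integralClosure OF E)) :=
    Nat.finite_of_card_ne_zero (by
      rw [hE.card_residueField]
      exact Nat.card_pos.ne')
  obtain ⟨-, a, ha, ⟨f⟩⟩ := latticeType_spec hE hnd hL
  obtain ⟨e, b, he, -⟩ := hc.exists_adapted_basis (le_refl L) rfl
  have hei : ∀ i, e i ∈ L := fun i => (he _).2 fun j => by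
    rw [e.repr_self, Finsupp.single_apply]
    split_ifs
    exacts [mem_pw_zero.2 ⟨1, map_one _⟩, zero_mem _]
  -- The parity statement requires some self-dual lattice as target; one hyperbolic plane is enough.
  refine (IsRamifiedInvolution.cosetCount_gramSet_zero (Pi.basisFun E (Fin 1 ⊕ Fin 1)) mem_stdLattice_iff_repr hc
    (hc.hypForm_conj 1) (hc.isSelfDual_stdLattice 1) (fun i j => h (e i) (e j))
    (fun i j => hh _ _) (fun i j => hL (hei i) _ (hei j)) _ ?_).1
  rw [hc.card_leftKer_eq_pow hL e he a f, ha]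

/-- Type 0 means that `L` is its own dual, and a self-dual lattice forces a totally isotropic
subspace of half the dimension. -/
theorem latticeType_ne_zero [IsAdicComplete (IsLocalRing.maximalIdeal OF) OF]
    (hE : IsRamifiedQuadratic c u) (hh : ∀ x y, h y x = c (h x y))
    (hnd : ∀ x, (∀ y, h x y = 0) → x = 0) (hL : L ≤ pwDual u h L) {r : ℕ}
    (hV : Module.finrank E V = 2 * r) (hns : ¬ IsSplit h) : latticeType OF u h L ≠ 0 := by
  intro h0
  have hc := hE.isRamifiedInvolution
  obtain ⟨-, a, ha, ⟨f⟩⟩ := latticeType_spec hE hnd hL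
  rw [h0] at ha
  have ha0 : ∀ i, a i = 0 := by
    intro i
    by_contra hi
    have : Nonempty {i // a i ≠ 0} := ⟨⟨i, hi⟩⟩
    exact Nat.card_pos.ne' ha.symm
  have hle : pwDual u h L ≤ L := by
    intro x hx
    have h1 : f (Submodule.Quotient.mk ⟨x, hx⟩) = 0 := by
      ext i
      have : Subsingleton (integralClosure OF E ⧸ Ideal.span {u ^ a i}) := by
        rw [Ideal.Quotient.subsingleton_iff, ha0 i, pow_zero, Ideal.span_singleton_one]
      exact Subsingleton.elim _ _
    rw [LinearEquiv.map_eq_zero_iff, Submodule.Quotient.mk_eq_zero] at h1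
    exact h1
  refine hns (hc.exists_isotropic_subspace hh (L := L) (fun y => ⟨fun hy => hL hy, fun hy => hle ?_⟩)
    (fun D hD hcD => hE.exists_sqrt D hD hcD) r hV)
  exact hy

end Density

/-! ### The Siegel series as a sum over integral lattices. -/

section Series

variable {OF F : Type*} [CommRing OF] [IsDomain OF] [IsDiscreteValuationRing OF]
  [Finite (IsLocalRing.ResidueField OF)]
  [Field F] [CharZero F] [Algebra OF F] [IsFractionRing OF F]
  {E : Type*} [Field E] [Algebra F E] [Algebra OF E] [IsScalarTower OF F E]
  [IsDiscreteValuationRing (integralClosure OF E)] [IsFractionRing (integralClosure OF E) E]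
  {c : E ≃ₐ[F] E} {u : integralClosure OF E}
  {V : Type*} [AddCommGroup V] [Module E V] [FiniteDimensional E V]
  {h : V →ₗ[E] V →ₛₗ[(c : E →+* E)] E} {L : Submodule (integralClosure OF E) V}
  [Submodule.IsLattice E L]

theorem integralOverlattices_eq (hE : IsRamifiedQuadratic c u) (hh : IsHermitianForm h) :
    integralOverlattices OF h L = overModules u h L := by
  ext L'
  constructor
  · rintro ⟨-, h1, h2⟩
    exact ⟨h1, hE.dual_eq_pwDual h L' ▸ h2⟩
  · intro h1
    exact ⟨hE.isRamifiedInvolution.isLattice_of_mem_overModules hh.nondegenerate h1, h1.1,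
      (hE.dual_eq_pwDual h L').symm ▸ h1.2⟩

theorem finite_integralOverlattices (hE : IsRamifiedQuadratic c u) (hh : IsHermitianForm h) :
    (integralOverlattices OF h L).Finite := by
  have hres : Finite (IsLocalRing.ResidueField (integralClosure OF E)) :=
    Nat.finite_of_card_ne_zero (by
      rw [hE.card_residueField]
      exact Nat.card_pos.ne')
  rw [integralOverlattices_eq hE hh]
  exact hE.isRamifiedInvolution.finite_overModules hh.nondegenerate

theorem latticeType_even_and_two_le [IsAdicComplete (IsLocalRing.maximalIdeal OF) OF]
    (hE : IsRamifiedQuadratic c u) (hh : IsHermitianForm h) {r : ℕ}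
    (hV : Module.finrank E V = 2 * r) (hns : ¬ IsSplit h) (hL : L ≤ pwDual u h L) :
    Even (latticeType OF u h L) ∧ 2 ≤ latticeType OF u h L := by
  have h1 := even_latticeType hE hh.conj_symm hh.nondegenerate hL
  have h2 := latticeType_ne_zero hE hh.conj_symm hh.nondegenerate hL hV hns
  rw [hV, Nat.even_add] at h1
  have h3 := h1.1 (even_two_mul r)
  obtain ⟨k, hk⟩ := h3
  exact ⟨⟨k, hk⟩, by omega⟩

theorem length_quotient_ne_top (hE : IsRamifiedQuadratic c u)
    {L' : Submodule (integralClosure OF E) V} [Submodule.IsLattice E L'] (hle : L ≤ L') :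
    Module.length (integralClosure OF E) (L' ⧸ L.submoduleOf L') ≠ ⊤ := by
  obtain ⟨a, -, ⟨f⟩⟩ := hE.isRamifiedInvolution.exists_monotone_quotient_equiv hle rfl
  rw [length_quotient_adapted hE.irreducible a f]
  exact ENat.natCast_ne_top _

/-- The normalized densities are the values of `siegelPolynomial` at all `q ^ (-s)`, which gives
existence; these are infinitely many points, which gives uniqueness. -/
theorem isSiegelSeries_iff (hE : IsRamifiedQuadratic c u) (hh : IsHermitianForm h) {r : ℕ}
    (hr : 0 < r) (hV : Module.finrank E V = 2 * r) (Y : Finset (Submodule (integralClosure OF E) V))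
    (hY : ∀ L', L' ∈ Y ↔ L' ∈ overModules u h L) (ht : ∀ L' ∈ Y, Even (latticeType OF u h L'))
    (P : ℤ[X]) : IsSiegelSeries OF u h r L P ↔
      P = siegelPolynomial (Nat.card (IsLocalRing.ResidueField OF)) Y
        (fun L' => (Module.length (integralClosure OF E) (L' ⧸ L.submoduleOf L')).toNat)
        (latticeType OF u h) := by
  have hq : 1 < Nat.card (IsLocalRing.ResidueField OF) := Finite.one_lt_card
  have hden := fun s => isLocalDensity_iff (s := r + s) hE hh.conj_symm hh.nondegenerate hV
    (by omega) (by omega) Y hY (latticeType OF u h) (fun L' hL' => by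
      have := hE.isRamifiedInvolution.isLattice_of_mem_overModules hh.nondegenerate hL'
      rw [← hV]
      exact (latticeType_spec hE hh.nondegenerate hL'.2).2)
  have hval := aeval_siegelPolynomial hq Y
    (fun L' => (Module.length (integralClosure OF E) (L' ⧸ L.submoduleOf L')).toNat)
    (latticeType OF u h) ht r
  constructor
  · intro hP
    refine eq_of_aeval_inv_pow_eq hq fun s => ?_
    obtain ⟨δ, hδ, hPδ⟩ := hP s
    rw [hPδ, hval, (hden s δ).1 hδ]
  · rintro rfl s
    exact ⟨_, (hden s _).2 rfl, hval s⟩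

end Series

end RamifiedSiegel

end

/-! ### The main theorem. -/

theorem lemma2p11
    -- `F` is a `p`-adic field with ring of integers `OF`, and `p` is odd
    (OF F : Type*) [CommRing OF] [IsDomain OF] [IsDiscreteValuationRing OF]
    [IsAdicComplete (IsLocalRing.maximalIdeal OF) OF]
    [Finite (IsLocalRing.ResidueField OF)]
    (hodd : Odd (Nat.card (IsLocalRing.ResidueField OF)))
    [Field F] [CharZero F] [Algebra OF F] [IsFractionRing OF F]
    -- `E / F` is a quadratic extension with Galois involution `c`
    (E : Type*) [Field E] [Algebra F E] [Algebra OF E] [IsScalarTower OF F E]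
    (hE : Module.finrank F E = 2) (c : E ≃ₐ[F] E) (hc : c ≠ AlgEquiv.refl)
    -- `u` is a uniformizer of `E` with `c u = - u`, and `E / F` is ramified
    (u : integralClosure OF E) (hu : Irreducible u) (huc : c (u : E) = -(u : E))
    (hram : (IsLocalRing.maximalIdeal OF).map (algebraMap OF (integralClosure OF E)) =
      Ideal.span {u} ^ 2)
    -- `(V, h)` is a nonsplit hermitian space of dimension `2 * r`
    (V : Type*) [AddCommGroup V] [Module E V] [FiniteDimensional E V]
    (r : ℕ) (hV : Module.finrank E V = 2 * r)
    (h : V →ₗ[E] V →ₛₗ[(c : E →+* E)] E) (hh : RamifiedSiegel.IsHermitianForm h)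
    (hns : ¬ RamifiedSiegel.IsSplit h)
    (L : Submodule (integralClosure OF E) V) (hL : L.IsLattice E) :
    -- the local Siegel series exists and is unique, and the sums below make sense
    (∃! P : Polynomial ℤ, RamifiedSiegel.IsSiegelSeries OF u h r L P) ∧
    (RamifiedSiegel.integralOverlattices OF h L).Finite ∧
    (∀ L' ∈ RamifiedSiegel.integralOverlattices OF h L,
      (∃ a, RamifiedSiegel.IsFundamentalInvariants OF u h L' a) ∧
      Module.length (integralClosure OF E) (L' ⧸ L.submoduleOf L') ≠ ⊤ ∧
      Even (RamifiedSiegel.latticeType OF u h L') ∧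
      2 ≤ RamifiedSiegel.latticeType OF u h L') ∧
    RamifiedSiegel.siegelSeries OF u h r L =
      ∑ᶠ L' ∈ RamifiedSiegel.integralOverlattices OF h L,
        Polynomial.X ^ (2 * (Module.length (integralClosure OF E) (L' ⧸ L.submoduleOf L')).toNat) *
          ∏ i ∈ Finset.range (RamifiedSiegel.latticeType OF u h L' / 2),
            (1 - Polynomial.C ((Nat.card (IsLocalRing.ResidueField OF) : ℤ) ^ (2 * i)) *
              Polynomial.X ^ 2) ∧
    RamifiedSiegel.derivDen OF u h r L =
      2 * ∑ᶠ L' ∈ RamifiedSiegel.integralOverlattices OF h L,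
        ∏ i ∈ Finset.Icc 1 (RamifiedSiegel.latticeType OF u h L' / 2 - 1),
          (1 - (Nat.card (IsLocalRing.ResidueField OF) : ℤ) ^ (2 * i)) := by
  have hR : RamifiedSiegel.IsRamifiedQuadratic c u :=
    ⟨RamifiedSiegel.isUnit_two_of_odd_card hodd, hE, hc, hu, huc, hram⟩
  have := hR.isDiscreteValuationRing
  have := hR.isFractionRing
  have hfin := RamifiedSiegel.finite_integralOverlattices (L := L) hR hh
  have hover := RamifiedSiegel.integralOverlattices_eq (L := L) hR hh
  -- The zero space is split, so `r` is positive. The density computation needs at least one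
  -- hyperbolic plane in the target even for `s = 0`.
  have hr : 0 < r := by
    by_contra hr
    refine hns ⟨⊥, ?_, fun x hx y _ => ?_⟩
    · rw [hV, finrank_bot, Nat.eq_zero_of_not_pos hr]
    · rw [(Submodule.mem_bot E).1 hx, map_zero, LinearMap.zero_apply]
  have htype : ∀ L' ∈ RamifiedSiegel.integralOverlattices OF h L,
      Even (RamifiedSiegel.latticeType OF u h L') ∧ 2 ≤ RamifiedSiegel.latticeType OF u h L' := by
    intro L' hL'
    have := hL'.1
    exact RamifiedSiegel.latticeType_even_and_two_le hR hh hV hns (hover ▸ hL').2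
  have hiff := RamifiedSiegel.isSiegelSeries_iff (L := L) hR hh hr hV hfin.toFinset
    (fun L' => by rw [hfin.mem_toFinset, hover])
    (fun L' hL' => (htype L' (hfin.mem_toFinset.1 hL')).1)
  -- The polynomial chosen by `siegelSeries` has the defining property because some polynomial does.
  have hser := (hiff _).1 (Classical.epsilon_spec ⟨_, (hiff _).2 rfl⟩)
  refine ⟨⟨_, (hiff _).2 rfl, fun P hP => (hiff P).1 hP⟩, hfin, fun L' hL' => ?_, ?_, ?_⟩
  · have := hL'.1
    exact ⟨(RamifiedSiegel.latticeType_spec hR hh.nondegenerate (hover ▸ hL').2).1,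
      RamifiedSiegel.length_quotient_ne_top hR hL'.2.1, htype L' hL'⟩
  · rw [finsum_mem_eq_finite_toFinset_sum _ hfin]
    exact hser
  · rw [finsum_mem_eq_finite_toFinset_sum _ hfin]
    refine Eq.trans ?_ (RamifiedSiegel.derivative_siegelPolynomial _
      (fun L' => (Module.length (integralClosure OF E) (L' ⧸ L.submoduleOf L')).toNat) _
      fun L' hL' => htype L' (hfin.mem_toFinset.1 hL'))
    rw [← hser]
    rfl
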